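/- **Conventions.** A *unitary category* is a $\mathbb C$-linear C*-category with finite-dimensional morphism spaces, a zero object, finite orthogonal direct sums, orthogonal splittings of projections, and finitely many isomorphism classes of simple objects. A *unitary multifusion category* is a unitary category with a bilinear monoidal structure such that $(f\otimes g)^\dagger=f^\dagger\otimes g^\dagger$, the associator and the unitors are unitary, and every object has left and right duals (the unit object $\mathbb 1$ need not be simple). It is *indecomposable* if $\mathbb 1\neq 0$ and for any two simple summands $S,T$ of $\mathbb 1$ there is an object $Z$ with $S\otimes Z\otimes T\neq 0$. An object $X$ is a *strong tensor generator* if there is an $n\ge 1$ such that every simple object is a direct summand of $X^{\otimes n}$. Two unitary multifusion categories $\mathcal C,\mathcal D$ are *Morita equivalent* if there is an invertible unitary $\mathcal D$-$\mathcal C$ bimodule category, that is, a unitary $\mathcal D$-$\mathcal C$ bimodule category $\mathcal M$ for which the action $\mathcal D\to \mathrm{End}_{\mathcal C}(\mathcal M)$ is an equivalence onto the category of unitary right $\mathcal C$-module endofunctors of $\mathcal M$. Intervals are the sets $I=[a,b]\cap\mathbb Z$ with $a\le b$, and $I^{+R}=[a-R,b+R]\cap \mathbb Z$. Each of the following is a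 unital C*-algebra $A$ with unital *-subalgebras $A_I$, namely the C*-algebraic colimit of the indicated local algebras along the indicated inclusions for $I\subseteq J$. - $A(\mathcal C,X)$, for $X\in\mathcal C$: local algebras $\mathrm{End}_{\mathcal C}(X^{\otimes I})$, inclusions $f\mapsto 1_X^{\otimes l}\otimes f\otimes 1_X^{\otimes r}$, where $l$ and $r$ are the numbers of sites of $J$ to the left and to the right of $I$. - $\mathcal L^\infty=\overline{\bigotimes}_{\mathbb Z}B(\ell^2(\mathbb N))$: local algebras $B(\ell^2(\mathbb N)^{\otimes I})$, inclusions $T\mapsto T\otimes 1$. - the stabilization $A(\mathcal C,X)^\infty$: local algebras $A(\mathcal C,X)_I\otimes B(\ell^2(\mathbb N)^{\otimes I})$, inclusions the tensor products of those above. Such $A$ and $B$ are *bounded spread isomorphic* if there are a *-isomorphism $\alpha:A\to B$ and an $R\ge 0$ with $\alpha(A_I)\subseteq B_{I^{+R}}$ and $\alpha^{-1}(B_I)\subseteq A_{I^{+R}}$ for all intervals $I$. **Theorem.** Let $\mathcal C$ and $\mathcal D$ be Morita equivalent indecomposable unitary multifusion categories, and let $X\in\mathcal C$ and $Y\in\mathcal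 D$ be strong tensor generators. Then the stabilized fusion spin chains $A(\mathcal C,X)^\infty$ and $A(\mathcal D,Y)^\infty$ are bounded spread isomorphic. In particular, every stabilized anyon chain is bounded spread isomorphic to $\mathcal L^\infty$: if $n\ge 1$, $\mathcal E$ is a unitary multifusion category that is unitarily monoidally equivalent to $\mathrm{Mat}_n(\mathrm{Hilb}_{f.d.})$ (equivalently, to the category of dagger endofunctors of a unitary category with exactly $n$ isomorphism classes of simple objects), and $X\in\mathcal E$ is a strong tensor generator, then $A(\mathcal E,X)^\infty$ and $\mathcal L^\infty$ are bounded spread isomorphic. -/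

import Mathlib

open CategoryTheory MonoidalCategory Limits

universe v u w v' u' w'

/-! ## Unitary categories -/

/-- A (finite) unitary category: a semisimple C*-category with finitely many isomorphism classes of
simple objects. The data are a `ℂ`-linear category with a conjugate-linear contravariant involution
`dagger` and a C*-norm on every morphism space (such a norm is unique). The morphism spaces are
finite dimensional, and the category has a zero object, orthogonal direct sums, and orthogonal
splittings of projections; finite dimensional C*-endomorphism algebras make it semisimple.
Composition is written in diagrammatic order, so `f ≫ dagger f` is `f† ∘ f`. -/
class UnitaryCategory (C : Type u) [Category.{v} C] extends Preadditive C, Linear ℂ C where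
  /-- The adjoint of a morphism. -/
  dagger : ∀ {X Y : C}, (X ⟶ Y) → (Y ⟶ X)
  dagger_dagger : ∀ {X Y : C} (f : X ⟶ Y), dagger (dagger f) = f
  dagger_comp : ∀ {X Y Z : C} (f : X ⟶ Y) (g : Y ⟶ Z), dagger (f ≫ g) = dagger g ≫ dagger f
  dagger_add : ∀ {X Y : C} (f g : X ⟶ Y), dagger (f + g) = dagger f + dagger g
  dagger_smul : ∀ {X Y : C} (c : ℂ) (f : X ⟶ Y), dagger (c • f) = star c • dagger f
  /-- The C*-norm. -/
  homNorm : ∀ {X Y : C}, (X ⟶ Y) → ℝ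
  homNorm_add_le : ∀ {X Y : C} (f g : X ⟶ Y), homNorm (f + g) ≤ homNorm f + homNorm g
  homNorm_smul : ∀ {X Y : C} (c : ℂ) (f : X ⟶ Y), homNorm (c • f) = ‖c‖ * homNorm f
  eq_zero_of_homNorm : ∀ {X Y : C} (f : X ⟶ Y), homNorm f = 0 → f = 0
  homNorm_comp_le : ∀ {X Y Z : C} (f : X ⟶ Y) (g : Y ⟶ Z),
    homNorm (f ≫ g) ≤ homNorm f * homNorm g
  homNorm_cstar : ∀ {X Y : C} (f : X ⟶ Y), homNorm (f ≫ dagger f) = homNorm f ^ 2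
  /-- Every `f† ∘ f` is a positive element of the algebra of endomorphisms of the source. -/
  exists_sqrt : ∀ {X Y : C} (f : X ⟶ Y), ∃ g : X ⟶ X, f ≫ dagger f = g ≫ dagger g
  finiteDimensional_hom : ∀ X Y : C, FiniteDimensional ℂ (X ⟶ Y)
  exists_zero : ∃ Z : C, 𝟙 Z = 0
  exists_directSum : ∀ X Y : C, ∃ (Z : C) (i : X ⟶ Z) (j : Y ⟶ Z),
    i ≫ dagger i = 𝟙 X ∧ j ≫ dagger j = 𝟙 Y ∧ i ≫ dagger j = 0 ∧
      dagger i ≫ i + dagger j ≫ j = 𝟙 Z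
  exists_splitting : ∀ {X : C} (p : X ⟶ X), p ≫ p = p → dagger p = p →
    ∃ (Y : C) (i : Y ⟶ X), i ≫ dagger i = 𝟙 Y ∧ dagger i ≫ i = p
  exists_simples : ∃ (n : ℕ) (S : Fin n → C), ∀ X : C, Simple X → ∃ k, Nonempty (X ≅ S k)

open UnitaryCategory (dagger)

namespace UnitaryCategory
variable {C : Type u} [Category.{v} C] [UnitaryCategory C]

lemma dagger_id (X : C) : dagger (𝟙 X) = 𝟙 X := by
  have h := dagger_comp (dagger (𝟙 X)) (𝟙 X)
  rw [dagger_dagger, Category.comp_id, dagger_dagger] at h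
  exact h.symm

/-- The endomorphism algebra of an object is a *-algebra. -/
instance endStarRing (X : C) : StarRing (End X) where
  star f := dagger (f : X ⟶ X)
  star_involutive f := dagger_dagger (C := C) f
  star_mul f g := dagger_comp (C := C) (X := X) g f
  star_add f g := dagger_add (C := C) (X := X) f g

lemma star_def {X : C} (f : End X) : star f = dagger (f : X ⟶ X) := rfl

instance endStarModule (X : C) : StarModule ℂ (End X) where
  star_smul c f := dagger_smul (C := C) (X := X) c f

lemma homNorm_zero (X Y : C) : homNorm (0 : X ⟶ Y) = 0 := by
  simpa using homNorm_smul (0 : ℂ) (0 : X ⟶ Y)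
lemma homNorm_neg {X Y : C} (f : X ⟶ Y) : homNorm (-f) = homNorm f := by
  simpa using homNorm_smul (-1 : ℂ) f

/-- The C*-norm of an endomorphism algebra, as a ring norm. -/
def endNorm (X : C) : RingNorm (End X) where
  toFun f := homNorm (f : X ⟶ X)
  map_zero' := homNorm_zero X X
  add_le' f g := homNorm_add_le (C := C) (X := X) f g
  neg' f := homNorm_neg (C := C) (X := X) f
  mul_le' f g := (homNorm_comp_le (C := C) (X := X) g f).trans_eq (mul_comm _ _)
  eq_zero_of_map_eq_zero' f := eq_zero_of_homNorm (C := C) (X := X) f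

instance (X : C) : FiniteDimensional ℂ (End X) := finiteDimensional_hom X X

/-- Endomorphism algebras are C*-algebras. -/
abbrev endCStarAlgebra (X : C) : CStarAlgebra (End X) :=
  letI : NormedRing (End X) := (endNorm X).toNormedRing
  letI : NormedAlgebra ℂ (End X) :=
    { (inferInstance : Algebra ℂ (End X)) with
      norm_smul_le := fun c f => (homNorm_smul (C := C) (X := X) c f).le }
  { (inferInstance : NormedRing (End X)), (inferInstance : NormedAlgebra ℂ (End X)),
    endStarRing X, endStarModule X with
    complete := (FiniteDimensional.complete ℂ (End X)).complete
    norm_mul_self_le := fun f => by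
      rw [← sq]
      exact (homNorm_cstar (C := C) (X := X) f).ge }

lemma span_unitary_end (X : C) :
    Submodule.span ℂ (unitary (End X) : Set (End X)) = ⊤ :=
  letI := endCStarAlgebra X
  CStarAlgebra.span_unitary (End X)

end UnitaryCategory

/-- A unitary multifusion category: a unitary category with a bilinear tensor product that is
compatible with the dagger, with unitary associator and unitors, and in which every object has
duals. The unit object need not be simple. -/
class UnitaryMultifusionCategory (C : Type u) [Category.{v} C] [MonoidalCategory C] extends
    UnitaryCategory C where
  whiskerLeft_add : ∀ (X : C) {Y Z : C} (f g : Y ⟶ Z), X ◁ (f + g) = X ◁ f + X ◁ g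
  whiskerLeft_smul : ∀ (X : C) {Y Z : C} (c : ℂ) (f : Y ⟶ Z), X ◁ (c • f) = c • X ◁ f
  add_whiskerRight : ∀ {X Y : C} (f g : X ⟶ Y) (Z : C), (f + g) ▷ Z = f ▷ Z + g ▷ Z
  smul_whiskerRight : ∀ {X Y : C} (c : ℂ) (f : X ⟶ Y) (Z : C), (c • f) ▷ Z = c • f ▷ Z
  dagger_whiskerLeft : ∀ (X : C) {Y Z : C} (f : Y ⟶ Z), dagger (X ◁ f) = X ◁ dagger f
  dagger_whiskerRight : ∀ {X Y : C} (f : X ⟶ Y) (Z : C), dagger (f ▷ Z) = dagger f ▷ Z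
  dagger_associator : ∀ X Y Z : C, dagger (α_ X Y Z).hom = (α_ X Y Z).inv
  dagger_leftUnitor : ∀ X : C, dagger (λ_ X).hom = (λ_ X).inv
  dagger_rightUnitor : ∀ X : C, dagger (ρ_ X).hom = (ρ_ X).inv
  exists_rightDual : ∀ X : C, ∃ Y : C, Nonempty (ExactPairing X Y)
  exists_leftDual : ∀ X : C, ∃ Y : C, Nonempty (ExactPairing Y X)

/-- A unitary multifusion category is indecomposable if it is nonzero and for any two simple
summands `S`, `T` of the unit object, `S ⊗ C ⊗ T ≠ 0`. -/
def IsIndecomposable (C : Type u) [Category.{v} C] [MonoidalCategory C]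
    [UnitaryMultifusionCategory C] : Prop :=
  ¬ IsZero (𝟙_ C) ∧
    ∀ S T : C, Simple S → Simple T → Nonempty (Retract S (𝟙_ C)) → Nonempty (Retract T (𝟙_ C)) →
      ∃ Z : C, ¬ IsZero ((S ⊗ Z) ⊗ T)

section TensorPower

variable {C : Type u} [Category.{v} C] [MonoidalCategory C]

/-- The tensor power `X^{⊗ n}`, bracketed to the left. -/
def tensorPower (X : C) : ℕ → C
  | 0 => 𝟙_ C
  | n + 1 => tensorPower X n ⊗ X

/-- The canonical isomorphism `X^{⊗ m} ⊗ X^{⊗ n} ≅ X^{⊗ (m + n)}`, made of associators and a unitor. -/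
def tensorPowerAdd (X : C) (m : ℕ) :
    ∀ n : ℕ, tensorPower X m ⊗ tensorPower X n ≅ tensorPower X (m + n)
  | 0 => ρ_ (tensorPower X m)
  | n + 1 => (α_ (tensorPower X m) (tensorPower X n) X).symm ≪≫
      whiskerRightIso (tensorPowerAdd X m n) X

lemma tensorPowerAdd_assoc (X : C) (a b c : ℕ) :
    (tensorPowerAdd X a b).hom ▷ tensorPower X c ≫ (tensorPowerAdd X (a + b) c).hom =
      (α_ _ _ _).hom ≫ tensorPower X a ◁ (tensorPowerAdd X b c).hom ≫
        (tensorPowerAdd X a (b + c)).hom ≫ eqToHom (congrArg _ (Nat.add_assoc a b c).symm) := by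
  induction c with
  | zero => simp [tensorPowerAdd, tensorPower]
  | succ c ih =>
    have h : eqToHom (congrArg (tensorPower X) (Nat.add_assoc a b (c + 1)).symm) =
        eqToHom (congrArg (tensorPower X) (Nat.add_assoc a b c).symm) ▷ X := by
      rw [eqToHom_whiskerRight]; rfl
    have h2 : tensorPowerAdd X a (b + (c + 1)) =
        (α_ (tensorPower X a) (tensorPower X (b + c)) X).symm ≪≫
      whiskerRightIso (tensorPowerAdd X a (b + c)) X := rfl
    rw [h, h2]
    simp only [tensorPowerAdd, tensorPower, Iso.trans_hom, Iso.symm_hom, whiskerRightIso_hom]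
    have ih' := congrArg (· ▷ X) ih
    simp only [comp_whiskerRight] at ih'
    simp only [MonoidalCategory.whiskerLeft_comp, Category.assoc, associator_inv_naturality_left_assoc]
    rw [ih']
    simp

lemma tensorPowerAdd_zero_left (X : C) (n : ℕ) :
    (tensorPowerAdd X 0 n).hom = (λ_ _).hom ≫ eqToHom (congrArg _ (Nat.zero_add n).symm) := by
  induction n with
  | zero => simp [tensorPowerAdd, tensorPower, unitors_equal]
  | succ n ih =>
    have h : eqToHom (congrArg (tensorPower X) (Nat.zero_add (n + 1)).symm) =
        eqToHom (congrArg (tensorPower X) (Nat.zero_add n).symm) ▷ X := by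
      rw [eqToHom_whiskerRight]; rfl
    rw [h]
    have e : (α_ (𝟙_ C) (tensorPower X n) X).inv ≫
        ((λ_ (tensorPower X n)).hom ≫
          eqToHom (congrArg (tensorPower X) (Nat.zero_add n).symm)) ▷ X =
        (λ_ (tensorPower X n ⊗ X)).hom ≫
          eqToHom (congrArg (tensorPower X) (Nat.zero_add n).symm) ▷ X := by
      rw [comp_whiskerRight, leftUnitor_tensor_hom, Category.assoc]
    rw [← ih] at e
    exact e

end TensorPower

section Local

variable {C : Type u} [Category.{v} C] [MonoidalCategory C]

/-- The canonical isomorphism `X^{⊗ l} ⊗ X^{⊗ k} ⊗ X^{⊗ r} ≅ X^{⊗ N}` for `l + k + r = N`. -/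
def embedAux (X : C) (l k r N : ℕ) (h : l + k + r = N) :
    (tensorPower X l ⊗ tensorPower X k) ⊗ tensorPower X r ≅ tensorPower X N :=
  whiskerRightIso (tensorPowerAdd X l k) (tensorPower X r) ≪≫ tensorPowerAdd X (l + k) r ≪≫
    eqToIso (congrArg (tensorPower X) h)

lemma embed_id (X : C) (k : ℕ) (f : tensorPower X k ⟶ tensorPower X k) (h : 0 + k + 0 = k) :
    (embedAux X 0 k 0 k h).inv ≫ (tensorPower X 0 ◁ f) ▷ tensorPower X 0 ≫ (embedAux X 0 k 0 k h).hom = f := by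
  rw [Iso.inv_comp_eq]
  simp only [embedAux, Iso.trans_hom, whiskerRightIso_hom, eqToIso.hom, tensorPowerAdd_zero_left]
  simp [tensorPowerAdd, tensorPower]

lemma eqToHom_tensorPowerAdd (X : C) {m n : ℕ} (h : m = n) (c : ℕ) :
    eqToHom (congrArg (tensorPower X) h) ▷ tensorPower X c ≫ (tensorPowerAdd X n c).hom =
      (tensorPowerAdd X m c).hom ≫ eqToHom (congrArg (fun i => tensorPower X (i + c)) h) := by
  subst h
  simp

lemma embedAux_comp (X : C) (l k r l' r' M : ℕ) (h' : l' + (l + k + r) + r' = M)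
    (h'' : l' + l + k + (r + r') = M) :
    (tensorPower X l' ◁ (embedAux X l k r _ rfl).hom) ▷ tensorPower X r' ≫
        (embedAux X l' (l + k + r) r' M h').hom =
      ((α_ _ _ _).inv ≫ (α_ _ _ _).inv ▷ _) ▷ _ ≫ (α_ _ _ _).hom ≫
        ((tensorPowerAdd X l' l).hom ▷ _) ▷ _ ≫ _ ◁ (tensorPowerAdd X r r').hom ≫
          (embedAux X (l' + l) k (r + r') M h'').hom := by
  have e1 : tensorPower X l' ◁ (tensorPowerAdd X (l + k) r).hom ≫
      (tensorPowerAdd X l' (l + k + r)).hom = (α_ _ _ _).inv ≫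
        (tensorPowerAdd X l' (l + k)).hom ▷ _ ≫ (tensorPowerAdd X (l' + (l + k)) r).hom ≫
          eqToHom (congrArg _ (Nat.add_assoc l' (l + k) r)) := by
    have := tensorPowerAdd_assoc X l' (l + k) r
    rw [reassoc_of% this]
    simp
  have e2 : tensorPower X l' ◁ (tensorPowerAdd X l k).hom ≫
      (tensorPowerAdd X l' (l + k)).hom = (α_ _ _ _).inv ≫
        (tensorPowerAdd X l' l).hom ▷ _ ≫ (tensorPowerAdd X (l' + l) k).hom ≫
          eqToHom (congrArg _ (Nat.add_assoc l' l k)) := by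
    have := tensorPowerAdd_assoc X l' l k
    rw [reassoc_of% this]
    simp
  have e3 := tensorPowerAdd_assoc X (l' + l + k) r r'
  simp only [embedAux, Iso.trans_hom, whiskerRightIso_hom, eqToIso.hom,
    Category.comp_id, eqToIso_refl, Iso.refl_hom]
  have e4 : tensorPower X l' ◁ ((tensorPowerAdd X l k).hom ▷ tensorPower X r ≫
        (tensorPowerAdd X (l + k) r).hom) ≫ (tensorPowerAdd X l' (l + k + r)).hom =
      (α_ _ _ _).inv ≫ (α_ _ _ _).inv ▷ _ ≫ ((tensorPowerAdd X l' l).hom ▷ _) ▷ _ ≫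
        (tensorPowerAdd X (l' + l) k).hom ▷ _ ≫ (tensorPowerAdd X (l' + l + k) r).hom ≫ eqToHom (congrArg (tensorPower X) (show l' + l + k + r = l' + (l + k + r) by omega)) := by
    rw [MonoidalCategory.whiskerLeft_comp, Category.assoc, e1]
    have e2' := congrArg (· ▷ tensorPower X r) e2
    simp only [comp_whiskerRight] at e2'
    rw [associator_inv_naturality_middle_assoc, reassoc_of% e2',
      reassoc_of% (eqToHom_tensorPowerAdd X (Nat.add_assoc l' l k) r)]
    simp
  have e4' := congrArg (· ▷ tensorPower X r') e4
  simp only [comp_whiskerRight] at e4'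
  simp only [comp_whiskerRight, Category.assoc]
  rw [reassoc_of% e4']
  have e5 := eqToHom_tensorPowerAdd X (show l' + l + k + r = l' + (l + k + r) by omega) r'
  rw [reassoc_of% e5, reassoc_of% e3, associator_naturality_left_assoc, ← whisker_exchange_assoc]
  simp

lemma embed_comp (X : C) (l k r N l' r' M l'' r'' : ℕ) (h : l + k + r = N) (h' : l' + N + r' = M)
    (hl : l' + l = l'') (hr : r + r' = r'') (h'' : l'' + k + r'' = M)
    (f : tensorPower X k ⟶ tensorPower X k) :
    (embedAux X l' N r' M h').inv ≫ (tensorPower X l' ◁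
      ((embedAux X l k r N h).inv ≫ (tensorPower X l ◁ f) ▷ tensorPower X r ≫
        (embedAux X l k r N h).hom)) ▷ tensorPower X r' ≫ (embedAux X l' N r' M h').hom =
    (embedAux X l'' k r'' M h'').inv ≫ (tensorPower X l'' ◁ f) ▷ tensorPower X r'' ≫
        (embedAux X l'' k r'' M h'').hom := by
  subst h hl hr
  have key := embedAux_comp X l k r l' r' M h' h''
  have hg : (tensorPower X l' ◁ ((tensorPower X l ◁ f) ▷ tensorPower X r)) ▷ tensorPower X r' ≫
      ((α_ _ _ _).inv ≫ (α_ _ _ _).inv ▷ _) ▷ _ ≫ (α_ _ _ _).hom ≫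
        ((tensorPowerAdd X l' l).hom ▷ _) ▷ _ ≫ _ ◁ (tensorPowerAdd X r r').hom =
      ((α_ _ _ _).inv ≫ (α_ _ _ _).inv ▷ _) ▷ _ ≫ (α_ _ _ _).hom ≫
        ((tensorPowerAdd X l' l).hom ▷ _) ▷ _ ≫ _ ◁ (tensorPowerAdd X r r').hom ≫
          (tensorPower X (l' + l) ◁ f) ▷ tensorPower X (r + r') := by
    have hf : ((tensorPowerAdd X l' l).hom ▷ tensorPower X k) ≫ tensorPower X (l' + l) ◁ f =
        (tensorPower X l' ⊗ tensorPower X l) ◁ f ≫ (tensorPowerAdd X l' l).hom ▷ tensorPower X k :=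
      (whisker_exchange _ _).symm
    rw [whisker_exchange,
      ← comp_whiskerRight_assoc ((tensorPowerAdd X l' l).hom ▷ tensorPower X k), hf]
    monoidal
  rw [← cancel_epi ((tensorPower X l' ◁ (embedAux X l k r _ rfl).hom) ▷ tensorPower X r' ≫
        (embedAux X l' (l + k + r) r' M h').hom)]
  trans (tensorPower X l' ◁ ((tensorPower X l ◁ f) ▷ tensorPower X r)) ▷ tensorPower X r' ≫
    ((tensorPower X l' ◁ (embedAux X l k r _ rfl).hom) ▷ tensorPower X r' ≫
        (embedAux X l' (l + k + r) r' M h').hom)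
  · simp only [Category.assoc, Iso.hom_inv_id_assoc]
    rw [← comp_whiskerRight_assoc, ← MonoidalCategory.whiskerLeft_comp, Iso.hom_inv_id_assoc]
    simp only [MonoidalCategory.whiskerLeft_comp, comp_whiskerRight, Category.assoc]
  · rw [key]
    simp only [Category.assoc, Iso.hom_inv_id_assoc]
    rw [reassoc_of% hg]

end Local

/-! ## Nets of local algebras and their quasi-local algebras -/

noncomputable section


/-- A net of local *-algebras over the nonempty bounded intervals `[a, b]` of `ℤ`, ordered by
inclusion, with unital *-homomorphisms `incl` for `I ⊆ J`. Every local algebra is spanned by its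
unitaries, as every C*-algebra is; this guarantees that the C*-colimit of the net exists. -/
structure LocalNet where
  alg : NonemptyInterval ℤ → Type w
  [ring : ∀ I, Ring (alg I)]
  [starRing : ∀ I, StarRing (alg I)]
  [algebra : ∀ I, Algebra ℂ (alg I)]
  [starModule : ∀ I, StarModule ℂ (alg I)]
  incl : ∀ I J : NonemptyInterval ℤ, I ≤ J → alg I →⋆ₐ[ℂ] alg J
  incl_refl : ∀ I a, incl I I le_rfl a = a
  incl_trans : ∀ (I J K) (hIJ : I ≤ J) (hJK : J ≤ K) (a : alg I),
    incl J K hJK (incl I J hIJ a) = incl I K (hIJ.trans hJK) a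
  span_unitary : ∀ I, Submodule.span ℂ (unitary (alg I) : Set (alg I)) = ⊤

attribute [instance] LocalNet.ring LocalNet.starRing LocalNet.algebra LocalNet.starModule

/-- A C*-seminorm on a unital complex *-algebra. -/
structure CStarSeminorm (A : Type w) [Ring A] [StarRing A] [Algebra ℂ A] extends Seminorm ℂ A where
  mul_le' : ∀ a b : A, toFun (a * b) ≤ toFun a * toFun b
  star_mul_self' : ∀ a : A, toFun (star a * a) = toFun a ^ 2

namespace CStarSeminorm
variable {A : Type w} [Ring A] [StarRing A] [Algebra ℂ A]

/-- The value of a C*-seminorm. -/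
def val (p : CStarSeminorm A) (a : A) : ℝ := p.toSeminorm a

lemma val_nonneg (p : CStarSeminorm A) (a : A) : 0 ≤ p.val a := apply_nonneg p.toSeminorm a
lemma val_mul_le (p : CStarSeminorm A) (a b : A) : p.val (a * b) ≤ p.val a * p.val b := p.mul_le' a b
lemma val_star_mul_self (p : CStarSeminorm A) (a : A) : p.val (star a * a) = p.val a ^ 2 :=
  p.star_mul_self' a

lemma val_one_le (p : CStarSeminorm A) : p.val 1 ≤ 1 := by
  have h := p.val_star_mul_self 1
  rw [star_one, mul_one] at h
  nlinarith [p.val_nonneg 1]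

lemma val_unitary_le (p : CStarSeminorm A) {u : A} (hu : u ∈ unitary A) : p.val u ≤ 1 := by
  have h := p.val_star_mul_self u
  rw [Unitary.star_mul_self_of_mem hu] at h
  nlinarith [p.val_nonneg u, p.val_one_le]

lemma val_star_le (p : CStarSeminorm A) (a : A) : p.val (star a) ≤ p.val a := by
  have h := p.val_star_mul_self (star a)
  rw [star_star] at h
  have h2 := p.val_mul_le a (star a)
  rcases (p.val_nonneg (star a)).eq_or_lt with h0 | h0
  · rw [← h0]; exact p.val_nonneg a
  · nlinarith

instance : Zero (CStarSeminorm A) :=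
  ⟨{ (0 : Seminorm ℂ A) with
      mul_le' := fun a b => by change (0 : ℝ) ≤ 0 * 0; simp
      star_mul_self' := fun a => by change (0 : ℝ) = 0 ^ 2; simp }⟩

lemma bddAbove (h : Submodule.span ℂ (unitary A : Set A) = ⊤) (a : A) :
    BddAbove (Set.range fun p : CStarSeminorm A => p.val a) := by
  have ha : a ∈ Submodule.span ℂ (unitary A : Set A) := h ▸ Submodule.mem_top
  induction ha using Submodule.span_induction with
  | mem u hu => exact ⟨1, by rintro _ ⟨p, rfl⟩; exact p.val_unitary_le hu⟩
  | zero => exact ⟨0, by rintro _ ⟨p, rfl⟩; exact (map_zero p.toSeminorm).le⟩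
  | add x y _ _ hx hy =>
    obtain ⟨M, hM⟩ := hx
    obtain ⟨N, hN⟩ := hy
    refine ⟨M + N, ?_⟩
    rintro _ ⟨p, rfl⟩
    exact (map_add_le_add p.toSeminorm x y).trans (add_le_add (hM ⟨p, rfl⟩) (hN ⟨p, rfl⟩))
  | smul c x _ hx =>
    obtain ⟨M, hM⟩ := hx
    refine ⟨‖c‖ * M, ?_⟩
    rintro _ ⟨p, rfl⟩
    exact (map_smul_eq_mul p.toSeminorm c x).le.trans
      (mul_le_mul_of_nonneg_left (hM ⟨p, rfl⟩) (norm_nonneg c))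

/-- The largest C*-seminorm on a *-algebra that is spanned by its unitaries. -/
def sup (h : Submodule.span ℂ (unitary A : Set A) = ⊤) : CStarSeminorm A where
  toFun a := ⨆ p : CStarSeminorm A, p.val a
  map_zero' := by
    have : ∀ p : CStarSeminorm A, p.val 0 = 0 := fun p => map_zero p.toSeminorm
    simp [this]
  add_le' a b := ciSup_le fun p => (map_add_le_add p.toSeminorm a b).trans
    (add_le_add (le_ciSup (bddAbove h a) p) (le_ciSup (bddAbove h b) p))
  neg' a := by
    have : ∀ p : CStarSeminorm A, p.val (-a) = p.val a := fun p => map_neg_eq_map p.toSeminorm a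
    simp [this]
  smul' c a := by
    have : ∀ p : CStarSeminorm A, p.val (c • a) = ‖c‖ * p.val a :=
      fun p => map_smul_eq_mul p.toSeminorm c a
    simp only [this]
    exact (Real.mul_iSup_of_nonneg (norm_nonneg c) _).symm
  mul_le' a b := ciSup_le fun p => (p.val_mul_le a b).trans
    (mul_le_mul (le_ciSup (bddAbove h a) p) (le_ciSup (bddAbove h b) p) (p.val_nonneg b)
      ((p.val_nonneg a).trans (le_ciSup (bddAbove h a) p)))
  star_mul_self' a := by
    have h0 : 0 ≤ ⨆ p : CStarSeminorm A, p.val a :=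
      Real.iSup_nonneg fun p => p.val_nonneg a
    apply le_antisymm
    · refine ciSup_le fun p => ?_
      rw [val_star_mul_self]
      exact pow_le_pow_left₀ (p.val_nonneg a) (le_ciSup (bddAbove h a) p) 2
    · rw [← Real.le_sqrt h0 (Real.iSup_nonneg fun p => p.val_nonneg _)]
      refine ciSup_le fun p => Real.le_sqrt_of_sq_le ?_
      rw [← val_star_mul_self]
      exact le_ciSup (bddAbove h (star a * a)) p

end CStarSeminorm

namespace LocalNet

variable (N : LocalNet.{w})

instance directedSystem : DirectedSystem N.alg (fun I J h => N.incl I J h) where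
  map_self := fun I a => N.incl_refl I a
  map_map := fun _ _ _ _ _ a => N.incl_trans _ _ _ _ _ a


/-- The algebraic colimit (the union) of the local algebras. -/
def Union : Type w := DirectLimit N.alg N.incl

instance : Ring N.Union := inferInstanceAs (Ring (DirectLimit N.alg N.incl))
instance : Algebra ℂ N.Union := inferInstanceAs (Algebra ℂ (DirectLimit N.alg N.incl))
instance : StarRing N.Union := inferInstanceAs (StarRing (DirectLimit N.alg N.incl))
instance : StarModule ℂ N.Union := inferInstanceAs (StarModule ℂ (DirectLimit N.alg N.incl))

/-- The canonical map of a local algebra to the algebraic colimit. -/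
def toUnion (I : NonemptyInterval ℤ) : N.alg I →⋆ₐ[ℂ] N.Union where
  toFun a := (⟦⟨I, a⟩⟧ : DirectLimit N.alg N.incl)
  map_one' := (DirectLimit.one_def (f := N.incl) I).symm
  map_mul' a b := (DirectLimit.mul_def (f := N.incl) I a b).symm
  map_zero' := (DirectLimit.zero_def (f := N.incl) I).symm
  map_add' a b := (DirectLimit.add_def (f := N.incl) I a b).symm
  commutes' c := (DirectLimit.algebraMap_def (f := N.incl) I c).symm
  map_star' a := (DirectLimit.star_def (f := N.incl) I a).symm

lemma exists_toUnion (x : N.Union) : ∃ I a, N.toUnion I a = x := by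
  induction x using DirectLimit.induction with
  | _ I a => exact ⟨I, a, rfl⟩

lemma span_unitary_union : Submodule.span ℂ (unitary N.Union : Set N.Union) = ⊤ := by
  rw [eq_top_iff]
  rintro x -
  obtain ⟨I, a, rfl⟩ := N.exists_toUnion x
  have ha : a ∈ Submodule.span ℂ (unitary (N.alg I) : Set (N.alg I)) :=
    N.span_unitary I ▸ Submodule.mem_top
  have h := Submodule.mem_map_of_mem (f := (N.toUnion I).toAlgHom.toLinearMap) ha
  rw [Submodule.map_span] at h
  refine Submodule.span_mono ?_ h
  rintro _ ⟨u, hu, rfl⟩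
  have hu' := Unitary.mem_iff.1 hu
  refine Unitary.mem_iff.2 ⟨?_, ?_⟩
  · change star (N.toUnion I u) * N.toUnion I u = 1
    rw [← map_star, ← map_mul, hu'.1, map_one]
  · change N.toUnion I u * star (N.toUnion I u) = 1
    rw [← map_star, ← map_mul, hu'.2, map_one]

/-- The largest C*-seminorm on the algebraic colimit. If the local algebras are C*-algebras with
injective inclusions, it restricts to the C*-norm of each of them. -/
def unionNorm : CStarSeminorm N.Union := CStarSeminorm.sup N.span_unitary_union

instance : SeminormedRing N.Union :=
  RingSeminorm.toSeminormedRing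
    { toFun := fun a => N.unionNorm.val a
      map_zero' := map_zero N.unionNorm.toSeminorm
      add_le' := map_add_le_add N.unionNorm.toSeminorm
      neg' := map_neg_eq_map N.unionNorm.toSeminorm
      mul_le' := N.unionNorm.val_mul_le }

lemma norm_def (a : N.Union) : ‖a‖ = N.unionNorm.val a := rfl

instance : NormedAlgebra ℂ N.Union where
  norm_smul_le c a := (map_smul_eq_mul N.unionNorm.toSeminorm c a).le

instance : NormedStarGroup N.Union where
  norm_star_le a := N.unionNorm.val_star_le a

/-- The quasi-local C*-algebra of a net: the colimit of the local algebras in unital C*-algebras,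
that is, the (separated) completion of the algebraic colimit in its largest C*-seminorm. -/
def QuasiLocal : Type w := UniformSpace.Completion N.Union

instance : NormedRing N.QuasiLocal := inferInstanceAs (NormedRing (UniformSpace.Completion N.Union))
instance : Algebra ℂ N.QuasiLocal := inferInstanceAs (Algebra ℂ (UniformSpace.Completion N.Union))
instance : NormedAlgebra ℂ N.QuasiLocal where
  norm_smul_le := norm_smul_le (α := ℂ) (β := UniformSpace.Completion N.Union)
instance : CompleteSpace N.QuasiLocal :=
  inferInstanceAs (CompleteSpace (UniformSpace.Completion N.Union))

/-- The canonical map of the algebraic colimit to the quasi-local algebra. -/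
def toQuasiLocal : N.Union →ₐ[ℂ] N.QuasiLocal where
  toFun a := (a : UniformSpace.Completion N.Union)
  map_one' := UniformSpace.Completion.coe_one N.Union
  map_mul' := UniformSpace.Completion.coe_mul
  map_zero' := UniformSpace.Completion.coe_zero
  map_add' := UniformSpace.Completion.coe_add
  commutes' _ := rfl

lemma norm_toQuasiLocal (a : N.Union) : ‖N.toQuasiLocal a‖ = ‖a‖ :=
  UniformSpace.Completion.norm_coe a

lemma dense_toQuasiLocal : DenseRange N.toQuasiLocal :=
  UniformSpace.Completion.denseRange_coe

instance : Star N.QuasiLocal where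
  star := UniformSpace.Completion.map (star : N.Union → N.Union)

lemma continuous_star_quasiLocal : Continuous (star : N.QuasiLocal → N.QuasiLocal) :=
  UniformSpace.Completion.continuous_map

lemma star_toQuasiLocal (a : N.Union) : star (N.toQuasiLocal a) = N.toQuasiLocal (star a) :=
  UniformSpace.Completion.map_coe (starNormedAddGroupHom (E := N.Union)).uniformContinuous a

instance : StarRing N.QuasiLocal where
  star_involutive x := by
    refine N.dense_toQuasiLocal.induction_on x (isClosed_eq
      (N.continuous_star_quasiLocal.comp N.continuous_star_quasiLocal) continuous_id) fun a => ?_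
    rw [star_toQuasiLocal, star_toQuasiLocal, star_star]
  star_mul x y := by
    refine N.dense_toQuasiLocal.induction_on₂ (isClosed_eq
      (N.continuous_star_quasiLocal.comp (continuous_fst.mul continuous_snd))
      ((N.continuous_star_quasiLocal.comp continuous_snd).mul
        (N.continuous_star_quasiLocal.comp continuous_fst))) (fun a b => ?_) x y
    rw [← map_mul, star_toQuasiLocal, star_toQuasiLocal, star_toQuasiLocal, star_mul, map_mul]
  star_add x y := by
    refine N.dense_toQuasiLocal.induction_on₂ (isClosed_eq
      (N.continuous_star_quasiLocal.comp (continuous_fst.add continuous_snd))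
      ((N.continuous_star_quasiLocal.comp continuous_fst).add
        (N.continuous_star_quasiLocal.comp continuous_snd))) (fun a b => ?_) x y
    rw [← map_add, star_toQuasiLocal, star_toQuasiLocal, star_toQuasiLocal, star_add, map_add]

instance : CStarAlgebra N.QuasiLocal where
  star_smul c x := by
    refine N.dense_toQuasiLocal.induction_on x (isClosed_eq
      (N.continuous_star_quasiLocal.comp (continuous_const_smul c))
      ((continuous_const_smul (star c)).comp N.continuous_star_quasiLocal)) fun a => ?_
    rw [← map_smul, star_toQuasiLocal, star_toQuasiLocal, star_smul, map_smul]
  norm_mul_self_le x := by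
    refine N.dense_toQuasiLocal.induction_on x (isClosed_le (continuous_norm.mul continuous_norm)
      (continuous_norm.comp (N.continuous_star_quasiLocal.mul continuous_id))) fun a => ?_
    rw [star_toQuasiLocal, ← map_mul, norm_toQuasiLocal, norm_toQuasiLocal, ← sq]
    exact (N.unionNorm.val_star_mul_self a).ge

/-- The canonical map of a local algebra to the quasi-local algebra. -/
def localHom (I : NonemptyInterval ℤ) : N.alg I →⋆ₐ[ℂ] N.QuasiLocal :=
  StarAlgHom.comp { N.toQuasiLocal with map_star' := fun a => (N.star_toQuasiLocal a).symm }
    (N.toUnion I)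

/-- The local subalgebra `A_I` of the quasi-local algebra `A`. -/
def localAlgebra (I : NonemptyInterval ℤ) : StarSubalgebra ℂ N.QuasiLocal := (N.localHom I).range

end LocalNet

/-- The `R`-neighbourhood `I^{+R} = [a - R, b + R]` of `I = [a, b]`. -/
def NonemptyInterval.thicken (I : NonemptyInterval ℤ) (R : ℕ) : NonemptyInterval ℤ :=
  ⟨(I.fst - R, I.snd + R), by have := I.fst_le_snd; dsimp only; omega⟩

/-- Two nets are bounded spread isomorphic if there are an isomorphism `α` of their quasi-local
C*-algebras and an `R ≥ 0` such that `α` maps `A_I` into `B_{I^{+R}}` and its inverse maps `B_I`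
into `A_{I^{+R}}`, for all `I`. -/
def BoundedSpreadIsomorphic (M : LocalNet.{w}) (N : LocalNet.{u}) : Prop :=
  ∃ (α : M.QuasiLocal ≃⋆ₐ[ℂ] N.QuasiLocal) (R : ℕ),
    (∀ I, ∀ a ∈ M.localAlgebra I, α a ∈ N.localAlgebra (I.thicken R)) ∧
    (∀ I, ∀ b ∈ N.localAlgebra I, α.symm b ∈ M.localAlgebra (I.thicken R))
end

/-! ## Fusion spin chains -/

noncomputable section

/-- The number of sites of an interval. -/
def NonemptyInterval.card (I : NonemptyInterval ℤ) : ℕ := (I.snd + 1 - I.fst).toNat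

lemma NonemptyInterval.card_eq {I J : NonemptyInterval ℤ} (h : I ≤ J) :
    (I.fst - J.fst).toNat + I.card + (J.snd - I.snd).toNat = J.card := by
  have h1 := I.fst_le_snd
  have h2 := J.fst_le_snd
  have h3 := NonemptyInterval.le_def.1 h
  unfold NonemptyInterval.card
  omega

section FusionSpinChain
variable {C : Type u} [Category.{v} C] [MonoidalCategory C] [UnitaryMultifusionCategory C]
open UnitaryCategory UnitaryMultifusionCategory

lemma dagger_eqToHom {A B : C} (h : A = B) : dagger (eqToHom h) = eqToHom h.symm := by
  subst h
  simp [dagger_id]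

lemma dagger_inv_of_hom {A B : C} (e : A ≅ B) (h : dagger e.hom = e.inv) : dagger e.inv = e.hom := by
  rw [← h, dagger_dagger]

lemma dagger_tensorPowerAdd (X : C) (m n : ℕ) :
    dagger (tensorPowerAdd X m n).hom = (tensorPowerAdd X m n).inv := by
  induction n with
  | zero => exact dagger_rightUnitor _
  | succ n ih =>
    change dagger ((α_ _ _ _).inv ≫ (tensorPowerAdd X m n).hom ▷ X) =
      (tensorPowerAdd X m n).inv ▷ X ≫ (α_ _ _ _).hom
    rw [dagger_comp, dagger_whiskerRight, ih, dagger_inv_of_hom _ (dagger_associator _ _ _)]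

lemma dagger_embedAux (X : C) (l k r N : ℕ) (h : l + k + r = N) :
    dagger (embedAux X l k r N h).hom = (embedAux X l k r N h).inv := by
  simp [embedAux, dagger_comp, dagger_whiskerRight, dagger_tensorPowerAdd, dagger_eqToHom]

/-- The map `f ↦ 1^{⊗ l} ⊗ f ⊗ 1^{⊗ r}` from `End (X^{⊗ k})` to `End (X^{⊗ N})`, where
`l + k + r = N`. -/
def embed (X : C) (l k r N : ℕ) (h : l + k + r = N) :
    End (tensorPower X k) →⋆ₐ[ℂ] End (tensorPower X N) where
  toFun f := ((embedAux X l k r N h).inv ≫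
    (tensorPower X l ◁ (f : tensorPower X k ⟶ tensorPower X k)) ▷ tensorPower X r ≫
      (embedAux X l k r N h).hom : tensorPower X N ⟶ tensorPower X N)
  map_one' := by
    change _ ≫ (tensorPower X l ◁ (𝟙 _)) ▷ _ ≫ _ = 𝟙 _
    simp
  map_mul' f g := by
    change _ ≫ (tensorPower X l ◁ ((g : tensorPower X k ⟶ tensorPower X k) ≫ f)) ▷ _ ≫ _ =
      (_ ≫ _ ≫ _) ≫ (_ ≫ _ ≫ _)
    simp
  map_zero' := by
    have h1 : tensorPower X l ◁ (0 : tensorPower X k ⟶ tensorPower X k) = 0 := by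
      simpa using whiskerLeft_smul (tensorPower X l) (0 : ℂ) (0 : tensorPower X k ⟶ tensorPower X k)
    have h2 : (0 : tensorPower X l ⊗ tensorPower X k ⟶ tensorPower X l ⊗ tensorPower X k) ▷
        tensorPower X r = 0 := by
      simpa using smul_whiskerRight (0 : ℂ)
        (0 : tensorPower X l ⊗ tensorPower X k ⟶ tensorPower X l ⊗ tensorPower X k) (tensorPower X r)
    change _ ≫ (tensorPower X l ◁ (0 : tensorPower X k ⟶ tensorPower X k)) ▷ _ ≫ _ = 0
    rw [h1, h2, zero_comp, comp_zero]
  map_add' f g := by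
    change _ ≫ (tensorPower X l ◁ ((f : tensorPower X k ⟶ tensorPower X k) + g)) ▷ _ ≫ _ =
      (_ ≫ _ ≫ _) + (_ ≫ _ ≫ _)
    rw [whiskerLeft_add, add_whiskerRight, Preadditive.add_comp, Preadditive.comp_add]
  commutes' c := by
    rw [Algebra.algebraMap_eq_smul_one, Algebra.algebraMap_eq_smul_one]
    change _ ≫ (tensorPower X l ◁ (c • 𝟙 _)) ▷ _ ≫ _ = c • 𝟙 _
    rw [whiskerLeft_smul, smul_whiskerRight, Linear.smul_comp, Linear.comp_smul]
    simp
  map_star' f := by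
    change _ ≫ (tensorPower X l ◁ (dagger (f : tensorPower X k ⟶ tensorPower X k))) ▷ _ ≫ _ =
      dagger (_ ≫ _ ≫ _)
    rw [dagger_comp, dagger_comp, dagger_whiskerRight, dagger_whiskerLeft, dagger_embedAux,
      dagger_inv_of_hom _ (dagger_embedAux X l k r N h), Category.assoc]

variable (X : C)

/-- The net `A(C, X)`, with local algebras `End (X^{⊗ I})` and inclusions that tensor with `1_X` at
the sites of `J \ I`. It is called a fusion spin chain if `C` is indecomposable and `X` is a strong
tensor generator. -/
def fusionSpinChain : LocalNet.{v} where
  alg I := End (tensorPower X I.card)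
  incl I J h := embed X (I.fst - J.fst).toNat I.card (J.snd - I.snd).toNat J.card
    (NonemptyInterval.card_eq h)
  incl_refl I a := by
    have key : ∀ (l r : ℕ) (hl : l = 0) (hr : r = 0) (h : l + I.card + r = I.card),
        embed X l I.card r I.card h a = a := by
      rintro _ _ rfl rfl h
      exact embed_id X I.card a h
    exact key _ _ (by simp) (by simp) _
  incl_trans I J K hIJ hJK a := by
    have h1 := NonemptyInterval.le_def.1 hIJ
    have h2 := NonemptyInterval.le_def.1 hJK
    exact embed_comp X _ _ _ _ _ _ _ _ _ _ _ (by omega) (by omega) _ a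
  span_unitary I := span_unitary_end _

instance (I : NonemptyInterval ℤ) : FiniteDimensional ℂ ((fusionSpinChain X).alg I) :=
  inferInstanceAs (FiniteDimensional ℂ (End (tensorPower X I.card)))

end FusionSpinChain

end

/-! ## The chain `L^∞` and stabilization -/

noncomputable section Ampliation

/-- The Hilbert space `ℓ²(α)`. -/
abbrev EllTwo (α : Type) : Type := lp (fun _ : α => ℂ) 2

variable {α β γ : Type}

namespace EllTwo

lemma summable_sq (ξ : EllTwo α) : Summable fun a => ‖ξ a‖ ^ 2 := by
  have h := lp.memℓp ξ
  rw [memℓp_gen_iff (by norm_num)] at h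
  simpa using h

lemma norm_sq (ξ : EllTwo α) : ‖ξ‖ ^ 2 = ∑' a, ‖ξ a‖ ^ 2 := by
  have h := lp.norm_rpow_eq_tsum (p := 2) (by norm_num) ξ
  simpa using h

lemma memLp_of_summable {f : α → ℂ} (h : Summable fun a => ‖f a‖ ^ 2) :
    Memℓp (E := fun _ : α => ℂ) f 2 := by
  rw [memℓp_gen_iff (by norm_num)]
  simpa using h

/-- Under `ℓ²(γ) = ℓ²(α) ⊗ ℓ²(β)`, the component in `ℓ²(α)` of a vector at `b : β`. -/
def slice (e : γ ≃ α × β) (ξ : EllTwo γ) (b : β) : EllTwo α :=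
  ⟨fun a => ξ (e.symm (a, b)), memLp_of_summable <|
    (summable_sq ξ).comp_injective (i := fun a => e.symm (a, b))
      (fun a a' h => by simpa using h)⟩

@[simp] lemma slice_apply (e : γ ≃ α × β) (ξ : EllTwo γ) (b : β) (a : α) :
    slice e ξ b a = ξ (e.symm (a, b)) := rfl

lemma summable_prod (e : γ ≃ α × β) (ξ : EllTwo γ) :
    Summable fun x : β × α => ‖ξ (e.symm (x.2, x.1))‖ ^ 2 :=
  (summable_sq ξ).comp_injective (i := fun x : β × α => e.symm (x.2, x.1))
    (fun x y h => by
      have := e.symm.injective h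
      ext <;> simp_all)

lemma summable_slice (e : γ ≃ α × β) (ξ : EllTwo γ) : Summable fun b => ‖slice e ξ b‖ ^ 2 := by
  simp only [norm_sq, slice_apply]
  exact (summable_prod e ξ).prod

lemma tsum_slice (e : γ ≃ α × β) (ξ : EllTwo γ) : ∑' b, ‖slice e ξ b‖ ^ 2 = ‖ξ‖ ^ 2 := by
  simp only [norm_sq, slice_apply]
  rw [← (summable_prod e ξ).tsum_prod (f := fun x : β × α => ‖ξ (e.symm (x.2, x.1))‖ ^ 2)]
  exact ((Equiv.prodComm β α).trans e.symm).tsum_eq fun c => ‖ξ c‖ ^ 2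

lemma summable_ampl (e : γ ≃ α × β) (T : EllTwo α →L[ℂ] EllTwo α) (ξ : EllTwo γ) :
    Summable fun x : β × α => ‖T (slice e ξ x.1) x.2‖ ^ 2 := by
  rw [summable_prod_of_nonneg fun _ => sq_nonneg _]
  refine ⟨fun b => summable_sq (T (slice e ξ b)), ?_⟩
  change Summable fun b => ∑' a, ‖T (slice e ξ b) a‖ ^ 2
  simp only [← norm_sq]
  refine Summable.of_nonneg_of_le (fun _ => by positivity) (fun b => ?_)
    ((summable_slice e ξ).mul_left (‖T‖ ^ 2))
  rw [← mul_pow]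
  exact pow_le_pow_left₀ (norm_nonneg _) (T.le_opNorm _) 2

/-- The operator `T ⊗ 1`, as a function. -/
def amplFun (e : γ ≃ α × β) (T : EllTwo α →L[ℂ] EllTwo α) (ξ : EllTwo γ) : EllTwo γ :=
  ⟨fun c => T (slice e ξ (e c).2) (e c).1, memLp_of_summable <|
    (summable_ampl e T ξ).comp_injective (i := fun c => ((e c).2, (e c).1)) fun c c' h => by
      apply e.injective
      simp only [Prod.mk.injEq] at h
      exact Prod.ext h.2 h.1⟩

lemma amplFun_apply (e : γ ≃ α × β) (T : EllTwo α →L[ℂ] EllTwo α) (ξ : EllTwo γ) (c : γ) :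
    amplFun e T ξ c = T (slice e ξ (e c).2) (e c).1 := rfl

lemma slice_amplFun (e : γ ≃ α × β) (T : EllTwo α →L[ℂ] EllTwo α) (ξ : EllTwo γ) (b : β) :
    slice e (amplFun e T ξ) b = T (slice e ξ b) := by
  ext a
  simp [amplFun_apply]

lemma norm_amplFun_le (e : γ ≃ α × β) (T : EllTwo α →L[ℂ] EllTwo α) (ξ : EllTwo γ) :
    ‖amplFun e T ξ‖ ≤ ‖T‖ * ‖ξ‖ := by
  refine le_of_sq_le_sq ?_ (by positivity)
  rw [← tsum_slice e, mul_pow, ← tsum_slice e ξ, ← tsum_mul_left]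
  refine (summable_slice e _).tsum_le_tsum (fun b => ?_) ((summable_slice e ξ).mul_left _)
  rw [slice_amplFun, ← mul_pow]
  exact pow_le_pow_left₀ (norm_nonneg _) (T.le_opNorm _) 2

lemma slice_add (e : γ ≃ α × β) (ξ η : EllTwo γ) (b : β) :
    slice e (ξ + η) b = slice e ξ b + slice e η b := rfl

lemma slice_smul (e : γ ≃ α × β) (c : ℂ) (ξ : EllTwo γ) (b : β) :
    slice e (c • ξ) b = c • slice e ξ b := rfl

lemma ext_slice (e : γ ≃ α × β) {ξ η : EllTwo γ} (h : ∀ b, slice e ξ b = slice e η b) : ξ = η := by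
  ext c
  have := congrArg (fun f : EllTwo α => f (e c).1) (h (e c).2)
  simpa using this

/-- The operator `T ⊗ 1` on `ℓ²(γ) = ℓ²(α) ⊗ ℓ²(β)`. -/
def amplCLM (e : γ ≃ α × β) (T : EllTwo α →L[ℂ] EllTwo α) : EllTwo γ →L[ℂ] EllTwo γ :=
  LinearMap.mkContinuous
    { toFun := amplFun e T
      map_add' := fun ξ η => ext_slice e fun b => by simp only [slice_amplFun, slice_add, map_add]
      map_smul' := fun c ξ => ext_slice e fun b => by
        simp only [slice_amplFun, slice_smul, map_smul, RingHom.id_apply] }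
    ‖T‖ (norm_amplFun_le e T)

lemma slice_amplCLM (e : γ ≃ α × β) (T : EllTwo α →L[ℂ] EllTwo α) (ξ : EllTwo γ) (b : β) :
    slice e (amplCLM e T ξ) b = T (slice e ξ b) := slice_amplFun e T ξ b

lemma inner_eq_tsum_slice (e : γ ≃ α × β) (ξ η : EllTwo γ) :
    inner ℂ ξ η = ∑' b, inner ℂ (slice e ξ b) (slice e η b) := by
  have hs : Summable fun c : γ => inner ℂ (ξ c) (η c) := lp.summable_inner ξ η
  have hs' : Summable fun x : β × α => inner ℂ (ξ (e.symm (x.2, x.1))) (η (e.symm (x.2, x.1))) :=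
    hs.comp_injective (i := fun x : β × α => e.symm (x.2, x.1)) (fun x y h => by
      have := e.symm.injective h
      ext <;> simp_all)
  simp only [lp.inner_eq_tsum, slice_apply]
  rw [← hs'.tsum_prod]
  exact (((Equiv.prodComm β α).trans e.symm).tsum_eq fun c => inner ℂ (ξ c) (η c)).symm

/-- The *-homomorphism `T ↦ T ⊗ 1` from `B(ℓ²(α))` to `B(ℓ²(γ))`, `ℓ²(γ) = ℓ²(α) ⊗ ℓ²(β)`. -/
def ampl (e : γ ≃ α × β) : (EllTwo α →L[ℂ] EllTwo α) →⋆ₐ[ℂ] (EllTwo γ →L[ℂ] EllTwo γ) where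
  toFun := amplCLM e
  map_one' := ContinuousLinearMap.ext fun ξ => ext_slice e fun b => slice_amplCLM e 1 ξ b
  map_mul' S T := ContinuousLinearMap.ext fun ξ => ext_slice e fun b => by
    change _ = slice e (amplCLM e S (amplCLM e T ξ)) b
    rw [slice_amplCLM, slice_amplCLM, slice_amplCLM]
    rfl
  map_zero' := ContinuousLinearMap.ext fun ξ => ext_slice e fun b => by
    rw [slice_amplCLM]
    rfl
  map_add' S T := ContinuousLinearMap.ext fun ξ => ext_slice e fun b => by
    change _ = slice e (amplCLM e S ξ + amplCLM e T ξ) b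
    rw [slice_add, slice_amplCLM, slice_amplCLM, slice_amplCLM]
    rfl
  commutes' c := ContinuousLinearMap.ext fun ξ => ext_slice e fun b => by
    rw [slice_amplCLM]
    rfl
  map_star' T := by
    rw [ContinuousLinearMap.star_eq_adjoint, ContinuousLinearMap.star_eq_adjoint,
      ContinuousLinearMap.eq_adjoint_iff]
    intro ξ η
    rw [inner_eq_tsum_slice e, inner_eq_tsum_slice e]
    simp only [slice_amplCLM, ContinuousLinearMap.adjoint_inner_left]

lemma ampl_apply (e : γ ≃ α × β) (T : EllTwo α →L[ℂ] EllTwo α) (ξ : EllTwo γ) (c : γ) :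
    ampl e T ξ c = T (slice e ξ (e c).2) (e c).1 := rfl

end EllTwo

open EllTwo

/-- The sites of an interval. -/
abbrev Site (I : NonemptyInterval ℤ) : Type := Set.Icc I.fst I.snd

/-- Functions from the sites of `I` to `ℕ`: the standard orthonormal basis of `ℓ²(ℕ)^{⊗ I}` is
indexed by them, so that `ℓ²(ℕ)^{⊗ I} = ℓ²(Config I)`. -/
abbrev Config (I : NonemptyInterval ℤ) : Type := Site I → ℕ

/-- The splitting of configurations that gives `ℓ²(ℕ)^{⊗ J} = ℓ²(ℕ)^{⊗ I} ⊗ ℓ²(ℕ)^{⊗ (J \ I)}`. -/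
def splitConfig {I J : NonemptyInterval ℤ} (h : I ≤ J) :
    Config J ≃ Config I × ({j : Site J // (j : ℤ) ∉ Set.Icc I.fst I.snd} → ℕ) where
  toFun x := (fun i => x ⟨i, (NonemptyInterval.le_def.1 h).1.trans i.2.1,
    i.2.2.trans (NonemptyInterval.le_def.1 h).2⟩, fun j => x j)
  invFun p j := if hj : (j : ℤ) ∈ Set.Icc I.fst I.snd then p.1 ⟨j, hj⟩ else p.2 ⟨j, hj⟩
  left_inv x := by
    funext j
    by_cases hj : (j : ℤ) ∈ Set.Icc I.fst I.snd <;> simp [hj]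
  right_inv p := by
    ext j
    · simp
    · have := j.2
      simp only [this, dite_false]

/-- The net `L^∞` with local algebras `B(ℓ²(ℕ)^{⊗ I})` and inclusions `T ↦ T ⊗ 1`. -/
def oscillatorChain : LocalNet.{0} where
  alg I := EllTwo (Config I) →L[ℂ] EllTwo (Config I)
  incl I J h := ampl (splitConfig h)
  incl_refl I T := by
    ext ξ x
    rw [ampl_apply]
    have : slice (splitConfig (le_refl I)) ξ ((splitConfig (le_refl I)) x).2 = ξ := by
      ext y
      rw [slice_apply]
      refine congrArg (ξ : Config _ → ℂ) ?_
      funext j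
      exact dif_pos j.2
    rw [this]
    rfl
  incl_trans I J K hIJ hJK T := by
    ext ξ x
    rw [ampl_apply, ampl_apply, ampl_apply]
    have : slice (splitConfig hIJ) (slice (splitConfig hJK) ξ ((splitConfig hJK) x).2)
        (splitConfig hIJ (splitConfig hJK x).1).2 =
        slice (splitConfig (hIJ.trans hJK)) ξ (splitConfig (hIJ.trans hJK) x).2 := by
      ext y
      simp only [slice_apply]
      refine congrArg (ξ : Config _ → ℂ) ?_
      funext k
      by_cases hk : (k : ℤ) ∈ Set.Icc J.fst J.snd
      · by_cases hk' : (k : ℤ) ∈ Set.Icc I.fst I.snd <;>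
          simp [splitConfig, -Set.mem_Icc, hk, hk']
      · have hk' : (k : ℤ) ∉ Set.Icc I.fst I.snd := fun h' =>
          hk ⟨(NonemptyInterval.le_def.1 hIJ).1.trans h'.1,
            h'.2.trans (NonemptyInterval.le_def.1 hIJ).2⟩
        simp [splitConfig, -Set.mem_Icc, hk, hk']
    rw [this]
    rfl
  span_unitary I := CStarAlgebra.span_unitary _

end Ampliation

noncomputable section
namespace LocalNet
open scoped TensorProduct

/-- The stabilization `A^∞` of a net of finite dimensional algebras, with local algebras
`A_I ⊗ B(ℓ²(ℕ)^{⊗ I})`. Since `A_I` is finite dimensional, the algebraic tensor product is the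
tensor product of von Neumann algebras. -/
def stabilization (N : LocalNet.{w}) [∀ I, FiniteDimensional ℂ (N.alg I)] : LocalNet.{w} where
  alg I := N.alg I ⊗[ℂ] oscillatorChain.alg I
  incl I J h :=
    { Algebra.TensorProduct.map (N.incl I J h).toAlgHom (oscillatorChain.incl I J h).toAlgHom with
      map_star' := fun x => by
        induction x using TensorProduct.induction_on with
        | zero => simp
        | tmul a b =>
          change (N.incl I J h) (star a) ⊗ₜ[ℂ] (oscillatorChain.incl I J h) (star b) =
            star ((N.incl I J h) a ⊗ₜ[ℂ] (oscillatorChain.incl I J h) b)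
          rw [map_star, map_star, TensorProduct.star_tmul]
        | add x y hx hy =>
          simp only [AlgHom.toRingHom_eq_coe, RingHom.toMonoidHom_eq_coe, OneHom.toFun_eq_coe,
            MonoidHom.toOneHom_coe, MonoidHom.coe_coe, RingHom.coe_coe] at hx hy ⊢
          rw [star_add, map_add, map_add, star_add, hx, hy] }
  incl_refl I x := by
    induction x using TensorProduct.induction_on with
    | zero => exact map_zero _
    | tmul a b =>
      change (N.incl I I le_rfl) a ⊗ₜ[ℂ] (oscillatorChain.incl I I le_rfl) b = a ⊗ₜ[ℂ] b
      rw [N.incl_refl, oscillatorChain.incl_refl]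
    | add x y hx hy => rw [map_add, hx, hy]
  incl_trans I J K hIJ hJK x := by
    induction x using TensorProduct.induction_on with
    | zero => simp only [map_zero]
    | tmul a b =>
      change (N.incl J K hJK (N.incl I J hIJ a)) ⊗ₜ[ℂ]
        (oscillatorChain.incl J K hJK (oscillatorChain.incl I J hIJ b)) =
        (N.incl I K _ a) ⊗ₜ[ℂ] (oscillatorChain.incl I K _ b)
      rw [N.incl_trans, oscillatorChain.incl_trans]
    | add x y hx hy => simp only [map_add, hx, hy]
  span_unitary I := by
    rw [eq_top_iff, ← TensorProduct.span_tmul_eq_top, Submodule.span_le]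
    rintro _ ⟨a, b, rfl⟩
    have ha : a ∈ Submodule.span ℂ (unitary (N.alg I) : Set (N.alg I)) :=
      N.span_unitary I ▸ Submodule.mem_top
    have hb : b ∈ Submodule.span ℂ
        (unitary (oscillatorChain.alg I) : Set (oscillatorChain.alg I)) :=
      oscillatorChain.span_unitary I ▸ Submodule.mem_top
    have h := Submodule.apply_mem_map₂ (TensorProduct.mk ℂ _ _) ha hb
    rw [Submodule.map₂_span_span] at h
    refine Submodule.span_mono ?_ h
    rintro _ ⟨u, hu, v, hv, rfl⟩
    have hu' := Unitary.mem_iff.1 hu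
    have hv' := Unitary.mem_iff.1 hv
    refine Unitary.mem_iff.2 ⟨?_, ?_⟩
    · simp [hu'.1, hv'.1, Algebra.TensorProduct.one_def]
    · simp [hu'.2, hv'.2, Algebra.TensorProduct.one_def]

end LocalNet
end

/-! ## Tensor generators, Morita equivalence, matrix categories -/

section Morita

/-- `X` is a strong tensor generator if a single tensor power `X^{⊗ n}`, `n ≥ 1`, contains all simple
objects as summands. -/
def IsStrongTensorGenerator {C : Type u} [Category.{v} C] [MonoidalCategory C]
    [UnitaryMultifusionCategory C] (X : C) : Prop :=
  ∃ n : ℕ, 1 ≤ n ∧ ∀ S : C, Simple S → Nonempty (Retract S (tensorPower X n))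

open MonoidalLeftAction MonoidalRightAction UnitaryCategory

/-- A left action of a unitary multifusion category on a unitary category is unitary if it is
bilinear and compatible with the dagger and its structure isomorphisms are unitary. -/
class UnitaryLeftModule (D : Type u) [Category.{v} D] [MonoidalCategory D]
    [UnitaryMultifusionCategory D] (M : Type w) [Category.{w'} M] [UnitaryCategory M]
    [MonoidalLeftAction D M] : Prop where
  add_actionHomLeft : ∀ {d d' : D} (f g : d ⟶ d') (m : M), (f + g) ⊵ₗ m = f ⊵ₗ m + g ⊵ₗ m
  smul_actionHomLeft : ∀ {d d' : D} (z : ℂ) (f : d ⟶ d') (m : M), (z • f) ⊵ₗ m = z • (f ⊵ₗ m)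
  actionHomRight_add : ∀ (d : D) {m m' : M} (f g : m ⟶ m'), d ⊴ₗ (f + g) = d ⊴ₗ f + d ⊴ₗ g
  actionHomRight_smul : ∀ (d : D) {m m' : M} (z : ℂ) (f : m ⟶ m'), d ⊴ₗ (z • f) = z • (d ⊴ₗ f)
  dagger_actionHomLeft : ∀ {d d' : D} (f : d ⟶ d') (m : M), dagger (f ⊵ₗ m) = dagger f ⊵ₗ m
  dagger_actionHomRight : ∀ (d : D) {m m' : M} (f : m ⟶ m'), dagger (d ⊴ₗ f) = d ⊴ₗ dagger f
  dagger_actionAssocIso : ∀ (d d' : D) (m : M), dagger (αₗ d d' m).hom = (αₗ d d' m).inv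
  dagger_actionUnitIso : ∀ m : M, dagger (λₗ[D] m).hom = (λₗ[D] m).inv

/-- The same for right actions. -/
class UnitaryRightModule (C : Type u) [Category.{v} C] [MonoidalCategory C]
    [UnitaryMultifusionCategory C] (M : Type w) [Category.{w'} M] [UnitaryCategory M]
    [MonoidalRightAction C M] : Prop where
  add_actionHomLeft : ∀ {m m' : M} (f g : m ⟶ m') (c : C), (f + g) ⊵ᵣ c = f ⊵ᵣ c + g ⊵ᵣ c
  smul_actionHomLeft : ∀ {m m' : M} (z : ℂ) (f : m ⟶ m') (c : C), (z • f) ⊵ᵣ c = z • (f ⊵ᵣ c)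
  actionHomRight_add : ∀ (m : M) {c c' : C} (f g : c ⟶ c'), m ⊴ᵣ (f + g) = m ⊴ᵣ f + m ⊴ᵣ g
  actionHomRight_smul : ∀ (m : M) {c c' : C} (z : ℂ) (f : c ⟶ c'), m ⊴ᵣ (z • f) = z • (m ⊴ᵣ f)
  dagger_actionHomLeft : ∀ {m m' : M} (f : m ⟶ m') (c : C), dagger (f ⊵ᵣ c) = dagger f ⊵ᵣ c
  dagger_actionHomRight : ∀ (m : M) {c c' : C} (f : c ⟶ c'), dagger (m ⊴ᵣ f) = m ⊴ᵣ dagger f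
  dagger_actionAssocIso : ∀ (m : M) (c c' : C), dagger (αᵣ m c c').hom = (αᵣ m c c').inv
  dagger_actionUnitIso : ∀ m : M, dagger (ρᵣ[C] m).hom = (ρᵣ[C] m).inv

/-- A `ℂ`-linear functor that preserves the dagger. -/
def IsDaggerFunctor {M : Type u} [Category.{v} M] [UnitaryCategory M] {M' : Type w}
    [Category.{w'} M'] [UnitaryCategory M'] (F : M ⥤ M') : Prop :=
  (∀ {m m' : M} (f g : m ⟶ m'), F.map (f + g) = F.map f + F.map g) ∧
  (∀ {m m' : M} (z : ℂ) (f : m ⟶ m'), F.map (z • f) = z • F.map f) ∧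
  ∀ {m m' : M} (f : m ⟶ m'), F.map (dagger f) = dagger (F.map f)

/-- The structure of a unitary `D`-`C` bimodule category on a unitary left `D`-module and right
`C`-module category `M`: a unitary natural middle associator that satisfies the coherence conditions
with the associators and the unitors of both actions. -/
structure UnitaryBimodule (D : Type u) [Category.{v} D] [MonoidalCategory D]
    [UnitaryMultifusionCategory D] (C : Type u') [Category.{v'} C] [MonoidalCategory C]
    [UnitaryMultifusionCategory C] (M : Type w) [Category.{w'} M] [UnitaryCategory M]
    [MonoidalLeftAction D M] [MonoidalRightAction C M] [UnitaryLeftModule D M]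
    [UnitaryRightModule C M] where
  /-- The middle associator. -/
  mid : ∀ (d : D) (m : M) (c : C), (d ⊙ₗ m) ⊙ᵣ c ≅ d ⊙ₗ (m ⊙ᵣ c)
  dagger_mid : ∀ (d : D) (m : M) (c : C), dagger (mid d m c).hom = (mid d m c).inv
  mid_naturality_left : ∀ {d d' : D} (f : d ⟶ d') (m : M) (c : C),
    (f ⊵ₗ m) ⊵ᵣ c ≫ (mid d' m c).hom = (mid d m c).hom ≫ f ⊵ₗ (m ⊙ᵣ c)
  mid_naturality_middle : ∀ (d : D) {m m' : M} (f : m ⟶ m') (c : C),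
    (d ⊴ₗ f) ⊵ᵣ c ≫ (mid d m' c).hom = (mid d m c).hom ≫ d ⊴ₗ (f ⊵ᵣ c)
  mid_naturality_right : ∀ (d : D) (m : M) {c c' : C} (f : c ⟶ c'),
    (d ⊙ₗ m) ⊴ᵣ f ≫ (mid d m c').hom = (mid d m c).hom ≫ d ⊴ₗ (m ⊴ᵣ f)
  mid_tensor_left : ∀ (d d' : D) (m : M) (c : C),
    (mid (d ⊗ d') m c).hom ≫ (αₗ d d' (m ⊙ᵣ c)).hom =
      (αₗ d d' m).hom ⊵ᵣ c ≫ (mid d (d' ⊙ₗ m) c).hom ≫ d ⊴ₗ (mid d' m c).hom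
  mid_tensor_right : ∀ (d : D) (m : M) (c c' : C),
    (mid d m (c ⊗ c')).hom ≫ d ⊴ₗ (αᵣ m c c').hom =
      (αᵣ (d ⊙ₗ m) c c').hom ≫ (mid d m c).hom ⊵ᵣ c' ≫ (mid d (m ⊙ᵣ c) c').hom
  mid_unit_left : ∀ (m : M) (c : C),
    (mid (𝟙_ D) m c).hom ≫ (λₗ (m ⊙ᵣ c)).hom = (λₗ m).hom ⊵ᵣ c
  mid_unit_right : ∀ (d : D) (m : M),
    (mid d m (𝟙_ C)).hom ≫ d ⊴ₗ (ρᵣ m).hom = (ρᵣ (d ⊙ₗ m)).hom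

/-- The bimodule category `M` is invertible if the action of `D` is an equivalence from `D` to the
category `End_C(M)` of unitary `C`-module endofunctors of `M` and `C`-module transformations. -/
structure UnitaryBimodule.IsInvertible {D : Type u} [Category.{v} D] [MonoidalCategory D]
    [UnitaryMultifusionCategory D] {C : Type u'} [Category.{v'} C] [MonoidalCategory C]
    [UnitaryMultifusionCategory C] {M : Type w} [Category.{w'} M] [UnitaryCategory M]
    [MonoidalLeftAction D M] [MonoidalRightAction C M] [UnitaryLeftModule D M]
    [UnitaryRightModule C M] (B : UnitaryBimodule D C M) : Prop where
  fullyFaithful : ∀ (d d' : D) (η : (MonoidalLeftAction.curriedAction D M).obj d ⟶ (MonoidalLeftAction.curriedAction D M).obj d'),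
    (∀ (m : M) (c : C), η.app m ⊵ᵣ c ≫ (B.mid d' m c).hom =
      (B.mid d m c).hom ≫ η.app (m ⊙ᵣ c)) →
    ∃! f : d ⟶ d', (MonoidalLeftAction.curriedAction D M).map f = η
  essSurj : ∀ (F : M ⥤ M) [F.RightLinear C], IsDaggerFunctor F →
    (∀ (m : M) (c : C), dagger (Functor.LaxRightLinear.μᵣ F m c) =
      Functor.OplaxRightLinear.δᵣ F m c) →
    ∃ (d : D) (e : (MonoidalLeftAction.curriedAction D M).obj d ≅ F),
      (∀ m : M, dagger (e.hom.app m) = e.inv.app m) ∧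
      ∀ (m : M) (c : C), e.hom.app m ⊵ᵣ c ≫ Functor.LaxRightLinear.μᵣ F m c =
        (B.mid d m c).hom ≫ e.hom.app (m ⊙ᵣ c)

/-- `C` and `D` are Morita equivalent if there is an invertible unitary `D`-`C` bimodule category. -/
def MoritaEquivalent (C : Type u) [Category.{v} C] [MonoidalCategory C]
    [UnitaryMultifusionCategory C] (D : Type u') [Category.{v'} D] [MonoidalCategory D]
    [UnitaryMultifusionCategory D] : Prop :=
  ∃ (M : Type w) (_ : Category.{w'} M) (_ : UnitaryCategory M) (_ : MonoidalLeftAction D M)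
    (_ : MonoidalRightAction C M) (_ : UnitaryLeftModule D M) (_ : UnitaryRightModule C M)
    (B : UnitaryBimodule D C M), B.IsInvertible

/-- `M` has exactly `n` isomorphism classes of simple objects. -/
def HasRank (M : Type u) [Category.{v} M] [UnitaryCategory M] (n : ℕ) : Prop :=
  ∃ S : Fin n → M, (∀ k, Simple (S k)) ∧ (∀ k l, Nonempty (S k ≅ S l) → k = l) ∧
    ∀ X : M, Simple X → ∃ k, Nonempty (X ≅ S k)

/-- `E` is unitarily monoidally equivalent to `Mat_n(Hilb_fd)`, the tensor category `End(M)` of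
dagger endofunctors of a unitary category `M` of rank `n`: it acts on such an `M`, and the action is
an equivalence from `E` to `End(M)`. -/
def IsMatrixCategory (n : ℕ) (E : Type u) [Category.{v} E] [MonoidalCategory E]
    [UnitaryMultifusionCategory E] : Prop :=
  ∃ (M : Type w) (_ : Category.{w'} M) (_ : UnitaryCategory M) (_ : MonoidalLeftAction E M)
    (_ : UnitaryLeftModule E M), HasRank M n ∧
      (∀ (d d' : E) (η : (MonoidalLeftAction.curriedAction E M).obj d ⟶ (MonoidalLeftAction.curriedAction E M).obj d'),
        ∃! f : d ⟶ d', (MonoidalLeftAction.curriedAction E M).map f = η) ∧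
      ∀ F : M ⥤ M, IsDaggerFunctor F →
        ∃ (d : E) (e : (MonoidalLeftAction.curriedAction E M).obj d ≅ F), ∀ m : M, dagger (e.hom.app m) = e.inv.app m

end Morita

/-! ## Interleaved nets -/

noncomputable section
namespace LocalNet

/-! The two stabilized chains are compared through auxiliary objects `x` in `C` and `y` in `D` whose
chains interleave. Let `M` be an invertible `D`-`C` bimodule category and `m₀` an object of it. Let
`F = m₀ ⊙ᵣ -`, from `C` to `M`, and let `G`, from `M` to `C`, be the direct sum of the internal homs
out of the simple objects of `M`. Both are right `C`-module functors. The composite `GF` is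
tensoring on the left with `x = G m₀`, and `FG` is a module endofunctor of `M`, hence the action of
some `y` in `D` by invertibility. So `End (x^{⊗ k})` consists of the module endomorphisms of
`(GF)^k`, and `End (y^{⊗ (k+1)})` of those of `(FG)^{k+1} = F (GF)^k G`. Whiskering maps the first
algebra to the second; there is a similar map back, and the composite of the two is `f ↦ 1 ⊗ f ⊗ 1`
(`exists_interleaving`). In the colimit such maps become mutually inverse, with bounded spread
(`boundedSpreadIsomorphic_of_interleaving`).

Stabilization allows `X` to be replaced by `x`. Choose `N` such that `X^{⊗ N}` and `Y^{⊗ N}` contain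
every simple object, and choose `m₀` with enough multiplicity that they embed isometrically in `x`
and `y`. The isometry identifies `End (X^{⊗ N k})` with a corner of `End (x^{⊗ k})`, cut out by a
product of one-site projections. As `X^{⊗ N}` contains every simple summand of `x`, a one-site
projection becomes equivalent to `1` after tensoring with operators on an infinite-dimensional
Hilbert space (`exists_isometry_tensor`). Conjugation with the product of the one-site isometries
replaces the corner by the whole algebra, compatibly with the inclusions
(`exists_natural_starAlgEquiv_of_corner`, `exists_blockAlg_equiv`).

The remaining work is to make `G` a unitary module functor. Its structure map bends morphisms `S l ⟶
S k ⊗ c` to morphisms between duals, and this bending preserves inner products once every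
coevaluation `η` is scaled so that `η† ∘ η` is a projection (`DualReps.inner_eq`,
`InternalHom.lineator_isometry`).

For a matrix category the same scheme is run with plain dagger endofunctors of `M`. There `y` is
arranged to be a multiple of a matrix unit `s`; the positive tensor powers of `s` have only scalar
endomorphisms, so the stabilized chain of `s` is `oscillatorChain`. -/

lemma toUnion_incl (N : LocalNet.{w}) {I J : NonemptyInterval ℤ} (h : I ≤ J) (a : N.alg I) :
    N.toUnion J (N.incl I J h a) = N.toUnion I a :=
  Quotient.sound ⟨J, le_rfl, h, N.incl_refl J _⟩

lemma exists_toUnion₂ (N : LocalNet.{w}) (x y : N.Union) :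
    ∃ I a b, N.toUnion I a = x ∧ N.toUnion I b = y := by
  obtain ⟨I, a, rfl⟩ := N.exists_toUnion x
  obtain ⟨J, b, rfl⟩ := N.exists_toUnion y
  exact ⟨I ⊔ J, N.incl _ _ le_sup_left a, N.incl _ _ le_sup_right b, N.toUnion_incl _ a,
    N.toUnion_incl _ b⟩

/-- The homomorphism from the algebraic colimit given by a compatible family. -/
def unionLift (N : LocalNet.{w}) {X : Type u} [Ring X] [StarRing X] [Algebra ℂ X]
    (g : ∀ I, N.alg I →⋆ₐ[ℂ] X) (hg : ∀ I J h a, g J (N.incl I J h a) = g I a) :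
    N.Union →⋆ₐ[ℂ] X :=
  let F : N.Union → X := DirectLimit.lift N.incl (fun I a => g I a) fun I J h a => (hg I J h a).symm
  have hF : ∀ I a, F (N.toUnion I a) = g I a := fun _ _ => rfl
  { toFun := F
    map_one' := by
      let I : NonemptyInterval ℤ := ⟨(0, 0), le_rfl⟩
      rw [← map_one (N.toUnion I), hF, map_one]
    map_mul' := fun x y => by
      obtain ⟨I, a, b, rfl, rfl⟩ := N.exists_toUnion₂ x y
      rw [← map_mul, hF, hF, hF, map_mul]
    map_zero' := by
      let I : NonemptyInterval ℤ := ⟨(0, 0), le_rfl⟩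
      rw [← map_zero (N.toUnion I), hF, map_zero]
    map_add' := fun x y => by
      obtain ⟨I, a, b, rfl, rfl⟩ := N.exists_toUnion₂ x y
      rw [← map_add, hF, hF, hF, map_add]
    commutes' := fun c => by
      let I : NonemptyInterval ℤ := ⟨(0, 0), le_rfl⟩
      rw [← AlgHomClass.commutes (N.toUnion I) c, hF, AlgHomClass.commutes]
    map_star' := fun x => by
      obtain ⟨I, a, rfl⟩ := N.exists_toUnion x
      rw [← map_star, hF, hF, map_star] }

lemma unionLift_toUnion (N : LocalNet.{w}) {X : Type u} [Ring X] [StarRing X] [Algebra ℂ X]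
    (g : ∀ I, N.alg I →⋆ₐ[ℂ] X) (hg : ∀ I J h a, g J (N.incl I J h a) = g I a)
    (I : NonemptyInterval ℤ) (a : N.alg I) : N.unionLift g hg (N.toUnion I a) = g I a := rfl

/-- The pullback of a C*-seminorm along a *-homomorphism. -/
def _root_.CStarSeminorm.comap {A : Type w} {B : Type u} [Ring A] [StarRing A] [Algebra ℂ A]
    [Ring B] [StarRing B] [Algebra ℂ B] (p : CStarSeminorm B) (α : A →⋆ₐ[ℂ] B) :
    CStarSeminorm A where
  toFun a := p.val (α a)
  map_zero' := by rw [map_zero]; exact map_zero p.toSeminorm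
  add_le' a b := by rw [map_add]; exact map_add_le_add p.toSeminorm _ _
  neg' a := by rw [map_neg]; exact map_neg_eq_map p.toSeminorm _
  smul' c a := by rw [map_smul]; exact map_smul_eq_mul p.toSeminorm _ _
  mul_le' a b := by rw [map_mul]; exact p.val_mul_le _ _
  star_mul_self' a := by rw [map_mul, map_star]; exact p.val_star_mul_self _

/-- The norm is the largest C*-seminorm, and the pullback along `α` of any C*-seminorm is one of the
competitors in the supremum that defines `‖a‖`. No injectivity or topology is needed. -/
lemma norm_union_map_le {A : LocalNet.{w}} {B : LocalNet.{u}} (α : A.Union →⋆ₐ[ℂ] B.Union)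
    (a : A.Union) : ‖α a‖ ≤ ‖a‖ := by
  refine ciSup_le fun p => ?_
  exact le_ciSup (CStarSeminorm.bddAbove A.span_unitary_union a) (p.comap α)

lemma uniformContinuous_union_map {A : LocalNet.{w}} {B : LocalNet.{u}}
    (α : A.Union →⋆ₐ[ℂ] B.Union) : UniformContinuous α :=
  (AddMonoidHomClass.lipschitz_of_bound α 1 fun a => by
    simpa using norm_union_map_le α a).uniformContinuous

/-- The extension of a *-homomorphism of algebraic colimits to the quasi-local algebras. -/
def extend {A : LocalNet.{w}} {B : LocalNet.{u}} (α : A.Union →⋆ₐ[ℂ] B.Union) :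
    A.QuasiLocal →⋆ₐ[ℂ] B.QuasiLocal :=
  let F : A.QuasiLocal → B.QuasiLocal := UniformSpace.Completion.map α
  have hc : Continuous F := UniformSpace.Completion.continuous_map
  have hF : ∀ a, F (A.toQuasiLocal a) = B.toQuasiLocal (α a) :=
    UniformSpace.Completion.map_coe (uniformContinuous_union_map α)
  { toFun := F
    map_one' := by rw [← map_one A.toQuasiLocal, hF, map_one, map_one]
    map_mul' := fun x y => by
      refine A.dense_toQuasiLocal.induction_on₂ (isClosed_eq
        (hc.comp (continuous_fst.mul continuous_snd))
        ((hc.comp continuous_fst).mul (hc.comp continuous_snd))) (fun a b => ?_) x y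
      rw [← map_mul, hF, hF, hF, map_mul, map_mul]
    map_zero' := by rw [← map_zero A.toQuasiLocal, hF, map_zero, map_zero]
    map_add' := fun x y => by
      refine A.dense_toQuasiLocal.induction_on₂ (isClosed_eq
        (hc.comp (continuous_fst.add continuous_snd))
        ((hc.comp continuous_fst).add (hc.comp continuous_snd))) (fun a b => ?_) x y
      rw [← map_add, hF, hF, hF, map_add, map_add]
    commutes' := fun c => by
      rw [← AlgHom.commutes A.toQuasiLocal, hF, AlgHomClass.commutes, AlgHom.commutes]
    map_star' := fun x => by
      refine A.dense_toQuasiLocal.induction_on x (isClosed_eq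
        (hc.comp A.continuous_star_quasiLocal) (B.continuous_star_quasiLocal.comp hc)) fun a => ?_
      rw [star_toQuasiLocal, hF, hF, star_toQuasiLocal, map_star] }

lemma extend_toQuasiLocal {A : LocalNet.{w}} {B : LocalNet.{u}} (α : A.Union →⋆ₐ[ℂ] B.Union)
    (a : A.Union) : extend α (A.toQuasiLocal a) = B.toQuasiLocal (α a) :=
  UniformSpace.Completion.map_coe (uniformContinuous_union_map α) a

lemma continuous_extend {A : LocalNet.{w}} {B : LocalNet.{u}} (α : A.Union →⋆ₐ[ℂ] B.Union) :
    Continuous (extend α) := UniformSpace.Completion.continuous_map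

lemma extend_extend {A : LocalNet.{w}} {B : LocalNet.{u}} (α : A.Union →⋆ₐ[ℂ] B.Union)
    (β : B.Union →⋆ₐ[ℂ] A.Union) (h : ∀ a, β (α a) = a) (x : A.QuasiLocal) :
    extend β (extend α x) = x := by
  refine A.dense_toQuasiLocal.induction_on x (isClosed_eq
    ((continuous_extend β).comp (continuous_extend α)) continuous_id) fun a => ?_
  rw [extend_toQuasiLocal, extend_toQuasiLocal, h]

end LocalNet

/-- Two mutually inverse *-homomorphisms of algebraic colimits of bounded spread extend to a bounded
spread isomorphism. -/
lemma boundedSpreadIsomorphic_of_union {A : LocalNet.{w}} {B : LocalNet.{u}}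
    (α : A.Union →⋆ₐ[ℂ] B.Union) (β : B.Union →⋆ₐ[ℂ] A.Union) (hβα : ∀ a, β (α a) = a)
    (hαβ : ∀ b, α (β b) = b) (R : ℕ)
    (hα : ∀ I a, ∃ b, B.toUnion (I.thicken R) b = α (A.toUnion I a))
    (hβ : ∀ I b, ∃ a, A.toUnion (I.thicken R) a = β (B.toUnion I b)) :
    BoundedSpreadIsomorphic A B := by
  refine ⟨StarAlgEquiv.ofStarAlgHom (LocalNet.extend α) (LocalNet.extend β) ?_ ?_, R, ?_, ?_⟩
  · ext x; exact LocalNet.extend_extend α β hβα x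
  · ext x; exact LocalNet.extend_extend β α hαβ x
  · rintro I _ ⟨a, rfl⟩
    obtain ⟨b, hb⟩ := hα I a
    refine ⟨b, ?_⟩
    change B.toQuasiLocal (B.toUnion _ b) = LocalNet.extend α (A.toQuasiLocal (A.toUnion I a))
    rw [hb, LocalNet.extend_toQuasiLocal]
  · rintro I _ ⟨a, rfl⟩
    obtain ⟨b, hb⟩ := hβ I a
    refine ⟨b, ?_⟩
    change A.toQuasiLocal (A.toUnion _ b) = LocalNet.extend β (B.toQuasiLocal (B.toUnion I a))
    rw [hb, LocalNet.extend_toQuasiLocal]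

/-! ### Blocks of consecutive sites and the intervals they cover. -/

namespace NonemptyInterval

/-- The union of the blocks of `N` consecutive sites with labels in `J`. -/
def block (N : ℕ) (J : NonemptyInterval ℤ) : NonemptyInterval ℤ :=
  ⟨(N * J.fst, N * J.snd + (N - 1 : ℕ)), by
    have := mul_le_mul_of_nonneg_left J.fst_le_snd (Int.natCast_nonneg N)
    dsimp only
    omega⟩

lemma block_mono (N : ℕ) {I J : NonemptyInterval ℤ} (h : I ≤ J) : I.block N ≤ J.block N := by
  obtain ⟨h1, h2⟩ := NonemptyInterval.le_def.1 h
  refine NonemptyInterval.le_def.2 ⟨?_, ?_⟩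
  · exact mul_le_mul_of_nonneg_left h1 (Int.natCast_nonneg N)
  · exact add_le_add_left (mul_le_mul_of_nonneg_left h2 (Int.natCast_nonneg N)) _

lemma le_thicken (I : NonemptyInterval ℤ) (R : ℕ) : I ≤ I.thicken R := by
  refine NonemptyInterval.le_def.2 ⟨?_, ?_⟩ <;> simp [thicken]

lemma thicken_mono {I J : NonemptyInterval ℤ} (h : I ≤ J) (R : ℕ) : I.thicken R ≤ J.thicken R := by
  obtain ⟨h1, h2⟩ := NonemptyInterval.le_def.1 h
  refine NonemptyInterval.le_def.2 ⟨?_, ?_⟩ <;> simp only [thicken] <;> omega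

lemma ediv_natCast_mono (N : ℕ) {a b : ℤ} (h : a ≤ b) : a / (N : ℤ) ≤ b / N := by
  rcases N.eq_zero_or_pos with rfl | hN
  · simp
  · exact Int.ediv_le_ediv (by exact_mod_cast hN) h

/-- The labels of the blocks that meet `I`. -/
def cover (N : ℕ) (I : NonemptyInterval ℤ) : NonemptyInterval ℤ :=
  ⟨(I.fst / N, I.snd / N), ediv_natCast_mono N I.fst_le_snd⟩

lemma cover_mono (N : ℕ) {I J : NonemptyInterval ℤ} (h : I ≤ J) : I.cover N ≤ J.cover N := by
  obtain ⟨h1, h2⟩ := NonemptyInterval.le_def.1 h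
  exact NonemptyInterval.le_def.2 ⟨ediv_natCast_mono N h1, ediv_natCast_mono N h2⟩

lemma le_block_cover {N : ℕ} (hN : 0 < N) (I : NonemptyInterval ℤ) : I ≤ (I.cover N).block N := by
  have hN' : (0 : ℤ) < N := by exact_mod_cast hN
  refine NonemptyInterval.le_def.2 ⟨?_, ?_⟩
  · exact Int.mul_ediv_self_le hN'.ne'
  · have := Int.lt_mul_ediv_self_add (x := I.snd) hN'
    simp only [block, cover]
    omega

/-- Rounding an endpoint to a block costs less than `N` sites and the extra block on that side costs
`N` more. This is where the spread `2 * N` comes from. -/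
lemma block_thicken_cover_le {N : ℕ} (hN : 0 < N) (I : NonemptyInterval ℤ) :
    ((I.cover N).thicken 1).block N ≤ I.thicken (2 * N) := by
  have hN' : (0 : ℤ) < N := by exact_mod_cast hN
  have h1 := Int.lt_mul_ediv_self_add (x := I.fst) hN'
  have h2 := Int.mul_ediv_self_le (x := I.snd) hN'.ne'
  refine NonemptyInterval.le_def.2 ⟨?_, ?_⟩ <;> simp only [block, cover, thicken] <;> push_cast <;>
    simp only [mul_sub, mul_add] <;> omega

end NonemptyInterval

open NonemptyInterval in
-- Blocks are cofinal among the intervals, so maps that are natural on blocks determine a map of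
-- colimits.
lemma exists_union_map_of_block {A : LocalNet.{w}} {B : LocalNet.{u}} {N : ℕ} (hN : 0 < N)
    (Φ : ∀ J : NonemptyInterval ℤ, A.alg (J.block N) →⋆ₐ[ℂ] B.alg ((J.thicken 1).block N))
    (hΦ : ∀ I J (h : I ≤ J) a, Φ J (A.incl _ _ (block_mono N h) a) =
      B.incl _ _ (block_mono N (thicken_mono h 1)) (Φ I a)) :
    ∃ α : A.Union →⋆ₐ[ℂ] B.Union,
      (∀ I a, α (A.toUnion (I.block N) a) = B.toUnion _ (Φ I a)) ∧
      ∀ I a, ∃ b, B.toUnion (I.thicken (2 * N)) b = α (A.toUnion I a) := by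
  -- An interval need not be a union of blocks, so its algebra is included in that of the blocks
  -- that meet it before `Φ` is applied.
  let g : ∀ I, A.alg I →⋆ₐ[ℂ] B.Union := fun I =>
    ((B.toUnion _).comp (Φ (I.cover N))).comp (A.incl I _ (le_block_cover hN I))
  have hg : ∀ I J h a, g J (A.incl I J h a) = g I a := by
    intro I J h a
    change B.toUnion _ (Φ _ (A.incl _ _ _ (A.incl _ _ _ a))) =
      B.toUnion _ (Φ _ (A.incl _ _ _ a))
    have e : A.incl J _ (le_block_cover hN J) (A.incl I J h a) =
        A.incl _ _ (block_mono N (cover_mono N h)) (A.incl I _ (le_block_cover hN I) a) := by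
      rw [A.incl_trans, A.incl_trans]
    rw [e, hΦ _ _ (cover_mono N h), B.toUnion_incl]
  have hα : ∀ I a, A.unionLift g hg (A.toUnion (I.block N) a) = B.toUnion _ (Φ I a) := by
    intro I a
    rw [A.unionLift_toUnion]
    change B.toUnion _ (Φ _ (A.incl _ _ _ a)) = _
    have hI : I ≤ (I.block N).cover N := by
      have hN' : (0 : ℤ) < N := by exact_mod_cast hN
      refine NonemptyInterval.le_def.2 ⟨?_, ?_⟩
      · simp only [block, cover]
        rw [Int.mul_ediv_cancel_left _ hN'.ne']
      · simp only [block, cover]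
        rw [Int.le_ediv_iff_mul_le hN', mul_comm]
        omega
    rw [← B.toUnion_incl (block_mono N (thicken_mono hI 1)), ← hΦ _ _ hI]
  refine ⟨A.unionLift g hg, hα, fun I a => ?_⟩
  refine ⟨B.incl _ _ (block_thicken_cover_le hN I)
    (Φ _ (A.incl _ _ (le_block_cover hN I) a)), ?_⟩
  rw [B.toUnion_incl, A.unionLift_toUnion]
  rfl

open NonemptyInterval in
/-- Natural homomorphisms between the algebras of blocks, in both directions and of spread one block,
whose compositions are the inclusions, give a bounded spread isomorphism. -/
lemma boundedSpreadIsomorphic_of_interleaving {A : LocalNet.{w}} {B : LocalNet.{u}} {N : ℕ}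
    (hN : 0 < N)
    (Φ : ∀ J : NonemptyInterval ℤ, A.alg (J.block N) →⋆ₐ[ℂ] B.alg ((J.thicken 1).block N))
    (Ψ : ∀ J : NonemptyInterval ℤ, B.alg (J.block N) →⋆ₐ[ℂ] A.alg ((J.thicken 1).block N))
    (hΦ : ∀ I J (h : I ≤ J) a, Φ J (A.incl _ _ (block_mono N h) a) =
      B.incl _ _ (block_mono N (thicken_mono h 1)) (Φ I a))
    (hΨ : ∀ I J (h : I ≤ J) a, Ψ J (B.incl _ _ (block_mono N h) a) =
      A.incl _ _ (block_mono N (thicken_mono h 1)) (Ψ I a))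
    (hΨΦ : ∀ J a, Ψ (J.thicken 1) (Φ J a) =
      A.incl _ _ (block_mono N ((J.le_thicken 1).trans ((J.thicken 1).le_thicken 1))) a)
    (hΦΨ : ∀ J a, Φ (J.thicken 1) (Ψ J a) =
      B.incl _ _ (block_mono N ((J.le_thicken 1).trans ((J.thicken 1).le_thicken 1))) a) :
    BoundedSpreadIsomorphic A B := by
  obtain ⟨α, hα, hα'⟩ := exists_union_map_of_block hN Φ hΦ
  obtain ⟨β, hβ, hβ'⟩ := exists_union_map_of_block hN Ψ hΨ
  refine boundedSpreadIsomorphic_of_union α β (fun x => ?_) (fun x => ?_) (2 * N) hα' hβ'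
  · obtain ⟨I, a, rfl⟩ := A.exists_toUnion x
    rw [← A.toUnion_incl (le_block_cover hN I), hα, hβ, hΨΦ, A.toUnion_incl]
  · obtain ⟨I, a, rfl⟩ := B.exists_toUnion x
    rw [← B.toUnion_incl (le_block_cover hN I), hβ, hα, hΦΨ, B.toUnion_incl]
end

/-! ## Semisimplicity of unitary categories -/

noncomputable section

/-- In finite dimension the spectrum is finite, since it consists of roots of the minimal
polynomial, so every function on it is continuous. A non-scalar self-adjoint element has at least
two spectral points, and the functional calculus of the indicator of one of them is the projection.
-/
lemma CStarAlgebra.exists_projection {A : Type w} [CStarAlgebra A] [FiniteDimensional ℂ A] {a : A}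
    (ha : IsSelfAdjoint a) (hs : ∀ z : ℂ, a ≠ z • 1) :
    ∃ p : A, IsSelfAdjoint p ∧ p * p = p ∧ p ≠ 0 ∧ p ≠ 1 := by
  have hnt : Nontrivial A := ⟨a, 0, by simpa using hs 0⟩
  have hfinC : (spectrum ℂ a).Finite := by
    have hint : IsIntegral ℂ a := Algebra.IsIntegral.isIntegral a
    refine ((minpoly ℂ a).roots.toFinset.finite_toSet).subset fun z hz => ?_
    have h := spectrum.subset_polynomial_aeval a (minpoly ℂ a) ⟨z, hz, rfl⟩
    rw [minpoly.aeval, spectrum.zero_eq] at h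
    simp only [Finset.mem_coe, Multiset.mem_toFinset]
    exact (Polynomial.mem_roots (minpoly.ne_zero hint)).2 h
  have hfin : (spectrum ℝ a).Finite := by
    have : spectrum ℝ a = (algebraMap ℝ ℂ) ⁻¹' spectrum ℂ a :=
      (spectrum.preimage_algebraMap ℂ).symm
    rw [this]
    exact hfinC.preimage (FaithfulSMul.algebraMap_injective ℝ ℂ).injOn
  have hcont : ∀ f : ℝ → ℝ, ContinuousOn f (spectrum ℝ a) := fun f =>
    hfin.continuousOn f
  have hne : (spectrum ℝ a).Nonempty := by
    by_contra h
    rw [Set.not_nonempty_iff_eq_empty] at h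
    refine hs (0 : ℝ) ?_
    have := CFC.eq_algebraMap_of_spectrum_subset_singleton a (0 : ℝ) (by simp [h]) ha
    simpa using this
  obtain ⟨x, hx⟩ := hne
  obtain ⟨y, hy, hxy⟩ : ∃ y ∈ spectrum ℝ a, y ≠ x := by
    by_contra! h
    refine hs (x : ℂ) ?_
    have := CFC.eq_algebraMap_of_spectrum_subset_singleton a x (fun y hy => h y hy) ha
    rw [this, Algebra.algebraMap_eq_smul_one]
    exact (Complex.coe_smul x (1 : A)).symm
  classical
  let f : ℝ → ℝ := fun t => if t = x then 1 else 0
  have hff : ∀ t, f t * f t = f t := fun t => by by_cases h : t = x <;> simp [f, h]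
  have hspec : spectrum ℝ (cfc f a) = f '' spectrum ℝ a := cfc_map_spectrum f a ha (hcont f)
  refine ⟨cfc f a, cfc_predicate f a, ?_, ?_, ?_⟩
  · rw [← cfc_mul f f a (hcont f) (hcont f)]
    simp only [hff]
  · intro h0
    rw [h0, spectrum.zero_eq] at hspec
    have : (1 : ℝ) ∈ ({0} : Set ℝ) := hspec ▸ ⟨x, hx, by simp [f]⟩
    simp at this
  · intro h0
    rw [h0, spectrum.one_eq] at hspec
    have : (0 : ℝ) ∈ ({1} : Set ℝ) := hspec ▸ ⟨y, hy, by simp [f, hxy]⟩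
    simp at this

namespace UnitaryCategory
variable {C : Type u} [Category.{v} C] [UnitaryCategory C]

lemma dagger_zero (X Y : C) : dagger (0 : X ⟶ Y) = 0 := by
  simpa using dagger_smul (0 : ℂ) (0 : X ⟶ Y)

lemma dagger_neg {X Y : C} (f : X ⟶ Y) : dagger (-f) = -dagger f := by
  simpa using dagger_smul (-1 : ℂ) f

lemma dagger_sub {X Y : C} (f g : X ⟶ Y) : dagger (f - g) = dagger f - dagger g := by
  rw [sub_eq_add_neg, dagger_add, dagger_neg, ← sub_eq_add_neg]

lemma dagger_sum {X Y : C} {ι : Type*} (s : Finset ι) (f : ι → (X ⟶ Y)) :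
    dagger (∑ k ∈ s, f k) = ∑ k ∈ s, dagger (f k) :=
  map_sum ({ toFun := dagger, map_zero' := dagger_zero X Y, map_add' := dagger_add } :
    (X ⟶ Y) →+ (Y ⟶ X)) f s

lemma dagger_injective {X Y : C} {f g : X ⟶ Y} (h : dagger f = dagger g) : f = g := by
  rw [← dagger_dagger f, h, dagger_dagger]

lemma eq_zero_of_comp_dagger {X Y : C} {f : X ⟶ Y} (h : f ≫ dagger f = 0) : f = 0 := by
  refine eq_zero_of_homNorm f ?_
  have := homNorm_cstar f
  rw [h, homNorm_zero] at this
  exact pow_eq_zero_iff two_ne_zero |>.1 this.symm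

lemma eq_zero_of_dagger_comp {X Y : C} {f : X ⟶ Y} (h : dagger f ≫ f = 0) : f = 0 := by
  refine dagger_injective ((eq_zero_of_comp_dagger (f := dagger f) ?_).trans (dagger_zero _ _).symm)
  rw [dagger_dagger, h]

lemma exists_projection {X : C} (a : X ⟶ X) (ha : dagger a = a) (hs : ∀ z : ℂ, a ≠ z • 𝟙 X) :
    ∃ p : X ⟶ X, dagger p = p ∧ p ≫ p = p ∧ p ≠ 0 ∧ p ≠ 𝟙 X :=
  letI := endCStarAlgebra X
  CStarAlgebra.exists_projection (A := End X) (a := a) ha hs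

/-- Real and imaginary parts reduce the claim to self-adjoint endomorphisms. -/
lemma exists_scalar_of_selfAdjoint {X : C}
    (key : ∀ a : X ⟶ X, dagger a = a → ∃ z : ℂ, a = z • 𝟙 X) (f : X ⟶ X) :
    ∃ z : ℂ, f = z • 𝟙 X := by
  obtain ⟨z, hz⟩ := key (f + dagger f) (by rw [dagger_add, dagger_dagger, add_comm])
  obtain ⟨w, hw⟩ := key (Complex.I • (f - dagger f)) (by
    rw [dagger_smul, dagger_sub, dagger_dagger, Complex.star_def, Complex.conj_I, ← neg_sub,
      smul_neg, neg_smul, neg_neg])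
  refine ⟨(1 / 2 : ℂ) * z - (Complex.I / 2) * w, ?_⟩
  have e : f = (1 / 2 : ℂ) • (f + dagger f) - (Complex.I / 2) • (Complex.I • (f - dagger f)) := by
    have hI : (Complex.I / 2) * Complex.I = -(1 / 2) := by
      rw [div_mul_eq_mul_div, Complex.I_mul_I, neg_div]
    rw [smul_smul, hI, neg_smul, sub_neg_eq_add, smul_add, smul_sub]
    have : f = (1 / 2 : ℂ) • f + (1 / 2 : ℂ) • f := by rw [← add_smul]; norm_num
    nth_rewrite 1 [this]
    abel
  rw [sub_smul, mul_smul, mul_smul, ← hz, ← hw]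
  exact e

/-- Every endomorphism of a simple object is a scalar. -/
lemma exists_scalar {S : C} [Simple S] (f : S ⟶ S) : ∃ z : ℂ, f = z • 𝟙 S := by
  refine exists_scalar_of_selfAdjoint (fun a ha => ?_) f
  by_contra! hs
  -- The image of this projection is a nonzero subobject of `S`, so it is all of `S`, which
  -- contradicts `p ≠ 𝟙`.
  obtain ⟨p, hp, hpp, hp0, hp1⟩ := exists_projection a ha hs
  obtain ⟨Y, i, hi, hip⟩ := exists_splitting p hpp hp
  have : Mono i := (SplitMono.mk (dagger i) hi).mono
  have hi0 : i ≠ 0 := by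
    rintro rfl
    rw [comp_zero] at hip
    exact hp0 hip.symm
  have : IsIso i := isIso_of_mono_of_nonzero hi0
  apply hp1
  rw [← hip, ← cancel_epi i, reassoc_of% hi, Category.comp_id]

/-- A nonzero mono `f` has `f ∘ f†` equal to a nonzero scalar, so a multiple of `f†` inverts it. -/
lemma simple_of_scalar {X : C} (h0 : 𝟙 X ≠ 0) (h : ∀ f : X ⟶ X, ∃ z : ℂ, f = z • 𝟙 X) :
    Simple X where
  mono_isIso_iff_nonzero {Y} f hf := by
    constructor
    · rintro hi rfl
      apply h0
      have : Epi (0 : Y ⟶ X) := inferInstance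
      rw [← cancel_epi (0 : Y ⟶ X)]
      simp
    · intro hf0
      obtain ⟨z, hz⟩ := h (dagger f ≫ f)
      have hz0 : z ≠ 0 := by
        rintro rfl
        rw [zero_smul] at hz
        exact hf0 (eq_zero_of_dagger_comp hz)
      have e : (z⁻¹ • dagger f) ≫ f = 𝟙 X := by
        rw [Linear.smul_comp, hz, smul_smul, inv_mul_cancel₀ hz0, one_smul]
      refine ⟨z⁻¹ • dagger f, ?_, e⟩
      rw [← cancel_mono f, Category.assoc, e]
      simp

/-- The scalar given by an endomorphism of a simple object. -/
def scal {X : C} (f : X ⟶ X) : ℂ := by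
  -- The value is `0` when the endomorphism is not a scalar, so no simplicity hypothesis has to be
  -- carried by the definition.
  classical exact if h : ∃ z : ℂ, f = z • 𝟙 X then h.choose else 0

lemma scal_smul_id {S : C} [Simple S] (f : S ⟶ S) : scal f • 𝟙 S = f := by
  have h := exists_scalar f
  rw [scal, dif_pos h]
  exact h.choose_spec.symm

lemma scal_smul_eq_comp {S X : C} [Simple S] (f : S ⟶ S) (g : S ⟶ X) : scal f • g = f ≫ g := by
  conv_rhs => rw [← scal_smul_id f, Linear.smul_comp, Category.id_comp]

lemma smul_id_injective {X : C} (h0 : 𝟙 X ≠ 0) {z w : ℂ} (h : z • 𝟙 X = w • 𝟙 X) : z = w := by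
  rw [← sub_eq_zero, ← sub_smul] at h
  exact sub_eq_zero.1 ((smul_eq_zero.1 h).resolve_right h0)

lemma scal_eq {S : C} [Simple S] {f : S ⟶ S} {z : ℂ} (h : f = z • 𝟙 S) : scal f = z :=
  smul_id_injective (id_nonzero S) ((scal_smul_id f).trans h)

lemma scal_add {S : C} [Simple S] (f g : S ⟶ S) : scal (f + g) = scal f + scal g :=
  scal_eq (by rw [add_smul, scal_smul_id, scal_smul_id])

lemma scal_smul {S : C} [Simple S] (c : ℂ) (f : S ⟶ S) : scal (c • f) = c * scal f :=
  scal_eq (by rw [mul_smul, scal_smul_id])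

lemma scal_zero {S : C} [Simple S] : scal (0 : S ⟶ S) = 0 := scal_eq (by rw [zero_smul])
lemma scal_id {S : C} [Simple S] : scal (𝟙 S) = 1 := scal_eq (by rw [one_smul])

/-- Positivity enters here: by `exists_sqrt` the scalar `f† ∘ f` has the form `z * star z`, so
dividing `f` by `z` makes it an isometry. -/
lemma exists_isometry_of_ne_zero {S X : C} [Simple S] {f : S ⟶ X} (hf : f ≠ 0) :
    ∃ c : ℂ, c ≠ 0 ∧ (c • f) ≫ dagger (c • f) = 𝟙 S := by
  obtain ⟨g, hg⟩ := exists_sqrt f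
  obtain ⟨z, rfl⟩ := exists_scalar g
  rw [dagger_smul, dagger_id, Linear.smul_comp, Linear.comp_smul, Category.comp_id, smul_smul] at hg
  have hz : z ≠ 0 := by
    rintro rfl
    rw [zero_mul, zero_smul] at hg
    exact hf (eq_zero_of_comp_dagger hg)
  refine ⟨z⁻¹, inv_ne_zero hz, ?_⟩
  rw [dagger_smul, Linear.smul_comp, Linear.comp_smul, hg, smul_smul, smul_smul]
  have hz' : star z ≠ 0 := star_ne_zero.2 hz
  have : z⁻¹ * (star z⁻¹ * (z * star z)) = 1 := by
    rw [star_inv₀]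
    field_simp
  rw [mul_assoc, this, one_smul]

lemma exists_unitary_of_ne_zero {S T : C} [Simple S] [Simple T] {f : S ⟶ T} (hf : f ≠ 0) :
    ∃ c : ℂ, c ≠ 0 ∧ (c • f) ≫ dagger (c • f) = 𝟙 S ∧ dagger (c • f) ≫ (c • f) = 𝟙 T := by
  obtain ⟨c, hc, h⟩ := exists_isometry_of_ne_zero hf
  refine ⟨c, hc, h, ?_⟩
  set g := c • f
  have : Mono g := (SplitMono.mk (dagger g) h).mono
  have hg : g ≠ 0 := smul_ne_zero hc hf
  have : IsIso g := isIso_of_mono_of_nonzero hg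
  rw [← cancel_epi g, reassoc_of% h, Category.comp_id]

lemma nonempty_iso_of_ne_zero {S T : C} [Simple S] [Simple T] {f : S ⟶ T} (hf : f ≠ 0) :
    Nonempty (S ≅ T) := by
  obtain ⟨c, -, h1, h2⟩ := exists_unitary_of_ne_zero hf
  exact ⟨⟨c • f, dagger (c • f), h1, h2⟩⟩

lemma simple_of_iso {S T : C} [Simple S] (e : S ≅ T) : Simple T := Simple.of_iso e.symm

/-! ### Orthogonal direct sums and decomposition into simple objects. -/

/-- `X` is the orthogonal direct sum of the objects `s k`. -/
structure OrthoSum {ι : Type} [Fintype ι] (s : ι → C) (X : C) where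
  incl : ∀ k, s k ⟶ X
  isometry : ∀ k, incl k ≫ dagger (incl k) = 𝟙 (s k)
  ortho : ∀ k l, k ≠ l → incl k ≫ dagger (incl l) = 0
  total : ∑ k, dagger (incl k) ≫ incl k = 𝟙 X

lemma exists_orthoSum {ι : Type} [Fintype ι] (s : ι → C) : ∃ X : C, Nonempty (OrthoSum s X) := by
  have : ∀ (n : ℕ) (s : Fin n → C), ∃ X : C, Nonempty (OrthoSum s X) := by
    intro n
    induction n with
    | zero =>
      intro s
      obtain ⟨Z, hZ⟩ := exists_zero (C := C)
      exact ⟨Z, ⟨⟨fun k => k.elim0, fun k => k.elim0, fun k => k.elim0, by simp [hZ]⟩⟩⟩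
    | succ n ih =>
      intro s
      obtain ⟨X, ⟨d⟩⟩ := ih fun k => s k.succ
      obtain ⟨Z, i, j, hi, hj, hij, hZ⟩ := exists_directSum (s 0) X
      have hji : j ≫ dagger i = 0 := by
        rw [← dagger_dagger (j ≫ dagger i), dagger_comp, dagger_dagger, hij, dagger_zero]
      refine ⟨Z, ⟨⟨fun k => Fin.cases (motive := fun k => s k ⟶ Z) i (fun k => d.incl k ≫ j) k,
        fun k => ?_, fun k l hkl => ?_, ?_⟩⟩⟩
      · refine Fin.cases ?_ (fun k => ?_) k
        · exact hi
        · change (d.incl k ≫ j) ≫ dagger (d.incl k ≫ j) = _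
          rw [dagger_comp, Category.assoc, reassoc_of% hj, d.isometry]
      · revert hkl
        refine Fin.cases ?_ (fun k => ?_) k <;> refine Fin.cases ?_ (fun l => ?_) l <;> intro hkl
        · exact absurd rfl hkl
        · change i ≫ dagger (d.incl l ≫ j) = 0
          rw [dagger_comp, reassoc_of% hij, zero_comp]
        · change (d.incl k ≫ j) ≫ dagger i = 0
          rw [Category.assoc, hji, comp_zero]
        · change (d.incl k ≫ j) ≫ dagger (d.incl l ≫ j) = _
          rw [dagger_comp, Category.assoc, reassoc_of% hj, d.ortho k l (by simpa using hkl)]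
      · rw [Fin.sum_univ_succ]
        change dagger i ≫ i + ∑ k, dagger (d.incl k ≫ j) ≫ d.incl k ≫ j = _
        have : ∀ k, dagger (d.incl k ≫ j) ≫ d.incl k ≫ j =
            dagger j ≫ (dagger (d.incl k) ≫ d.incl k) ≫ j := fun k => by
          rw [dagger_comp]; simp only [Category.assoc]
        simp only [this]
        rw [← Preadditive.comp_sum, ← Preadditive.sum_comp, d.total, Category.id_comp, hZ]
  -- The sum over a general index type is transported from `Fin` along an enumeration; the `eqToHom`
  -- factors only correct the index.
  obtain ⟨X, ⟨d⟩⟩ := this (Fintype.card ι) fun k => s ((Fintype.equivFin ι).symm k)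
  let e := Fintype.equivFin ι
  have h : ∀ k, s (e.symm (e k)) = s k := fun k => by rw [e.symm_apply_apply]
  have aux : ∀ k l, k = l → ∀ hkl : s (e.symm l) = s (e.symm k),
      eqToHom hkl ≫ d.incl k = d.incl l := by
    rintro k _ rfl hkl
    simp
  refine ⟨X, ⟨⟨fun k => eqToHom (h k).symm ≫ d.incl (e k), fun k => ?_, fun k l hkl => ?_, ?_⟩⟩⟩
  · have : ∀ {A B : C} (hAB : A = B) (f : B ⟶ X), f ≫ dagger f = 𝟙 B →
        (eqToHom hAB ≫ f) ≫ dagger (eqToHom hAB ≫ f) = 𝟙 A := by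
      rintro A _ rfl f hf
      simpa using hf
    exact this _ _ (d.isometry _)
  · rw [dagger_comp, Category.assoc, reassoc_of% d.ortho (e k) (e l) (by simpa using hkl)]
    simp
  · have : ∀ {A B : C} (hAB : A = B) (f : B ⟶ X),
        dagger (eqToHom hAB ≫ f) ≫ eqToHom hAB ≫ f = dagger f ≫ f := by
      rintro A _ rfl f
      simp
    simp only [this]
    rw [← d.total]
    exact e.sum_comp (fun k => dagger (d.incl k) ≫ d.incl k)

/-- Induction on the dimension of the endomorphism algebra. If there are non-scalar endomorphisms, a
proper projection and its complement split `X` into two pieces. The endomorphism algebra of a piece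
embeds in that of `X` as a corner that misses `𝟙 X`, so its dimension is strictly smaller. -/
lemma exists_simple_decomposition (X : C) : ∃ (ι : Type) (_ : Fintype ι) (s : ι → C),
    (∀ k, Simple (s k)) ∧ Nonempty (OrthoSum s X) := by
  suffices H : ∀ (n : ℕ) (X : C), Module.finrank ℂ (X ⟶ X) < n → ∃ (ι : Type) (_ : Fintype ι)
      (s : ι → C), (∀ k, Simple (s k)) ∧ Nonempty (OrthoSum s X) from
    H _ X (Nat.lt_succ_self _)
  intro n
  induction n with
  | zero => intro X h; exact absurd h (Nat.not_lt_zero _)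
  | succ n ih =>
    intro X hX
    by_cases h0 : 𝟙 X = 0
    · exact ⟨Empty, inferInstance, fun k => k.elim, fun k => k.elim,
        ⟨⟨fun k => k.elim, fun k => k.elim, fun k => k.elim, by simp [h0]⟩⟩⟩
    by_cases hs : ∀ f : X ⟶ X, ∃ z : ℂ, f = z • 𝟙 X
    · have := simple_of_scalar h0 hs
      exact ⟨Unit, inferInstance, fun _ => X, fun _ => this,
        ⟨⟨fun _ => 𝟙 X, fun _ => by simp [dagger_id], fun k l h => absurd rfl h,
          by simp [dagger_id]⟩⟩⟩
    obtain ⟨p, hp, hpp, hp0, hp1⟩ : ∃ p : X ⟶ X, dagger p = p ∧ p ≫ p = p ∧ p ≠ 0 ∧ p ≠ 𝟙 X := by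
      by_contra! hno
      refine absurd (exists_scalar_of_selfAdjoint fun a ha => ?_) hs
      by_contra! hs
      obtain ⟨p, h1, h2, h3, h4⟩ := exists_projection a ha hs
      exact h4 (hno p h1 h2 h3)
    have split : ∀ q : X ⟶ X, dagger q = q → q ≫ q = q → q ≠ 𝟙 X → ∃ (ι : Type) (_ : Fintype ι)
        (s : ι → C) (i : ∀ k, s k ⟶ X), (∀ k, Simple (s k)) ∧
        (∀ k, i k ≫ dagger (i k) = 𝟙 (s k)) ∧ (∀ k l, k ≠ l → i k ≫ dagger (i l) = 0) ∧
        (∑ k, dagger (i k) ≫ i k = q) ∧ ∀ k, i k ≫ q = i k := by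
      intro q hq hqq hq1
      obtain ⟨Y, j, hj, hjq⟩ := exists_splitting q hqq hq
      have hlt : Module.finrank ℂ (Y ⟶ Y) < Module.finrank ℂ (X ⟶ X) := by
        have := finiteDimensional_hom X X
        have := finiteDimensional_hom Y Y
        let φ : (Y ⟶ Y) →ₗ[ℂ] (X ⟶ X) :=
          { toFun := fun f => dagger j ≫ f ≫ j
            map_add' := fun f g => by simp
            map_smul' := fun c f => by simp }
        have hφ : Function.Injective φ := fun f g hfg => by
          have h : j ≫ (dagger j ≫ f ≫ j) ≫ dagger j = j ≫ (dagger j ≫ g ≫ j) ≫ dagger j :=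
            congrArg (fun x => j ≫ x ≫ dagger j) hfg
          simp only [Category.assoc, hj, Category.comp_id] at h
          rwa [reassoc_of% hj, reassoc_of% hj] at h
        rw [← LinearMap.finrank_range_of_inj hφ]
        refine Submodule.finrank_lt fun htop => ?_
        obtain ⟨f, hf⟩ : 𝟙 X ∈ LinearMap.range φ := htop ▸ Submodule.mem_top
        apply hq1
        have hf' : dagger j ≫ f ≫ j = 𝟙 X := hf
        calc q = q ≫ dagger j ≫ f ≫ j := by rw [hf', Category.comp_id]
          _ = dagger j ≫ f ≫ j := by rw [← hjq, Category.assoc, reassoc_of% hj]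
          _ = 𝟙 X := hf'
      obtain ⟨ι, hι, s, hs, ⟨d⟩⟩ := ih Y (by omega)
      refine ⟨ι, hι, s, fun k => d.incl k ≫ j, hs, fun k => ?_, fun k l hkl => ?_, ?_, fun k => ?_⟩
      · rw [dagger_comp, Category.assoc, reassoc_of% hj, d.isometry]
      · rw [dagger_comp, Category.assoc, reassoc_of% hj, d.ortho k l hkl]
      · have : ∀ k, dagger (d.incl k ≫ j) ≫ d.incl k ≫ j =
            dagger j ≫ (dagger (d.incl k) ≫ d.incl k) ≫ j := fun k => by
          rw [dagger_comp]; simp only [Category.assoc]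
        simp only [this]
        rw [← Preadditive.comp_sum, ← Preadditive.sum_comp, d.total, Category.id_comp, hjq]
      · rw [← hjq, Category.assoc, reassoc_of% hj]
    obtain ⟨ι, hι, s, i, hs1, hi, hio, hit, hiq⟩ := split p hp hpp hp1
    obtain ⟨κ, hκ, t, j, ht1, hj, hjo, hjt, hjq⟩ := split (𝟙 X - p)
      (by rw [dagger_sub, hp, dagger_id])
      (by simp [hpp]) (by simpa using hp0)
    have hij : ∀ k l, i k ≫ dagger (j l) = 0 := fun k l => by
      rw [← hiq, ← hjq l, dagger_comp, dagger_sub, dagger_id, hp, Category.assoc]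
      simp [reassoc_of% hpp]
    refine ⟨ι ⊕ κ, inferInstance, Sum.elim s t, fun k => ?_, ⟨⟨fun k => ?_, fun k => ?_,
      fun k l hkl => ?_, ?_⟩⟩⟩
    · cases k with
      | inl k => exact hs1 k
      | inr k => exact ht1 k
    · exact match k with
      | .inl k => i k
      | .inr k => j k
    · cases k with
      | inl k => exact hi k
      | inr k => exact hj k
    · cases k with
      | inl k =>
        cases l with
        | inl l => exact hio k l (by simpa using hkl)
        | inr l => exact hij k l
      | inr k =>
        cases l with
        | inl l =>
          change j k ≫ dagger (i l) = 0
          rw [← dagger_dagger (j k ≫ dagger (i l)), dagger_comp, dagger_dagger, hij, dagger_zero]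
        | inr l => exact hjo k l (by simpa using hkl)
    · rw [Fintype.sum_sum_type]
      change ∑ k, dagger (i k) ≫ i k + ∑ k, dagger (j k) ≫ j k = 𝟙 X
      rw [hit, hjt, add_sub_cancel]

/-! ### Representatives of the simple objects and orthonormal bases of morphism spaces. -/

/-- A family of representatives of the isomorphism classes of simple objects. -/
structure SimpleReps {ι : Type} (S : ι → C) : Prop where
  simple : ∀ k, Simple (S k)
  eq_of_iso : ∀ k l, Nonempty (S k ≅ S l) → k = l
  exists_iso : ∀ X : C, Simple X → ∃ k, Nonempty (S k ≅ X)

lemma exists_simpleReps (C : Type u) [Category.{v} C] [UnitaryCategory C] :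
    ∃ (ι : Type) (_ : Fintype ι) (S : ι → C), SimpleReps S := by
  classical
  obtain ⟨n, S, hS⟩ := exists_simples (C := C)
  -- The given list may contain repetitions and objects that are not simple; the simple entries with
  -- no earlier isomorphic entry are kept.
  let P : Fin n → Prop := fun k => Simple (S k) ∧ ∀ l < k, ¬ Nonempty (S l ≅ S k)
  refine ⟨{k // P k}, inferInstance, fun k => S k, ⟨fun k => k.2.1, ?_, ?_⟩⟩
  · rintro k l ⟨e⟩
    rcases lt_trichotomy k.1 l.1 with h | h | h
    · exact absurd ⟨e⟩ (l.2.2 _ h)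
    · exact Subtype.ext h
    · exact absurd ⟨e.symm⟩ (k.2.2 _ h)
  · intro X hX
    obtain ⟨k, hk, hmin⟩ := WellFounded.has_min (wellFounded_lt (α := Fin n))
      {k | Nonempty (X ≅ S k)} (hS X hX)
    obtain ⟨e⟩ := hk
    refine ⟨⟨k, simple_of_iso e, fun l hl ⟨e'⟩ => hmin l ⟨e ≪≫ e'.symm⟩ hl⟩, ⟨e.symm⟩⟩

lemma SimpleReps.hom_eq_zero {ι : Type} {S : ι → C} (hS : SimpleReps S) {k l : ι} (h : k ≠ l)
    (f : S k ⟶ S l) : f = 0 := by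
  have := hS.simple k
  have := hS.simple l
  by_contra hf
  exact h (hS.eq_of_iso k l (nonempty_iso_of_ne_zero hf))

/-- An orthonormal basis of the space of morphisms from `S` to `X`. -/
structure HomBasis (S X : C) where
  ι : Type
  [fintype : Fintype ι]
  b : ι → (S ⟶ X)
  isometry : ∀ k, b k ≫ dagger (b k) = 𝟙 S
  ortho : ∀ k l, k ≠ l → b k ≫ dagger (b l) = 0
  total : ∀ f : S ⟶ X, ∑ k, scal (f ≫ dagger (b k)) • b k = f

attribute [instance] HomBasis.fintype

lemma exists_unitary_of_iso {S T : C} [Simple S] (e : S ≅ T) :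
    ∃ f : S ⟶ T, f ≫ dagger f = 𝟙 S ∧ dagger f ≫ f = 𝟙 T := by
  have := simple_of_iso e
  have he : e.hom ≠ 0 := by
    intro h
    apply id_nonzero S
    rw [← e.hom_inv_id, h, zero_comp]
  obtain ⟨c, -, h1, h2⟩ := exists_unitary_of_ne_zero he
  exact ⟨_, h1, h2⟩

/-- The inclusions of those summands of `X` that are isomorphic to `S` form a basis; the other
summands receive no nonzero morphism from `S`. -/
lemma nonempty_homBasis (S X : C) [Simple S] : Nonempty (HomBasis S X) := by
  classical
  obtain ⟨ι, _, s, hs, ⟨d⟩⟩ := exists_simple_decomposition X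
  choose u hu hu' using fun k : {k // Nonempty (S ≅ s k)} => exists_unitary_of_iso k.2.some
  refine ⟨⟨{k // Nonempty (S ≅ s k)}, fun k => u k ≫ d.incl k, fun k => ?_, fun k l hkl => ?_,
    fun f => ?_⟩⟩
  · rw [dagger_comp, Category.assoc, reassoc_of% d.isometry, hu]
  · rw [dagger_comp, Category.assoc, reassoc_of% d.ortho k l (by simpa [Subtype.ext_iff] using hkl)]
    simp
  · have h1 : ∀ k, scal (f ≫ dagger (u k ≫ d.incl k)) • (u k ≫ d.incl k) =
        f ≫ dagger (d.incl k.1) ≫ d.incl k.1 := by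
      intro k
      rw [scal_smul_eq_comp, dagger_comp]
      simp only [Category.assoc]
      rw [reassoc_of% hu']
    have h2 : ∀ k, ¬ Nonempty (S ≅ s k) → f ≫ dagger (d.incl k) ≫ d.incl k = 0 := by
      intro k hk
      have := hs k
      have : f ≫ dagger (d.incl k) = 0 := by
        by_contra h
        exact hk (nonempty_iso_of_ne_zero h)
      rw [reassoc_of% this, zero_comp]
    simp only [h1]
    conv_rhs => rw [← Category.comp_id f, ← d.total, Preadditive.comp_sum]
    rw [← Finset.sum_subtype (Finset.univ.filter fun k => Nonempty (S ≅ s k)) (by simp)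
      (fun k => f ≫ dagger (d.incl k) ≫ d.incl k)]
    exact Finset.sum_subset (Finset.subset_univ _) fun k _ hk => h2 k (by simpa using hk)

/-- A chosen orthonormal basis of the space of morphisms from a simple object. -/
def homBasis (S X : C) [Simple S] : HomBasis S X := (nonempty_homBasis S X).some

/-- A morphism is determined by its compositions with the morphisms from simple objects. -/
lemma SimpleReps.hom_ext {ι : Type} {S : ι → C} (hS : SimpleReps S) {X Y : C} {f g : X ⟶ Y}
    (h : ∀ (k : ι) (b : S k ⟶ X), b ≫ f = b ≫ g) : f = g := by
  obtain ⟨κ, _, s, hs, ⟨d⟩⟩ := exists_simple_decomposition X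
  rw [← Category.id_comp f, ← Category.id_comp g, ← d.total, Preadditive.sum_comp,
    Preadditive.sum_comp]
  refine Finset.sum_congr rfl fun k _ => ?_
  obtain ⟨l, ⟨e⟩⟩ := hS.exists_iso (s k) (hs k)
  have := h l (e.hom ≫ d.incl k)
  rw [Category.assoc, Category.assoc, Iso.cancel_iso_hom_left] at this
  rw [Category.assoc, this, Category.assoc]

/-- The resolution of the identity of `X` over its isotypic components. -/
lemma SimpleReps.sum_homBasis {ι : Type} [Fintype ι] {S : ι → C} (hS : SimpleReps S)
    {X : C} (b : ∀ k, HomBasis (S k) X) :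
    ∑ k, ∑ j, dagger ((b k).b j) ≫ (b k).b j = 𝟙 X := by
  classical
  refine hS.hom_ext fun k f => ?_
  have := hS.simple k
  rw [Category.comp_id, Preadditive.comp_sum, Finset.sum_eq_single k]
  · rw [Preadditive.comp_sum]
    conv_rhs => rw [← (b k).total f]
    refine Finset.sum_congr rfl fun j _ => ?_
    rw [scal_smul_eq_comp, Category.assoc]
  · intro l _ hl
    rw [Preadditive.comp_sum]
    refine Finset.sum_eq_zero fun j _ => ?_
    rw [← Category.assoc, hS.hom_eq_zero hl.symm (f ≫ dagger _), zero_comp]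
  · intro h
    exact absurd (Finset.mem_univ k) h

lemma exists_isometry_of_retract {S X : C} [Simple S] (r : Retract S X) :
    ∃ f : S ⟶ X, f ≫ dagger f = 𝟙 S := by
  have h : r.i ≠ 0 := by
    intro h
    apply id_nonzero S
    rw [← r.retract, h, zero_comp]
  obtain ⟨c, -, hc⟩ := exists_isometry_of_ne_zero h
  exact ⟨_, hc⟩

/-- The retract given by an isometry. -/
def retractOfIsometry {S X : C} (f : S ⟶ X) (h : f ≫ dagger f = 𝟙 S) : Retract S X :=
  ⟨f, dagger f, h⟩

lemma nonempty_retract_of_ne_zero {S X : C} [Simple S] {f : S ⟶ X} (h : f ≠ 0) :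
    Nonempty (Retract S X) := by
  obtain ⟨c, -, hc⟩ := exists_isometry_of_ne_zero h
  exact ⟨retractOfIsometry _ hc⟩

end UnitaryCategory
end

/-! ## Operators on `ℓ²` -/

noncomputable section
namespace EllTwo
variable {α β γ α' β' : Type}

/-- The standard basis vectors. -/
def basisVec [DecidableEq α] (a : α) : EllTwo α := lp.single 2 a (1 : ℂ)

lemma basisVec_apply [DecidableEq α] (a c : α) : basisVec a c = if c = a then 1 else 0 := by
  rw [basisVec, lp.single_apply, Pi.single_apply]

lemma clm_ext [DecidableEq α] {S T : EllTwo α →L[ℂ] EllTwo β}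
    (h : ∀ a, S (basisVec a) = T (basisVec a)) : S = T := by
  ext1 ξ
  have hs := lp.hasSum_single (E := fun _ : α => ℂ) (p := 2) (by norm_num) ξ
  have e : ∀ a, lp.single 2 a (ξ a) = ξ a • basisVec a := fun a => by
    rw [basisVec, ← lp.single_smul, smul_eq_mul, mul_one]
  simp only [e] at hs
  have h1 := S.hasSum hs
  have h2 := T.hasSum hs
  simp only [map_smul, h] at h1 h2
  exact h1.unique h2

/-- The vector that agrees with `c` outside the first factor of `e`. -/
def upd (e : γ ≃ α × β) (a : α) (c : γ) : γ := e.symm (a, (e c).2)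

lemma upd_eq_iff (e : γ ≃ α × β) (a : α) (c x : γ) :
    upd e a c = x ↔ a = (e x).1 ∧ (e c).2 = (e x).2 := by
  rw [upd, Equiv.symm_apply_eq, Prod.ext_iff]

lemma ampl_basisVec [DecidableEq α] [DecidableEq γ] (e : γ ≃ α × β) (T : EllTwo α →L[ℂ] EllTwo α)
    (x c : γ) [Decidable (upd e (e x).1 c = x)] : ampl e T (basisVec x) c =
      if upd e (e x).1 c = x then T (basisVec (e x).1) (e c).1 else 0 := by
  rw [ampl_apply]
  by_cases h : upd e (e x).1 c = x
  · rw [if_pos h]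
    have : slice e (basisVec x) (e c).2 = basisVec (e x).1 := by
      ext a
      rw [slice_apply, basisVec_apply, basisVec_apply]
      congr 1
      have := (upd_eq_iff e _ _ _).1 h
      rw [Equiv.symm_apply_eq, Prod.ext_iff]
      simp [this.2]
    rw [this]
  · rw [if_neg h]
    have : slice e (basisVec x) (e c).2 = 0 := by
      ext a
      rw [slice_apply, basisVec_apply, if_neg]
      · rfl
      · intro h'
        exact h ((upd_eq_iff e _ _ _).2 ⟨rfl, ((upd_eq_iff e a _ _).1 h').2⟩)
    rw [this, map_zero]
    rfl

/-- The matrix coefficient of the product is a delta in the remaining coordinates times a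
coefficient of each operator. This formula is symmetric in the two operators, which is why they
commute. -/
lemma ampl_ampl_basisVec [DecidableEq α] [DecidableEq α'] [DecidableEq γ] (e : γ ≃ α × β)
    (e' : γ ≃ α' × β') (h1 : ∀ a c, (e' (upd e a c)).1 = (e' c).1)
    (h2 : ∀ a b c, upd e a (upd e' b c) = upd e' b (upd e a c))
    (S : EllTwo α →L[ℂ] EllTwo α) (T : EllTwo α' →L[ℂ] EllTwo α') (x c : γ) :
    ampl e S (ampl e' T (basisVec x)) c = if upd e (e x).1 (upd e' (e' x).1 c) = x then
      T (basisVec (e' x).1) (e' c).1 * S (basisVec (e x).1) (e c).1 else 0 := by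
  rw [ampl_apply]
  have key : ∀ a, slice e (ampl e' T (basisVec x)) (e c).2 a =
      if upd e a (upd e' (e' x).1 c) = x then T (basisVec (e' x).1) (e' c).1 else 0 := by
    intro a
    rw [slice_apply]
    change ampl e' T (basisVec x) (upd e a c) = _
    rw [ampl_basisVec, h1, h2]
  by_cases h : upd e (e x).1 (upd e' (e' x).1 c) = x
  · rw [if_pos h]
    have : slice e (ampl e' T (basisVec x)) (e c).2 =
        T (basisVec (e' x).1) (e' c).1 • basisVec (e x).1 := by
      ext a
      rw [key, lp.coeFn_smul, Pi.smul_apply, basisVec_apply, smul_eq_mul]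
      by_cases ha : a = (e x).1
      · rw [if_pos (by rw [ha]; exact h), if_pos ha, mul_one]
      · rw [if_neg (fun h' => ha ((upd_eq_iff e _ _ _).1 h').1), if_neg ha, mul_zero]
    rw [this, map_smul, lp.coeFn_smul, Pi.smul_apply, smul_eq_mul]
  · rw [if_neg h]
    have : slice e (ampl e' T (basisVec x)) (e c).2 = 0 := by
      ext a
      rw [key, if_neg]
      · rfl
      · intro h'
        have := (upd_eq_iff e _ _ _).1 h'
        exact h ((upd_eq_iff e _ _ _).2 ⟨rfl, this.2⟩)
    rw [this, map_zero]
    rfl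

/-- Operators on different tensor factors commute. -/
lemma commute_ampl (e : γ ≃ α × β) (e' : γ ≃ α' × β') (h1 : ∀ a c, (e' (upd e a c)).1 = (e' c).1)
    (h1' : ∀ a c, (e (upd e' a c)).1 = (e c).1)
    (h2 : ∀ a b c, upd e a (upd e' b c) = upd e' b (upd e a c))
    (S : EllTwo α →L[ℂ] EllTwo α) (T : EllTwo α' →L[ℂ] EllTwo α') :
    Commute (ampl e S) (ampl e' T) := by
  classical
  refine clm_ext fun x => ?_
  ext c
  change ampl e S (ampl e' T (basisVec x)) c = ampl e' T (ampl e S (basisVec x)) c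
  rw [ampl_ampl_basisVec e e' h1 h2, ampl_ampl_basisVec e' e h1' fun a b c => (h2 b a c).symm, h2,
    mul_comm]

/-- The operator that takes a vector to its component at `b`. -/
def sliceCLM (e : γ ≃ α × β) (b : β) : EllTwo γ →L[ℂ] EllTwo α :=
  LinearMap.mkContinuous
    { toFun := fun ξ => slice e ξ b
      map_add' := fun ξ η => slice_add e ξ η b
      map_smul' := fun c ξ => slice_smul e c ξ b } 1 fun ξ => by
    rw [one_mul]
    refine le_of_sq_le_sq ?_ (norm_nonneg _)
    rw [← tsum_slice e ξ]
    exact (summable_slice e ξ).le_tsum b fun _ _ => sq_nonneg _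

lemma sliceCLM_apply (e : γ ≃ α × β) (b : β) (ξ : EllTwo γ) : sliceCLM e b ξ = slice e ξ b := rfl

/-- The vector with the single nonzero component `ζ` at `b`. -/
def unslice [DecidableEq β] (e : γ ≃ α × β) (ζ : EllTwo α) (b : β) : EllTwo γ :=
  ⟨fun c => if (e c).2 = b then ζ (e c).1 else 0, memLp_of_summable <| by
    have hi : Function.Injective fun a => e.symm (a, b) := fun a a' h => by simpa using h
    refine (hi.summable_iff fun c hc => ?_).1 ?_
    · rw [if_neg]
      · simp
      · rintro rfl
        exact hc ⟨(e c).1, by simp⟩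
    · refine (summable_sq ζ).congr fun a => ?_
      simp⟩

lemma slice_unslice [DecidableEq β] (e : γ ≃ α × β) (ζ : EllTwo α) (b b' : β) :
    slice e (unslice e ζ b) b' = if b' = b then ζ else 0 := by
  ext a
  rw [slice_apply]
  change (if (e (e.symm (a, b'))).2 = b then ζ (e (e.symm (a, b'))).1 else 0) = _
  by_cases h : b' = b <;> simp [h]

/-- The components of a vector are coisometries with orthogonal supports; their adjoints are the
isometries of a Cuntz family. -/
lemma adjoint_sliceCLM [DecidableEq β] (e : γ ≃ α × β) (b : β) (ζ : EllTwo α) :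
    ContinuousLinearMap.adjoint (sliceCLM e b) ζ = unslice e ζ b := by
  refine ext_inner_right ℂ fun η => ?_
  rw [ContinuousLinearMap.adjoint_inner_left, sliceCLM_apply, inner_eq_tsum_slice e, tsum_eq_single b]
  · rw [slice_unslice, if_pos rfl]
  · intro b' hb'
    rw [slice_unslice, if_neg hb', inner_zero_left]

/-- `ℓ²(α)` is the orthogonal sum of `β` copies of itself if `α` is equivalent to `α × β`. -/
lemma exists_isometries [Fintype β] (e : α ≃ α × β) : ∃ v : β → (EllTwo α →L[ℂ] EllTwo α),
    (∀ b, star (v b) * v b = 1) ∧ (∀ b b', b ≠ b' → star (v b) * v b' = 0) ∧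
      ∑ b, v b * star (v b) = 1 := by
  classical
  have hs : ∀ b, star (ContinuousLinearMap.adjoint (sliceCLM e b)) = sliceCLM e b := fun b => by
    rw [ContinuousLinearMap.star_eq_adjoint, ContinuousLinearMap.adjoint_adjoint]
  refine ⟨fun b => ContinuousLinearMap.adjoint (sliceCLM e b), fun b => ?_, fun b b' hb => ?_, ?_⟩
  · rw [hs]
    ext1 ζ
    change sliceCLM e b (ContinuousLinearMap.adjoint (sliceCLM e b) ζ) = ζ
    rw [adjoint_sliceCLM, sliceCLM_apply, slice_unslice, if_pos rfl]
  · rw [hs]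
    ext1 ζ
    change sliceCLM e b (ContinuousLinearMap.adjoint (sliceCLM e b') ζ) = 0
    rw [adjoint_sliceCLM, sliceCLM_apply, slice_unslice, if_neg hb]
  · simp only [hs]
    ext1 ξ
    refine ext_slice e fun b => ?_
    rw [sum_apply, ← sliceCLM_apply, map_sum, Finset.sum_eq_single b]
    · change sliceCLM e b (ContinuousLinearMap.adjoint (sliceCLM e b) (sliceCLM e b ξ)) = _
      rw [adjoint_sliceCLM, sliceCLM_apply, slice_unslice, if_pos rfl]
      rfl
    · intro b' _ hb'
      change sliceCLM e b (ContinuousLinearMap.adjoint (sliceCLM e b') (sliceCLM e b' ξ)) = _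
      rw [adjoint_sliceCLM, sliceCLM_apply, slice_unslice, if_neg hb'.symm]
    · intro h
      exact absurd (Finset.mem_univ b) h

end EllTwo

/-! ### Commutation and Cuntz families in the oscillator chain. -/

open EllTwo

lemma splitConfig_fst {I J : NonemptyInterval ℤ} (h : I ≤ J) (x : Config J) (i : Site I) :
    (splitConfig h x).1 i = x ⟨i, (NonemptyInterval.le_def.1 h).1.trans i.2.1,
      i.2.2.trans (NonemptyInterval.le_def.1 h).2⟩ := rfl

lemma upd_splitConfig {I J : NonemptyInterval ℤ} (h : I ≤ J) (a : Config I) (x : Config J)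
    (j : Site J) : upd (splitConfig h) a x j =
      if hj : (j : ℤ) ∈ Set.Icc I.fst I.snd then a ⟨j, hj⟩ else x j := by
  by_cases hj : (j : ℤ) ∈ Set.Icc I.fst I.snd
  · rw [dif_pos hj]
    exact dif_pos hj
  · rw [dif_neg hj]
    exact dif_neg hj

/-- Local operators on disjoint intervals commute. -/
lemma oscillatorChain_commute {I I' J : NonemptyInterval ℤ} (h : I ≤ J) (h' : I' ≤ J)
    (hd : I.snd < I'.fst) (S : oscillatorChain.alg I) (T : oscillatorChain.alg I') :
    Commute (oscillatorChain.incl I J h S) (oscillatorChain.incl I' J h' T) := by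
  have hdis : ∀ j : ℤ, j ∈ Set.Icc I.fst I.snd → j ∉ Set.Icc I'.fst I'.snd :=
    fun j hj hj' => by have := hj.2; have := hj'.1; omega
  refine commute_ampl _ _ (fun a c => ?_) (fun a c => ?_) (fun a b c => ?_) S T
  · funext i
    rw [splitConfig_fst, splitConfig_fst, upd_splitConfig, dif_neg]
    exact fun hi => hdis _ hi i.2
  · funext i
    rw [splitConfig_fst, splitConfig_fst, upd_splitConfig, dif_neg]
    exact hdis _ i.2
  · funext j
    simp only [upd_splitConfig]
    by_cases hj : (j : ℤ) ∈ Set.Icc I.fst I.snd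
    · rw [dif_pos hj, dif_neg (hdis _ hj), dif_pos hj]
    · rw [dif_neg hj, dif_neg hj]

lemma oscillatorChain_exists_isometries (I : NonemptyInterval ℤ) (κ : Type) [Fintype κ]
    [Nonempty κ] : ∃ v : κ → oscillatorChain.alg I,
    (∀ b, star (v b) * v b = 1) ∧ (∀ b b', b ≠ b' → star (v b) * v b' = 0) ∧
      ∑ b, v b * star (v b) = 1 := by
  have : Nonempty (Site I) := ⟨⟨I.fst, le_rfl, I.fst_le_snd⟩⟩
  have : Finite (Site I) := Set.finite_Icc _ _
  -- Configurations of a nonempty finite set of sites form a countably infinite set, which absorbs a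
  -- finite nonempty factor.
  have e : Nonempty (Config I ≃ Config I × κ) :=
    ⟨(nonempty_denumerable (Config I)).some.eqv.trans
      ((nonempty_denumerable (Config I × κ)).some.eqv).symm⟩
  exact exists_isometries e.some

end

/-! ## Locality of fusion spin chains, and powers of a morphism -/

section
variable {C : Type u} [Category.{v} C] [MonoidalCategory C]

/-- Stated for arbitrary objects and isomorphisms, so that the index arithmetic of tensor powers
does not enter the computation. -/
lemma conj_leftUnitor_whiskerRight {A B Z : C} (e : A ⊗ B ≅ Z) (E : (𝟙_ C ⊗ A) ⊗ B ≅ Z)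
    (hE : E.hom = (λ_ A).hom ▷ B ≫ e.hom) (f : A ⟶ A) :
    E.inv ≫ (𝟙_ C ◁ f) ▷ B ≫ E.hom = e.inv ≫ f ▷ B ≫ e.hom := by
  rw [Iso.inv_comp_eq, hE, Category.assoc, Iso.hom_inv_id_assoc, ← comp_whiskerRight_assoc,
    ← comp_whiskerRight_assoc, leftUnitor_naturality]

lemma conj_rightUnitor {A Z : C} (e : A ≅ Z) (E : A ⊗ 𝟙_ C ≅ Z)
    (hE : E.hom = (ρ_ A).hom ≫ e.hom) (f : A ⟶ A) :
    E.inv ≫ f ▷ 𝟙_ C ≫ E.hom = e.inv ≫ f ≫ e.hom := by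
  rw [Iso.inv_comp_eq, hE, Category.assoc, Iso.hom_inv_id_assoc, rightUnitor_naturality_assoc]

lemma embedAux_zero_left (X : C) (k r N : ℕ) (h : 0 + k + r = N) (h' : k + r = N) :
    (embedAux X 0 k r N h).hom = (λ_ _).hom ▷ _ ≫ (tensorPowerAdd X k r).hom ≫
      eqToHom (congrArg (tensorPower X) h') := by
  subst h'
  have e := eqToHom_tensorPowerAdd X (Nat.zero_add k).symm r
  have e1 : (tensorPowerAdd X 0 k).hom ▷ tensorPower X r =
      (λ_ (tensorPower X k)).hom ▷ tensorPower X r ≫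
        eqToHom (congrArg (tensorPower X) (Nat.zero_add k).symm) ▷ tensorPower X r :=
    (congrArg (· ▷ tensorPower X r) (tensorPowerAdd_zero_left X k)).trans (comp_whiskerRight _ _ _)
  have e2 : eqToHom (congrArg (tensorPower X) (Nat.zero_add k).symm) ▷ tensorPower X r ≫
      (tensorPowerAdd X (0 + k) r).hom ≫ eqToHom (congrArg (tensorPower X) h) =
      (tensorPowerAdd X k r).hom ≫ eqToHom rfl := by
    rw [reassoc_of% e, eqToHom_trans]
  refine (congrArg (· ≫ ((tensorPowerAdd X (0 + k) r).hom ≫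
    eqToHom (congrArg (tensorPower X) h))) e1).trans ?_
  exact (Category.assoc _ _ _).trans (congrArg _ e2)

lemma embedAux_zero_right (X : C) (l k N : ℕ) (h : l + k + 0 = N) (h' : l + k = N) :
    (embedAux X l k 0 N h).hom = (ρ_ _).hom ≫ (tensorPowerAdd X l k).hom ≫
      eqToHom (congrArg (tensorPower X) h') := by
  subst h'
  simp [embedAux, tensorPowerAdd, tensorPower]

/-- The inclusion `f ↦ f ⊗ 1`. -/
lemma embed_zero_left (X : C) (k r N : ℕ) (h : 0 + k + r = N) (h' : k + r = N)
    (f : tensorPower X k ⟶ tensorPower X k) :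
    (embedAux X 0 k r N h).inv ≫ (tensorPower X 0 ◁ f) ▷ tensorPower X r ≫
        (embedAux X 0 k r N h).hom =
      (tensorPowerAdd X k r ≪≫ eqToIso (congrArg (tensorPower X) h')).inv ≫
        f ▷ tensorPower X r ≫
        (tensorPowerAdd X k r ≪≫ eqToIso (congrArg (tensorPower X) h')).hom :=
  conj_leftUnitor_whiskerRight _ (embedAux X 0 k r N h) (embedAux_zero_left X k r N h h') f

/-- The inclusion `g ↦ 1 ⊗ g`. -/
lemma embed_zero_right (X : C) (k r N : ℕ) (h : k + r + 0 = N) (h' : k + r = N)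
    (g : tensorPower X r ⟶ tensorPower X r) :
    (embedAux X k r 0 N h).inv ≫ (tensorPower X k ◁ g) ▷ tensorPower X 0 ≫
        (embedAux X k r 0 N h).hom =
      (tensorPowerAdd X k r ≪≫ eqToIso (congrArg (tensorPower X) h')).inv ≫
        tensorPower X k ◁ g ≫
        (tensorPowerAdd X k r ≪≫ eqToIso (congrArg (tensorPower X) h')).hom :=
  conj_rightUnitor _ (embedAux X k r 0 N h) (embedAux_zero_right X k r N h h') _

/-- `f ↦ f ⊗ 1` and `g ↦ 1 ⊗ g` have commuting ranges. -/
lemma embed_comp_comm (X : C) (k r N : ℕ) (h : 0 + k + r = N) (h' : k + r + 0 = N)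
    (f : tensorPower X k ⟶ tensorPower X k) (g : tensorPower X r ⟶ tensorPower X r) :
    ((embedAux X 0 k r N h).inv ≫ (tensorPower X 0 ◁ f) ▷ tensorPower X r ≫
        (embedAux X 0 k r N h).hom) ≫
      (embedAux X k r 0 N h').inv ≫ (tensorPower X k ◁ g) ▷ tensorPower X 0 ≫
        (embedAux X k r 0 N h').hom =
    ((embedAux X k r 0 N h').inv ≫ (tensorPower X k ◁ g) ▷ tensorPower X 0 ≫
        (embedAux X k r 0 N h').hom) ≫
      (embedAux X 0 k r N h).inv ≫ (tensorPower X 0 ◁ f) ▷ tensorPower X r ≫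
        (embedAux X 0 k r N h).hom := by
  rw [embed_zero_left X k r N h h', embed_zero_right X k r N h' h']
  simp only [Category.assoc, Iso.hom_inv_id_assoc]
  rw [whisker_exchange_assoc]

/-! ### Powers of a morphism. -/

/-- The power `X^{⊗ N k} ⟶ x^{⊗ k}` of a morphism `X^{⊗ N} ⟶ x`. -/
def powHom {X x : C} {N : ℕ} (i : tensorPower X N ⟶ x) :
    ∀ k : ℕ, tensorPower X (N * k) ⟶ tensorPower x k
  | 0 => 𝟙 _
  | k + 1 => (tensorPowerAdd X (N * k) N).inv ≫ powHom i k ▷ tensorPower X N ≫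
      tensorPower x k ◁ i

/-- The induction step of `tensorPowerAdd_powHom`, with tensor powers replaced by arbitrary objects;
only associativity of the regrouping maps and the interchange law are used. -/
lemma tensorPowerAdd_powHom_aux {A B T A' B' t AB BT ABT AB' : C} (a : A ⊗ B ≅ AB)
    (b : B ⊗ T ≅ BT) (abt : AB ⊗ T ≅ ABT) (aBT : A ⊗ BT ≅ ABT) (c : A' ⊗ B' ≅ AB')
    (p : A ⟶ A') (q : B ⟶ B') (r : AB ⟶ AB') (i : T ⟶ t)
    (hassoc : a.hom ▷ T ≫ abt.hom = (α_ A B T).hom ≫ A ◁ b.hom ≫ aBT.hom)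
    (ih : a.hom ≫ r = p ▷ B ≫ A' ◁ q ≫ c.hom) :
    aBT.hom ≫ abt.inv ≫ r ▷ T ≫ AB' ◁ i =
      p ▷ BT ≫ A' ◁ (b.inv ≫ q ▷ T ≫ B' ◁ i) ≫ (α_ A' B' t).inv ≫ c.hom ▷ t := by
  have e4 : aBT.hom ≫ abt.inv = A ◁ b.inv ≫ (α_ A B T).inv ≫ a.hom ▷ T := by
    rw [Iso.comp_inv_eq]
    simp only [Category.assoc, hassoc]
    simp
  have ih' := congrArg (· ▷ T) ih
  simp only [comp_whiskerRight] at ih'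
  rw [reassoc_of% e4, reassoc_of% ih']
  simp only [MonoidalCategory.whiskerLeft_comp, Category.assoc]
  rw [← whisker_exchange_assoc, ← whisker_exchange]
  simp

/-- Powers of `i` are multiplicative under concatenation. The compatibility of compression with the
inclusions and the factorization of the range projection both rest on this. -/
lemma tensorPowerAdd_powHom {X x : C} {N : ℕ} (i : tensorPower X N ⟶ x) (l k : ℕ) :
    (tensorPowerAdd X (N * l) (N * k)).hom ≫ eqToHom (congrArg _ (Nat.mul_add N l k).symm) ≫
      powHom i (l + k) = powHom i l ▷ _ ≫ _ ◁ powHom i k ≫ (tensorPowerAdd x l k).hom := by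
  induction k with
  | zero =>
    have h : powHom i l ▷ 𝟙_ C ≫ tensorPower x l ◁ 𝟙 (𝟙_ C) ≫ (ρ_ (tensorPower x l)).hom =
      (ρ_ _).hom ≫ 𝟙 _ ≫ powHom i l := by simp
    exact h.symm
  | succ k ih =>
    have e3 := eqToHom_tensorPowerAdd X (Nat.mul_add N l k).symm N
    have hassoc := tensorPowerAdd_assoc X (N * l) (N * k) N
    let a := tensorPowerAdd X (N * l) (N * k) ≪≫
      eqToIso (congrArg (tensorPower X) (Nat.mul_add N l k).symm)
    let aBT : tensorPower X (N * l) ⊗ tensorPower X (N * k + N) ≅ tensorPower X (N * (l + k) + N) :=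
      tensorPowerAdd X (N * l) (N * k + N) ≪≫
      eqToIso (congrArg (tensorPower X) (show N * l + (N * k + N) = N * (l + k) + N by ring))
    have := tensorPowerAdd_powHom_aux a (tensorPowerAdd X (N * k) N)
      (tensorPowerAdd X (N * (l + k)) N) aBT (tensorPowerAdd x l k) (powHom i l) (powHom i k)
      (powHom i (l + k)) i (by
        simp only [a, aBT, Iso.trans_hom, eqToIso.hom, comp_whiskerRight, Category.assoc, e3]
        rw [reassoc_of% hassoc]
        simp) (by simpa [a] using ih)
    exact (Category.assoc _ _ _).symm.trans this
end

section
variable {C : Type u} [Category.{v} C] [MonoidalCategory C]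

lemma embedAux_powHom {X x : C} {N : ℕ} (i : tensorPower X N ⟶ x) (l k r K : ℕ)
    (h : l + k + r = K) (h' : N * l + N * k + N * r = N * K) :
    (embedAux X (N * l) (N * k) (N * r) (N * K) h').hom ≫ powHom i K =
      ((powHom i l ▷ _ ≫ _ ◁ powHom i k) ▷ _ ≫ _ ◁ powHom i r) ≫ (embedAux x l k r K h).hom := by
  subst h
  have h1 := tensorPowerAdd_powHom i l k
  have h2 := tensorPowerAdd_powHom i (l + k) r
  have e := eqToHom_tensorPowerAdd X (Nat.mul_add N l k).symm (N * r)
  simp only [embedAux, Iso.trans_hom, whiskerRightIso_hom, eqToIso.hom, Category.assoc,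
    eqToHom_refl, Category.comp_id]
  have e' : (tensorPowerAdd X (N * l + N * k) (N * r)).hom =
      eqToHom (congrArg (tensorPower X) (Nat.mul_add N l k).symm) ▷ tensorPower X (N * r) ≫
        (tensorPowerAdd X (N * (l + k)) (N * r)).hom ≫ eqToHom (by rw [Nat.mul_add]) := by
    rw [reassoc_of% e]
    simp
  rw [e']
  simp only [Category.assoc, eqToHom_trans_assoc]
  rw [h2, whisker_exchange_assoc]
  simp only [← comp_whiskerRight_assoc, Category.assoc]
  rw [h1]

end

section
variable {C : Type u} [Category.{v} C] [MonoidalCategory C] [UnitaryMultifusionCategory C]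
open UnitaryCategory UnitaryMultifusionCategory

lemma comp_dagger_of_dagger_eq_inv {A B : C} (e : A ≅ B) (h : dagger e.hom = e.inv) :
    e.inv ≫ dagger e.inv = 𝟙 _ := by rw [dagger_inv_of_hom e h, Iso.inv_hom_id]

lemma isometry_comp {A B D : C} {f : A ⟶ B} {g : B ⟶ D} (hf : f ≫ dagger f = 𝟙 _)
    (hg : g ≫ dagger g = 𝟙 _) : (f ≫ g) ≫ dagger (f ≫ g) = 𝟙 _ := by
  rw [dagger_comp, Category.assoc, reassoc_of% hg, hf]

lemma isometry_whiskerRight {A B : C} {f : A ⟶ B} (hf : f ≫ dagger f = 𝟙 _) (D : C) :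
    f ▷ D ≫ dagger (f ▷ D) = 𝟙 _ := by
  rw [dagger_whiskerRight, ← comp_whiskerRight, hf, id_whiskerRight]

lemma isometry_whiskerLeft {A B : C} {f : A ⟶ B} (hf : f ≫ dagger f = 𝟙 _) (D : C) :
    D ◁ f ≫ dagger (D ◁ f) = 𝟙 _ := by
  rw [dagger_whiskerLeft, ← MonoidalCategory.whiskerLeft_comp, hf, MonoidalCategory.whiskerLeft_id]

lemma powHom_isometry {X x : C} {N : ℕ} {i : tensorPower X N ⟶ x} (hi : i ≫ dagger i = 𝟙 _)
    (k : ℕ) : powHom i k ≫ dagger (powHom i k) = 𝟙 _ := by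
  induction k with
  | zero =>
    change 𝟙 (𝟙_ C) ≫ dagger (𝟙 (𝟙_ C)) = 𝟙 _
    rw [dagger_id, Category.id_comp]
  | succ k ih =>
    exact isometry_comp (comp_dagger_of_dagger_eq_inv _ (dagger_tensorPowerAdd X (N * k) N))
      (isometry_comp (isometry_whiskerRight ih _) (isometry_whiskerLeft hi _))

/-- If `powHom i k` intertwines `f` and `g`, the larger power intertwines their amplifications,
because it factors as the powers of `i` on the left, middle and right sites. -/
lemma embed_comp_powHom {X x : C} {N : ℕ} (i : tensorPower X N ⟶ x) (l k r K : ℕ)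
    (h : l + k + r = K) (h' : N * l + N * k + N * r = N * K)
    (f : tensorPower X (N * k) ⟶ tensorPower X (N * k)) (g : tensorPower x k ⟶ tensorPower x k)
    (hfg : f ≫ powHom i k = powHom i k ≫ g) :
    (embed X (N * l) (N * k) (N * r) (N * K) h' f : tensorPower X (N * K) ⟶ _) ≫ powHom i K =
      powHom i K ≫ (embed x l k r K h g : tensorPower x K ⟶ _) := by
  have e := embedAux_powHom i l k r K h h'
  change ((embedAux X (N * l) (N * k) (N * r) (N * K) h').inv ≫
    (tensorPower X (N * l) ◁ f) ▷ tensorPower X (N * r) ≫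
      (embedAux X (N * l) (N * k) (N * r) (N * K) h').hom) ≫ powHom i K =
    powHom i K ≫ (embedAux x l k r K h).inv ≫ (tensorPower x l ◁ g) ▷ tensorPower x r ≫
      (embedAux x l k r K h).hom
  rw [← cancel_epi (embedAux X (N * l) (N * k) (N * r) (N * K) h').hom, reassoc_of% e]
  simp only [Category.assoc, Iso.hom_inv_id_assoc, e]
  rw [whisker_exchange_assoc]
  simp only [← comp_whiskerRight_assoc, Category.assoc]
  rw [whisker_exchange_assoc]
  simp only [← MonoidalCategory.whiskerLeft_comp, hfg]

/-- The projection `i†i` onto the image of a power of an isometry is the product of the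
projections of the factors. -/
lemma powHom_projection_add {X x : C} {N : ℕ} (i : tensorPower X N ⟶ x) (l k : ℕ)
    (h : 0 + l + k = l + k) (h' : l + k + 0 = l + k) :
    dagger (powHom i (l + k)) ≫ powHom i (l + k) =
      (embed x 0 l k (l + k) h (dagger (powHom i l) ≫ powHom i l) : tensorPower x (l + k) ⟶ _) ≫
      (embed x l k 0 (l + k) h' (dagger (powHom i k) ≫ powHom i k) : tensorPower x (l + k) ⟶ _) := by
  have e := tensorPowerAdd_powHom i l k
  have e' : powHom i (l + k) = (tensorPowerAdd X (N * l) (N * k) ≪≫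
      eqToIso (congrArg _ (Nat.mul_add N l k).symm)).inv ≫ powHom i l ▷ _ ≫ _ ◁ powHom i k ≫
        (tensorPowerAdd x l k).hom := by
    rw [← e]; simp
  have e1 := embed_zero_left x l k (l + k) h rfl (dagger (powHom i l) ≫ powHom i l)
  have e2 := embed_zero_right x l k (l + k) h' rfl (dagger (powHom i k) ≫ powHom i k)
  refine Eq.trans ?_ (congrArg₂ (· ≫ ·) e1 e2).symm
  -- The regrouping isomorphism is unitary, so it cancels between the two powers of `i` and leaves
  -- the projections of the two factors.
  have hu : dagger (tensorPowerAdd X (N * l) (N * k) ≪≫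
      eqToIso (congrArg (tensorPower X) (Nat.mul_add N l k).symm)).inv ≫
        (tensorPowerAdd X (N * l) (N * k) ≪≫
      eqToIso (congrArg (tensorPower X) (Nat.mul_add N l k).symm)).inv = 𝟙 _ := by
    rw [dagger_inv_of_hom _ (by simp [dagger_comp, dagger_tensorPowerAdd, dagger_eqToHom]),
      Iso.hom_inv_id]
  rw [e']
  simp only [dagger_comp, Category.assoc]
  rw [reassoc_of% hu, dagger_tensorPowerAdd, dagger_whiskerLeft, dagger_whiskerRight]
  simp only [Iso.trans_hom, Iso.trans_inv, eqToIso_refl, Iso.refl_hom, Iso.refl_inv,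
    Category.comp_id, Category.id_comp, Category.assoc, Iso.hom_inv_id_assoc,
    comp_whiskerRight, MonoidalCategory.whiskerLeft_comp]
  rw [whisker_exchange_assoc, whisker_exchange_assoc]

end

section
variable {C : Type u} [Category.{v} C] [MonoidalCategory C] [UnitaryMultifusionCategory C]

/-- Local operators on disjoint intervals commute. -/
lemma fusionSpinChain_commute (X : C) {I I' J : NonemptyInterval ℤ} (h : I ≤ J) (h' : I' ≤ J)
    (hd : I.snd < I'.fst) (a : (fusionSpinChain X).alg I) (b : (fusionSpinChain X).alg I') :
    Commute ((fusionSpinChain X).incl I J h a) ((fusionSpinChain X).incl I' J h' b) := by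
  obtain ⟨h1, h2⟩ := NonemptyInterval.le_def.1 h
  obtain ⟨h1', h2'⟩ := NonemptyInterval.le_def.1 h'
  have hI := I.fst_le_snd
  have hI' := I'.fst_le_snd
  -- The two intervals are enlarged until they are adjacent and fill `J`, so that the amplifications
  -- become `a ⊗ 1` and `1 ⊗ b`.
  let K : NonemptyInterval ℤ := ⟨(J.fst, I.snd), h1.trans hI⟩
  let K' : NonemptyInterval ℤ := ⟨(I.snd + 1, J.snd), by dsimp only; omega⟩
  have hK : I ≤ K := NonemptyInterval.le_def.2 ⟨h1, le_rfl⟩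
  have hK' : I' ≤ K' := NonemptyInterval.le_def.2 ⟨by dsimp only [K']; omega, h2'⟩
  have hKJ : K ≤ J := NonemptyInterval.le_def.2 ⟨le_rfl, h2⟩
  have hKJ' : K' ≤ J := NonemptyInterval.le_def.2 ⟨by dsimp only [K']; omega, le_rfl⟩
  rw [← (fusionSpinChain X).incl_trans I K J hK hKJ, ← (fusionSpinChain X).incl_trans I' K' J hK' hKJ']
  generalize (fusionSpinChain X).incl I K hK a = a'
  generalize (fusionSpinChain X).incl I' K' hK' b = b'
  -- The numbers of sites are made variables, because substitution is not possible in the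
  -- expressions of the net.
  have key : ∀ (l r l' r' : ℕ) (hl : l = 0) (hr : r = K'.card) (hl' : l' = K.card) (hr' : r' = 0)
      (e : l + K.card + r = J.card) (e' : l' + K'.card + r' = J.card),
      Commute (embed X l K.card r J.card e a') (embed X l' K'.card r' J.card e' b') := by
    rintro _ _ _ _ rfl rfl rfl rfl e e'
    exact (embed_comp_comm X K.card K'.card J.card e e' a' b').symm
  refine key _ _ _ _ ?_ ?_ ?_ ?_ _ _ <;> simp only [K, K', NonemptyInterval.card] <;> omega

end

/-! ## Conjugation by a product of local isometries -/

/-- The ordered product `f a * f (a + 1) * ⋯ * f (a + n - 1)`. -/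
def prodRange {B : Type*} [Monoid B] (f : ℤ → B) (a : ℤ) : ℕ → B
  | 0 => 1
  | n + 1 => prodRange f a n * f (a + n)

section prodRange
variable {B : Type*}

lemma prodRange_add [Monoid B] (f : ℤ → B) (a : ℤ) (l k : ℕ) :
    prodRange f a (l + k) = prodRange f a l * prodRange f (a + l) k := by
  induction k with
  | zero => exact (mul_one _).symm
  | succ k ih =>
    change prodRange f a (l + k) * f (a + ((l + k : ℕ) : ℤ)) =
      prodRange f a l * (prodRange f (a + l) k * f (a + l + k))
    rw [ih, mul_assoc]
    push_cast
    rw [add_assoc]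

lemma prodRange_congr [Monoid B] {f g : ℤ → B} {a : ℤ} {n : ℕ}
    (h : ∀ j, a ≤ j → j < a + n → f j = g j) : prodRange f a n = prodRange g a n := by
  induction n with
  | zero => rfl
  | succ n ih =>
    change prodRange f a n * f (a + n) = prodRange g a n * g (a + n)
    rw [ih fun j hj hj' => h j hj (by push_cast; omega),
      h (a + n) (by omega) (by push_cast; omega)]

lemma map_prodRange [Monoid B] {B' : Type*} [Monoid B'] {F : Type*} [FunLike F B B']
    [MonoidHomClass F B B'] (φ : F) (f : ℤ → B) (a : ℤ) (n : ℕ) :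
    φ (prodRange f a n) = prodRange (fun j => φ (f j)) a n := by
  induction n with
  | zero => exact map_one φ
  | succ n ih => exact (map_mul φ _ _).trans (congrArg (· * _) ih)

lemma commute_prodRange [Monoid B] {x : B} {f : ℤ → B} {a : ℤ} {n : ℕ}
    (h : ∀ j, a ≤ j → j < a + n → Commute x (f j)) : Commute x (prodRange f a n) := by
  induction n with
  | zero => exact Commute.one_right x
  | succ n ih =>
    exact (ih fun j hj hj' => h j hj (by push_cast; omega)).mul_right
      (h (a + n) (by omega) (by push_cast; omega))

lemma star_prodRange_mul_self [Monoid B] [StarMul B] {f : ℤ → B} (h : ∀ j, star (f j) * f j = 1)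
    (a : ℤ) (n : ℕ) : star (prodRange f a n) * prodRange f a n = 1 := by
  induction n with
  | zero => exact (congrArg (· * (1 : B)) (star_one B)).trans (mul_one _)
  | succ n ih =>
    change star (prodRange f a n * f (a + n)) * (prodRange f a n * f (a + n)) = 1
    rw [star_mul, mul_assoc, ← mul_assoc (star (prodRange f a n)), ih, one_mul, h]

end prodRange

section
open NonemptyInterval

lemma NonemptyInterval.pure_le_iff {j : ℤ} {J : NonemptyInterval ℤ} :
    NonemptyInterval.pure j ≤ J ↔ J.fst ≤ j ∧ j ≤ J.snd := NonemptyInterval.le_def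

variable {A : NonemptyInterval ℤ → Type u} {P : NonemptyInterval ℤ → Type w}
  [∀ J, Ring (A J)] [∀ J, StarRing (A J)] [∀ J, Algebra ℂ (A J)] 
  [∀ J, Ring (P J)] [∀ J, StarRing (P J)] [∀ J, Algebra ℂ (P J)] 

/-- A system of corner embeddings `κ J : A J → P J` that are compatible with the inclusions, and whose
projections `κ J 1` are products over the sites of range projections of local isometries `V j`, can
be conjugated to a natural isomorphism. -/
lemma exists_natural_starAlgEquiv_of_corner
    (ιA : ∀ I J, I ≤ J → A I →⋆ₐ[ℂ] A J) (ιP : ∀ I J, I ≤ J → P I →⋆ₐ[ℂ] P J)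
    (ιP_refl : ∀ I a, ιP I I le_rfl a = a)
    (ιP_trans : ∀ I J K (h : I ≤ J) (h' : J ≤ K) a, ιP J K h' (ιP I J h a) = ιP I K (h.trans h') a)
    (comm : ∀ I I' J (h : I ≤ J) (h' : I' ≤ J), I.snd < I'.fst → ∀ a b,
      Commute (ιP I J h a) (ιP I' J h' b))
    (κ : ∀ J, A J →ₗ[ℂ] P J) (ν : ∀ J, P J →ₗ[ℂ] A J)
    (κ_mul : ∀ J a b, κ J (a * b) = κ J a * κ J b) (κ_star : ∀ J a, κ J (star a) = star (κ J a))
    (νκ : ∀ J a, ν J (κ J a) = a) (κν : ∀ J b, κ J (ν J b) = κ J 1 * b * κ J 1)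
    (κ_incl : ∀ I J h a, κ J (ιA I J h a) = κ J 1 * ιP I J h (κ I a))
    (κ_one : ∀ (I J : NonemptyInterval ℤ) (h : I ≤ J) (h' : NonemptyInterval.pure J.snd ≤ J), J.fst = I.fst →
      J.snd = I.snd + 1 → κ J 1 = ιP I J h (κ I 1) * ιP _ J h' (κ _ 1))
    (V : ∀ j, P (NonemptyInterval.pure j)) (hV : ∀ j, star (V j) * V j = 1)
    (hV' : ∀ j, V j * star (V j) = κ _ 1) :
    ∃ θ : ∀ J, A J ≃⋆ₐ[ℂ] P J, ∀ I J h a, θ J (ιA I J h a) = ιP I J h (θ I a) := by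
  classical
  -- The isometries of sites outside `J` are replaced by `1`, so that products over ranges can be
  -- split without side conditions.
  let v : ∀ J : NonemptyInterval ℤ, ℤ → P J :=
    fun J j => if h : NonemptyInterval.pure j ≤ J then ιP _ J h (V j) else 1
  have hv : ∀ J j, star (v J j) * v J j = 1 := by
    intro J j
    by_cases h : NonemptyInterval.pure j ≤ J
    · simp only [v, dif_pos h, ← map_star, ← map_mul, hV, map_one]
    · simp [v, dif_neg h]
  -- `W J` is an isometry with range projection `κ J 1`. Conjugation with it identifies the corner
  -- `κ J 1 * P J * κ J 1` with all of `P J`.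
  let W : ∀ J : NonemptyInterval ℤ, P J := fun J => prodRange (v J) J.fst J.card
  have hW : ∀ J, star (W J) * W J = 1 := fun J => star_prodRange_mul_self (hv J) _ _
  have hsplit : ∀ I J (h : I ≤ J), W J = prodRange (v J) J.fst (I.fst - J.fst).toNat *
      ιP I J h (W I) * prodRange (v J) (I.snd + 1) (J.snd - I.snd).toNat := by
    intro I J h
    have h1 := NonemptyInterval.le_def.1 h
    have h2 := I.fst_le_snd
    have e1 : J.fst + ((I.fst - J.fst).toNat : ℤ) = I.fst := by omega
    have e2 : J.fst + (((I.fst - J.fst).toNat + I.card : ℕ) : ℤ) = I.snd + 1 := by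
      simp only [NonemptyInterval.card]; omega
    simp only [W]
    rw [← card_eq h, prodRange_add, prodRange_add, e1, e2, map_prodRange]
    congr 2
    refine prodRange_congr fun j hj hj' => ?_
    have hjI : NonemptyInterval.pure j ≤ I := pure_le_iff.2 ⟨hj, by simp only [NonemptyInterval.card] at hj'; omega⟩
    simp only [v, dif_pos hjI, dif_pos (hjI.trans h), ιP_trans]
  have hW' : ∀ J, W J * star (W J) = κ J 1 := by
    suffices H : ∀ (n : ℕ) (J : NonemptyInterval ℤ), J.snd = J.fst + n →
        W J * star (W J) = κ J 1 from
      fun J => H (J.snd - J.fst).toNat J (by have := J.fst_le_snd; omega)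
    intro n
    induction n with
    | zero =>
      rintro ⟨⟨a, b⟩, hab⟩ hJ
      simp only [Nat.cast_zero, add_zero] at hJ
      subst hJ
      have : W (NonemptyInterval.pure b) = V b := by
        have hc : (NonemptyInterval.pure b).card = 1 := by simp [NonemptyInterval.card, NonemptyInterval.pure]
        simp only [W, hc]
        change 1 * v (NonemptyInterval.pure b) (b + ((0 : ℕ) : ℤ)) = _
        rw [one_mul]
        simp only [Nat.cast_zero, add_zero, v, le_refl, dif_pos, ιP_refl]
      change W (NonemptyInterval.pure b) * star (W (NonemptyInterval.pure b)) = κ (NonemptyInterval.pure b) 1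
      rw [this, hV']
    | succ n ih =>
      intro J hJ
      let I : NonemptyInterval ℤ := ⟨(J.fst, J.fst + n), by dsimp only; omega⟩
      have hI : J.snd = I.snd + 1 := by simp only [I]; rw [hJ]; push_cast; ring
      have h : I ≤ J := NonemptyInterval.le_def.2 ⟨le_rfl, by omega⟩
      have h' : NonemptyInterval.pure J.snd ≤ J := pure_le_iff.2 ⟨J.fst_le_snd, le_rfl⟩
      have e1 : (I.fst - J.fst).toNat = 0 := by simp [I]
      have e2 : (J.snd - I.snd).toNat = 1 := by omega
      have e3 : v J (I.snd + 1) = ιP _ J h' (V J.snd) := by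
        rw [← hI]; simp only [v, dif_pos h']
      have e4 : W J = ιP I J h (W I) * ιP _ J h' (V J.snd) := by
        rw [hsplit I J h, e1, e2]
        change 1 * _ * (1 * v J (I.snd + 1 + ((0 : ℕ) : ℤ))) = _
        rw [Nat.cast_zero, add_zero, e3, one_mul, one_mul]
      -- The range projection of the last site commutes past `star (W I)`, so `W J * star (W J)` is
      -- the product of the two range projections.
      have hc := comm I (NonemptyInterval.pure J.snd) J h h' (by change I.snd < J.snd; omega)
        (star (W I)) (κ _ 1)
      rw [e4, κ_one I J h h' rfl hI, ← ih I rfl, star_mul, mul_assoc, ← mul_assoc (ιP _ J h' _),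
        ← map_star, ← map_star, ← map_mul, hV', map_mul, mul_assoc, hc.eq]
  have hκ1 : ∀ J a, κ J 1 * κ J a = κ J a := fun J a => by rw [← κ_mul, one_mul]
  have hκ1' : ∀ J a, κ J a * κ J 1 = κ J a := fun J a => by rw [← κ_mul, mul_one]
  have hκW : ∀ J, κ J 1 * W J = W J := fun J => by rw [← hW', mul_assoc, hW, mul_one]
  have hWκ : ∀ J, star (W J) * κ J 1 = star (W J) := fun J => by
    rw [← hW', ← mul_assoc, hW, one_mul]
  let θ : ∀ J, A J ≃⋆ₐ[ℂ] P J := fun J =>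
    { toFun := fun a => star (W J) * κ J a * W J
      invFun := fun b => ν J (W J * b * star (W J))
      left_inv := fun a => by
        dsimp only
        have : W J * (star (W J) * κ J a * W J) * star (W J) =
            W J * star (W J) * κ J a * (W J * star (W J)) := by simp only [mul_assoc]
        rw [this, hW', hκ1, hκ1', νκ]
      right_inv := fun b => by
        dsimp only
        have : star (W J) * (κ J 1 * (W J * b * star (W J)) * κ J 1) * W J =
          star (W J) * (κ J 1 * W J) * b * (star (W J) * κ J 1 * W J) := by simp only [mul_assoc]
        rw [κν, this, hκW, hWκ, hW, one_mul, mul_one]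
      map_mul' := fun a b => by
        have : star (W J) * κ J a * W J * (star (W J) * κ J b * W J) =
          star (W J) * (κ J a * (W J * star (W J))) * κ J b * W J := by simp only [mul_assoc]
        rw [this, hW', hκ1', κ_mul]
        simp only [mul_assoc]
      map_add' := fun a b => by rw [map_add, mul_add, add_mul]
      map_star' := fun a => by
        simp only [κ_star, star_mul, star_star, mul_assoc]
      map_smul' := fun c a => by
        rw [map_smul, mul_smul_comm, smul_mul_assoc] }
  refine ⟨θ, fun I J h a => ?_⟩
  change star (W J) * κ J (ιA I J h a) * W J = ιP I J h (star (W I) * κ I a * W I)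
  have h1 := NonemptyInterval.le_def.1 h
  have h2 := I.fst_le_snd
  -- The factors of `W J` at sites outside `I` commute with the image of `P I` and are isometries,
  -- so they cancel in the conjugation. This gives naturality.
  have hL : ∀ x : P I, Commute (ιP I J h x)
      (prodRange (v J) J.fst (I.fst - J.fst).toNat) := fun x =>
    commute_prodRange fun j hj hj' => by
      have hjJ : NonemptyInterval.pure j ≤ J := pure_le_iff.2 ⟨hj, by omega⟩
      simp only [v, dif_pos hjJ]
      exact (comm _ _ J hjJ h (by change j < I.fst; omega) _ _).symm
  have hR : ∀ x : P I, Commute (ιP I J h x)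
      (prodRange (v J) (I.snd + 1) (J.snd - I.snd).toNat) := fun x =>
    commute_prodRange fun j hj hj' => by
      have hjJ : NonemptyInterval.pure j ≤ J := pure_le_iff.2 ⟨by omega, by omega⟩
      simp only [v, dif_pos hjJ]
      exact comm _ _ J h hjJ (by change I.snd < j; omega) _ _
  have hL1 : star (prodRange (v J) J.fst (I.fst - J.fst).toNat) *
    prodRange (v J) J.fst (I.fst - J.fst).toNat = 1 := star_prodRange_mul_self (hv J) _ _
  have hR1 : star (prodRange (v J) (I.snd + 1) (J.snd - I.snd).toNat) *
    prodRange (v J) (I.snd + 1) (J.snd - I.snd).toNat = 1 := star_prodRange_mul_self (hv J) _ _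
  rw [κ_incl, ← mul_assoc, hWκ, hsplit I J h]
  generalize prodRange (v J) J.fst (I.fst - J.fst).toNat = L at hL hL1
  generalize prodRange (v J) (I.snd + 1) (J.snd - I.snd).toNat = R at hR hR1
  calc star (L * ιP I J h (W I) * R) * ιP I J h (κ I a) * (L * ιP I J h (W I) * R)
      = star R * ιP I J h (star (W I)) * star L * (ιP I J h (κ I a) * L) * ιP I J h (W I) * R := by
        simp only [star_mul, map_star, mul_assoc]
    _ = star R * ιP I J h (star (W I)) * (star L * L) * ιP I J h (κ I a) * ιP I J h (W I) * R := by
        rw [(hL _).eq]; simp only [mul_assoc]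
    _ = star R * (ιP I J h (star (W I) * κ I a * W I) * R) := by
        rw [hL1]; simp only [mul_one, map_mul, mul_assoc]
    _ = ιP I J h (star (W I) * κ I a * W I) := by
        rw [(hR _).eq, ← mul_assoc, hR1, one_mul]

end

/-! ## Absorbing multiplicities in a tensor factor -/

section
open UnitaryCategory
open scoped TensorProduct
variable {C : Type u} [Category.{v} C] [UnitaryCategory C]

/-- If the isometry `i : W ⟶ Z` hits every simple summand of `Z`, then its range projection is
equivalent to the identity after tensoring with an algebra that contains Cuntz families. -/
lemma exists_isometry_tensor {W Z : C} (i : W ⟶ Z) (hi : i ≫ dagger i = 𝟙 W)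
    (hW : ∀ S : C, Simple S → Nonempty (Retract S Z) → Nonempty (Retract S W))
    {B : Type w} [Ring B] [StarRing B] [Algebra ℂ B] [StarModule ℂ B]
    (hB : ∀ (κ : Type) [Fintype κ] [Nonempty κ], ∃ v : κ → B,
      (∀ b, star (v b) * v b = 1) ∧ (∀ b b', b ≠ b' → star (v b) * v b' = 0) ∧
        ∑ b, v b * star (v b) = 1) :
    ∃ V : End Z ⊗[ℂ] B, star V * V = 1 ∧ V * star V = (show End Z from dagger i ≫ i) ⊗ₜ[ℂ] (1 : B) := by
  classical
  obtain ⟨β, _, t, ht, ⟨T⟩⟩ := exists_simple_decomposition W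
  -- The complement of `W` in `Z`. The simple summands of `W` together with those of `Z'` decompose
  -- `Z`.
  obtain ⟨Z', j, hj, hj'⟩ := exists_splitting (𝟙 Z - dagger i ≫ i)
    (by simp [Preadditive.sub_comp, Preadditive.comp_sub, reassoc_of% hi])
    (by simp [dagger_sub, dagger_id, dagger_comp, dagger_dagger])
  obtain ⟨α, _, z, hz, ⟨T'⟩⟩ := exists_simple_decomposition Z'
  have hji : j ≫ dagger i = 0 := by
    have h1 : j ≫ (dagger j ≫ j) ≫ dagger i = 0 := by
      rw [hj']; simp [Preadditive.sub_comp, hi]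
    simpa [reassoc_of% hj] using h1
  have hij : i ≫ dagger j = 0 := by
    have := congrArg dagger hji
    rwa [dagger_comp, dagger_dagger, dagger_zero] at this
  let s : β ⊕ α → C := Sum.elim t z
  have hs : ∀ c, Simple (s c) := by rintro (c | c); exacts [ht c, hz c]
  let e : ∀ c, s c ⟶ Z := fun c => match c with
    | .inl b => T.incl b ≫ i
    | .inr a => T'.incl a ≫ j
  let g : ∀ b, t b ⟶ Z := fun b => T.incl b ≫ i
  have hg : ∀ b, g b ≫ dagger (g b) = 𝟙 _ := fun b => by
    simp [g, dagger_comp, reassoc_of% hi, T.isometry]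
  have hg' : ∀ b b', b ≠ b' → g b ≫ dagger (g b') = 0 := fun b b' h => by
    simp [g, dagger_comp, reassoc_of% hi, T.ortho _ _ h]
  have hgs : ∑ b, dagger (g b) ≫ g b = dagger i ≫ i := by
    simp only [g, dagger_comp, Category.assoc]
    rw [← Preadditive.comp_sum]
    have := congrArg (· ≫ i) T.total
    simp only [Preadditive.sum_comp, Category.assoc, Category.id_comp] at this
    rw [this]
  have hh : ∀ a, (T'.incl a ≫ j) ≫ dagger (T'.incl a ≫ j) = 𝟙 _ := fun a => by
    simp [dagger_comp, reassoc_of% hj, T'.isometry]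
  have hh' : ∀ a a', a ≠ a' → (T'.incl a ≫ j) ≫ dagger (T'.incl a' ≫ j) = 0 := fun a a' h => by
    simp [dagger_comp, reassoc_of% hj, T'.ortho _ _ h]
  have hgh : ∀ b a, (T.incl b ≫ i) ≫ dagger (T'.incl a ≫ j) = 0 := fun b a => by
    simp [dagger_comp, reassoc_of% hij]
  have hhg : ∀ a b, (T'.incl a ≫ j) ≫ dagger (T.incl b ≫ i) = 0 := fun a b => by
    simp [dagger_comp, reassoc_of% hji]
  have he : ∀ c, e c ≫ dagger (e c) = 𝟙 _ := by
    rintro (b | a)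
    · exact hg b
    · exact hh a
  have he' : ∀ c c', c ≠ c' → e c ≫ dagger (e c') = 0 := by
    rintro (b | a) (b' | a') h
    · exact hg' b b' (fun h' => h (congrArg _ h'))
    · exact hgh b a'
    · exact hhg a b'
    · exact hh' a a' (fun h' => h (congrArg _ h'))
  have hes : ∑ c, dagger (e c) ≫ e c = 𝟙 Z := by
    rw [Fintype.sum_sum_type]
    have h1 : ∑ a, dagger (T'.incl a ≫ j) ≫ T'.incl a ≫ j = dagger j ≫ j := by
      simp only [dagger_comp, Category.assoc]
      rw [← Preadditive.comp_sum]
      have := congrArg (· ≫ j) T'.total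
      simp only [Preadditive.sum_comp, Category.assoc, Category.id_comp] at this
      rw [this]
    exact (congrArg₂ (· + ·) hgs (h1.trans hj')).trans (by abel)
  -- Every summand `c` of `Z` is assigned an isomorphic summand `σ c` of `W`. Summands of `W` are
  -- assigned to themselves, so no fibre of `σ` is empty and each fibre can index a Cuntz family.
  have hσ : ∀ c, ∃ (b : β) (f : s c ⟶ t b), (f ≫ dagger f = 𝟙 _ ∧ dagger f ≫ f = 𝟙 _) ∧
      ∀ b', c = .inl b' → b = b' := by
    rintro (b | a)
    · exact ⟨b, 𝟙 _, by simp [dagger_id, s], fun b' h => by simpa using h⟩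
    · have := hz a
      obtain ⟨r⟩ := hW (z a) (hz a) ⟨retractOfIsometry (T'.incl a ≫ j) (hh a)⟩
      have h0 : r.i ≠ 0 := fun h => by
        have := r.retract
        rw [h, zero_comp] at this
        exact id_nonzero (z a) this.symm
      have : ∃ b, r.i ≫ dagger (T.incl b) ≠ 0 := by
        by_contra! h
        apply h0
        rw [← Category.comp_id r.i, ← T.total, Preadditive.comp_sum]
        exact Finset.sum_eq_zero fun b _ => by rw [reassoc_of% (h b), zero_comp]
      obtain ⟨b, hb⟩ := this
      have := ht b
      obtain ⟨c, -, hc, hc'⟩ := exists_unitary_of_ne_zero hb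
      exact ⟨b, _, ⟨hc, hc'⟩, fun b' h => by simp at h⟩
  choose σ f hf hσ' using hσ
  have hne : ∀ b, Nonempty {c // σ c = b} := fun b => ⟨⟨.inl b, hσ' _ b rfl⟩⟩
  choose v hv1 hv2 hv3 using fun b => hB {c // σ c = b}
  let w : β ⊕ α → B := fun c => v (σ c) ⟨c, rfl⟩
  have hw1 : ∀ c, star (w c) * w c = 1 := fun c => hv1 _ _
  have hw2 : ∀ c c', c ≠ c' → σ c = σ c' → star (w c) * w c' = 0 := by
    intro c c' h h'
    have : w c = v (σ c') ⟨c, h'⟩ := by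
      have : ∀ b (hb : σ c = b), w c = v b ⟨c, hb⟩ := by rintro _ rfl; rfl
      exact this _ h'
    rw [this]
    exact hv2 _ _ _ (fun h'' => h (congrArg Subtype.val h''))
  have hw3 : ∀ b, ∑ c with σ c = b, w c * star (w c) = 1 := by
    intro b
    rw [← hv3 b, Finset.sum_subtype (p := fun c => σ c = b) _ (by simp)]
    refine Finset.sum_congr rfl ?_
    rintro ⟨c, rfl⟩ _
    rfl
  -- `m c` is the partial isometry that carries the summand `c` onto the summand `σ c`.
  let m : β ⊕ α → End Z := fun c => (dagger (e c) ≫ f c ≫ g (σ c) : Z ⟶ Z)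
  have hm1 : ∀ c c', σ c ≠ σ c' → star (m c) * m c' = 0 := by
    intro c c' h
    change (dagger (e c') ≫ f c' ≫ g (σ c')) ≫ dagger (dagger (e c) ≫ f c ≫ g (σ c)) = 0
    simp [dagger_comp, reassoc_of% (hg' _ _ (Ne.symm h))]
  have hm2 : ∀ c, star (m c) * m c = (dagger (e c) ≫ e c : Z ⟶ Z) := by
    intro c
    change (dagger (e c) ≫ f c ≫ g (σ c)) ≫ dagger (dagger (e c) ≫ f c ≫ g (σ c)) = _
    simp [dagger_comp, dagger_dagger, reassoc_of% (hg (σ c)), reassoc_of% (hf c).1]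
  have hm3 : ∀ c c', c ≠ c' → m c * star (m c') = 0 := by
    intro c c' h
    change dagger (dagger (e c') ≫ f c' ≫ g (σ c')) ≫ (dagger (e c) ≫ f c ≫ g (σ c)) = 0
    simp [dagger_comp, dagger_dagger, reassoc_of% (he' _ _ (Ne.symm h))]
  have hm4 : ∀ c, m c * star (m c) = (dagger (g (σ c)) ≫ g (σ c) : Z ⟶ Z) := by
    intro c
    change dagger (dagger (e c) ≫ f c ≫ g (σ c)) ≫ (dagger (e c) ≫ f c ≫ g (σ c)) = _
    simp [dagger_comp, dagger_dagger, reassoc_of% (he c), reassoc_of% (hf c).2]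
  -- Different summands with the same target `σ c` are kept apart by the orthogonal isometries of
  -- the Cuntz family. The ranges over one fibre add up to `1` in `B`, so each summand of `W` is
  -- filled exactly once.
  refine ⟨∑ c, m c ⊗ₜ[ℂ] w c, ?_, ?_⟩
  · have h1 : ∀ c c', star (m c ⊗ₜ[ℂ] w c) * (m c' ⊗ₜ[ℂ] w c') =
        if c = c' then (show End Z from dagger (e c) ≫ e c) ⊗ₜ[ℂ] (1 : B) else 0 := by
      intro c c'
      rw [TensorProduct.star_tmul, Algebra.TensorProduct.tmul_mul_tmul]
      split_ifs with h
      · subst h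
        rw [hw1, hm2]
      · by_cases h' : σ c = σ c'
        · rw [hw2 c c' h h', TensorProduct.tmul_zero]
        · rw [hm1 c c' h', TensorProduct.zero_tmul]
    simp only [star_sum, Finset.sum_mul, Finset.mul_sum, h1,
      Finset.sum_ite_eq', Finset.mem_univ, if_true]
    rw [← TensorProduct.sum_tmul]
    exact congrArg (fun x : End Z => x ⊗ₜ[ℂ] (1 : B)) hes
  · have h1 : ∀ c c', (m c ⊗ₜ[ℂ] w c) * star (m c' ⊗ₜ[ℂ] w c') =
        if c = c' then (show End Z from dagger (g (σ c)) ≫ g (σ c)) ⊗ₜ[ℂ] (w c * star (w c)) else 0 := by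
      intro c c'
      rw [TensorProduct.star_tmul, Algebra.TensorProduct.tmul_mul_tmul]
      split_ifs with h
      · subst h
        rw [hm4]
      · rw [hm3 c c' h, TensorProduct.zero_tmul]
    simp only [star_sum, Finset.sum_mul, Finset.mul_sum, h1, Finset.sum_ite_eq',
      Finset.mem_univ, if_true]
    rw [← Finset.sum_fiberwise (s := Finset.univ) (g := σ)]
    have h2 : ∀ b, ∑ c with σ c = b, (show End Z from dagger (g (σ c)) ≫ g (σ c)) ⊗ₜ[ℂ]
        (w c * star (w c)) = (show End Z from dagger (g b) ≫ g b) ⊗ₜ[ℂ] (1 : B) := by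
      intro b
      rw [← hw3 b, TensorProduct.tmul_sum]
      refine Finset.sum_congr rfl fun c hc => ?_
      rw [(Finset.mem_filter.1 hc).2]
    rw [Finset.sum_congr rfl fun b _ => h2 b, ← TensorProduct.sum_tmul]
    exact congrArg (fun x : End Z => x ⊗ₜ[ℂ] (1 : B)) hgs

end

/-! ### Tensor products of star homomorphisms and sizes of blocks. -/

section
open scoped TensorProduct

/-- The tensor product of two homomorphisms of *-algebras. -/
noncomputable def tensorStarMap {A B A' B' : Type*} [Ring A] [StarRing A] [Algebra ℂ A] [StarModule ℂ A]
    [Ring B] [StarRing B] [Algebra ℂ B] [StarModule ℂ B]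
    [Ring A'] [StarRing A'] [Algebra ℂ A'] [StarModule ℂ A']
    [Ring B'] [StarRing B'] [Algebra ℂ B'] [StarModule ℂ B']
    (f : A →⋆ₐ[ℂ] A') (g : B →⋆ₐ[ℂ] B') : A ⊗[ℂ] B →⋆ₐ[ℂ] A' ⊗[ℂ] B' :=
  { Algebra.TensorProduct.map f.toAlgHom g.toAlgHom with
    map_star' := fun x => by
      change Algebra.TensorProduct.map f.toAlgHom g.toAlgHom (star x) =
        star (Algebra.TensorProduct.map f.toAlgHom g.toAlgHom x)
      induction x using TensorProduct.induction_on with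
      | zero => simp
      | tmul a b =>
        change f (star a) ⊗ₜ[ℂ] g (star b) = star (f a ⊗ₜ[ℂ] g b)
        rw [map_star, map_star, TensorProduct.star_tmul]
      | add x y hx hy => rw [star_add, map_add, map_add, star_add, hx, hy] }

@[simp] lemma tensorStarMap_tmul {A B A' B' : Type*} [Ring A] [StarRing A] [Algebra ℂ A]
    [StarModule ℂ A] [Ring B] [StarRing B] [Algebra ℂ B] [StarModule ℂ B]
    [Ring A'] [StarRing A'] [Algebra ℂ A'] [StarModule ℂ A']
    [Ring B'] [StarRing B'] [Algebra ℂ B'] [StarModule ℂ B']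
    (f : A →⋆ₐ[ℂ] A') (g : B →⋆ₐ[ℂ] B') (a : A) (b : B) :
    tensorStarMap f g (a ⊗ₜ b) = f a ⊗ₜ g b := rfl

end

namespace NonemptyInterval

lemma card_block {N : ℕ} (hN : 0 < N) (J : NonemptyInterval ℤ) :
    (J.block N).card = N * J.card := by
  have h := J.fst_le_snd
  zify
  have h2 := mul_le_mul_of_nonneg_left h (Int.natCast_nonneg N)
  simp only [NonemptyInterval.card, block]
  rw [Int.toNat_of_nonneg (by omega), Int.toNat_of_nonneg (by omega)]
  push_cast [hN]
  ring

lemma block_snd_lt {N : ℕ} (hN : 0 < N) {I I' : NonemptyInterval ℤ} (h : I.snd < I'.fst) :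
    (I.block N).snd < (I'.block N).fst := by
  have h2 := mul_le_mul_of_nonneg_left (Int.add_one_le_iff.2 h) (Int.natCast_nonneg N)
  simp only [block]
  rw [mul_add] at h2
  omega

end NonemptyInterval

/-! ### Compression of a chain, in blocks, by the powers of an isometry. -/

section
open UnitaryCategory UnitaryMultifusionCategory NonemptyInterval
open scoped TensorProduct
variable {C : Type u} [Category.{v} C] 

/-- Compression of endomorphisms: `f ↦ i ∘ f ∘ i†`. -/
def conjLin [UnitaryCategory C] {A B : C} (i : A ⟶ B) : End A →ₗ[ℂ] End B where
  toFun f := (dagger i ≫ (f : A ⟶ A) ≫ i : B ⟶ B)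
  map_add' f g := by
    change dagger i ≫ ((f : A ⟶ A) + g) ≫ i = dagger i ≫ (f : A ⟶ A) ≫ i + dagger i ≫ (g : A ⟶ A) ≫ i
    rw [Preadditive.add_comp, Preadditive.comp_add]
  map_smul' c f := by
    change dagger i ≫ (c • (f : A ⟶ A)) ≫ i = c • (dagger i ≫ (f : A ⟶ A) ≫ i)
    rw [Linear.smul_comp, Linear.comp_smul]

lemma conjLin_apply [UnitaryCategory C] {A B : C} (i : A ⟶ B) (f : End A) :
    conjLin i f = (dagger i ≫ (f : A ⟶ A) ≫ i : B ⟶ B) := rfl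

variable [MonoidalCategory C] [UnitaryMultifusionCategory C]

/-- The power of `i : X^{⊗ N} ⟶ x` over the blocks of an interval. -/
def blockHom {X x : C} {N : ℕ} (hN : 0 < N) (i : tensorPower X N ⟶ x) (J : NonemptyInterval ℤ) :
    tensorPower X (J.block N).card ⟶ tensorPower x J.card :=
  eqToHom (congrArg (tensorPower X) (card_block hN J)) ≫ powHom i J.card

lemma blockHom_isometry {X x : C} {N : ℕ} (hN : 0 < N) {i : tensorPower X N ⟶ x}
    (hi : i ≫ dagger i = 𝟙 _) (J : NonemptyInterval ℤ) :
    blockHom hN i J ≫ dagger (blockHom hN i J) = 𝟙 _ :=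
  isometry_comp (by rw [dagger_eqToHom, eqToHom_trans, eqToHom_refl]) (powHom_isometry hi _)

/-- The inclusion of local algebras, as a map of morphisms. -/
def inclHom (X : C) {I J : NonemptyInterval ℤ} (h : I ≤ J)
    (f : tensorPower X I.card ⟶ tensorPower X I.card) : tensorPower X J.card ⟶ tensorPower X J.card :=
  (fusionSpinChain X).incl I J h f

lemma dagger_inclHom (X : C) {I J : NonemptyInterval ℤ} (h : I ≤ J)
    (f : tensorPower X I.card ⟶ tensorPower X I.card) :
    dagger (inclHom X h f) = inclHom X h (dagger f) :=
  (map_star ((fusionSpinChain X).incl I J h) f).symm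

lemma incl_comp_blockHom {X x : C} {N : ℕ} (hN : 0 < N) {i : tensorPower X N ⟶ x}
    {I J : NonemptyInterval ℤ} (h : I ≤ J) (f : tensorPower X (I.block N).card ⟶ tensorPower X (I.block N).card)
    (g : tensorPower x I.card ⟶ tensorPower x I.card)
    (hfg : f ≫ blockHom hN i I = blockHom hN i I ≫ g) :
    inclHom X (block_mono N h) f ≫ blockHom hN i J = blockHom hN i J ≫ inclHom x h g := by
  -- The sizes of the blocks equal multiples of `N` only propositionally; with variables in their
  -- place the equalities can be substituted.
  have key : ∀ (l k r K l' k' r' K' : ℕ) (hl : l' = N * l) (hk : k' = N * k) (hr : r' = N * r)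
      (hK : K' = N * K) (e : l + k + r = K) (e' : l' + k' + r' = K')
      (f : tensorPower X k' ⟶ tensorPower X k') (g : tensorPower x k ⟶ tensorPower x k)
      (_ : f ≫ eqToHom (congrArg (tensorPower X) hk) ≫ powHom i k =
        (eqToHom (congrArg (tensorPower X) hk) ≫ powHom i k) ≫ g),
      (embed X l' k' r' K' e' f : tensorPower X K' ⟶ _) ≫
          eqToHom (congrArg (tensorPower X) hK) ≫ powHom i K =
        (eqToHom (congrArg (tensorPower X) hK) ≫ powHom i K) ≫ (embed x l k r K e g : tensorPower x K ⟶ _) := by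
    rintro l k r K _ _ _ _ rfl rfl rfl rfl e e' f g hfg
    simp only [eqToHom_refl, Category.id_comp] at hfg ⊢
    exact embed_comp_powHom i l k r K e e' f g hfg
  obtain ⟨h1, h2⟩ := NonemptyInterval.le_def.1 h
  refine key _ _ _ _ _ _ _ _ ?_ (card_block hN I) ?_ (card_block hN J) _ _ f g hfg
  · simp only [block]
    rw [← mul_sub]
    zify
    rw [Int.toNat_of_nonneg (mul_nonneg (by positivity) (by omega)), Int.toNat_of_nonneg (by omega)]
  · simp only [block]
    rw [add_sub_add_right_eq_sub, ← mul_sub]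
    zify
    rw [Int.toNat_of_nonneg (mul_nonneg (by positivity) (by omega)), Int.toNat_of_nonneg (by omega)]

/-- The compression to the image of the power of an isometry is compatible with the inclusions. -/
lemma conj_inclHom {X x : C} {N : ℕ} (hN : 0 < N) {i : tensorPower X N ⟶ x}
    (hi : i ≫ dagger i = 𝟙 _) {I J : NonemptyInterval ℤ} (h : I ≤ J)
    (f : tensorPower X (I.block N).card ⟶ tensorPower X (I.block N).card) :
    dagger (blockHom hN i J) ≫ inclHom X (block_mono N h) f ≫ blockHom hN i J =
      inclHom x h (dagger (blockHom hN i I) ≫ f ≫ blockHom hN i I) ≫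
        dagger (blockHom hN i J) ≫ 𝟙 _ ≫ blockHom hN i J := by
  have hI := blockHom_isometry hN hi I
  -- A compressed morphism intertwines on one side only when it is preceded by the isometry. The
  -- identity needed concerns the adjoint power, so the intertwining is proved for `dagger f` and
  -- then daggered.
  have e := incl_comp_blockHom hN (i := i) h (dagger f)
    (dagger (blockHom hN i I) ≫ dagger f ≫ blockHom hN i I) (by simp [reassoc_of% hI])
  have e2 := congrArg dagger e
  rw [dagger_comp, dagger_comp, dagger_inclHom, dagger_inclHom, dagger_dagger] at e2
  rw [reassoc_of% e2, Category.id_comp]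
  simp only [dagger_comp, dagger_dagger, Category.assoc]

/-- The range projection of the power of a morphism is the product over adjacent intervals. -/
lemma blockHom_projection {X x : C} {N : ℕ} (hN : 0 < N) (i : tensorPower X N ⟶ x)
    {I I' J : NonemptyInterval ℤ} (h : I ≤ J) (h' : I' ≤ J) (h1 : I.fst = J.fst)
    (h2 : I.snd + 1 = I'.fst) (h3 : I'.snd = J.snd) :
    dagger (blockHom hN i J) ≫ blockHom hN i J =
      inclHom x h (dagger (blockHom hN i I) ≫ blockHom hN i I) ≫
        inclHom x h' (dagger (blockHom hN i I') ≫ blockHom hN i I') := by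
  have e0 : ∀ J, dagger (blockHom hN i J) ≫ blockHom hN i J =
      dagger (powHom i J.card) ≫ powHom i J.card := by
    intro J
    simp [blockHom, dagger_comp, dagger_eqToHom]
  rw [e0, e0, e0]
  have key : ∀ (l k r K l' k' r' : ℕ) (hl : l = 0) (hr : r = k') (hl' : l' = k) (hr' : r' = 0)
      (e : l + k + r = K) (e' : l' + k' + r' = K),
      dagger (powHom i K) ≫ powHom i K =
        (embed x l k r K e (dagger (powHom i k) ≫ powHom i k) : tensorPower x K ⟶ _) ≫
        (embed x l' k' r' K e' (dagger (powHom i k') ≫ powHom i k') : tensorPower x K ⟶ _) := by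
    rintro l k r K l' k' r' rfl rfl rfl rfl e e'
    have : l' + r = K := e'
    subst this
    exact powHom_projection_add i l' r e e'
  have hI := I.fst_le_snd
  have hI' := I'.fst_le_snd
  refine key _ _ _ _ _ _ _ ?_ ?_ ?_ ?_ _ _ <;> (try simp only [NonemptyInterval.card]) <;> omega

end

/-! ### Amplification of corner embeddings by a tensor factor. -/

section
open scoped TensorProduct
variable {A P B A' P' B' : Type*}
  [Ring A'] [Algebra ℂ A'] [Ring P'] [Algebra ℂ P'] [Ring B'] [Algebra ℂ B']
  [Ring A] [Algebra ℂ A] [Ring P] [Algebra ℂ P] [Ring B] [Algebra ℂ B]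

/-- The amplification `κ ⊗ id` of a linear map. -/
noncomputable abbrev amplify (B : Type*) [Ring B] [Algebra ℂ B] (κ : A →ₗ[ℂ] P) :
    A ⊗[ℂ] B →ₗ[ℂ] P ⊗[ℂ] B :=
  TensorProduct.map κ LinearMap.id

lemma amplify_mul {κ : A →ₗ[ℂ] P} (h : ∀ a b, κ (a * b) = κ a * κ b) (x y : A ⊗[ℂ] B) :
    amplify B κ (x * y) = amplify B κ x * amplify B κ y := by
  induction x using TensorProduct.induction_on with
  | zero => simp
  | tmul f s =>
    induction y using TensorProduct.induction_on with
    | zero => simp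
    | tmul g t => simp [h]
    | add x y hx hy => rw [mul_add, map_add, hx, hy, map_add, mul_add]
  | add x y hx hy => rw [add_mul, map_add, hx, hy, map_add, add_mul]

lemma amplify_leftInverse {κ : A →ₗ[ℂ] P} {ν : P →ₗ[ℂ] A} (h : ∀ a, ν (κ a) = a) (x : A ⊗[ℂ] B) :
    amplify B ν (amplify B κ x) = x := by
  induction x using TensorProduct.induction_on with
  | zero => simp
  | tmul f s => simp [h]
  | add x y hx hy => rw [map_add, map_add, hx, hy]

lemma amplify_corner {κ : A →ₗ[ℂ] P} {ν : P →ₗ[ℂ] A} (h : ∀ b, κ (ν b) = κ 1 * b * κ 1)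
    (x : P ⊗[ℂ] B) :
    amplify B κ (amplify B ν x) = amplify B κ 1 * x * amplify B κ 1 := by
  induction x using TensorProduct.induction_on with
  | zero => simp
  | tmul f s => simp [h, Algebra.TensorProduct.one_def]
  | add x y hx hy => rw [map_add, map_add, hx, hy, mul_add, add_mul]

variable [StarRing A] [StarModule ℂ A] [StarRing P] [StarModule ℂ P] [StarRing B] [StarModule ℂ B]
  [StarRing A'] [StarModule ℂ A'] [StarRing P'] [StarModule ℂ P'] [StarRing B'] [StarModule ℂ B']

lemma amplify_star {κ : A →ₗ[ℂ] P} (h : ∀ a, κ (star a) = star (κ a)) (x : A ⊗[ℂ] B) :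
    amplify B κ (star x) = star (amplify B κ x) := by
  induction x using TensorProduct.induction_on with
  | zero => simp
  | tmul f s => simp [h]
  | add x y hx hy => rw [star_add, map_add, hx, hy, map_add, star_add]

lemma amplify_natural {κ : A →ₗ[ℂ] P} {κ' : A' →ₗ[ℂ] P'} {ιA : A →⋆ₐ[ℂ] A'} {ιP : P →⋆ₐ[ℂ] P'}
    (ιB : B →⋆ₐ[ℂ] B') (h : ∀ a, κ' (ιA a) = κ' 1 * ιP (κ a)) (x : A ⊗[ℂ] B) :
    amplify B' κ' (tensorStarMap ιA ιB x) =
      amplify B' κ' 1 * tensorStarMap ιP ιB (amplify B κ x) := by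
  induction x using TensorProduct.induction_on with
  | zero => simp
  | tmul f s => simp [h, Algebra.TensorProduct.one_def]
  | add x y hx hy => rw [map_add, map_add, map_add, map_add, hx, hy, mul_add]

end

section
open UnitaryCategory
variable {C : Type u} [Category.{v} C] [UnitaryCategory C] {A B : C} {i : A ⟶ B}

lemma conjLin_mul (hi : i ≫ dagger i = 𝟙 A) (f g : End A) :
    conjLin i (f * g) = conjLin i f * conjLin i g := by
  have : ∀ f g : A ⟶ A, dagger i ≫ (g ≫ f) ≫ i = (dagger i ≫ g ≫ i) ≫ dagger i ≫ f ≫ i :=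
    fun f g => by simp [reassoc_of% hi]
  exact this f g

lemma conjLin_star (f : End A) : conjLin i (star f) = star (conjLin i f) := by
  have : ∀ f : A ⟶ A, dagger i ≫ dagger f ≫ i = dagger (dagger i ≫ f ≫ i) :=
    fun f => by simp [dagger_comp, dagger_dagger]
  exact this f

lemma conjLin_leftInverse (hi : i ≫ dagger i = 𝟙 A) (f : End A) :
    conjLin (dagger i) (conjLin i f) = f := by
  have : ∀ f : A ⟶ A, dagger (dagger i) ≫ (dagger i ≫ f ≫ i) ≫ dagger i = f :=
    fun f => by simp only [dagger_dagger, Category.assoc, hi, Category.comp_id, reassoc_of% hi]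
  exact this f

lemma conjLin_corner (f : End B) :
    conjLin i (conjLin (dagger i) f) = conjLin i 1 * f * conjLin i 1 := by
  have : ∀ f : B ⟶ B, dagger i ≫ (dagger (dagger i) ≫ f ≫ dagger i) ≫ i =
      (dagger i ≫ 𝟙 _ ≫ i) ≫ f ≫ dagger i ≫ 𝟙 _ ≫ i :=
    fun f => by simp only [dagger_dagger, Category.assoc, Category.id_comp]
  exact this f

end

/-! ### The chain of `x` with the oscillators of `N` sites at each site. -/

section
open UnitaryCategory UnitaryMultifusionCategory NonemptyInterval
open scoped TensorProduct
variable {C : Type u} [Category.{v} C] [MonoidalCategory C] [UnitaryMultifusionCategory C]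

/-- Local algebras of the chain of `x`, tensored with the oscillators of a block of `N` sites at each
site. -/
abbrev BlockAlg (x : C) (N : ℕ) (J : NonemptyInterval ℤ) : Type v :=
  End (tensorPower x J.card) ⊗[ℂ] oscillatorChain.alg (J.block N)

/-- The inclusions of the algebras `BlockAlg x N J`. -/
noncomputable def blockIncl (x : C) (N : ℕ) {I J : NonemptyInterval ℤ} (h : I ≤ J) :
    BlockAlg x N I →⋆ₐ[ℂ] BlockAlg x N J :=
  tensorStarMap (A' := End (tensorPower x J.card)) ((fusionSpinChain x).incl I J h)
    (oscillatorChain.incl _ _ (block_mono N h))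

lemma blockIncl_tmul (x : C) (N : ℕ) {I J : NonemptyInterval ℤ} (h : I ≤ J)
    (a : End (tensorPower x I.card)) (t : oscillatorChain.alg (I.block N)) :
    blockIncl x N h (a ⊗ₜ t) =
      (show End (tensorPower x J.card) from (fusionSpinChain x).incl I J h a) ⊗ₜ[ℂ]
        oscillatorChain.incl _ _ (block_mono N h) t := rfl

lemma blockIncl_refl (x : C) (N : ℕ) (I : NonemptyInterval ℤ) (a : BlockAlg x N I) :
    blockIncl x N (le_refl I) a = a := by
  induction a using TensorProduct.induction_on with
  | zero => exact map_zero _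
  | tmul a t =>
    rw [blockIncl_tmul]
    exact congrArg₂ (TensorProduct.tmul ℂ) ((fusionSpinChain x).incl_refl I a)
      (oscillatorChain.incl_refl _ t)
  | add a b ha hb => rw [map_add, ha, hb]

lemma blockIncl_trans (x : C) (N : ℕ) {I J K : NonemptyInterval ℤ} (h : I ≤ J) (h' : J ≤ K)
    (a : BlockAlg x N I) : blockIncl x N h' (blockIncl x N h a) = blockIncl x N (h.trans h') a := by
  induction a using TensorProduct.induction_on with
  | zero => simp only [map_zero]
  | tmul a t =>
    rw [blockIncl_tmul, blockIncl_tmul, blockIncl_tmul]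
    exact congrArg₂ (TensorProduct.tmul ℂ) ((fusionSpinChain x).incl_trans _ _ _ h h' a)
      (oscillatorChain.incl_trans _ _ _ _ _ t)
  | add a b ha hb => simp only [map_add, ha, hb]

lemma blockIncl_commute (x : C) {N : ℕ} (hN : 0 < N) {I I' J : NonemptyInterval ℤ} (h : I ≤ J)
    (h' : I' ≤ J) (hd : I.snd < I'.fst) (a : BlockAlg x N I) (b : BlockAlg x N I') :
    Commute (blockIncl x N h a) (blockIncl x N h' b) := by
  induction a using TensorProduct.induction_on with
  | zero => rw [map_zero]; exact Commute.zero_left _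
  | tmul a t =>
    induction b using TensorProduct.induction_on with
    | zero => rw [map_zero]; exact Commute.zero_right _
    | tmul b s =>
      rw [blockIncl_tmul, blockIncl_tmul, Commute, SemiconjBy,
        Algebra.TensorProduct.tmul_mul_tmul, Algebra.TensorProduct.tmul_mul_tmul]
      exact congrArg₂ (TensorProduct.tmul ℂ) (fusionSpinChain_commute x h h' hd a b).eq
        (oscillatorChain_commute _ _ (block_snd_lt hN hd) t s).eq
    | add b b' hb hb' => rw [map_add]; exact hb.add_right hb'
  | add a a' ha ha' => rw [map_add]; exact ha.add_left ha'

lemma nonempty_iso_tensorPower_pure {C : Type u} [Category.{v} C] [MonoidalCategory C] (x : C) (j : ℤ) :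
    Nonempty (tensorPower x (NonemptyInterval.pure j).card ≅ x) := by
  have h : (NonemptyInterval.pure j).card = 1 := by simp [NonemptyInterval.card, NonemptyInterval.pure]
  rw [h]
  exact ⟨λ_ x⟩

/-- If `i : X^{⊗ N} ⟶ x` is an isometry that hits every simple summand of `x`, then the stabilized
chains of `X`, in blocks of `N` sites, and of `x` are naturally isomorphic. -/
lemma exists_blockAlg_equiv {X x : C} {N : ℕ} (hN : 0 < N) (i : tensorPower X N ⟶ x)
    (hi : i ≫ dagger i = 𝟙 _)
    (hfull : ∀ S : C, Simple S → Nonempty (Retract S x) → Nonempty (Retract S (tensorPower X N))) :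
    ∃ θ : ∀ J : NonemptyInterval ℤ,
        (fusionSpinChain X).stabilization.alg (J.block N) ≃⋆ₐ[ℂ] BlockAlg x N J,
      ∀ I J (h : I ≤ J) a, θ J ((fusionSpinChain X).stabilization.incl _ _ (block_mono N h) a) =
        blockIncl x N h (θ I a) := by
  have hI := blockHom_isometry hN hi
  let κ : ∀ J : NonemptyInterval ℤ,
      (fusionSpinChain X).stabilization.alg (J.block N) →ₗ[ℂ] BlockAlg x N J := fun J =>
    amplify _ (conjLin (blockHom hN i J))
  let ν : ∀ J : NonemptyInterval ℤ,
      BlockAlg x N J →ₗ[ℂ] (fusionSpinChain X).stabilization.alg (J.block N) := fun J =>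
    amplify _ (conjLin (dagger (blockHom hN i J)))
  have hκ1 : ∀ J, κ J 1 = conjLin (blockHom hN i J) 1 ⊗ₜ 1 := fun J => rfl
  have hV : ∀ j : ℤ, ∃ V : BlockAlg x N (NonemptyInterval.pure j), star V * V = 1 ∧
      V * star V = κ _ 1 := by
    intro j
    -- At one site the range projection of `i` is equivalent to the identity, as the oscillators of
    -- the block provide Cuntz families of every finite nonempty size.
    obtain ⟨V, hV, hV'⟩ := exists_isometry_tensor (blockHom hN i (NonemptyInterval.pure j)) (hI _)
      (fun S hS ⟨r⟩ => by
        obtain ⟨e⟩ := nonempty_iso_tensorPower_pure x j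
        obtain ⟨r'⟩ := hfull S hS ⟨r.trans e.retract⟩
        have hc : ((NonemptyInterval.pure j).block N).card = N := by
          rw [card_block hN]; simp [NonemptyInterval.card, NonemptyInterval.pure]
        rw [hc]
        exact ⟨r'⟩)
      (B := oscillatorChain.alg ((NonemptyInterval.pure j).block N))
      (fun κ _ _ => oscillatorChain_exists_isometries _ κ)
    refine ⟨V, hV, hV'.trans ?_⟩
    rw [hκ1, conjLin_apply]
    refine congrArg (fun f : End (tensorPower x _) => f ⊗ₜ[ℂ] _) ?_
    exact congrArg (dagger (blockHom hN i _) ≫ ·) (Category.id_comp _).symm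
  choose V hV hV' using hV
  refine exists_natural_starAlgEquiv_of_corner
    (A := fun J => (fusionSpinChain X).stabilization.alg (J.block N)) (P := BlockAlg x N)
    (fun I J h => (fusionSpinChain X).stabilization.incl _ _ (block_mono N h))
    (fun I J h => blockIncl x N h) (blockIncl_refl x N)
    (fun I J K h h' a => blockIncl_trans x N h h' a)
    (fun I I' J h h' hd a b => blockIncl_commute x hN h h' hd a b) κ ν ?_ ?_ ?_ ?_ ?_ ?_ V hV hV'
  · exact fun J => amplify_mul (conjLin_mul (hI J))
  · exact fun J => amplify_star conjLin_star
  · exact fun J => amplify_leftInverse (conjLin_leftInverse (hI J))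
  · exact fun J => amplify_corner conjLin_corner
  · exact fun I J h => amplify_natural (P := End (tensorPower x I.card))
      (P' := End (tensorPower x J.card)) (oscillatorChain.incl _ _ (block_mono N h))
      (fun f => conj_inclHom hN hi h f)
  · intro I J h h' h1 h2
    rw [hκ1, hκ1, hκ1, blockIncl_tmul, blockIncl_tmul, Algebra.TensorProduct.tmul_mul_tmul,
      map_one (oscillatorChain.incl _ _ _), map_one (oscillatorChain.incl _ _ _), one_mul]
    refine congrArg (fun f : End (tensorPower x _) => f ⊗ₜ[ℂ] _) ?_
    have e := blockHom_projection hN i h h' h1.symm h2.symm rfl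
    -- Multiplication in `End` is opposite to composition, so the two commuting projections have to
    -- be exchanged.
    have hc := (fusionSpinChain_commute x h h' (show I.snd < J.snd by omega)
      (conjLin (blockHom hN i I) 1) (conjLin (blockHom hN i _) 1)).eq
    refine Eq.trans ?_ hc.symm
    have e1 : ∀ J, conjLin (blockHom hN i J) 1 = (dagger (blockHom hN i J) ≫ blockHom hN i J :
        tensorPower x J.card ⟶ tensorPower x J.card) :=
      fun J => congrArg (dagger (blockHom hN i _) ≫ ·) (Category.id_comp _)
    rw [e1, e1, e1]
    exact e

end

/-! ## Equivariant functors and the tensor powers of an object that acts by an equivariant functor -/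

section
variable {Γ : Type*} {N₀ N₁ N₂ N₃ : Type*} [Category N₀] [Category N₁] [Category N₂] [Category N₃]
  {T₀ : Γ → N₀ ⥤ N₀} {T₁ : Γ → N₁ ⥤ N₁} {T₂ : Γ → N₂ ⥤ N₂} {T₃ : Γ → N₃ ⥤ N₃}

/-- A functor that intertwines two families of endofunctors laxly. -/
structure EqvFunctor (T₀ : Γ → N₀ ⥤ N₀) (T₁ : Γ → N₁ ⥤ N₁) where
  F : N₀ ⥤ N₁
  μ : ∀ γ n, (T₁ γ).obj (F.obj n) ⟶ F.obj ((T₀ γ).obj n)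
  μ_naturality : ∀ γ {n n' : N₀} (f : n ⟶ n'),
    (T₁ γ).map (F.map f) ≫ μ γ n' = μ γ n ≫ F.map ((T₀ γ).map f)

/-- An equivariant functor with an equivariant endomorphism. -/
structure EqvEndo (T₀ : Γ → N₀ ⥤ N₀) (T₁ : Γ → N₁ ⥤ N₁) extends EqvFunctor T₀ T₁ where
  app : ∀ n, F.obj n ⟶ F.obj n
  naturality : ∀ {n n' : N₀} (f : n ⟶ n'), F.map f ≫ app n' = app n ≫ F.map f
  equivariant : ∀ γ n, (T₁ γ).map (app n) ≫ μ γ n = μ γ n ≫ app ((T₀ γ).obj n)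

namespace EqvFunctor

lemma ext_heq {A B : EqvFunctor T₀ T₁} (h : A.F = B.F) (h' : HEq A.μ B.μ) : A = B := by
  obtain ⟨F, μ, _⟩ := A
  obtain ⟨F', μ', _⟩ := B
  obtain rfl : F = F' := h
  obtain rfl : μ = μ' := eq_of_heq h'
  rfl

/-- The identity functor. -/
@[simps] def id (T₀ : Γ → N₀ ⥤ N₀) : EqvFunctor T₀ T₀ where
  F := 𝟭 N₀
  μ _ _ := 𝟙 _
  μ_naturality _ _ _ _ := (Category.comp_id _).trans (Category.id_comp _).symm

/-- The composition of equivariant functors. -/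
@[simps] def comp (A : EqvFunctor T₀ T₁) (B : EqvFunctor T₁ T₂) : EqvFunctor T₀ T₂ where
  F := A.F ⋙ B.F
  μ γ n := B.μ γ (A.F.obj n) ≫ B.F.map (A.μ γ n)
  μ_naturality γ n n' f := by
    rw [Functor.comp_map, reassoc_of% B.μ_naturality, ← B.F.map_comp, A.μ_naturality,
      B.F.map_comp, Category.assoc, Functor.comp_map]

/-- Composition of functors is strictly associative, and so are the structure maps. Working with
equalities of functors, rather than isomorphisms, keeps coherence out of all later whiskering
arguments. -/
lemma comp_assoc (A : EqvFunctor T₀ T₁) (B : EqvFunctor T₁ T₂) (D : EqvFunctor T₂ T₃) :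
    (A.comp B).comp D = A.comp (B.comp D) :=
  ext_heq rfl (heq_of_eq (by
    funext γ n
    change D.μ γ _ ≫ D.F.map (B.μ γ _ ≫ B.F.map (A.μ γ n)) =
      (D.μ γ _ ≫ D.F.map (B.μ γ _)) ≫ D.F.map (B.F.map (A.μ γ n))
    rw [D.F.map_comp, Category.assoc]))

lemma id_comp (A : EqvFunctor T₀ T₁) : (id T₀).comp A = A :=
  ext_heq rfl (heq_of_eq (by
    funext γ n
    change A.μ γ n ≫ A.F.map (𝟙 _) = A.μ γ n
    rw [A.F.map_id, Category.comp_id]))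

lemma comp_id (A : EqvFunctor T₀ T₁) : A.comp (id T₁) = A :=
  ext_heq rfl (heq_of_eq (by
    funext γ n
    change 𝟙 _ ≫ A.μ γ n = A.μ γ n
    rw [Category.id_comp]))

/-- The powers of an equivariant endofunctor. -/
def pow (P : EqvFunctor T₀ T₀) : ℕ → EqvFunctor T₀ T₀
  | 0 => id T₀
  | k + 1 => P.comp (pow P k)

/-- Regrouping an alternating word in `F` and `G`. It is what makes the interleaving maps commute
with amplification. -/
lemma comp_pow (F : EqvFunctor T₀ T₁) (G : EqvFunctor T₁ T₀) (k : ℕ) :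
    F.comp ((G.comp F).pow k) = ((F.comp G).pow k).comp F := by
  induction k with
  | zero => exact (comp_id _).trans (id_comp _).symm
  | succ k ih =>
    change F.comp ((G.comp F).comp ((G.comp F).pow k)) = ((F.comp G).comp ((F.comp G).pow k)).comp F
    rw [comp_assoc G F, ih, ← comp_assoc F G, comp_assoc (F.comp G)]

lemma pow_comp_succ (F : EqvFunctor T₀ T₁) (G : EqvFunctor T₁ T₀) (k : ℕ) :
    (G.comp F).pow (k + 1) = G.comp (((F.comp G).pow k).comp F) := by
  rw [← comp_pow, ← comp_assoc]
  rfl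

end EqvFunctor

namespace EqvEndo

lemma ext_heq {a b : EqvEndo T₀ T₁} (h : a.toEqvFunctor = b.toEqvFunctor) (h' : HEq a.app b.app) :
    a = b := by
  obtain ⟨A, f, _, _⟩ := a
  obtain ⟨B, g, _, _⟩ := b
  obtain rfl : A = B := h
  obtain rfl : f = g := eq_of_heq h'
  rfl

/-- Unfolds the structure map of a triple composite into the shape in which the equivariance of each
factor can be rewritten. -/
lemma assoc_aux (a : EqvFunctor T₁ T₂) (A : EqvFunctor T₀ T₁) (B : EqvFunctor T₂ T₃) (γ : Γ) (n : N₀) :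
    (A.comp (a.comp B)).μ γ n = (B.μ γ (a.F.obj (A.F.obj n)) ≫
        B.F.map (a.μ γ (A.F.obj n))) ≫ B.F.map (a.F.map (A.μ γ n)) := rfl

/-- The whiskering of an equivariant endomorphism on both sides. -/
@[simps! app] def sandwich (A : EqvFunctor T₀ T₁) (a : EqvEndo T₁ T₂) (B : EqvFunctor T₂ T₃) :
    EqvEndo T₀ T₃ where
  toEqvFunctor := A.comp (a.toEqvFunctor.comp B)
  app n := B.F.map (a.app (A.F.obj n))
  naturality f := by
    change B.F.map (a.F.map (A.F.map f)) ≫ _ = _ ≫ B.F.map (a.F.map (A.F.map f))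
    rw [← B.F.map_comp, a.naturality, B.F.map_comp]
  equivariant γ n := by
    have key : (T₃ γ).map (B.F.map (a.app (A.F.obj n))) ≫ (B.μ γ (a.F.obj (A.F.obj n)) ≫
        B.F.map (a.μ γ (A.F.obj n))) ≫ B.F.map (a.F.map (A.μ γ n)) =
        ((B.μ γ (a.F.obj (A.F.obj n)) ≫ B.F.map (a.μ γ (A.F.obj n))) ≫
          B.F.map (a.F.map (A.μ γ n))) ≫ B.F.map (a.app (A.F.obj ((T₀ γ).obj n))) := by
      simp only [Category.assoc]
      rw [reassoc_of% B.μ_naturality]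
      simp only [← B.F.map_comp]
      rw [reassoc_of% a.equivariant, a.naturality]
    exact (congrArg (_ ≫ ·) (assoc_aux a.toEqvFunctor A B γ n)).trans
      (key.trans (congrArg (· ≫ _) (assoc_aux a.toEqvFunctor A B γ n).symm))

lemma sandwich_sandwich {N₄ N₅ : Type*} [Category N₄] [Category N₅] {T₄ : Γ → N₄ ⥤ N₄}
    {T₅ : Γ → N₅ ⥤ N₅} (A' : EqvFunctor T₀ T₁) (A : EqvFunctor T₁ T₂) (a : EqvEndo T₂ T₃)
    (B : EqvFunctor T₃ T₄) (B' : EqvFunctor T₄ T₅) :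
    sandwich A' (sandwich A a B) B' = sandwich (A'.comp A) a (B.comp B') :=
  ext_heq (by
    change A'.comp ((A.comp (a.toEqvFunctor.comp B)).comp B') =
      (A'.comp A).comp (a.toEqvFunctor.comp (B.comp B'))
    simp only [EqvFunctor.comp_assoc]) HEq.rfl

lemma app_eq {a b : EqvEndo T₀ T₁} (h : a = b) (n : N₀) :
    a.app n = eqToHom (by rw [h]) ≫ b.app n ≫ eqToHom (by rw [h]) := by
  subst h
  simp

end EqvEndo

end

/-! ### Actions that commute with a family of functors, and objects that act by a given functor. -/

section
open MonoidalLeftAction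
variable {Γ : Type*} {S : Type u} [Category.{v} S] [MonoidalCategory S] {N : Type u'}
  [Category.{v'} N] [MonoidalLeftAction S N]

/-- The structure morphisms that make the functors of an action equivariant. -/
structure EqvAction (S : Type u) [Category.{v} S] [MonoidalCategory S] {N : Type u'}
    [Category.{v'} N] [MonoidalLeftAction S N] (T : Γ → N ⥤ N) where
  mid : ∀ γ (d : S) (n : N), (T γ).obj (d ⊙ₗ n) ⟶ d ⊙ₗ (T γ).obj n
  naturality_left : ∀ γ {d d' : S} (f : d ⟶ d') (n : N),
    (T γ).map (f ⊵ₗ n) ≫ mid γ d' n = mid γ d n ≫ f ⊵ₗ (T γ).obj n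
  naturality_right : ∀ γ (d : S) {n n' : N} (f : n ⟶ n'),
    (T γ).map (d ⊴ₗ f) ≫ mid γ d n' = mid γ d n ≫ d ⊴ₗ (T γ).map f
  tensor : ∀ γ (d d' : S) (n : N), mid γ (d ⊗ d') n ≫ (αₗ d d' ((T γ).obj n)).hom =
    (T γ).map (αₗ d d' n).hom ≫ mid γ d (d' ⊙ₗ n) ≫ d ⊴ₗ mid γ d' n
  unit : ∀ γ (n : N), mid γ (𝟙_ S) n ≫ (λₗ ((T γ).obj n)).hom = (T γ).map (λₗ n).hom

/-- The action is full and faithful with respect to equivariant natural transformations. -/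
def EqvAction.IsFullyFaithful {T : Γ → N ⥤ N} (B : EqvAction S T) : Prop :=
  ∀ (d : S) (η : ∀ n : N, d ⊙ₗ n ⟶ d ⊙ₗ n),
    (∀ {n n' : N} (f : n ⟶ n'), d ⊴ₗ f ≫ η n' = η n ≫ d ⊴ₗ f) →
    (∀ γ n, (T γ).map (η n) ≫ B.mid γ d n = B.mid γ d n ≫ η ((T γ).obj n)) →
    ∃! f : d ⟶ d, ∀ n, f ⊵ₗ n = η n

/-- An isomorphism of the action of `x` with an equivariant functor. -/
structure EqvAction.Rep {T : Γ → N ⥤ N} (B : EqvAction S T) (x : S) (P : EqvFunctor T T) where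
  e : ∀ n : N, x ⊙ₗ n ≅ P.F.obj n
  naturality : ∀ {n n' : N} (f : n ⟶ n'), x ⊴ₗ f ≫ (e n').hom = (e n).hom ≫ P.F.map f
  equivariant : ∀ γ n, (T γ).map (e n).hom ≫ P.μ γ n = B.mid γ x n ≫ (e ((T γ).obj n)).hom

namespace EqvAction.Rep

variable {T : Γ → N ⥤ N} {B : EqvAction S T} {x : S} {P : EqvFunctor T T} 

/-- The unit object acts by the identity. -/
@[simps] def one (B : EqvAction S T) : B.Rep (𝟙_ S) (EqvFunctor.id T) where
  e n := λₗ n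
  naturality f := (actionUnitIso_hom_naturality f).symm
  equivariant γ n := (Category.comp_id _).trans (B.unit γ n).symm

/-- The isomorphism `(x ⊗ y) ⊙ n ≅ x ⊙ (y ⊙ n) ≅ P (Q n)`. -/
@[simps] def tensorIso {y : S} {Q : EqvFunctor T T} (e : B.Rep x P) (e' : B.Rep y Q) (n : N) :
    (x ⊗ y) ⊙ₗ n ≅ P.F.obj (Q.F.obj n) where
  hom := (αₗ x y n).hom ≫ x ⊴ₗ (e'.e n).hom ≫ (e.e (Q.F.obj n)).hom
  inv := (e.e (Q.F.obj n)).inv ≫ x ⊴ₗ (e'.e n).inv ≫ (αₗ x y n).inv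
  hom_inv_id := by simp only [Category.assoc, Iso.hom_inv_id_assoc, actionHomRight_hom_inv_assoc,
    Iso.hom_inv_id]
  inv_hom_id := by simp only [Category.assoc, Iso.inv_hom_id_assoc, actionHomRight_inv_hom_assoc,
    Iso.inv_hom_id]

/-- A tensor product acts by the composition. -/
@[simps] def tensor {y : S} {Q : EqvFunctor T T} (e : B.Rep x P) (e' : B.Rep y Q) :
    B.Rep (x ⊗ y) (Q.comp P) where
  e n := tensorIso e e' n
  naturality {n n'} f := by
    have key : (x ⊗ y) ⊴ₗ f ≫ (αₗ x y n').hom ≫ x ⊴ₗ (e'.e n').hom ≫ (e.e (Q.F.obj n')).hom =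
        ((αₗ x y n).hom ≫ x ⊴ₗ (e'.e n).hom ≫ (e.e (Q.F.obj n)).hom) ≫ P.F.map (Q.F.map f) := by
      rw [Category.assoc, Category.assoc, ← e.naturality, ← actionHomRight_comp_assoc x,
        ← e'.naturality]
      simp
    exact key
  equivariant γ n := by
    have key : (T γ).map ((αₗ x y n).hom ≫ x ⊴ₗ (e'.e n).hom ≫ (e.e (Q.F.obj n)).hom) ≫
        P.μ γ (Q.F.obj n) ≫ P.F.map (Q.μ γ n) = B.mid γ (x ⊗ y) n ≫
          (αₗ x y ((T γ).obj n)).hom ≫ x ⊴ₗ (e'.e ((T γ).obj n)).hom ≫ (e.e _).hom := by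
      rw [(T γ).map_comp, (T γ).map_comp, Category.assoc, Category.assoc, reassoc_of% e.equivariant,
        reassoc_of% B.naturality_right, ← e.naturality, ← actionHomRight_comp_assoc x,
        e'.equivariant, reassoc_of% B.tensor, actionHomRight_comp, Category.assoc]
    exact key

/-- The tensor powers of `x` act by the powers of `P`. -/
def pow (e : B.Rep x P) : ∀ k : ℕ, B.Rep (tensorPower x k) (P.pow k)
  | 0 => one B
  | k + 1 => tensor (e.pow k) e

/-- The endomorphism of the functor `P` given by an endomorphism of `x`. -/
@[simps! app] def endo (e : B.Rep x P) (f : x ⟶ x) : EqvEndo T T where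
  toEqvFunctor := P
  app n := (e.e n).inv ≫ f ⊵ₗ n ≫ (e.e n).hom
  naturality g := by
    rw [← cancel_epi (e.e _).hom, ← reassoc_of% e.naturality, Iso.hom_inv_id_assoc,
      Category.assoc, Category.assoc, Iso.hom_inv_id_assoc, action_exchange_assoc, e.naturality]
  equivariant γ n := by
    have h : (T γ).map (e.e n).inv ≫ B.mid γ x n = P.μ γ n ≫ (e.e _).inv := by
      rw [Iso.eq_comp_inv, Category.assoc, ← e.equivariant, ← Functor.map_comp_assoc,
        Iso.inv_hom_id, CategoryTheory.Functor.map_id, Category.id_comp]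
    rw [(T γ).map_comp, (T γ).map_comp, Category.assoc, Category.assoc, e.equivariant,
      reassoc_of% B.naturality_left, reassoc_of% h]

/-- Fullness of the action, transported along the isomorphism of `x ⊙ₗ -` with `P`. -/
lemma exists_endo (hB : B.IsFullyFaithful) (e : B.Rep x P) (a : EqvEndo T T)
    (ha : a.toEqvFunctor = P) : ∃ f, e.endo f = a := by
  obtain ⟨A, a, h1, h2⟩ := a
  obtain rfl : A = P := ha
  obtain ⟨f, hf, -⟩ := hB x (fun n => (e.e n).hom ≫ a n ≫ (e.e n).inv)
    (fun {n n'} g => by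
      rw [reassoc_of% e.naturality, reassoc_of% h1, Category.assoc, Category.assoc]
      congr 2
      rw [Iso.eq_inv_comp, ← reassoc_of% e.naturality, Iso.hom_inv_id, Category.comp_id])
    (fun γ n => by
      have h : (T γ).map (e.e n).inv ≫ B.mid γ x n = A.μ γ n ≫ (e.e _).inv := by
        rw [Iso.eq_comp_inv, Category.assoc, ← e.equivariant, ← Functor.map_comp_assoc,
          Iso.inv_hom_id, CategoryTheory.Functor.map_id, Category.id_comp]
      rw [(T γ).map_comp, (T γ).map_comp, Category.assoc, Category.assoc, h, reassoc_of% h2,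
        reassoc_of% e.equivariant])
  refine ⟨f, EqvEndo.ext_heq rfl (heq_of_eq ?_)⟩
  funext n
  change (e.e n).inv ≫ f ⊵ₗ n ≫ (e.e n).hom = a n
  rw [hf]
  simp

lemma endo_injective (hB : B.IsFullyFaithful) (e : B.Rep x P) {f g : x ⟶ x}
    (h : e.endo f = e.endo g) : f = g := by
  have h' : ∀ n, f ⊵ₗ n = g ⊵ₗ n := fun n => by
    have : (e.e n).inv ≫ f ⊵ₗ n ≫ (e.e n).hom =
      𝟙 _ ≫ ((e.e n).inv ≫ g ⊵ₗ n ≫ (e.e n).hom) ≫ 𝟙 _ := EqvEndo.app_eq h n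
    simpa using this
  exact (hB x (fun n => g ⊵ₗ n) (fun f => action_exchange _ _)
    (fun γ n => B.naturality_left γ g n)).unique h' (fun n => rfl)

/-- Whiskering with `y` on the right. -/
lemma endo_whiskerRight {y : S} {Q : EqvFunctor T T} (e : B.Rep x P) (e' : B.Rep y Q) (f : x ⟶ x) :
    (tensor e e').endo (f ▷ y) = EqvEndo.sandwich Q (e.endo f) (EqvFunctor.id T) :=
  EqvEndo.ext_heq (congrArg Q.comp (EqvFunctor.comp_id P).symm) (heq_of_eq (by
    funext n
    have key : ((e.e (Q.F.obj n)).inv ≫ x ⊴ₗ (e'.e n).inv ≫ (αₗ x y n).inv) ≫ (f ▷ y) ⊵ₗ n ≫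
        (αₗ x y n).hom ≫ x ⊴ₗ (e'.e n).hom ≫ (e.e (Q.F.obj n)).hom =
        (e.e (Q.F.obj n)).inv ≫ f ⊵ₗ (Q.F.obj n) ≫ (e.e (Q.F.obj n)).hom := by
      rw [whiskerRight_actionHomLeft]
      simp only [Category.assoc, Iso.inv_hom_id_assoc, ← action_exchange_assoc,
        actionHomRight_inv_hom_assoc]
    exact key))

/-- Whiskering with `x` on the left. -/
lemma endo_whiskerLeft {y : S} {Q : EqvFunctor T T} (e : B.Rep x P) (e' : B.Rep y Q) (f : y ⟶ y) :
    (tensor e e').endo (x ◁ f) = EqvEndo.sandwich (EqvFunctor.id T) (e'.endo f) P :=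
  EqvEndo.ext_heq (EqvFunctor.id_comp (Q.comp P)).symm (heq_of_eq (by
    funext n
    have key : ((e.e (Q.F.obj n)).inv ≫ x ⊴ₗ (e'.e n).inv ≫ (αₗ x y n).inv) ≫ (x ◁ f) ⊵ₗ n ≫
        (αₗ x y n).hom ≫ x ⊴ₗ (e'.e n).hom ≫ (e.e (Q.F.obj n)).hom =
        P.F.map ((e'.e n).inv ≫ f ⊵ₗ n ≫ (e'.e n).hom) := by
      rw [whiskerLeft_actionHomLeft]
      simp only [Category.assoc, Iso.inv_hom_id_assoc]
      rw [← actionHomRight_comp_assoc, ← actionHomRight_comp_assoc, e.naturality,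
        Iso.inv_hom_id_assoc, Category.assoc]
    exact key))

/-- Equalities of functors such as `comp_assoc` change the type of a representation. Packing the
functor and the representation into a pair allows such representations to be compared and rewritten.
-/
lemma sigma_ext {P P' : EqvFunctor T T} {e : B.Rep x P} {e' : B.Rep x P'} (h : P = P')
    (h' : HEq e.e e'.e) : (⟨P, e⟩ : Σ P, B.Rep x P) = ⟨P', e'⟩ := by
  subst h
  obtain ⟨f, _, _⟩ := e
  obtain ⟨g, _, _⟩ := e'
  obtain rfl : f = g := eq_of_heq h'
  rfl

/-- The action of an isomorphic object. -/
@[simps] def ofIso {y : S} (e : B.Rep x P) (u : x ≅ y) : B.Rep y P where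
  e n :=
    { hom := u.inv ⊵ₗ n ≫ (e.e n).hom
      inv := (e.e n).inv ≫ u.hom ⊵ₗ n
      hom_inv_id := by simp only [Category.assoc, Iso.hom_inv_id_assoc, inv_hom_actionHomLeft]
      inv_hom_id := by simp only [Category.assoc, hom_inv_actionHomLeft_assoc, Iso.inv_hom_id] }
  naturality f := by
    rw [action_exchange_assoc, e.naturality, Category.assoc]
  equivariant γ n := by
    rw [Functor.map_comp_assoc, e.equivariant, reassoc_of% B.naturality_left]

lemma endo_ofIso {y : S} (e : B.Rep x P) (u : x ≅ y) (g : y ⟶ y) :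
    (e.ofIso u).endo g = e.endo (u.hom ≫ g ≫ u.inv) :=
  EqvEndo.ext_heq rfl (heq_of_eq (by
    funext n
    have key : ((e.e n).inv ≫ u.hom ⊵ₗ n) ≫ g ⊵ₗ n ≫ u.inv ⊵ₗ n ≫ (e.e n).hom =
        (e.e n).inv ≫ (u.hom ≫ g ≫ u.inv) ⊵ₗ n ≫ (e.e n).hom := by
      simp only [comp_actionHomLeft, Category.assoc]
    exact key))

lemma ofIso_trans {y z : S} (e : B.Rep x P) (u : x ≅ y) (v : y ≅ z) :
    e.ofIso (u ≪≫ v) = (e.ofIso u).ofIso v := by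
  simp only [ofIso, mk.injEq]
  funext n
  ext
  simp

lemma tensor_ofIso {y z : S} {Q : EqvFunctor T T} (e : B.Rep x P) (e' : B.Rep y Q) (u : x ≅ z) :
    tensor (e.ofIso u) e' = (tensor e e').ofIso (whiskerRightIso u y) := by
  have key : ∀ n, tensorIso (e.ofIso u) e' n = ((tensor e e').ofIso (whiskerRightIso u y)).e n := by
    intro n
    ext
    have key : (αₗ z y n).hom ≫ z ⊴ₗ (e'.e n).hom ≫ u.inv ⊵ₗ (Q.F.obj n) ≫ (e.e _).hom =
        (u.inv ▷ y) ⊵ₗ n ≫ (αₗ x y n).hom ≫ x ⊴ₗ (e'.e n).hom ≫ (e.e (Q.F.obj n)).hom := by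
      rw [whiskerRight_actionHomLeft]
      simp only [Category.assoc, Iso.inv_hom_id_assoc]
      rw [action_exchange_assoc]
    exact key
  exact eq_of_heq (Sigma.mk.inj (sigma_ext rfl (heq_of_eq (funext key)))).2

/-- The coherence of the action associator. Together with `tensor_one` it says that representing
objects is strictly monoidal up to the structure isomorphisms of the category. -/
lemma tensor_assoc {y z : S} {Q R : EqvFunctor T T} (e : B.Rep x P) (e' : B.Rep y Q)
    (e'' : B.Rep z R) :
    (⟨_, (tensor e (tensor e' e'')).ofIso (α_ x y z).symm⟩ : Σ P, B.Rep ((x ⊗ y) ⊗ z) P) =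
      ⟨_, tensor (tensor e e') e''⟩ :=
  sigma_ext (EqvFunctor.comp_assoc _ _ _) (heq_of_eq (by
    funext n
    apply Iso.ext
    have key : (α_ x y z).hom ⊵ₗ n ≫ (αₗ x (y ⊗ z) n).hom ≫
        x ⊴ₗ ((αₗ y z n).hom ≫ y ⊴ₗ (e''.e n).hom ≫ (e'.e (R.F.obj n)).hom) ≫
          (e.e (Q.F.obj (R.F.obj n))).hom =
        (αₗ (x ⊗ y) z n).hom ≫ (x ⊗ y) ⊴ₗ (e''.e n).hom ≫ (αₗ x y (R.F.obj n)).hom ≫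
          x ⊴ₗ (e'.e (R.F.obj n)).hom ≫ (e.e (Q.F.obj (R.F.obj n))).hom := by
      simp only [actionHomRight_comp, Category.assoc, associator_actionHom_assoc,
        tensor_actionHomRight, Iso.inv_hom_id_assoc]
    exact key))

lemma tensor_one (e : B.Rep x P) :
    (⟨_, (tensor e (one B)).ofIso (ρ_ x)⟩ : Σ P, B.Rep x P) = ⟨P, e⟩ :=
  sigma_ext (EqvFunctor.id_comp _) (heq_of_eq (by
    funext n
    apply Iso.ext
    have key : (ρ_ x).inv ⊵ₗ n ≫ (αₗ x (𝟙_ S) n).hom ≫ x ⊴ₗ (λₗ n).hom ≫ (e.e n).hom =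
        (e.e n).hom := by
      rw [← rightUnitor_actionHom_assoc, inv_hom_actionHomLeft_assoc]
    exact key))

lemma tensor_pow (e : B.Rep x P) (m n : ℕ) :
    (⟨_, (tensor (e.pow m) (e.pow n)).ofIso (tensorPowerAdd x m n)⟩ :
      Σ P, B.Rep (tensorPower x (m + n)) P) = ⟨_, e.pow (m + n)⟩ := by
  induction n with
  | zero => exact tensor_one (e.pow m)
  | succ n ih =>
    have h1 := tensor_assoc (e.pow m) (e.pow n) e
    have h2 := congrArg (fun p : Σ P, B.Rep ((tensorPower x m ⊗ tensorPower x n) ⊗ x) P =>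
      (⟨_, p.2.ofIso (whiskerRightIso (tensorPowerAdd x m n) x)⟩ :
        Σ P, B.Rep (tensorPower x (m + n) ⊗ x) P)) h1
    have h3 := congrArg (fun p : Σ P, B.Rep (tensorPower x (m + n)) P =>
      (⟨_, tensor p.2 e⟩ : Σ P, B.Rep (tensorPower x (m + n) ⊗ x) P)) ih
    dsimp only at h2 h3
    rw [← ofIso_trans] at h2
    rw [tensor_ofIso] at h3
    exact h2.trans h3

/-- Tensoring with identities on the left and right becomes whiskering with powers of `P`. The order
is reversed: the rightmost tensor factors act on an object before the others. -/
lemma endo_embed {C : Type u} [Category.{v} C] [MonoidalCategory C] [UnitaryMultifusionCategory C]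
    [MonoidalLeftAction C N] {B : EqvAction C T} {x : C}
    (e : B.Rep x P) (l k r K : ℕ) (h : l + k + r = K) (f : End (tensorPower x k)) :
    (e.pow K).endo (embed x l k r K h f) =
      EqvEndo.sandwich (P.pow r) ((e.pow k).endo f) (P.pow l) := by
  have h1 : (⟨_, (tensor (tensor (e.pow l) (e.pow k)) (e.pow r)).ofIso (embedAux x l k r K h)⟩ :
      Σ P, B.Rep (tensorPower x K) P) = ⟨_, e.pow K⟩ := by
    subst h
    have h3 := congrArg (fun p : Σ P, B.Rep (tensorPower x (l + k)) P =>
      (⟨_, (tensor p.2 (e.pow r)).ofIso (tensorPowerAdd x (l + k) r)⟩ :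
        Σ P, B.Rep (tensorPower x (l + k + r)) P)) (tensor_pow e l k)
    dsimp only at h3
    rw [tensor_ofIso, ← ofIso_trans, tensor_pow e (l + k) r] at h3
    refine Eq.trans ?_ h3
    simp only [embedAux, eqToIso_refl, Iso.trans_refl]
  have h2 := congrArg (fun p : Σ P, B.Rep (tensorPower x K) P => p.2.endo (embed x l k r K h f)) h1
  dsimp only at h2
  rw [← h2, endo_ofIso]
  have h4 : (embedAux x l k r K h).hom ≫ (embed x l k r K h f : tensorPower x K ⟶ _) ≫
      (embedAux x l k r K h).inv = (tensorPower x l ◁ (f : tensorPower x k ⟶ _)) ▷ tensorPower x r := by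
    change _ ≫ ((embedAux x l k r K h).inv ≫ _ ≫ (embedAux x l k r K h).hom) ≫ _ = _
    simp only [Category.assoc, Iso.hom_inv_id_assoc, Iso.hom_inv_id, Category.comp_id]
  rw [h4, endo_whiskerRight, endo_whiskerLeft, EqvEndo.sandwich_sandwich, EqvFunctor.comp_id,
    EqvFunctor.comp_id]

end EqvAction.Rep
end

/-! ## Interleaving of two chains -/

section
open MonoidalLeftAction UnitaryCategory
variable {Γ : Type*} {C : Type u} [Category.{v} C] [MonoidalCategory C]
  [UnitaryMultifusionCategory C] {N : Type*} [Category N] [UnitaryCategory N]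
  [MonoidalLeftAction C N] [UnitaryLeftModule C N] {T : Γ → N ⥤ N}

/-- The isomorphism of the action of `x` with the functor `P` is unitary. -/
def EqvAction.Rep.IsUnitary {B : EqvAction C T} {x : C} {P : EqvFunctor T T} (e : B.Rep x P) : Prop :=
  ∀ n, dagger (e.e n).hom = (e.e n).inv

lemma EqvAction.Rep.IsUnitary.pow {B : EqvAction C T} {x : C} {P : EqvFunctor T T} {e : B.Rep x P}
    (he : e.IsUnitary) (k : ℕ) : (e.pow k).IsUnitary := by
  induction k with
  | zero => exact fun n => UnitaryLeftModule.dagger_actionUnitIso n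
  | succ k ih =>
    intro n
    have key : dagger ((αₗ (tensorPower x k) x n).hom ≫ tensorPower x k ⊴ₗ (e.e n).hom ≫
        ((e.pow k).e (P.F.obj n)).hom) = ((e.pow k).e (P.F.obj n)).inv ≫
          tensorPower x k ⊴ₗ (e.e n).inv ≫ (αₗ (tensorPower x k) x n).inv := by
      rw [dagger_comp, dagger_comp, ih, UnitaryLeftModule.dagger_actionHomRight, he,
        UnitaryLeftModule.dagger_actionAssocIso, Category.assoc]
    exact key

end

section
open MonoidalLeftAction UnitaryCategory
variable {Γ : Type*} {C : Type u} [Category.{v} C] [MonoidalCategory C]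
  [UnitaryMultifusionCategory C] {N₀ : Type*} [Category N₀] [UnitaryCategory N₀]
  [MonoidalLeftAction C N₀] [UnitaryLeftModule C N₀] {T₀ : Γ → N₀ ⥤ N₀}
  {D : Type u'} [Category.{v'} D] [MonoidalCategory D]
  [UnitaryMultifusionCategory D] {N₁ : Type*} [Category N₁] [UnitaryCategory N₁]
  [MonoidalLeftAction D N₁] [UnitaryLeftModule D N₁] {T₁ : Γ → N₁ ⥤ N₁}
  {B₀ : EqvAction C T₀} {B₁ : EqvAction D T₁} {x : C} {y : D}

lemma dagger_eqToHom' {N : Type*} [Category N] [UnitaryCategory N] {A B : N} (h : A = B) :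
    dagger (eqToHom h) = eqToHom h.symm := by
  subst h
  simp [dagger_id]

lemma dagger_inv_of_hom_eq {N : Type*} [Category N] [UnitaryCategory N] {A B : N} (e : A ≅ B)
    (h : dagger e.hom = e.inv) : dagger e.inv = e.hom := by
  rw [← h, dagger_dagger]

/-- A functor between representations of `x` and `y` carries endomorphisms of `x` to endomorphisms of
`y`. -/
lemma exists_starAlgHom_sandwich {P : EqvFunctor T₀ T₀} {Q : EqvFunctor T₁ T₁}
    (hB₁ : B₁.IsFullyFaithful) (e₀ : B₀.Rep x P) (e₁ : B₁.Rep y Q)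
    (he₀ : e₀.IsUnitary) (he₁ : e₁.IsUnitary) (F : EqvFunctor T₀ T₁) (G : EqvFunctor T₁ T₀)
    (hF : IsDaggerFunctor F.F) (hQ : Q = G.comp (P.comp F)) :
    ∃ φ : End x →⋆ₐ[ℂ] End y, ∀ f, e₁.endo (φ f) = EqvEndo.sandwich G (e₀.endo f) F := by
  -- The whiskered endomorphism is equivariant and lives on the functor represented by `y`, so
  -- fullness of the action gives an endomorphism of `y`.
  have hex : ∀ f : x ⟶ x, ∃ g, e₁.endo g = EqvEndo.sandwich G (e₀.endo f) F := fun f =>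
    e₁.exists_endo hB₁ _ hQ.symm
  choose φ hφ using hex
  obtain ⟨hF1, hF2, hF3⟩ := hF
  -- On each object, `φ f` is `F` applied to the action of `f`, conjugated with a unitary that does
  -- not depend on `f`. All algebraic properties of `φ`, including compatibility with the dagger,
  -- follow by faithfulness of the action.
  have hw : ∃ w : ∀ n, F.F.obj (x ⊙ₗ G.F.obj n) ≅ y ⊙ₗ n, (∀ n, dagger (w n).hom = (w n).inv) ∧
      ∀ f n, φ f ⊵ₗ n = (w n).inv ≫ F.F.map (f ⊵ₗ G.F.obj n) ≫ (w n).hom := by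
    have hobj : ∀ n, F.F.obj (P.F.obj (G.F.obj n)) = Q.F.obj n := fun n => by rw [hQ]; rfl
    refine ⟨fun n => F.F.mapIso (e₀.e _) ≪≫ eqToIso (hobj n) ≪≫ (e₁.e n).symm, fun n => ?_,
      fun f n => ?_⟩
    · simp only [Iso.trans_hom, Functor.mapIso_hom, eqToIso.hom, Iso.symm_hom, Iso.trans_inv,
        Functor.mapIso_inv, eqToIso.inv, Iso.symm_inv, dagger_comp]
      rw [dagger_inv_of_hom_eq _ (he₁ n), dagger_eqToHom', ← hF3, he₀, Category.assoc]
    · have h : (e₁.e n).inv ≫ φ f ⊵ₗ n ≫ (e₁.e n).hom = eqToHom (hobj n).symm ≫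
          F.F.map ((e₀.e _).inv ≫ f ⊵ₗ G.F.obj n ≫ (e₀.e _).hom) ≫ eqToHom (hobj n) :=
        EqvEndo.app_eq (hφ f) n
      rw [Iso.inv_comp_eq, ← Iso.eq_comp_inv] at h
      rw [h]
      simp
  obtain ⟨w, hw, hwφ⟩ := hw
  have hfaith : ∀ f g : y ⟶ y, (∀ n : N₁, f ⊵ₗ n = g ⊵ₗ n) → f = g := fun f g h =>
    (hB₁ y (fun n => g ⊵ₗ n) (fun f => action_exchange _ _)
      (fun γ n => B₁.naturality_left γ g n)).unique h (fun n => rfl)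
  have h1 : φ (𝟙 x) = 𝟙 y := hfaith _ _ fun n => by
    rw [hwφ]; simp
  have hmul : ∀ f g, φ (f ≫ g) = φ f ≫ φ g := fun f g => hfaith _ _ fun n => by
    rw [comp_actionHomLeft, hwφ, hwφ, hwφ]; simp
  have hadd : ∀ f g, φ (f + g) = φ f + φ g := fun f g => hfaith _ _ fun n => by
    rw [UnitaryLeftModule.add_actionHomLeft, hwφ, hwφ, hwφ, UnitaryLeftModule.add_actionHomLeft,
      hF1, Preadditive.add_comp, Preadditive.comp_add]
  have hsmul : ∀ (c : ℂ) f, φ (c • f) = c • φ f := fun c f => hfaith _ _ fun n => by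
    rw [UnitaryLeftModule.smul_actionHomLeft, hwφ, hwφ, UnitaryLeftModule.smul_actionHomLeft,
      hF2, Linear.smul_comp, Linear.comp_smul]
  have hstar : ∀ f, φ (dagger f) = dagger (φ f) := fun f => hfaith _ _ fun n => by
    rw [← UnitaryLeftModule.dagger_actionHomLeft, hwφ, hwφ,
      ← UnitaryLeftModule.dagger_actionHomLeft, hF3, dagger_comp, dagger_comp, hw,
      dagger_inv_of_hom_eq _ (hw n), Category.assoc]
  have h0 : φ 0 = 0 := by simpa using hsmul 0 0
  exact ⟨{ toFun := φ
           map_one' := h1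
           map_mul' := fun f g => hmul g f
           map_zero' := h0
           map_add' := hadd
           commutes' := fun c => by
             rw [Algebra.algebraMap_eq_smul_one, Algebra.algebraMap_eq_smul_one]
             exact (hsmul c (𝟙 x)).trans (congrArg (c • ·) h1)
           map_star' := hstar }, hφ⟩

/-- Two objects that act by the two compositions of a pair of functors have interleaved
endomorphism algebras of tensor powers. -/
lemma exists_interleaving (hB₀ : B₀.IsFullyFaithful) (hB₁ : B₁.IsFullyFaithful)
    (F : EqvFunctor T₀ T₁) (G : EqvFunctor T₁ T₀) (hF : IsDaggerFunctor F.F)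
    (hG : IsDaggerFunctor G.F) (e₀ : B₀.Rep x (F.comp G)) (e₁ : B₁.Rep y (G.comp F))
    (he₀ : e₀.IsUnitary) (he₁ : e₁.IsUnitary) :
    ∃ (φ : ∀ k, End (tensorPower x k) →⋆ₐ[ℂ] End (tensorPower y (k + 1)))
      (ψ : ∀ k, End (tensorPower y k) →⋆ₐ[ℂ] End (tensorPower x (k + 1))),
      (∀ l k r K (h : l + k + r = K) (h' : l + (k + 1) + r = K + 1) f,
        φ K (embed x l k r K h f) = embed y l (k + 1) r (K + 1) h' (φ k f)) ∧
      (∀ l k r K (h : l + k + r = K) (h' : l + (k + 1) + r = K + 1) f,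
        ψ K (embed y l k r K h f) = embed x l (k + 1) r (K + 1) h' (ψ k f)) ∧
      (∀ k (h : 1 + k + 1 = k + 1 + 1) f, ψ (k + 1) (φ k f) = embed x 1 k 1 (k + 1 + 1) h f) ∧
      ∀ k (h : 1 + k + 1 = k + 1 + 1) f, φ (k + 1) (ψ k f) = embed y 1 k 1 (k + 1 + 1) h f := by
  -- In diagrammatic order `(G.comp F)^{k+1}` is `G`, then `(F.comp G)^k`, then `F`; so sandwiching
  -- between `G` and `F` lands in the endomorphisms of `y^{⊗ (k+1)}`.
  choose φ hφ using fun k => exists_starAlgHom_sandwich hB₁ (e₀.pow k) (e₁.pow (k + 1)) (he₀.pow k)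
    (he₁.pow (k + 1)) F G hF (EqvFunctor.pow_comp_succ F G k)
  choose ψ hψ using fun k => exists_starAlgHom_sandwich hB₀ (e₁.pow k) (e₀.pow (k + 1)) (he₁.pow k)
    (he₀.pow (k + 1)) G F hG (EqvFunctor.pow_comp_succ G F k)
  have hone₀ : (F.comp G).pow 1 = F.comp G := EqvFunctor.comp_id _
  have hone₁ : (G.comp F).pow 1 = G.comp F := EqvFunctor.comp_id _
  refine ⟨φ, ψ, ?_, ?_, ?_, ?_⟩
  · intro l k r K h h' f
    apply (e₁.pow (K + 1)).endo_injective hB₁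
    rw [EqvAction.Rep.endo_embed, hφ, hφ, EqvAction.Rep.endo_embed, EqvEndo.sandwich_sandwich,
      EqvEndo.sandwich_sandwich, EqvFunctor.comp_pow F G, EqvFunctor.comp_pow G F]
  · intro l k r K h h' f
    apply (e₀.pow (K + 1)).endo_injective hB₀
    rw [EqvAction.Rep.endo_embed, hψ, hψ, EqvAction.Rep.endo_embed, EqvEndo.sandwich_sandwich,
      EqvEndo.sandwich_sandwich, EqvFunctor.comp_pow F G, EqvFunctor.comp_pow G F]
  -- Two successive sandwiches whisker with `F.comp G` on both sides, which is the functor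
  -- represented by one extra factor `x` at each end.
  · intro k h f
    apply (e₀.pow (k + 1 + 1)).endo_injective hB₀
    rw [EqvAction.Rep.endo_embed, hψ, hφ, EqvEndo.sandwich_sandwich, hone₀]
  · intro k h f
    apply (e₁.pow (k + 1 + 1)).endo_injective hB₁
    rw [EqvAction.Rep.endo_embed, hφ, hψ, EqvEndo.sandwich_sandwich, hone₁]

end

/-! ### From interleaved tensor powers to a bounded spread isomorphism. -/

section
open UnitaryCategory NonemptyInterval
open scoped TensorProduct
variable {C : Type u} [Category.{v} C] [MonoidalCategory C] [UnitaryMultifusionCategory C]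
  {D : Type u'} [Category.{v'} D] [MonoidalCategory D] [UnitaryMultifusionCategory D]

lemma card_thicken (J : NonemptyInterval ℤ) : (J.thicken 1).card = J.card + 1 + 1 := by
  have := J.fst_le_snd
  simp only [NonemptyInterval.card, thicken]
  omega

lemma embed_trans (x : C) (l k r N l' r' M l'' r'' : ℕ) (h : l + k + r = N)
    (h' : l' + N + r' = M) (hl : l' + l = l'') (hr : r + r' = r'') (h'' : l'' + k + r'' = M)
    (f : End (tensorPower x k)) :
    embed x l' N r' M h' (embed x l k r N h f) = embed x l'' k r'' M h'' f :=
  embed_comp x l k r N l' r' M l'' r'' h h' hl hr h'' f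

lemma tensorStarMap_blockIncl {x : C} {y : D} {N : ℕ}
    (φ : ∀ J : NonemptyInterval ℤ,
      End (tensorPower x J.card) →⋆ₐ[ℂ] End (tensorPower y (J.thicken 1).card))
    (hφ : ∀ I J (h : I ≤ J) f, φ J ((fusionSpinChain x).incl I J h f) =
      (fusionSpinChain y).incl _ _ (thicken_mono h 1) (φ I f))
    {I J : NonemptyInterval ℤ} (h : I ≤ J) (a : BlockAlg x N I) :
    tensorStarMap (φ J) (oscillatorChain.incl _ _ (block_mono N (J.le_thicken 1)))
      (blockIncl x N h a) = blockIncl y N (thicken_mono h 1)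
        (tensorStarMap (φ I) (oscillatorChain.incl _ _ (block_mono N (I.le_thicken 1))) a) := by
  induction a using TensorProduct.induction_on with
  | zero => simp only [map_zero]
  | tmul a t =>
    refine congrArg₂ (TensorProduct.tmul ℂ) (hφ I J h a) ?_
    exact (oscillatorChain.incl_trans _ _ _ _ _ t).trans (oscillatorChain.incl_trans _ _ _ _ _ t).symm
  | add a b ha hb => simp only [map_add, ha, hb]

lemma tensorStarMap_tensorStarMap_block {x : C} {y : D} {N : ℕ}
    (φ : ∀ J : NonemptyInterval ℤ,
      End (tensorPower x J.card) →⋆ₐ[ℂ] End (tensorPower y (J.thicken 1).card))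
    (ψ : ∀ J : NonemptyInterval ℤ,
      End (tensorPower y J.card) →⋆ₐ[ℂ] End (tensorPower x (J.thicken 1).card))
    (hψφ : ∀ J f, ψ (J.thicken 1) (φ J f) = (fusionSpinChain x).incl _ _
      ((J.le_thicken 1).trans ((J.thicken 1).le_thicken 1)) f)
    (J : NonemptyInterval ℤ) (a : BlockAlg x N J) :
    tensorStarMap (ψ (J.thicken 1))
      (oscillatorChain.incl _ _ (block_mono N ((J.thicken 1).le_thicken 1)))
      (tensorStarMap (φ J) (oscillatorChain.incl _ _ (block_mono N (J.le_thicken 1))) a) =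
      blockIncl x N ((J.le_thicken 1).trans ((J.thicken 1).le_thicken 1)) a := by
  induction a using TensorProduct.induction_on with
  | zero => simp only [map_zero]
  | tmul a t =>
    exact congrArg₂ (TensorProduct.tmul ℂ) (hψφ J a) (oscillatorChain.incl_trans _ _ _ _ _ t)
  | add a b ha hb => simp only [map_add, ha, hb]

lemma boundedSpreadIsomorphic_of_blockAlg {A : LocalNet.{w}} {B : LocalNet.{w'}} {x : C} {y : D}
    {N : ℕ} (hN : 0 < N)
    (θ : ∀ J : NonemptyInterval ℤ, A.alg (J.block N) ≃⋆ₐ[ℂ] BlockAlg x N J)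
    (hθ : ∀ I J (h : I ≤ J) a, θ J (A.incl _ _ (block_mono N h) a) = blockIncl x N h (θ I a))
    (ϑ : ∀ J : NonemptyInterval ℤ, B.alg (J.block N) ≃⋆ₐ[ℂ] BlockAlg y N J)
    (hϑ : ∀ I J (h : I ≤ J) a, ϑ J (B.incl _ _ (block_mono N h) a) = blockIncl y N h (ϑ I a))
    (φ : ∀ J : NonemptyInterval ℤ,
      End (tensorPower x J.card) →⋆ₐ[ℂ] End (tensorPower y (J.thicken 1).card))
    (ψ : ∀ J : NonemptyInterval ℤ,
      End (tensorPower y J.card) →⋆ₐ[ℂ] End (tensorPower x (J.thicken 1).card))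
    (hφ : ∀ I J (h : I ≤ J) f, φ J ((fusionSpinChain x).incl I J h f) =
      (fusionSpinChain y).incl _ _ (thicken_mono h 1) (φ I f))
    (hψ : ∀ I J (h : I ≤ J) f, ψ J ((fusionSpinChain y).incl I J h f) =
      (fusionSpinChain x).incl _ _ (thicken_mono h 1) (ψ I f))
    (hψφ : ∀ J f, ψ (J.thicken 1) (φ J f) = (fusionSpinChain x).incl _ _
      ((J.le_thicken 1).trans ((J.thicken 1).le_thicken 1)) f)
    (hφψ : ∀ J f, φ (J.thicken 1) (ψ J f) = (fusionSpinChain y).incl _ _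
      ((J.le_thicken 1).trans ((J.thicken 1).le_thicken 1)) f) :
    BoundedSpreadIsomorphic A B := by
  have hθ' : ∀ I J (h : I ≤ J) a, A.incl _ _ (block_mono N h) ((θ I).symm a) =
      (θ J).symm (blockIncl x N h a) := fun I J h a => by
    rw [← (θ J).symm_apply_apply (A.incl _ _ _ _), hθ, (θ I).apply_symm_apply]
  have hϑ' : ∀ I J (h : I ≤ J) a, B.incl _ _ (block_mono N h) ((ϑ I).symm a) =
      (ϑ J).symm (blockIncl y N h a) := fun I J h a => by
    rw [← (ϑ J).symm_apply_apply (B.incl _ _ _ _), hϑ, (ϑ I).apply_symm_apply]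
  refine boundedSpreadIsomorphic_of_interleaving hN
    (fun J => (((ϑ (J.thicken 1)).symm : _ →⋆ₐ[ℂ] _).comp (tensorStarMap (φ J)
      (oscillatorChain.incl _ _ (block_mono N (J.le_thicken 1))))).comp (θ J : _ →⋆ₐ[ℂ] _))
    (fun J => (((θ (J.thicken 1)).symm : _ →⋆ₐ[ℂ] _).comp (tensorStarMap (ψ J)
      (oscillatorChain.incl _ _ (block_mono N (J.le_thicken 1))))).comp (ϑ J : _ →⋆ₐ[ℂ] _))
    ?_ ?_ ?_ ?_
  · intro I J h a
    change (ϑ _).symm (tensorStarMap _ _ (θ J (A.incl _ _ _ a))) =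
      B.incl _ _ _ ((ϑ _).symm (tensorStarMap _ _ (θ I a)))
    rw [hθ _ _ h, hϑ' _ _ (thicken_mono h 1), tensorStarMap_blockIncl φ hφ h]
  · intro I J h a
    change (θ _).symm (tensorStarMap _ _ (ϑ J (B.incl _ _ _ a))) =
      A.incl _ _ _ ((θ _).symm (tensorStarMap _ _ (ϑ I a)))
    rw [hϑ _ _ h, hθ' _ _ (thicken_mono h 1), tensorStarMap_blockIncl ψ hψ h]
  · intro J a
    change (θ _).symm (tensorStarMap _ _ (ϑ _ ((ϑ _).symm (tensorStarMap _ _ (θ J a))))) = _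
    rw [(ϑ _).apply_symm_apply, tensorStarMap_tensorStarMap_block φ ψ hψφ, ← hθ,
      (θ _).symm_apply_apply]
  · intro J a
    change (ϑ _).symm (tensorStarMap _ _ (θ _ ((θ _).symm (tensorStarMap _ _ (ϑ J a))))) = _
    rw [(θ _).apply_symm_apply, tensorStarMap_tensorStarMap_block ψ φ hφψ, ← hϑ,
      (ϑ _).symm_apply_apply]

/-- Interleaved endomorphism algebras of the tensor powers of `x` and `y` give a bounded spread
isomorphism of nets whose blocks are the stabilized blocks of the chains of `x` and `y`. -/
lemma boundedSpreadIsomorphic_of_interleaved {A : LocalNet.{w}} {B : LocalNet.{w'}} {x : C} {y : D}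
    {N : ℕ} (hN : 0 < N)
    (θ : ∀ J : NonemptyInterval ℤ, A.alg (J.block N) ≃⋆ₐ[ℂ] BlockAlg x N J)
    (hθ : ∀ I J (h : I ≤ J) a, θ J (A.incl _ _ (block_mono N h) a) = blockIncl x N h (θ I a))
    (ϑ : ∀ J : NonemptyInterval ℤ, B.alg (J.block N) ≃⋆ₐ[ℂ] BlockAlg y N J)
    (hϑ : ∀ I J (h : I ≤ J) a, ϑ J (B.incl _ _ (block_mono N h) a) = blockIncl y N h (ϑ I a))
    (φ : ∀ k, End (tensorPower x k) →⋆ₐ[ℂ] End (tensorPower y (k + 1)))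
    (ψ : ∀ k, End (tensorPower y k) →⋆ₐ[ℂ] End (tensorPower x (k + 1)))
    (hφ : ∀ l k r K (h : l + k + r = K) (h' : l + (k + 1) + r = K + 1) f,
        φ K (embed x l k r K h f) = embed y l (k + 1) r (K + 1) h' (φ k f))
    (hψ : ∀ l k r K (h : l + k + r = K) (h' : l + (k + 1) + r = K + 1) f,
        ψ K (embed y l k r K h f) = embed x l (k + 1) r (K + 1) h' (ψ k f))
    (hψφ : ∀ k (h : 1 + k + 1 = k + 1 + 1) f, ψ (k + 1) (φ k f) = embed x 1 k 1 (k + 1 + 1) h f)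
    (hφψ : ∀ k (h : 1 + k + 1 = k + 1 + 1) f, φ (k + 1) (ψ k f) = embed y 1 k 1 (k + 1 + 1) h f) :
    BoundedSpreadIsomorphic A B := by
  -- The sites of the two chains are offset by half a step. On `J = [a, b]` the map `φ'` lands in
  -- `[a - 1, b]`, whereas `ψ'` lands in `[a, b + 1]`; with these opposite offsets both composites
  -- put the original operator back on `[a, b]`.
  let φ' : ∀ J : NonemptyInterval ℤ,
      End (tensorPower x J.card) →⋆ₐ[ℂ] End (tensorPower y (J.thicken 1).card) := fun J =>
    (embed y 0 (J.card + 1) 1 _ (by rw [card_thicken]; omega)).comp (φ J.card)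
  let ψ' : ∀ J : NonemptyInterval ℤ,
      End (tensorPower y J.card) →⋆ₐ[ℂ] End (tensorPower x (J.thicken 1).card) := fun J =>
    (embed x 1 (J.card + 1) 0 _ (by rw [card_thicken]; omega)).comp (ψ J.card)
  have hφ' : ∀ I J (h : I ≤ J) f, φ' J ((fusionSpinChain x).incl I J h f) =
      (fusionSpinChain y).incl _ _ (thicken_mono h 1) (φ' I f) := by
    intro I J h f
    have hc := card_eq h
    have h1 := NonemptyInterval.le_def.1 h
    have e1 := hφ _ _ _ _ hc (by omega) f
    have e2 := card_thicken I
    have e3 := card_thicken J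
    refine (congrArg (embed y 0 (J.card + 1) 1 _ _) e1).trans ?_
    rw [embed_trans (l'' := (I.fst - J.fst).toNat) (r'' := (J.snd - I.snd).toNat + 1)
      (hl := by omega) (hr := by omega) (h'' := by omega)]
    refine (embed_trans _ _ _ _ _ _ _ _ _ _ _ _ ?_ ?_ _ _).symm
    · simp only [thicken]; omega
    · simp only [thicken]; omega
  have hψ' : ∀ I J (h : I ≤ J) f, ψ' J ((fusionSpinChain y).incl I J h f) =
      (fusionSpinChain x).incl _ _ (thicken_mono h 1) (ψ' I f) := by
    intro I J h f
    have hc := card_eq h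
    have h1 := NonemptyInterval.le_def.1 h
    have e1 := hψ _ _ _ _ hc (by omega) f
    have e2 := card_thicken I
    have e3 := card_thicken J
    refine (congrArg (embed x 1 (J.card + 1) 0 _ _) e1).trans ?_
    rw [embed_trans (l'' := (I.fst - J.fst).toNat + 1) (r'' := (J.snd - I.snd).toNat)
      (hl := by omega) (hr := by omega) (h'' := by omega)]
    refine (embed_trans _ _ _ _ _ _ _ _ _ _ _ _ ?_ ?_ _ _).symm
    · simp only [thicken]; omega
    · simp only [thicken]; omega
  have hψφ' : ∀ J f, ψ' (J.thicken 1) (φ' J f) = (fusionSpinChain x).incl _ _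
      ((J.le_thicken 1).trans ((J.thicken 1).le_thicken 1)) f := by
    intro J f
    have e2 := card_thicken J
    have e3 := card_thicken (J.thicken 1)
    have e1 := hψ 0 (J.card + 1) 1 (J.thicken 1).card (by omega) (by omega) (φ J.card f)
    rw [hψφ J.card (by omega)] at e1
    refine (congrArg (embed x 1 ((J.thicken 1).card + 1) 0 _ _) e1).trans ?_
    rw [embed_trans (l'' := 1) (r'' := 1) (hl := by omega) (hr := by omega) (h'' := by omega)]
    refine embed_trans _ _ _ _ _ _ _ _ _ _ _ _ ?_ ?_ _ _
    · simp only [thicken]; omega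
    · simp only [thicken]; omega
  have hφψ' : ∀ J f, φ' (J.thicken 1) (ψ' J f) = (fusionSpinChain y).incl _ _
      ((J.le_thicken 1).trans ((J.thicken 1).le_thicken 1)) f := by
    intro J f
    have e2 := card_thicken J
    have e3 := card_thicken (J.thicken 1)
    have e1 := hφ 1 (J.card + 1) 0 (J.thicken 1).card (by omega) (by omega) (ψ J.card f)
    rw [hφψ J.card (by omega)] at e1
    refine (congrArg (embed y 0 ((J.thicken 1).card + 1) 1 _ _) e1).trans ?_
    rw [embed_trans (l'' := 1) (r'' := 1) (hl := by omega) (hr := by omega) (h'' := by omega)]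
    refine embed_trans _ _ _ _ _ _ _ _ _ _ _ _ ?_ ?_ _ _
    · simp only [thicken]; omega
    · simp only [thicken]; omega
  exact boundedSpreadIsomorphic_of_blockAlg hN θ hθ ϑ hϑ φ' ψ' hφ' hψ' hψφ' hφψ'

end

/-! ## Functors built from morphism spaces -/

section
open UnitaryCategory
variable {M : Type u} [Category.{v} M] [UnitaryCategory M] {C : Type u'} [Category.{v'} C]
  [UnitaryCategory C]

/-- A dagger functor `G = ⨁ i, s i ⊗ Hom(m i, K i -)`. For `f : m i ⟶ K i n`, `E i n f` is the
corresponding morphism from the summand `s i`. -/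
structure SumFunctor {ι : Type} [Fintype ι] (s : ι → C) (m : ι → M) [∀ i, Simple (m i)] (K : ι → M ⥤ M) where
  G : M ⥤ C
  isDagger : IsDaggerFunctor G
  E : ∀ i n, (m i ⟶ (K i).obj n) →ₗ[ℂ] (s i ⟶ G.obj n)
  E_map : ∀ i {n n'} (f : m i ⟶ (K i).obj n) (h : n ⟶ n'), E i n f ≫ G.map h = E i n' (f ≫ (K i).map h)
  E_inner : ∀ i n (f g : m i ⟶ (K i).obj n), E i n f ≫ dagger (E i n g) = scal (f ≫ dagger g) • 𝟙 _
  E_ortho : ∀ i j n (f : m i ⟶ (K i).obj n) (g : m j ⟶ (K j).obj n), i ≠ j →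
    E i n f ≫ dagger (E j n g) = 0
  total : ∀ n, ∑ i, ∑ k, dagger (E i n ((homBasis (m i) ((K i).obj n)).b k)) ≫
    E i n ((homBasis (m i) ((K i).obj n)).b k) = 𝟙 _

/-- Orthonormal bases turn `⨁ i, s i ⊗ Hom(m i, K i n)` into an orthogonal sum of copies of the `s
i`. The maps `E i n` are linear in the morphism and jointly detect morphisms out of the sum, so
functoriality and compatibility with the dagger reduce to naturality in the morphism. -/
lemma exists_sumFunctor {ι : Type} [Fintype ι] (s : ι → C) (m : ι → M) [∀ i, Simple (m i)]
    (K : ι → M ⥤ M) (hK : ∀ i, IsDaggerFunctor (K i)) : Nonempty (SumFunctor s m K) := by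
  classical
  let b : ∀ n i, HomBasis (m i) ((K i).obj n) := fun n i => homBasis _ _
  choose Z hZ using fun n => exists_orthoSum (fun p : Σ i, (b n i).ι => s p.1)
  let Q : ∀ n, OrthoSum (fun p : Σ i, (b n i).ι => s p.1) (Z n) := fun n => (hZ n).some
  let E : ∀ i n, (m i ⟶ (K i).obj n) →ₗ[ℂ] (s i ⟶ Z n) := fun i n =>
    { toFun := fun f => ∑ k, scal (f ≫ dagger ((b n i).b k)) • (Q n).incl ⟨i, k⟩
      map_add' := fun f g => by
        simp only [Preadditive.add_comp, scal_add, add_smul, Finset.sum_add_distrib]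
      map_smul' := fun c f => by
        simp only [Linear.smul_comp, scal_smul, mul_smul, Finset.smul_sum, RingHom.id_apply] }
  have hE : ∀ i n f, E i n f = ∑ k, scal (f ≫ dagger ((b n i).b k)) • (Q n).incl ⟨i, k⟩ :=
    fun i n f => rfl
  have hEb : ∀ i n k, E i n ((b n i).b k) = (Q n).incl ⟨i, k⟩ := by
    intro i n k
    rw [hE, Finset.sum_eq_single k]
    · rw [(b n i).isometry, scal_id, one_smul]
    · intro l _ hl
      rw [(b n i).ortho k l hl.symm, scal_zero, zero_smul]
    · simp
  have hortho : ∀ i j n (f : m i ⟶ (K i).obj n) (g : m j ⟶ (K j).obj n), i ≠ j →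
      E i n f ≫ dagger (E j n g) = 0 := by
    intro i j n f g hij
    simp only [hE, dagger_sum, dagger_smul, Preadditive.sum_comp, Preadditive.comp_sum,
      Linear.smul_comp, Linear.comp_smul]
    refine Finset.sum_eq_zero fun k _ => ?_
    rw [Finset.sum_eq_zero, smul_zero]
    intro l _
    rw [(Q n).ortho _ _ (fun h => hij (congrArg Sigma.fst h)), smul_zero]
  have hinner' : ∀ i n f k, E i n f ≫ dagger ((Q n).incl ⟨i, k⟩) =
      scal (f ≫ dagger ((b n i).b k)) • 𝟙 _ := by
    intro i n f k
    rw [hE, Preadditive.sum_comp, Finset.sum_eq_single k]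
    · rw [Linear.smul_comp, (Q n).isometry]
    · intro l _ hl
      rw [Linear.smul_comp, (Q n).ortho _ _ (fun h => hl (by simpa using h)), smul_zero]
    · simp
  have hinner : ∀ i n (f g : m i ⟶ (K i).obj n),
      E i n f ≫ dagger (E i n g) = scal (f ≫ dagger g) • 𝟙 _ := by
    intro i n f g
    conv_rhs => rw [← (b n i).total g]
    conv_lhs => rw [hE i n g]
    simp only [dagger_sum, dagger_smul, Preadditive.comp_sum, Linear.comp_smul, hinner']
    have : ∀ (t : Finset (b n i).ι) (c : (b n i).ι → (m i ⟶ m i)), scal (∑ k ∈ t, c k) = ∑ k ∈ t, scal (c k) := by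
      intro t c
      induction t using Finset.cons_induction with
      | empty => simp [scal_zero]
      | cons a t ha ih => rw [Finset.sum_cons, Finset.sum_cons, scal_add, ih]
    rw [this, Finset.sum_smul]
    refine Finset.sum_congr rfl fun k _ => ?_
    rw [scal_smul, mul_smul]
  have htotal : ∀ n, ∑ p : Σ i, (b n i).ι, dagger (E p.1 n ((b n p.1).b p.2)) ≫
      E p.1 n ((b n p.1).b p.2) = 𝟙 (Z n) := by
    intro n
    simp only [hEb]
    exact (Q n).total
  let Gm : ∀ {n n'}, (n ⟶ n') → (Z n ⟶ Z n') := fun {n n'} h =>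
    ∑ p : Σ i, (b n i).ι, dagger (E p.1 n ((b n p.1).b p.2)) ≫ E p.1 n' ((b n p.1).b p.2 ≫ (K p.1).map h)
  have hEG : ∀ i {n n'} (f : m i ⟶ (K i).obj n) (h : n ⟶ n'),
      E i n f ≫ Gm h = E i n' (f ≫ (K i).map h) := by
    intro i n n' f h
    simp only [Gm, Preadditive.comp_sum, Fintype.sum_sigma]
    rw [Finset.sum_eq_single i]
    · conv_rhs => rw [← (b n i).total f, Preadditive.sum_comp, map_sum]
      refine Finset.sum_congr rfl fun k _ => ?_
      rw [← Category.assoc, hinner, Linear.smul_comp, Linear.smul_comp, Category.id_comp, map_smul]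
    · intro j _ hj
      refine Finset.sum_eq_zero fun k _ => ?_
      rw [← Category.assoc, hortho _ _ _ _ _ hj.symm, zero_comp]
    · simp
  have hext : ∀ {n Y} (f g : Z n ⟶ Y), (∀ i φ, E i n φ ≫ f = E i n φ ≫ g) → f = g := by
    intro n Y f g h
    rw [← Category.id_comp f, ← Category.id_comp g, ← htotal n, Preadditive.sum_comp,
      Preadditive.sum_comp]
    refine Finset.sum_congr rfl fun p _ => ?_
    rw [Category.assoc, Category.assoc, h]
  let G : M ⥤ C :=
    { obj := Z
      map := Gm
      map_id := fun n => hext _ _ fun i φ => by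
        rw [hEG, CategoryTheory.Functor.map_id, Category.comp_id, Category.comp_id]
      map_comp := fun f g => hext _ _ fun i φ => by
        rw [hEG, CategoryTheory.Functor.map_comp, ← Category.assoc (E i _ φ), hEG, hEG, Category.assoc] }
  refine ⟨⟨G, ⟨?_, ?_, ?_⟩, E, hEG, hinner, hortho, fun n => (Fintype.sum_sigma _).symm.trans (htotal n)⟩⟩
  · intro n n' f g
    refine hext _ _ fun i φ => ?_
    change E i n φ ≫ Gm (f + g) = E i n φ ≫ (Gm f + Gm g)
    rw [Preadditive.comp_add, hEG, hEG, hEG, (hK i).1, Preadditive.comp_add, map_add]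
  · intro n n' z f
    refine hext _ _ fun i φ => ?_
    change E i n φ ≫ Gm (z • f) = E i n φ ≫ (z • Gm f)
    rw [Linear.comp_smul, hEG, hEG, (hK i).2.1, Linear.comp_smul, map_smul]
  · intro n n' f
    refine hext _ _ fun i φ => dagger_injective (hext _ _ fun j ψ => ?_)
    change E j n ψ ≫ dagger (E i n' φ ≫ Gm (dagger f)) = E j n ψ ≫ dagger (E i n' φ ≫ dagger (Gm f))
    rw [dagger_comp (E i n' φ) (dagger (Gm f)), dagger_dagger, ← Category.assoc, hEG, hEG]
    by_cases hij : j = i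
    · subst hij
      rw [hinner, hinner, (hK j).2.2, dagger_comp, dagger_dagger, Category.assoc]
    · rw [hortho _ _ _ _ _ hij, hortho _ _ _ _ _ hij]

namespace SumFunctor

variable {ι : Type} [Fintype ι] {s : ι → C} {m : ι → M} [∀ i, Simple (m i)] {K : ι → M ⥤ M}
  (R : SumFunctor s m K)

/-- A dagger functor `W` preserves the decomposition of `R.G.obj n`, so a morphism out of `W.obj
(R.G.obj n)` can be prescribed freely and linearly on the summands. Taking `W` to be `tensorRight c`
gives morphisms out of `G n ⊗ c`. -/
lemma exists_desc {B : Type w} [Category.{w'} B] [UnitaryCategory B] (W : C ⥤ B)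
    (hW : IsDaggerFunctor W) {n : M} {Y : B}
    (t : ∀ i, (m i ⟶ (K i).obj n) →ₗ[ℂ] (W.obj (s i) ⟶ Y)) :
    ∃ τ : W.obj (R.G.obj n) ⟶ Y, ∀ i f, W.map (R.E i n f) ≫ τ = t i f := by
  refine ⟨∑ i, ∑ k, W.map (dagger (R.E i n ((homBasis (m i) ((K i).obj n)).b k))) ≫
    t i ((homBasis (m i) ((K i).obj n)).b k), fun i f => ?_⟩
  simp only [Preadditive.comp_sum]
  rw [Finset.sum_eq_single i]
  · conv_rhs => rw [← (homBasis (m i) ((K i).obj n)).total f, map_sum]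
    refine Finset.sum_congr rfl fun k _ => ?_
    rw [← Category.assoc, ← W.map_comp, R.E_inner, hW.2.1, CategoryTheory.Functor.map_id,
      Linear.smul_comp, Category.id_comp, map_smul]
  · intro j _ hj
    refine Finset.sum_eq_zero fun k _ => ?_
    rw [← Category.assoc, ← W.map_comp, R.E_ortho _ _ _ _ _ hj.symm, ← zero_smul ℂ (𝟙 _ ≫ 0), hW.2.1,
      zero_smul, zero_comp]
  · simp

lemma map_hom_ext {B : Type w} [Category.{w'} B] [UnitaryCategory B] (W : C ⥤ B)
    (hW : IsDaggerFunctor W) {n : M} {Y : B} {f g : W.obj (R.G.obj n) ⟶ Y}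
    (h : ∀ i φ, W.map (R.E i n φ) ≫ f = W.map (R.E i n φ) ≫ g) : f = g := by
  have hsum : ∀ {κ : Type} [Fintype κ] {X Y : C} (c : κ → (X ⟶ Y)), W.map (∑ k, c k) = ∑ k, W.map (c k) := by
    intro κ _ X Y c
    exact map_sum (AddMonoidHom.mk' (fun f : X ⟶ Y => W.map f) (fun f g => hW.1 f g)) c _
  rw [← Category.id_comp f, ← Category.id_comp g, ← CategoryTheory.Functor.map_id, ← R.total n, hsum]
  simp only [hsum, W.map_comp, Preadditive.sum_comp, Category.assoc, h]

lemma hom_ext {n : M} {Y : C} {f g : R.G.obj n ⟶ Y} (h : ∀ i φ, R.E i n φ ≫ f = R.E i n φ ≫ g) :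
    f = g :=
  R.map_hom_ext (𝟭 C) ⟨fun _ _ => rfl, fun _ _ => rfl, fun _ => rfl⟩ h

end SumFunctor

end

/-! ## Duals of simple objects -/

section Rotation
variable {C : Type u} [Category.{v} C] [MonoidalCategory C]

/-- `β` and `γ` are related by bending `u` and `v` to their right duals. -/
def IsRotation {u v c : C} (u' v' : C) [ExactPairing u u'] [ExactPairing v v'] (β : v ⟶ u ⊗ c) (γ : u' ⟶ c ⊗ v') : Prop :=
  η_ u u' ≫ u ◁ γ ≫ (α_ u c v').inv = η_ v v' ≫ β ▷ v'

namespace IsRotation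
variable {u u' v v' w w' c c' : C} [ExactPairing u u'] [ExactPairing v v'] [ExactPairing w w']

/-- Up to a unitor this is the adjunction between tensoring with `v` and with its dual. -/
lemma coev_whiskerRight_bijective (X : C) : Function.Bijective (fun β : v ⟶ X => η_ v v' ≫ β ▷ v') := by
  have h : (fun β : v ⟶ X => η_ v v' ≫ β ▷ v') =
      (tensorRightHomEquiv (𝟙_ C) v v' X) ∘ (fun β => (λ_ v).hom ≫ β) := by
    funext β
    simp only [tensorRightHomEquiv, Equiv.coe_fn_mk, Function.comp]
    monoidal
  rw [h]
  refine (Equiv.bijective _).comp ⟨fun a b hab => ?_, fun b => ⟨(λ_ v).inv ≫ b, by simp⟩⟩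
  simpa using hab

lemma coev_whiskerLeft_bijective (X : C) : Function.Bijective (fun γ : u' ⟶ X => η_ u u' ≫ u ◁ γ) := by
  have h : (fun γ : u' ⟶ X => η_ u u' ≫ u ◁ γ) =
      (tensorLeftHomEquiv (𝟙_ C) u u' X) ∘ (fun γ => (ρ_ u').hom ≫ γ) := by
    funext γ
    simp only [tensorLeftHomEquiv, Equiv.coe_fn_mk, Function.comp]
    monoidal
  rw [h]
  refine (Equiv.bijective _).comp ⟨fun a b hab => ?_, fun b => ⟨(ρ_ u').inv ≫ b, by simp⟩⟩
  simpa using hab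

lemma exists_right (u' v' : C) [ExactPairing u u'] [ExactPairing v v'] (β : v ⟶ u ⊗ c) : ∃ γ, IsRotation u' v' β γ := by
  obtain ⟨γ, hγ⟩ := (coev_whiskerLeft_bijective (u := u) (u' := u') (c ⊗ v')).2
    (η_ v v' ≫ β ▷ v' ≫ (α_ u c v').hom)
  refine ⟨γ, ?_⟩
  dsimp only at hγ
  rw [IsRotation, reassoc_of% hγ, Iso.hom_inv_id, Category.comp_id]

lemma exists_left (u v : C) [ExactPairing u u'] [ExactPairing v v'] (γ : u' ⟶ c ⊗ v') : ∃ β : v ⟶ u ⊗ c, IsRotation u' v' β γ := by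
  obtain ⟨β, hβ⟩ := (coev_whiskerRight_bijective (v := v) (v' := v') (u ⊗ c)).2
    (η_ u u' ≫ u ◁ γ ≫ (α_ u c v').inv)
  exact ⟨β, hβ.symm⟩

lemma unique_right {β : v ⟶ u ⊗ c} {γ γ' : u' ⟶ c ⊗ v'} (h : IsRotation u' v' β γ)
    (h' : IsRotation u' v' β γ') : γ = γ' := by
  refine (coev_whiskerLeft_bijective (u := u) (u' := u') (c ⊗ v')).1 ?_
  rw [IsRotation] at h h'
  rw [← h', ← Category.assoc, ← Category.assoc, cancel_mono] at h
  exact h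

lemma whisker {β : v ⟶ u ⊗ c} {γ : u' ⟶ c ⊗ v'} (h : IsRotation u' v' β γ) (g : c ⟶ c') :
    IsRotation u' v' (β ≫ u ◁ g) (γ ≫ g ▷ v') := by
  rw [IsRotation] at h ⊢
  rw [comp_whiskerRight, ← reassoc_of% h]
  monoidal

/-- Bending is functorial under stacking. Through this, associativity of the module structure on
internal homs reduces to coherence of the action. -/
lemma comp {β : v ⟶ u ⊗ c} {γ : u' ⟶ c ⊗ v'} (h : IsRotation u' v' β γ) {β' : w ⟶ v ⊗ c'}
    {γ' : v' ⟶ c' ⊗ w'} (h' : IsRotation v' w' β' γ') :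
    IsRotation u' w' (β' ≫ β ▷ c' ≫ (α_ u c c').hom) (γ ≫ c ◁ γ' ≫ (α_ c c' w').inv) := by
  rw [IsRotation] at h h' ⊢
  have e1 : η_ u u' ≫ u ◁ (γ ≫ c ◁ γ' ≫ (α_ c c' w').inv) ≫ (α_ u (c ⊗ c') w').inv =
      (η_ u u' ≫ u ◁ γ ≫ (α_ u c v').inv) ≫ (u ⊗ c) ◁ γ' ≫ (α_ _ _ _).inv ≫
        (α_ u c c').hom ▷ w' := by monoidal
  have e2 : η_ w w' ≫ (β' ≫ β ▷ c' ≫ (α_ u c c').hom) ▷ w' =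
      (η_ w w' ≫ β' ▷ w') ≫ (β ▷ c') ▷ w' ≫ (α_ u c c').hom ▷ w' := by monoidal
  rw [e1, e2, h, ← h']
  have e3 : β ▷ v' ≫ (u ⊗ c) ◁ γ' = v ◁ γ' ≫ β ▷ _ := (whisker_exchange _ _).symm
  simp only [Category.assoc]
  rw [reassoc_of% e3]
  monoidal

lemma unit (v v' : C) [ExactPairing v v'] : IsRotation v' v' (ρ_ v).inv (λ_ v').inv := by
  rw [IsRotation]
  monoidal

end IsRotation

/-- By the zigzag identity, `s ▷ q` factors through `(s ≫ η_ q q') ▷ q`. It is used in the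
contrapositive: a summand of the unit that does not kill `q` maps nontrivially to `q ⊗ q'`. -/
lemma whiskerRight_eq_zero_of_comp_coev [Preadditive C] [MonoidalPreadditive C] {q q' S : C} [ExactPairing q q'] {s : S ⟶ 𝟙_ C}
    (h : s ≫ η_ q q' = 0) : s ▷ q = 0 := by
  have e : s ▷ q = (s ≫ η_ q q') ▷ q ≫ (α_ _ _ _).hom ≫ q ◁ ε_ q q' ≫ (ρ_ q).hom ≫ (λ_ q).inv := by
    have := ExactPairing.evaluation_coevaluation q q'
    rw [comp_whiskerRight, Category.assoc, reassoc_of% this]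
    simp
  rw [e, h]
  simp

lemma whiskerLeft_eq_zero_of_comp_coev [Preadditive C] [MonoidalPreadditive C] {q q' S : C} [ExactPairing q q'] {s : S ⟶ 𝟙_ C}
    (h : s ≫ η_ q q' = 0) : q' ◁ s = 0 := by
  have e : q' ◁ s = q' ◁ (s ≫ η_ q q') ≫ (α_ _ _ _).inv ≫ ε_ q q' ▷ q' ≫ (λ_ q').hom ≫ (ρ_ q').inv := by
    have := ExactPairing.coevaluation_evaluation q q'
    rw [MonoidalCategory.whiskerLeft_comp, Category.assoc, reassoc_of% this]
    simp
  rw [e, h]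
  simp

end Rotation

/-! ### Normalized duals of simple objects and unitarity of the rotation. -/

section
open UnitaryCategory UnitaryMultifusionCategory
variable {C : Type u} [Category.{v} C] [MonoidalCategory C] [UnitaryMultifusionCategory C]

instance : MonoidalPreadditive C where
  whiskerLeft_zero {X Y Z} := by
    have h := whiskerLeft_smul X (0 : ℂ) (0 : Y ⟶ Z)
    rwa [zero_smul, zero_smul] at h
  zero_whiskerRight {X Y Z} := by
    have h := smul_whiskerRight (0 : ℂ) (0 : Y ⟶ Z) X
    rwa [zero_smul, zero_smul] at h
  whiskerLeft_add := whiskerLeft_add _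
  add_whiskerRight f g := add_whiskerRight f g _

/-- Rescaling of a duality. -/
noncomputable abbrev CategoryTheory.ExactPairing.rescale {u u' : C} (p : ExactPairing u u') (t : ℂ) (ht : t ≠ 0) : ExactPairing u u' where
  coevaluation' := t⁻¹ • η_ u u'
  evaluation' := t • ε_ u u'
  coevaluation_evaluation' := by
    rw [whiskerLeft_smul, smul_whiskerRight, Linear.comp_smul, Linear.smul_comp, Linear.comp_smul, smul_smul,
      inv_mul_cancel₀ ht, one_smul, ExactPairing.coevaluation_evaluation]
  evaluation_coevaluation' := by
    rw [whiskerLeft_smul, smul_whiskerRight, Linear.comp_smul, Linear.smul_comp, Linear.comp_smul, smul_smul,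
      inv_mul_cancel₀ ht, one_smul, ExactPairing.evaluation_coevaluation]

lemma coev_ne_zero {u u' : C} [ExactPairing u u'] (h : 𝟙 u ≠ 0) : η_ u u' ≠ 0 := by
  intro h0
  refine h ((IsRotation.coev_whiskerRight_bijective (v := u) (v' := u') u).1 ?_)
  simp [h0]

/-- Every simple object has a dual for which `η† ∘ η` is a projection. -/
lemma exists_normalized_dual (u : C) [Simple u] : ∃ (u' : C) (_ : ExactPairing u u'),
    (η_ u u' ≫ dagger (η_ u u')) ≫ η_ u u' ≫ dagger (η_ u u') = η_ u u' ≫ dagger (η_ u u') := by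
  obtain ⟨u', ⟨p⟩⟩ := exists_rightDual u
  have h0 := coev_ne_zero (u' := u') (id_nonzero u)
  set z := η_ u u' ≫ dagger (η_ u u') with hz
  -- The endomorphism `z` of the unit slides onto the strand of `u`, where simplicity turns it into
  -- a scalar. The unit itself need not be simple.
  have hχ : ∃ χ : ℂ, z ≫ η_ u u' = χ • η_ u u' := by
    obtain ⟨χ, hχ⟩ := exists_scalar ((λ_ u).inv ≫ z ▷ u ≫ (λ_ u).hom)
    refine ⟨χ, ?_⟩
    have e : z ≫ η_ u u' = η_ u u' ≫ ((λ_ u).inv ≫ z ▷ u ≫ (λ_ u).hom) ▷ u' := by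
      have := whisker_exchange z (η_ u u')
      have e' : z ≫ η_ u u' = (ρ_ _).inv ≫ (z ▷ 𝟙_ C ≫ 𝟙_ C ◁ η_ u u') ≫ (λ_ _).hom := by monoidal
      rw [e', ← this]
      monoidal
    rw [e, hχ, smul_whiskerRight, id_whiskerRight, Linear.comp_smul, Category.comp_id]
  obtain ⟨χ, hχ⟩ := hχ
  have hzz : z ≫ z = χ • z := by
    conv_lhs => rw [hz, ← Category.assoc, ← hz, hχ, Linear.smul_comp]
  obtain ⟨κ, _, S, hS⟩ := exists_simpleReps C
  -- A simple object on which `η` does not vanish makes it possible to compare norms in a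
  -- one-dimensional endomorphism algebra.
  have hne : ∃ k, ∃ s : S k ⟶ 𝟙_ C, s ≫ η_ u u' ≠ 0 := by
    by_contra! h
    exact h0 (hS.hom_ext fun k b => by rw [h k b, comp_zero])
  obtain ⟨k, s, hs⟩ := hne
  have := hS.simple k
  obtain ⟨a, ha, ha'⟩ := exists_isometry_of_ne_zero hs
  have hzd : dagger z = z := by rw [hz, dagger_comp, dagger_dagger]
  have hsz : s ≫ z ≫ dagger s = (a * star a)⁻¹ • 𝟙 _ := by
    rw [eq_inv_smul_iff₀ (mul_ne_zero ha (star_ne_zero.2 ha)), ← ha', dagger_smul, Linear.comp_smul,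
      Linear.smul_comp, dagger_comp, smul_smul, mul_comm, hz]
    simp only [Category.assoc]
  have hs' : s ≫ z ≠ 0 := by
    intro h
    rw [reassoc_of% h, zero_comp] at hsz
    exact smul_ne_zero (inv_ne_zero (mul_ne_zero ha (star_ne_zero.2 ha))) (id_nonzero (S k)) hsz.symm
  obtain ⟨b, hb, hb'⟩ := exists_isometry_of_ne_zero hs'
  -- The scalar has to be positive, not only nonzero: then `η` can be divided by `t` with `χ = t *
  -- star t`, which divides `z` by `χ` and makes it idempotent.
  have hχ' : χ = (a * b⁻¹) * star (a * b⁻¹) := by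
    have h1 : (s ≫ z) ≫ dagger (s ≫ z) = (χ * (a * star a)⁻¹) • 𝟙 _ := by
      rw [dagger_comp, hzd, Category.assoc, ← Category.assoc z z, hzz, Linear.smul_comp, Linear.comp_smul, hsz, smul_smul]
    rw [dagger_smul, Linear.comp_smul, Linear.smul_comp, h1, smul_smul, smul_smul] at hb'
    have h2 := smul_id_injective (id_nonzero (S k)) (hb'.trans (one_smul ℂ _).symm)
    have := star_ne_zero.2 ha
    have := star_ne_zero.2 hb
    rw [star_mul', star_inv₀]
    field_simp at h2 ⊢
    linear_combination h2
  set t := a * b⁻¹ with ht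
  have ht0 : t ≠ 0 := mul_ne_zero ha (inv_ne_zero hb)
  refine ⟨u', p.rescale t ht0, ?_⟩
  change ((t⁻¹ • η_ u u') ≫ dagger (t⁻¹ • η_ u u')) ≫ ((t⁻¹ • η_ u u') ≫ dagger (t⁻¹ • η_ u u')) =
    (t⁻¹ • η_ u u') ≫ dagger (t⁻¹ • η_ u u')
  have e : (t⁻¹ • η_ u u') ≫ dagger (t⁻¹ • η_ u u') = χ⁻¹ • z := by
    rw [dagger_smul, Linear.comp_smul, Linear.smul_comp, smul_smul, hχ', star_inv₀, ← hz, mul_comm, ← mul_inv]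
  rw [e, Linear.smul_comp, Linear.comp_smul, hzz, smul_smul χ⁻¹ χ, inv_mul_cancel₀, one_smul]
  rw [hχ']
  exact mul_ne_zero ht0 (star_ne_zero.2 ht0)

/-- Bending identifies the endomorphisms of `u'` with those of `u`, and scalars with scalars. -/
lemma simple_right_of_simple_left (u u' : C) [ExactPairing u u'] [Simple u] : Simple u' := by
  refine simple_of_scalar (fun h => coev_ne_zero (u' := u') (id_nonzero u) ?_) fun f => ?_
  · rw [← Category.comp_id (η_ u u'), ← whiskerLeft_id, h, MonoidalPreadditive.whiskerLeft_zero, comp_zero]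
  · obtain ⟨g, hg⟩ := (IsRotation.coev_whiskerRight_bijective (v := u) (v' := u') u).2 (η_ u u' ≫ u ◁ f)
    obtain ⟨z, rfl⟩ := exists_scalar g
    refine ⟨z, (IsRotation.coev_whiskerLeft_bijective (u := u) (u' := u') u').1 ?_⟩
    dsimp only at hg ⊢
    rw [← hg, smul_whiskerRight, whiskerLeft_smul, whiskerLeft_id, id_whiskerRight]

lemma simple_left_of_simple_right (u u' : C) [ExactPairing u u'] [Simple u'] : Simple u := by
  refine simple_of_scalar (fun h => id_nonzero u' ?_) fun f => ?_
  · refine (IsRotation.coev_whiskerLeft_bijective (u := u) (u' := u') u').1 ?_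
    dsimp only
    rw [whiskerLeft_id, Category.comp_id, MonoidalPreadditive.whiskerLeft_zero, comp_zero,
      ← Category.comp_id (η_ u u'), ← id_whiskerRight, h, MonoidalPreadditive.zero_whiskerRight, comp_zero]
  · obtain ⟨g, hg⟩ := (IsRotation.coev_whiskerLeft_bijective (u := u) (u' := u') u').2 (η_ u u' ≫ f ▷ u')
    obtain ⟨z, rfl⟩ := exists_scalar g
    refine ⟨z, (IsRotation.coev_whiskerRight_bijective (v := u) (v' := u') u).1 ?_⟩
    dsimp only at hg ⊢
    rw [← hg, smul_whiskerRight, whiskerLeft_smul, whiskerLeft_id, id_whiskerRight]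

/-- Representatives `S k` of the simple objects, with normalized right duals. -/
structure DualReps {ι : Type} (S : ι → C) where
  reps : SimpleReps S
  dual : ι → C
  pairing : ∀ k, ExactPairing (S k) (dual k)
  projection : ∀ k, (η_ (S k) (dual k) ≫ dagger (η_ (S k) (dual k))) ≫ η_ (S k) (dual k) ≫ dagger (η_ (S k) (dual k)) =
    η_ (S k) (dual k) ≫ dagger (η_ (S k) (dual k))

attribute [instance] DualReps.pairing

lemma UnitaryCategory.SimpleReps.nonempty_dualReps {ι : Type} {S : ι → C} (hS : SimpleReps S) : Nonempty (DualReps S) := by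
  have := hS.simple
  choose d p h using fun k => exists_normalized_dual (S k)
  exact ⟨⟨hS, d, p, h⟩⟩

/-- Bending turns an isomorphism between duals into a nonzero morphism between the simple objects
themselves, and conversely. Every simple object occurs because it has a left dual, which is simple
too. -/
lemma DualReps.reps_dual {ι : Type} {S : ι → C} (R : DualReps S) : SimpleReps R.dual where
  simple k := have := R.reps.simple k; simple_right_of_simple_left (S k) (R.dual k)
  eq_of_iso k l := by
    rintro ⟨e⟩
    have := R.reps.simple k
    have := R.reps.simple l
    have := simple_right_of_simple_left (S k) (R.dual k)
    obtain ⟨g, hg⟩ := (IsRotation.coev_whiskerRight_bijective (v := S l) (v' := R.dual l) (S k)).2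
      (η_ (S k) (R.dual k) ≫ S k ◁ e.hom)
    refine (R.reps.eq_of_iso l k (nonempty_iso_of_ne_zero (f := g) ?_)).symm
    rintro rfl
    have h : e.hom = 0 := (IsRotation.coev_whiskerLeft_bijective (u := S k) (u' := R.dual k) _).1 (by
      dsimp only at hg ⊢
      rw [← hg, MonoidalPreadditive.zero_whiskerRight, MonoidalPreadditive.whiskerLeft_zero, comp_zero, comp_zero])
    apply id_nonzero (R.dual k)
    rw [← e.hom_inv_id, h, zero_comp]
  exists_iso X hX := by
    obtain ⟨Y, ⟨p⟩⟩ := exists_leftDual X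
    have := simple_left_of_simple_right Y X
    obtain ⟨k, ⟨e⟩⟩ := R.reps.exists_iso Y this
    have := R.reps.simple k
    have := simple_right_of_simple_left (S k) (R.dual k)
    obtain ⟨g, hg⟩ := (IsRotation.coev_whiskerLeft_bijective (u := S k) (u' := R.dual k) X).2
      (η_ Y X ≫ e.inv ▷ X)
    refine ⟨k, nonempty_iso_of_ne_zero (f := g) ?_⟩
    rintro rfl
    have h : e.inv = 0 := (IsRotation.coev_whiskerRight_bijective (v := Y) (v' := X) _).1 (by
      dsimp only at hg ⊢
      rw [← hg, MonoidalPreadditive.zero_whiskerRight, MonoidalPreadditive.whiskerLeft_zero, comp_zero, comp_zero])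
    apply id_nonzero Y
    rw [← e.inv_hom_id, h, zero_comp]

namespace IsRotation
variable {u u' v v' c : C} [ExactPairing u u'] [ExactPairing v v'] {β β' : v ⟶ u ⊗ c} {γ γ' : u' ⟶ c ⊗ v'}

lemma add (h : IsRotation u' v' β γ) (h' : IsRotation u' v' β' γ') : IsRotation u' v' (β + β') (γ + γ') := by
  rw [IsRotation] at *
  rw [whiskerLeft_add, add_whiskerRight, Preadditive.add_comp, Preadditive.comp_add, h, h', Preadditive.comp_add]

lemma smul (h : IsRotation u' v' β γ) (z : ℂ) : IsRotation u' v' (z • β) (z • γ) := by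
  rw [IsRotation] at *
  rw [whiskerLeft_smul, smul_whiskerRight, Linear.smul_comp, Linear.comp_smul, h, Linear.comp_smul]

/-- Both sides are the same endomorphism of the unit, computed by closing the diagram on either
strand. -/
lemma inner_smul [Simple u'] [Simple v] (h : IsRotation u' v' β γ) (h' : IsRotation u' v' β' γ') :
    scal (β ≫ dagger β') • (η_ v v' ≫ dagger (η_ v v')) = scal (γ ≫ dagger γ') • (η_ u u' ≫ dagger (η_ u u')) := by
  have e : (η_ u u' ≫ u ◁ γ ≫ (α_ u c v').inv) ≫ dagger (η_ u u' ≫ u ◁ γ' ≫ (α_ u c v').inv) =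
      (η_ v v' ≫ β ▷ v') ≫ dagger (η_ v v' ≫ β' ▷ v') := by
    rw [IsRotation] at h h'
    rw [h, h']
  have ha : dagger (α_ u c v').inv = (α_ u c v').hom := by rw [← dagger_associator, dagger_dagger]
  simp only [dagger_comp, ha, dagger_whiskerLeft, dagger_whiskerRight, Category.assoc, Iso.inv_hom_id_assoc] at e
  rw [← MonoidalCategory.whiskerLeft_comp_assoc, ← comp_whiskerRight_assoc, ← scal_smul_id (γ ≫ dagger γ'),
    ← scal_smul_id (β ≫ dagger β'), whiskerLeft_smul, smul_whiskerRight, whiskerLeft_id, id_whiskerRight, Linear.smul_comp,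
    Linear.smul_comp, Linear.comp_smul, Linear.comp_smul, Category.id_comp, Category.id_comp] at e
  exact e.symm

end IsRotation

/-- For `β ≠ 0`, `inner_smul` makes the two coevaluation projections proportional. Nonzero
proportional projections are equal, so the proportionality of the inner products becomes an
equality. For `β = 0` uniqueness of the rotation gives `γ = 0`. -/
lemma DualReps.inner_eq {ι : Type} {S : ι → C} (R : DualReps S) {k l : ι} {c : C} [Simple (S l)] [Simple (R.dual k)]
    {β β' : S l ⟶ S k ⊗ c} {γ γ' : R.dual k ⟶ c ⊗ R.dual l}
    (h : IsRotation (R.dual k) (R.dual l) β γ) (h' : IsRotation (R.dual k) (R.dual l) β' γ') :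
    scal (β ≫ dagger β') = scal (γ ≫ dagger γ') := by
  by_cases h0 : β = 0
  · have : γ = 0 := by
      by_contra hγ
      subst h0
      refine hγ (h.unique_right ?_)
      rw [IsRotation]
      simp
    rw [h0, this, zero_comp, zero_comp, scal_zero, scal_zero]
  have hz0 : ∀ {j : ι}, η_ (S j) (R.dual j) ≫ dagger (η_ (S j) (R.dual j)) ≠ 0 := fun {j} hj =>
    have := R.reps.simple j
    coev_ne_zero (u' := R.dual j) (id_nonzero (S j)) (eq_zero_of_comp_dagger hj)
  have hzz : η_ (S l) (R.dual l) ≫ dagger (η_ (S l) (R.dual l)) = η_ (S k) (R.dual k) ≫ dagger (η_ (S k) (R.dual k)) := by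
    have e := h.inner_smul h
    have hb : scal (β ≫ dagger β) ≠ 0 := by
      intro hb
      refine h0 (eq_zero_of_comp_dagger ?_)
      rw [← scal_smul_id (β ≫ dagger β), hb, zero_smul]
    have pl := R.projection l
    have pk := R.projection k
    set a := η_ (S l) (R.dual l) ≫ dagger (η_ (S l) (R.dual l))
    set b := η_ (S k) (R.dual k) ≫ dagger (η_ (S k) (R.dual k))
    rw [← eq_inv_smul_iff₀ hb, smul_smul] at e
    generalize (scal (β ≫ dagger β))⁻¹ * scal (γ ≫ dagger γ) = r at e
    have ha : a ≠ 0 := hz0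
    have hb' : b ≠ 0 := hz0
    rw [e, Linear.smul_comp, Linear.comp_smul, pk, smul_smul] at pl
    rw [e] at ha
    have h1 := sub_eq_zero.2 pl
    rw [← sub_smul, smul_eq_zero] at h1
    have h2 := h1.resolve_right hb'
    have hr : r ≠ 0 := fun hr => ha (by rw [hr, zero_smul])
    have hr1 : r = 1 := by
      have : r * (r - 1) = 0 := by linear_combination h2
      exact sub_eq_zero.1 ((mul_eq_zero.1 this).resolve_left hr)
    rw [e, hr1, one_smul]
  have e := h.inner_smul h'
  rw [hzz, ← sub_eq_zero, ← sub_smul, smul_eq_zero] at e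
  exact sub_eq_zero.1 (e.resolve_right hz0)

end

/-! ## The module functor of internal homs -/

section
open UnitaryCategory UnitaryMultifusionCategory MonoidalRightAction
variable {C : Type u} [Category.{v} C] [MonoidalCategory C] [UnitaryMultifusionCategory C]
  {κ : Type} [Fintype κ] {S : κ → C}

namespace DualReps

/-- The bijection of `IsRotation`. -/
noncomputable def rot (R : DualReps S) (k l : κ) (c : C) :
    (S l ⟶ S k ⊗ c) →ₗ[ℂ] (R.dual k ⟶ c ⊗ R.dual l) where
  toFun β := (IsRotation.exists_right (R.dual k) (R.dual l) β).choose
  map_add' β β' := (IsRotation.exists_right (R.dual k) (R.dual l) (β + β')).choose_spec.unique_right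
    ((IsRotation.exists_right (R.dual k) (R.dual l) β).choose_spec.add
      (IsRotation.exists_right (R.dual k) (R.dual l) β').choose_spec)
  map_smul' z β := (IsRotation.exists_right (R.dual k) (R.dual l) (z • β)).choose_spec.unique_right
    ((IsRotation.exists_right (R.dual k) (R.dual l) β).choose_spec.smul z)

lemma isRotation_rot (R : DualReps S) {k l : κ} {c : C} (β : S l ⟶ S k ⊗ c) :
    IsRotation (R.dual k) (R.dual l) β (R.rot k l c β) :=
  (IsRotation.exists_right (R.dual k) (R.dual l) β).choose_spec

end DualReps

variable {M : Type w} [Category.{w'} M] [UnitaryCategory M] [MonoidalRightAction C M]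
  [UnitaryRightModule C M] {ι : Type} [Fintype ι]

lemma isDaggerFunctor_tensorRight (c : C) : IsDaggerFunctor (tensorRight c) :=
  ⟨fun _ _ => add_whiskerRight _ _ _, fun _ _ => smul_whiskerRight _ _ _,
    fun _ => (dagger_whiskerRight _ _).symm⟩

lemma isDaggerFunctor_actionRight (c : C) : IsDaggerFunctor (actionRight M c) :=
  ⟨fun _ _ => UnitaryRightModule.add_actionHomLeft _ _ _,
    fun _ _ => UnitaryRightModule.smul_actionHomLeft _ _ _,
    fun _ => (UnitaryRightModule.dagger_actionHomLeft _ _).symm⟩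

/-- The functor `⨁ a k, S k ⊗ Hom(m a, - ⊙ᵣ (S k)^*)`, the sum of the internal homs from `m a`. -/
structure InternalHom (R : DualReps S) (m : ι → M) [∀ a, Simple (m a)] where
  G : M ⥤ C
  isDagger : IsDaggerFunctor G
  E : ∀ a k n, (m a ⟶ n ⊙ᵣ R.dual k) →ₗ[ℂ] (S k ⟶ G.obj n)
  E_map : ∀ a k {n n' : M} (f : m a ⟶ n ⊙ᵣ R.dual k) (h : n ⟶ n'),
    E a k n f ≫ G.map h = E a k n' (f ≫ h ⊵ᵣ R.dual k)
  E_inner : ∀ a k n (f g : m a ⟶ n ⊙ᵣ R.dual k),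
    E a k n f ≫ dagger (E a k n g) = scal (f ≫ dagger g) • 𝟙 _
  E_ortho : ∀ a k b l n (f : m a ⟶ n ⊙ᵣ R.dual k) (g : m b ⟶ n ⊙ᵣ R.dual l), (a, k) ≠ (b, l) →
    E a k n f ≫ dagger (E b l n g) = 0
  exists_desc : ∀ (n : M) (c Y : C) (t : ∀ a k, (m a ⟶ n ⊙ᵣ R.dual k) →ₗ[ℂ] (S k ⊗ c ⟶ Y)),
    ∃ τ : G.obj n ⊗ c ⟶ Y, ∀ a k f, E a k n f ▷ c ≫ τ = t a k f
  hom_ext_tensor : ∀ {n : M} {c Y : C} {f g : G.obj n ⊗ c ⟶ Y},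
    (∀ a k φ, E a k n φ ▷ c ≫ f = E a k n φ ▷ c ≫ g) → f = g
  hom_ext : ∀ {n : M} {Y : C} {f g : G.obj n ⟶ Y}, (∀ a k φ, E a k n φ ≫ f = E a k n φ ≫ g) → f = g

lemma nonempty_internalHom (R : DualReps S) (m : ι → M) [∀ a, Simple (m a)] :
    Nonempty (InternalHom R m) := by
  obtain ⟨Q⟩ := exists_sumFunctor (fun p : ι × κ => S p.2) (fun p => m p.1)
    (fun p => actionRight M (R.dual p.2)) (fun p => isDaggerFunctor_actionRight _)
  exact ⟨⟨Q.G, Q.isDagger, fun a k n => Q.E (a, k) n, fun a k _ _ f h => Q.E_map (a, k) f h,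
    fun a k n f g => Q.E_inner (a, k) n f g, fun a k b l n f g h => Q.E_ortho (a, k) (b, l) n f g h,
    fun n c Y t => (Q.exists_desc (tensorRight c) (isDaggerFunctor_tensorRight c)
      (fun p => t p.1 p.2)).imp fun τ hτ a k f => hτ (a, k) f,
    fun h => Q.map_hom_ext (tensorRight _) (isDaggerFunctor_tensorRight _) (fun p f => h p.1 p.2 f),
    fun h => Q.hom_ext (fun p f => h p.1 p.2 f)⟩⟩

lemma UnitaryCategory.SimpleReps.whiskerRight_hom_ext (hS : SimpleReps S) {X Y c : C} {f g : X ⊗ c ⟶ Y}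
    (h : ∀ k (b : S k ⟶ X), b ▷ c ≫ f = b ▷ c ≫ g) : f = g := by
  have := hS.simple
  have e := hS.sum_homBasis (fun k => homBasis (S k) X)
  rw [← Category.id_comp f, ← Category.id_comp g, ← id_whiskerRight, ← e]
  simp only [sum_whiskerRight, Preadditive.sum_comp, comp_whiskerRight, Category.assoc, h]

namespace InternalHom
variable {R : DualReps S} {m : ι → M} [∀ a, Simple (m a)] (H : InternalHom R m)

/-- The morphisms `S k ⟶ G n` are given by those `m a ⟶ n ⊙ᵣ R.dual k`. So `S l ⟶ S k ⊗ c ⟶ G n ⊗ c`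
can be sent to the morphism in which the first arrow is bent and acts on `n`. Orthonormal bases of
the spaces `S l ⟶ S k ⊗ c` turn this prescription into a definition on each summand. -/
lemma exists_lineator (n : M) (c : C) : ∃ τ : H.G.obj n ⊗ c ⟶ H.G.obj (n ⊙ᵣ c),
    ∀ a k l (f : m a ⟶ n ⊙ᵣ R.dual k) (β : S l ⟶ S k ⊗ c) (γ : R.dual k ⟶ c ⊗ R.dual l),
      IsRotation (R.dual k) (R.dual l) β γ →
      β ≫ H.E a k n f ▷ c ≫ τ = H.E a l (n ⊙ᵣ c) (f ≫ n ⊴ᵣ γ ≫ (αᵣ n c (R.dual l)).hom) := by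
  have := R.reps.simple
  classical
  obtain ⟨τ, hτ⟩ := H.exists_desc n c (H.G.obj (n ⊙ᵣ c)) (fun a k =>
    { toFun := fun f => ∑ l, ∑ j, dagger ((homBasis (S l) (S k ⊗ c)).b j) ≫
        H.E a l (n ⊙ᵣ c) (f ≫ n ⊴ᵣ R.rot k l c ((homBasis (S l) (S k ⊗ c)).b j) ≫ (αᵣ n c (R.dual l)).hom)
      map_add' := fun f g => by
        simp only [Preadditive.add_comp, map_add, Preadditive.comp_add, Finset.sum_add_distrib]
      map_smul' := fun z f => by
        simp only [Linear.smul_comp, map_smul, Linear.comp_smul, Finset.smul_sum, RingHom.id_apply] })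
  refine ⟨τ, fun a k l f β γ h => ?_⟩
  obtain rfl := (R.isRotation_rot β).unique_right h
  rw [hτ]
  simp only [LinearMap.coe_mk, AddHom.coe_mk, Preadditive.comp_sum]
  rw [Finset.sum_eq_single l]
  · have e : ∀ β : S l ⟶ S k ⊗ c, H.E a l (n ⊙ᵣ c) (f ≫ n ⊴ᵣ R.rot k l c β ≫ (αᵣ n c (R.dual l)).hom) =
        (H.E a l (n ⊙ᵣ c) ∘ₗ
        { toFun := fun β => f ≫ n ⊴ᵣ R.rot k l c β ≫ (αᵣ n c (R.dual l)).hom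
          map_add' := fun β β' => by
            rw [map_add, UnitaryRightModule.actionHomRight_add, Preadditive.add_comp, Preadditive.comp_add]
          map_smul' := fun z β => by
            rw [map_smul, UnitaryRightModule.actionHomRight_smul, Linear.smul_comp, Linear.comp_smul,
              RingHom.id_apply] } : (S l ⟶ S k ⊗ c) →ₗ[ℂ] _) β := fun _ => rfl
    simp only [e]
    conv_rhs => rw [← (homBasis (S l) (S k ⊗ c)).total β, map_sum]
    refine Finset.sum_congr rfl fun j _ => ?_
    rw [← Category.assoc, ← scal_smul_eq_comp, map_smul]
  · intro l' _ hl
    refine Finset.sum_eq_zero fun j _ => ?_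
    rw [← Category.assoc, R.reps.hom_eq_zero hl.symm (β ≫ _), zero_comp]
  · simp

/-- The structure morphism of the module functor. -/
noncomputable def lineator (n : M) (c : C) : H.G.obj n ⊗ c ⟶ H.G.obj (n ⊙ᵣ c) :=
  (H.exists_lineator n c).choose

lemma comp_lineator (n : M) (c : C) {a k l} (f : m a ⟶ n ⊙ᵣ R.dual k) {β : S l ⟶ S k ⊗ c}
    {γ : R.dual k ⟶ c ⊗ R.dual l} (h : IsRotation (R.dual k) (R.dual l) β γ) :
    β ≫ H.E a k n f ▷ c ≫ H.lineator n c =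
      H.E a l (n ⊙ᵣ c) (f ≫ n ⊴ᵣ γ ≫ (αᵣ n c (R.dual l)).hom) :=
  (H.exists_lineator n c).choose_spec a k l f β γ h

lemma hom_ext_rot {n : M} {c Y : C} {f g : H.G.obj n ⊗ c ⟶ Y}
    (h : ∀ a k l φ (β : S l ⟶ S k ⊗ c), β ≫ H.E a k n φ ▷ c ≫ f = β ≫ H.E a k n φ ▷ c ≫ g) : f = g :=
  H.hom_ext_tensor fun a k φ => R.reps.hom_ext fun l β => h a k l φ β

lemma lineator_naturality_left {n n' : M} (h : n ⟶ n') (c : C) :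
    H.G.map h ▷ c ≫ H.lineator n' c = H.lineator n c ≫ H.G.map (h ⊵ᵣ c) := by
  refine H.hom_ext_rot fun a k l φ β => ?_
  have hβ := R.isRotation_rot β
  have e := H.comp_lineator n c φ hβ
  rw [reassoc_of% e, H.E_map, ← comp_whiskerRight_assoc, H.E_map, H.comp_lineator n' c _ hβ]
  simp only [Category.assoc]
  have e1 := action_exchange_assoc h (R.rot k l c β) (αᵣ n' c (R.dual l)).hom
  rw [← e1, actionHomLeft_tensor]
  simp only [Category.assoc, Iso.inv_hom_id, Category.comp_id]

/-- Bending commutes with composition on the strand `c`. -/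
lemma lineator_naturality_right (n : M) {c c' : C} (g : c ⟶ c') :
    H.G.obj n ◁ g ≫ H.lineator n c' = H.lineator n c ≫ H.G.map (n ⊴ᵣ g) := by
  refine H.hom_ext_rot fun a k l φ β => ?_
  have hβ := R.isRotation_rot β
  have e := H.comp_lineator n c φ hβ
  have e' := H.comp_lineator n c' φ (hβ.whisker g)
  rw [reassoc_of% e, H.E_map, ← whisker_exchange_assoc, ← Category.assoc, e']
  simp only [Category.assoc, actionHomRight_comp, actionHomRight_whiskerRight, Iso.inv_hom_id, Category.comp_id]

lemma lineator_assoc (n : M) (c c' : C) :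
    H.lineator n (c ⊗ c') ≫ H.G.map (αᵣ n c c').hom =
      (α_ _ c c').inv ≫ H.lineator n c ▷ c' ≫ H.lineator (n ⊙ᵣ c) c' := by
  refine H.hom_ext_tensor fun a k φ => ?_
  rw [← cancel_epi (α_ (S k) c c').hom]
  refine R.reps.whiskerRight_hom_ext fun l β => R.reps.hom_ext fun l' β' => ?_
  have hβ := R.isRotation_rot β
  have hβ' := R.isRotation_rot β'
  have e := H.comp_lineator n c φ hβ
  have e' := H.comp_lineator n (c ⊗ c') φ (hβ.comp hβ')
  have e2 := H.comp_lineator (n ⊙ᵣ c) c' (φ ≫ n ⊴ᵣ R.rot k l c β ≫ (αᵣ n c (R.dual l)).hom) hβ'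
  have e3 : β' ≫ β ▷ c' ≫ (α_ (S k) c c').hom ≫ H.E a k n φ ▷ (c ⊗ c') ≫ (α_ _ c c').inv ≫
      H.lineator n c ▷ c' ≫ H.lineator (n ⊙ᵣ c) c' =
      β' ≫ (β ≫ H.E a k n φ ▷ c ≫ H.lineator n c) ▷ c' ≫ H.lineator (n ⊙ᵣ c) c' := by
    monoidal
  rw [e3, e, e2]
  simp only [Category.assoc] at e'
  rw [reassoc_of% e', H.E_map]
  congr 1
  simp only [Category.assoc, actionHomRight_comp]
  congr 2
  have e4 := actionHom_associator c c' (R.dual l') n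
  have e5 : n ⊴ᵣ (α_ c c' (R.dual l')).inv ≫ (αᵣ n (c ⊗ c') (R.dual l')).hom ≫
      (αᵣ n c c').hom ⊵ᵣ R.dual l' = (αᵣ n c (c' ⊗ R.dual l')).hom ≫ (αᵣ (n ⊙ᵣ c) c' (R.dual l')).hom := by
    rw [← e4, actionHomRight_inv_hom_assoc]
  rw [e5, whiskerRight_actionHomLeft]
  simp only [Category.assoc, Iso.inv_hom_id_assoc]

lemma lineator_unit (n : M) : H.lineator n (𝟙_ C) ≫ H.G.map (ρᵣ n).hom = (ρ_ _).hom := by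
  refine H.hom_ext_tensor fun a k φ => ?_
  rw [← cancel_epi (ρ_ (S k)).inv]
  have e := H.comp_lineator n (𝟙_ C) φ (IsRotation.unit (S k) (R.dual k))
  rw [reassoc_of% e, H.E_map, rightUnitor_naturality, Iso.inv_hom_id_assoc]
  congr 1
  have e1 := actionHom_leftUnitor (R.dual k) n
  simp only [Category.assoc]
  rw [← e1, actionHomRight_inv_hom, Category.comp_id]

/-- Tested on pairs of elementary morphisms, both sides are products of two inner products, or zero
by orthogonality. They agree because bending preserves inner products (`DualReps.inner_eq`); when
the indices `k` differ, both vanish. -/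
lemma lineator_isometry (n : M) (c : C) : H.lineator n c ≫ dagger (H.lineator n c) = 𝟙 _ := by
  classical
  have := R.reps.simple
  have := R.reps_dual.simple
  refine H.hom_ext_rot fun a k l φ β => dagger_injective (H.hom_ext_rot fun b k' l' φ' β' => ?_)
  have hβ := R.isRotation_rot β
  have hβ' := R.isRotation_rot β'
  have e := H.comp_lineator n c φ hβ
  have e' := H.comp_lineator n c φ' hβ'
  set T := H.lineator n c
  have l1 : β' ≫ H.E b k' n φ' ▷ c ≫ dagger (β ≫ H.E a k n φ ▷ c ≫ T ≫ dagger T) =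
      (β' ≫ H.E b k' n φ' ▷ c ≫ T) ≫ dagger (β ≫ H.E a k n φ ▷ c ≫ T) := by
    simp only [dagger_comp, Category.assoc, dagger_dagger]
  have l2 : β' ≫ H.E b k' n φ' ▷ c ≫ dagger (β ≫ H.E a k n φ ▷ c ≫ 𝟙 _) =
      β' ≫ (H.E b k' n φ' ≫ dagger (H.E a k n φ)) ▷ c ≫ dagger β := by
    simp only [dagger_comp, Category.assoc, dagger_id, Category.id_comp, dagger_whiskerRight, comp_whiskerRight]
  rw [l1, l2, e, e']
  by_cases hl : (b, l') = (a, l)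
  · obtain ⟨rfl, rfl⟩ := Prod.mk.inj hl
    rw [H.E_inner]
    have hα : dagger (αᵣ n c (R.dual l')).hom = (αᵣ n c (R.dual l')).inv := UnitaryRightModule.dagger_actionAssocIso _ _ _
    simp only [dagger_comp, Category.assoc, hα, Iso.hom_inv_id_assoc, UnitaryRightModule.dagger_actionHomRight]
    rw [← actionHomRight_comp_assoc]
    by_cases hk : k' = k
    · subst hk
      rw [H.E_inner, smul_whiskerRight, id_whiskerRight, Linear.smul_comp, Linear.comp_smul, Category.id_comp,
        ← scal_smul_id (R.rot k' l' c β' ≫ dagger (R.rot k' l' c β)), ← scal_smul_id (β' ≫ dagger β),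
        UnitaryRightModule.actionHomRight_smul, Linear.smul_comp, Linear.comp_smul, actionHomRight_id, Category.id_comp,
        scal_smul, smul_smul, R.inner_eq hβ' hβ, mul_comm]
    · rw [H.E_ortho _ _ _ _ _ _ _ (by simpa using hk), R.reps_dual.hom_eq_zero hk (R.rot k' l' c β' ≫ _),
        MonoidalPreadditive.zero_whiskerRight, zero_comp, comp_zero, ← zero_smul ℂ (𝟙 _ ≫ 0), UnitaryRightModule.actionHomRight_smul,
        zero_smul, zero_comp, comp_zero, scal_zero, zero_smul]
  · rw [H.E_ortho _ _ _ _ _ _ _ hl]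
    by_cases hl' : l' = l
    · subst hl'
      have hab : b ≠ a := fun h => hl (by rw [h])
      rw [H.E_ortho _ _ _ _ _ _ _ (fun h => hab (Prod.mk.inj h).1), MonoidalPreadditive.zero_whiskerRight, zero_comp, comp_zero]
    · exact (R.reps.hom_eq_zero hl' _).symm

/-- The lineator is an isometry, so it is enough that its range contains every elementary morphism.
The identity of `c ⊗ R.dual l` is resolved over the duals of the representatives, which are again
representatives, and each basis morphism is the bending of some `S l ⟶ S k ⊗ c`. -/
lemma lineator_coisometry (n : M) (c : C) : dagger (H.lineator n c) ≫ H.lineator n c = 𝟙 _ := by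
  have := R.reps.simple
  have := R.reps_dual.simple
  have hi := H.lineator_isometry n c
  set T := H.lineator n c with hT
  suffices h : ∀ a l (g : m a ⟶ (n ⊙ᵣ c) ⊙ᵣ R.dual l), ∃ y, H.E a l _ g = y ≫ T by
    refine H.hom_ext fun a l g => ?_
    obtain ⟨y, hy⟩ := h a l g
    rw [hy, Category.assoc, reassoc_of% hi, Category.comp_id]
  intro a l g
  have e := R.reps_dual.sum_homBasis (fun k => homBasis (R.dual k) (c ⊗ R.dual l))
  choose β hβ using fun k j => IsRotation.exists_left (S k) (S l) ((homBasis (R.dual k) (c ⊗ R.dual l)).b j)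
  have hs : ∀ {K : Type} [Fintype K] {X Y : C} (f : K → (X ⟶ Y)), n ⊴ᵣ (∑ i, f i) = ∑ i, n ⊴ᵣ f i := by
    intro K _ X Y f
    exact map_sum (AddMonoidHom.mk' (fun f : X ⟶ Y => n ⊴ᵣ f)
      (fun f g => UnitaryRightModule.actionHomRight_add n f g)) f _
  refine ⟨∑ k, ∑ j, β k j ≫ H.E a k n (g ≫ (αᵣ n c (R.dual l)).inv ≫
    n ⊴ᵣ dagger ((homBasis (R.dual k) (c ⊗ R.dual l)).b j)) ▷ c, ?_⟩
  simp only [Preadditive.sum_comp, Category.assoc]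
  have e' : g = ∑ k, ∑ j, g ≫ (αᵣ n c (R.dual l)).inv ≫
      n ⊴ᵣ dagger ((homBasis (R.dual k) (c ⊗ R.dual l)).b j) ≫ n ⊴ᵣ ((homBasis (R.dual k) (c ⊗ R.dual l)).b j) ≫ (αᵣ n c (R.dual l)).hom := by
    simp only [← actionHomRight_comp_assoc]
    simp only [← Preadditive.comp_sum, ← Preadditive.sum_comp, ← hs]
    rw [e, actionHomRight_id, Category.id_comp, Iso.inv_hom_id, Category.comp_id]
  conv_lhs => rw [e']
  simp only [map_sum]
  refine Finset.sum_congr rfl fun k _ => Finset.sum_congr rfl fun j _ => ?_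
  rw [hT, H.comp_lineator n c _ (hβ k j)]
  simp only [Category.assoc]

end InternalHom

end

/-! ## The Morita context of an invertible bimodule category -/

section
open MonoidalRightAction
variable {C : Type u} [Category.{v} C] [MonoidalCategory C] {N N' : Type*} [Category N] [Category N']
  [MonoidalRightAction C N'] [MonoidalRightAction C N]

/-- The module functor structure given by an invertible lineator. -/
abbrev rightLinearOfIso (F : N ⥤ N') (μ : ∀ n (c : C), F.obj n ⊙ᵣ c ≅ F.obj (n ⊙ᵣ c))
    (naturality_right : ∀ n {c c' : C} (f : c ⟶ c'),
      F.obj n ⊴ᵣ f ≫ (μ n c').hom = (μ n c).hom ≫ F.map (n ⊴ᵣ f))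
    (naturality_left : ∀ {n n' : N} (f : n ⟶ n') (c : C),
      F.map f ⊵ᵣ c ≫ (μ n' c).hom = (μ n c).hom ≫ F.map (f ⊵ᵣ c))
    (associativity : ∀ n (c c' : C), (μ n (c ⊗ c')).hom ≫ F.map (αᵣ n c c').hom =
      (αᵣ (F.obj n) c c').hom ≫ (μ n c).hom ⊵ᵣ c' ≫ (μ (n ⊙ᵣ c) c').hom)
    (unitality : ∀ n, (ρᵣ (F.obj n)).hom = (μ n (𝟙_ C)).hom ≫ F.map (ρᵣ n).hom) :
    F.RightLinear C where
  μᵣ n c := (μ n c).hom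
  μᵣ_naturality_right := naturality_right
  μᵣ_naturality_left := naturality_left
  μᵣ_associativity := associativity
  μᵣ_unitality := unitality
  δᵣ n c := (μ n c).inv
  δᵣ_naturality_right n c c' f := by
    rw [Iso.eq_inv_comp, ← reassoc_of% naturality_right n f, Iso.hom_inv_id, Category.comp_id]
  δᵣ_naturality_left f c := by
    rw [Iso.eq_inv_comp, ← reassoc_of% naturality_left f c, Iso.hom_inv_id, Category.comp_id]
  δᵣ_associativity n c c' := by
    rw [Iso.inv_comp_eq, reassoc_of% associativity n c c', Iso.hom_inv_id_assoc,
      hom_inv_actionHomLeft, Category.comp_id]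
  δᵣ_unitality_inv n := by
    rw [Iso.eq_comp_inv, Iso.inv_comp_eq, unitality, Category.assoc, ← F.map_comp, Iso.hom_inv_id,
      CategoryTheory.Functor.map_id, Category.comp_id]
  μᵣ_comp_δᵣ n c := (μ n c).hom_inv_id
  δᵣ_comp_μᵣ n c := (μ n c).inv_hom_id

end

/-! ### The action of a category on itself. -/

section
open UnitaryCategory UnitaryMultifusionCategory MonoidalLeftAction
variable {C : Type u} [Category.{v} C] [MonoidalCategory C] 

instance [UnitaryMultifusionCategory C] : UnitaryLeftModule C C where
  add_actionHomLeft f g m := add_whiskerRight f g m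
  smul_actionHomLeft z f m := smul_whiskerRight z f m
  actionHomRight_add d _ _ f g := whiskerLeft_add d f g
  actionHomRight_smul d _ _ z f := whiskerLeft_smul d z f
  dagger_actionHomLeft f m := dagger_whiskerRight f m
  dagger_actionHomRight d _ _ f := dagger_whiskerLeft d f
  dagger_actionAssocIso := dagger_associator
  dagger_actionUnitIso := dagger_leftUnitor

variable (C) in
/-- The left action of `C` on itself commutes with the right action. -/
def selfEqvAction : EqvAction C (fun c : C => tensorRight c) where
  mid c d n := (α_ d n c).hom
  naturality_left c _ _ f n := by
    have key : (f ▷ n) ▷ c ≫ (α_ _ n c).hom = (α_ _ n c).hom ≫ f ▷ (n ⊗ c) := by simp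
    exact key
  naturality_right c d _ _ f := by
    have key : (d ◁ f) ▷ c ≫ (α_ d _ c).hom = (α_ d _ c).hom ≫ d ◁ f ▷ c := by simp
    exact key
  tensor c d d' n := by
    have key : (α_ (d ⊗ d') n c).hom ≫ (α_ d d' (n ⊗ c)).hom =
      (α_ d d' n).hom ▷ c ≫ (α_ d (d' ⊗ n) c).hom ≫ d ◁ (α_ d' n c).hom := (pentagon _ _ _ _).symm
    exact key
  unit c n := by
    have key : (α_ (𝟙_ C) n c).hom ≫ (λ_ (n ⊗ c)).hom = (λ_ n).hom ▷ c := by simp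
    exact key

/-- An equivariant transformation is determined by its component at the unit object, and any
component there extends. -/
lemma selfEqvAction_isFullyFaithful : (selfEqvAction C).IsFullyFaithful := by
  intro d η hn he
  have key : ∀ (ζ : ∀ n, d ⊗ n ⟶ d ⊗ n), (∀ {n n' : C} (f : n ⟶ n'), d ◁ f ≫ ζ n' = ζ n ≫ d ◁ f) →
    (∀ c n, ζ n ▷ c ≫ (α_ d n c).hom = (α_ d n c).hom ≫ ζ (n ⊗ c)) →
    ∃! f : d ⟶ d, ∀ n, f ▷ n = ζ n := by
    intro ζ hn he
    refine ⟨(ρ_ d).inv ≫ ζ (𝟙_ C) ≫ (ρ_ d).hom, fun n => ?_, fun f hf => ?_⟩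
    · have h1 := he n (𝟙_ C)
      have h2 := hn (λ_ n).hom
      rw [← Iso.eq_comp_inv] at h1
      simp only [comp_whiskerRight]
      rw [h1]
      simp only [Category.assoc]
      have h3 : (α_ d (𝟙_ C) n).inv ≫ (ρ_ d).hom ▷ n = d ◁ (λ_ n).hom := by simp
      rw [h3, ← h2]
      monoidal
    · rw [← hf (𝟙_ C)]
      simp
  exact key η hn he
end

/-! ### The free functor, the internal hom functor and the objects that represent their composites.
-/

section
open UnitaryCategory MonoidalRightAction
open scoped MonoidalLeftAction
variable {C : Type u} [Category.{v} C] [MonoidalCategory C] [UnitaryMultifusionCategory C]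
  {D : Type u'} [Category.{v'} D] [MonoidalCategory D] [UnitaryMultifusionCategory D]
  {M : Type w} [Category.{w'} M] [UnitaryCategory M] [MonoidalLeftAction D M] [MonoidalRightAction C M]
  [UnitaryLeftModule D M] [UnitaryRightModule C M]

/-- The left action of a bimodule category commutes with the right action. -/
def UnitaryBimodule.eqvAction (B : UnitaryBimodule D C M) : EqvAction D (fun c : C => actionRight M c) where
  mid c d n := (B.mid d n c).hom
  naturality_left c _ _ f n := B.mid_naturality_left f n c
  naturality_right c d _ _ f := B.mid_naturality_middle d f c
  tensor c d d' n := B.mid_tensor_left d d' n c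
  unit c n := B.mid_unit_left n c

lemma UnitaryBimodule.IsInvertible.exists_hom {B : UnitaryBimodule D C M} (hB : B.IsInvertible) (d d' : D)
    (η : ∀ n : M, d ⊙ₗ n ⟶ d' ⊙ₗ n) (hn : ∀ {n n' : M} (f : n ⟶ n'), d ⊴ₗ f ≫ η n' = η n ≫ d' ⊴ₗ f)
    (he : ∀ (c : C) n, η n ⊵ᵣ c ≫ (B.mid d' n c).hom = (B.mid d n c).hom ≫ η (n ⊙ᵣ c)) :
    ∃! f : d ⟶ d', ∀ n, f ⊵ₗ n = η n := by
  obtain ⟨f, hf, hu⟩ := hB.fullyFaithful d d' ⟨η, fun _ _ f => hn f⟩ (fun m c => he c m)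
  refine ⟨f, fun n => congr_app hf n, fun g hg => hu g ?_⟩
  ext n
  exact hg n

lemma UnitaryBimodule.IsInvertible.isFullyFaithful {B : UnitaryBimodule D C M} (hB : B.IsInvertible) :
    B.eqvAction.IsFullyFaithful := fun d η hn he => hB.exists_hom d d η hn he

variable (C) in
/-- The functor `m ⊙ᵣ -`. -/
def freeFunctor (m : M) : EqvFunctor (fun c : C => tensorRight c) (fun c : C => actionRight M c) where
  F :=
    { obj := fun n => m ⊙ᵣ n
      map := fun f => m ⊴ᵣ f
      map_id := fun n => actionHomRight_id n m
      map_comp := fun f g => actionHomRight_comp m f g }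
  μ c n := (αᵣ m n c).inv
  μ_naturality c n n' f := by
    have key : (m ⊴ᵣ f) ⊵ᵣ c ≫ (αᵣ m n' c).inv = (αᵣ m n c).inv ≫ m ⊴ᵣ (f ▷ c) := by
      rw [actionHomRight_whiskerRight, Iso.inv_hom_id_assoc]
    exact key

lemma isDaggerFunctor_freeFunctor (m : M) : IsDaggerFunctor (freeFunctor C m).F :=
  ⟨fun f g => UnitaryRightModule.actionHomRight_add m f g,
    fun z f => UnitaryRightModule.actionHomRight_smul m z f,
    fun f => (UnitaryRightModule.dagger_actionHomRight m f).symm⟩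

namespace InternalHom
variable {κ : Type} [Fintype κ] {S : κ → C} {ι : Type} [Fintype ι] {R : DualReps S} {m : ι → M}
  [∀ a, Simple (m a)] (H : InternalHom R m)

/-- The module functor structure of `H.G`. -/
noncomputable def eqvFunctor : EqvFunctor (fun c : C => actionRight M c) (fun c : C => tensorRight c) where
  F := H.G
  μ c n := H.lineator n c
  μ_naturality c _ _ f := H.lineator_naturality_left f c

/-- The lineator as an isomorphism. -/
@[simps] noncomputable def lineatorIso (n : M) (c : C) : H.G.obj n ⊗ c ≅ H.G.obj (n ⊙ᵣ c) where
  hom := H.lineator n c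
  inv := dagger (H.lineator n c)
  hom_inv_id := H.lineator_isometry n c
  inv_hom_id := H.lineator_coisometry n c

lemma lineator_assoc' (n : M) (c c' : C) :
    H.lineator n c ▷ c' ≫ H.lineator (n ⊙ᵣ c) c' ≫ H.G.map (αᵣ n c c').inv =
      (α_ _ c c').hom ≫ H.lineator n (c ⊗ c') := by
  have h := H.lineator_assoc n c c'
  rw [Iso.eq_inv_comp] at h
  rw [← reassoc_of% h, ← H.G.map_comp, Iso.hom_inv_id, CategoryTheory.Functor.map_id, Category.comp_id]

/-- The object `G m₀` acts on `C` by the functor `G (m₀ ⊙ᵣ -)`. -/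
noncomputable def selfRep (m₀ : M) : (selfEqvAction C).Rep (H.G.obj m₀) ((freeFunctor C m₀).comp H.eqvFunctor) where
  e n := H.lineatorIso m₀ n
  naturality f := H.lineator_naturality_right m₀ f
  equivariant c n := H.lineator_assoc' m₀ n c

lemma selfRep_isUnitary (m₀ : M) : (H.selfRep m₀).IsUnitary := fun _ => rfl

/-- The structure of the functor `m₀ ⊙ᵣ G -`. -/
noncomputable def freeIso (m₀ n : M) (c : C) : (m₀ ⊙ᵣ H.G.obj n) ⊙ᵣ c ≅ m₀ ⊙ᵣ H.G.obj (n ⊙ᵣ c) where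
  hom := (αᵣ m₀ (H.G.obj n) c).inv ≫ m₀ ⊴ᵣ H.lineator n c
  inv := m₀ ⊴ᵣ dagger (H.lineator n c) ≫ (αᵣ m₀ (H.G.obj n) c).hom
  hom_inv_id := by
    rw [Category.assoc, ← actionHomRight_comp_assoc, H.lineator_isometry, actionHomRight_id, Category.id_comp,
      Iso.inv_hom_id]
  inv_hom_id := by
    rw [Category.assoc, Iso.hom_inv_id_assoc, ← actionHomRight_comp, H.lineator_coisometry, actionHomRight_id]

/-- The composite is a unitary module endofunctor of `M`, with structure assembled from the action
associator and the lineator, so invertibility of the bimodule supplies the representing object.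
Unitarity of the lineator is indispensable here. -/
lemma exists_rep {B : UnitaryBimodule D C M} (hB : B.IsInvertible) (m₀ : M) :
    ∃ (y : D) (e : B.eqvAction.Rep y (H.eqvFunctor.comp (freeFunctor C m₀))), e.IsUnitary := by
  let P : M ⥤ M := (H.eqvFunctor.comp (freeFunctor C m₀)).F
  let _ : P.RightLinear C := rightLinearOfIso P (fun n c => H.freeIso m₀ n c)
    (fun n c c' f => by
      have key : (m₀ ⊙ᵣ H.G.obj n) ⊴ᵣ f ≫ (αᵣ m₀ (H.G.obj n) c').inv ≫ m₀ ⊴ᵣ H.lineator n c' =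
          ((αᵣ m₀ (H.G.obj n) c).inv ≫ m₀ ⊴ᵣ H.lineator n c) ≫ m₀ ⊴ᵣ H.G.map (n ⊴ᵣ f) := by
        rw [Category.assoc, ← actionHomRight_comp, ← H.lineator_naturality_right, actionHomRight_comp,
          whiskerRight_actionHomLeft]
        simp only [Category.assoc, Iso.inv_hom_id_assoc]
      exact key)
    (fun {n n'} f c => ((H.eqvFunctor.comp (freeFunctor C m₀)).μ_naturality c f))
    (fun n c c' => by
      have key : ((αᵣ m₀ (H.G.obj n) (c ⊗ c')).inv ≫ m₀ ⊴ᵣ H.lineator n (c ⊗ c')) ≫ m₀ ⊴ᵣ H.G.map (αᵣ n c c').hom =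
          (αᵣ (m₀ ⊙ᵣ H.G.obj n) c c').hom ≫ ((αᵣ m₀ (H.G.obj n) c).inv ≫ m₀ ⊴ᵣ H.lineator n c) ⊵ᵣ c' ≫
          (αᵣ m₀ (H.G.obj (n ⊙ᵣ c)) c').inv ≫ m₀ ⊴ᵣ H.lineator (n ⊙ᵣ c) c' := by
        rw [Category.assoc, ← actionHomRight_comp, H.lineator_assoc, comp_actionHomLeft, actionHomRight_comp,
          actionHomRight_comp, actionHomRight_whiskerRight]
        have h := actionHom_associator (H.G.obj n) c c' m₀
        have h' : (αᵣ m₀ (H.G.obj n) (c ⊗ c')).inv ≫ m₀ ⊴ᵣ (α_ (H.G.obj n) c c').inv ≫ (αᵣ m₀ (H.G.obj n ⊗ c) c').hom =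
            (αᵣ (m₀ ⊙ᵣ H.G.obj n) c c').hom ≫ (αᵣ m₀ (H.G.obj n) c).inv ⊵ᵣ c' := by
          rw [Iso.inv_comp_eq, ← cancel_epi (m₀ ⊴ᵣ (α_ (H.G.obj n) c c').hom), actionHomRight_hom_inv_assoc,
            reassoc_of% h, hom_inv_actionHomLeft, Category.comp_id]
        simp only [Category.assoc]
        rw [reassoc_of% h']
      exact key)
    (fun n => by
      have key : (ρᵣ[C] (m₀ ⊙ᵣ H.G.obj n)).hom = ((αᵣ m₀ (H.G.obj n) (𝟙_ C)).inv ≫ m₀ ⊴ᵣ H.lineator n (𝟙_ C)) ≫ m₀ ⊴ᵣ H.G.map (ρᵣ n).hom := by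
        rw [Category.assoc, ← actionHomRight_comp, H.lineator_unit, actionHom_rightUnitor, Iso.inv_hom_id_assoc]
      exact key)
  have hF := isDaggerFunctor_freeFunctor (C := C) m₀
  have hG := H.isDagger
  obtain ⟨y, e, he, he'⟩ := hB.essSurj P
    ⟨fun f g => (congrArg (freeFunctor C m₀).F.map (hG.1 f g)).trans (hF.1 _ _),
      fun z f => (congrArg (freeFunctor C m₀).F.map (hG.2.1 z f)).trans (hF.2.1 _ _),
      fun f => (congrArg (freeFunctor C m₀).F.map (hG.2.2 f)).trans (hF.2.2 _)⟩
    (fun n c => by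
      have key : dagger ((αᵣ m₀ (H.G.obj n) c).inv ≫ m₀ ⊴ᵣ H.lineator n c) =
          m₀ ⊴ᵣ dagger (H.lineator n c) ≫ (αᵣ m₀ (H.G.obj n) c).hom := by
        rw [dagger_comp, UnitaryRightModule.dagger_actionHomRight, ← UnitaryRightModule.dagger_actionAssocIso, dagger_dagger]
      exact key)
  exact ⟨y, ⟨fun n => e.app n, fun f => e.hom.naturality f, fun c n => he' n c⟩, he⟩

end InternalHom

end

/-! ## Generators -/

section
open UnitaryCategory
variable {C : Type u} [Category.{v} C] [UnitaryCategory C]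

lemma exists_sum_comp_eq_id {g : C} (hg : ∀ S : C, Simple S → Nonempty (Retract S g)) (n : C) :
    ∃ (κ : Type) (_ : Fintype κ) (p : κ → (n ⟶ g)) (q : κ → (g ⟶ n)), ∑ k, p k ≫ q k = 𝟙 n := by
  obtain ⟨κ, hκ, s, hs, ⟨d⟩⟩ := exists_simple_decomposition n
  refine ⟨κ, hκ, fun k => dagger (d.incl k) ≫ (hg (s k) (hs k)).some.i,
    fun k => (hg (s k) (hs k)).some.r ≫ d.incl k, ?_⟩
  simp only [Category.assoc, Retract.retract_assoc, d.total]

lemma UnitaryCategory.SimpleReps.exists_ne_zero {ι : Type} {S : ι → C} (hS : SimpleReps S) {X : C} (h : 𝟙 X ≠ 0) :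
    ∃ k, ∃ f : S k ⟶ X, f ≠ 0 := by
  by_contra! h'
  exact h (hS.hom_ext fun k b => by rw [h' k b, zero_comp, zero_comp])

lemma ne_zero_of_isometry {X Y : C} {f : X ⟶ Y} (hf : f ≫ dagger f = 𝟙 X) (h : 𝟙 X ≠ 0) : 𝟙 Y ≠ 0 := by
  intro h0
  rw [← hf, ← Category.comp_id f, h0, comp_zero, zero_comp] at h
  exact h rfl

/-- An orthogonal family of isometries from the summands adds up to an isometry from the sum. -/
lemma UnitaryCategory.OrthoSum.exists_isometry {K : Type} [Fintype K] {s : K → C} {X Z : C} (d : OrthoSum s X)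
    (g : ∀ k, s k ⟶ Z) (hg : ∀ k, g k ≫ dagger (g k) = 𝟙 _)
    (hg' : ∀ k l, k ≠ l → g k ≫ dagger (g l) = 0) : ∃ i : X ⟶ Z, i ≫ dagger i = 𝟙 X := by
  classical
  refine ⟨∑ k, dagger (d.incl k) ≫ g k, ?_⟩
  rw [← d.total, dagger_sum, Preadditive.sum_comp]
  refine Finset.sum_congr rfl fun k _ => ?_
  rw [Preadditive.comp_sum, Finset.sum_eq_single k]
  · simp only [dagger_comp, dagger_dagger, Category.assoc]
    rw [reassoc_of% hg]
  · intro l _ hl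
    simp only [dagger_comp, dagger_dagger, Category.assoc]
    rw [reassoc_of% hg' k l hl.symm]
    simp
  · simp

/-- An object embeds isometrically into any object that contains its simple summands often enough. -/
lemma exists_isometry_of_orthogonal_family {K L : Type} [Fintype K] {s : K → C} {X Y Z : C}
    (d : OrthoSum s X) (g : ∀ k, s k ⟶ Y) (hg : ∀ k, g k ≫ dagger (g k) = 𝟙 _) (J : L → (Y ⟶ Z))
    (hJ : ∀ l, J l ≫ dagger (J l) = 𝟙 _) (hJ' : ∀ l l', l ≠ l' → J l ≫ dagger (J l') = 0) (e : K → L)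
    (he : Function.Injective e) : ∃ i : X ⟶ Z, i ≫ dagger i = 𝟙 X := by
  refine d.exists_isometry (fun k => g k ≫ J (e k)) (fun k => ?_) fun k l hkl => ?_
  · rw [dagger_comp, Category.assoc, reassoc_of% hJ, hg]
  · rw [dagger_comp, Category.assoc, reassoc_of% hJ' (e k) (e l) (fun h => hkl (he h)), zero_comp, comp_zero]

end

/-! ### Powers of generators and faithfulness of the action. -/

section
open UnitaryCategory UnitaryMultifusionCategory
variable {C : Type u} [Category.{v} C] [MonoidalCategory C] [UnitaryMultifusionCategory C]

/-- Every simple object is a summand of its product with some simple summand of the unit. -/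
lemma exists_unit_summand (d : C) [Simple d] : ∃ (S : C) (_ : Simple S) (s : S ⟶ 𝟙_ C),
    s ≫ dagger s = 𝟙 S ∧ (ρ_ d).inv ≫ d ◁ dagger s ≠ 0 := by
  obtain ⟨κ, _, t, ht, ⟨e⟩⟩ := exists_simple_decomposition (𝟙_ C)
  by_contra! h
  have h' : ∀ k, d ◁ dagger (e.incl k) = 0 := fun k => by
    have := h (t k) (ht k) (e.incl k) (e.isometry k)
    rwa [Iso.inv_comp_eq, comp_zero] at this
  apply id_nonzero d
  rw [← Iso.inv_hom_id (ρ_ d), ← Category.id_comp (ρ_ d).hom, ← whiskerLeft_id, ← e.total]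
  simp [whiskerLeft_sum, h']

lemma tensorPower_mul_retract {X : C} {n : ℕ}
    (hX : ∀ S : C, Simple S → Nonempty (Retract S (tensorPower X n))) (k : ℕ) (S : C) (hS : Simple S) :
    Nonempty (Retract S (tensorPower X (n * (k + 1)))) := by
  induction k generalizing S with
  | zero => simpa using hX S hS
  | succ k ih =>
    -- `S` is a summand of `S ⊗ T` for a suitable summand `T` of the unit; `S` sits in the first `n
    -- * (k + 1)` factors and `T` in the last `n`.
    obtain ⟨T, hT, t, ht, h⟩ := exists_unit_summand S
    obtain ⟨f, hf⟩ := exists_isometry_of_retract (ih S hS).some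
    obtain ⟨g, hg⟩ := exists_isometry_of_retract (hX T hT).some
    have e : n * (k + 1) + n = n * (k + 1 + 1) := by ring
    rw [← e]
    refine nonempty_retract_of_ne_zero (f := ((ρ_ S).inv ≫ S ◁ dagger t) ≫ f ▷ T ≫ _ ◁ g ≫
      (tensorPowerAdd X (n * (k + 1)) n).hom) fun h0 => h ?_
    have h1 := congrArg (· ≫ (tensorPowerAdd X (n * (k + 1)) n).inv ≫ _ ◁ dagger g ≫ dagger f ▷ T) h0
    simp only [Category.assoc, Iso.hom_inv_id_assoc, zero_comp] at h1
    rw [← MonoidalCategory.whiskerLeft_comp_assoc _ g, hg, whiskerLeft_id, Category.id_comp, ← comp_whiskerRight, hf,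
      id_whiskerRight, Category.comp_id] at h1
    exact h1

lemma exists_common_power {C' : Type u'} [Category.{v'} C'] [MonoidalCategory C'] [UnitaryMultifusionCategory C']
    {X : C} {Y : C'} (hX : IsStrongTensorGenerator X) (hY : IsStrongTensorGenerator Y) :
    ∃ N : ℕ, 1 ≤ N ∧ (∀ S : C, Simple S → Nonempty (Retract S (tensorPower X N))) ∧
      ∀ S : C', Simple S → Nonempty (Retract S (tensorPower Y N)) := by
  obtain ⟨n, hn, hX⟩ := hX
  obtain ⟨n', hn', hY⟩ := hY
  refine ⟨n * n', Nat.mul_pos hn hn', fun S hS => ?_, fun S hS => ?_⟩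
  · have := tensorPower_mul_retract hX (n' - 1) S hS
    rwa [Nat.sub_add_cancel hn'] at this
  · have := tensorPower_mul_retract hY (n - 1) S hS
    rwa [Nat.sub_add_cancel hn, mul_comm] at this

open MonoidalRightAction
variable {M : Type w} [Category.{w'} M] [UnitaryCategory M] [MonoidalRightAction C M]
  [UnitaryRightModule C M]

lemma zero_actionHomLeft (n n' : M) (c : C) : (0 : n ⟶ n') ⊵ᵣ c = 0 := by
  have h := UnitaryRightModule.smul_actionHomLeft (0 : ℂ) (0 : n ⟶ n') c
  rwa [zero_smul, zero_smul] at h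

lemma actionHomRight_sum (n : M) {K : Type} [Fintype K] {c c' : C} (f : K → (c ⟶ c')) :
    n ⊴ᵣ (∑ i, f i) = ∑ i, n ⊴ᵣ f i :=
  map_sum (AddMonoidHom.mk' (fun f : c ⟶ c' => n ⊴ᵣ f)
    (fun f g => UnitaryRightModule.actionHomRight_add n f g)) f _

lemma sum_actionHomLeft {n n' : M} {K : Type} [Fintype K] (f : K → (n ⟶ n')) (c : C) :
    (∑ i, f i) ⊵ᵣ c = ∑ i, f i ⊵ᵣ c :=
  map_sum (AddMonoidHom.mk' (fun f : n ⟶ n' => f ⊵ᵣ c)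
    (fun f g => UnitaryRightModule.add_actionHomLeft f g c)) f _

variable (M) in
/-- The objects that act by zero. -/
def ActsByZero (c : C) : Prop := ∀ n : M, 𝟙 (n ⊙ᵣ c) = 0

lemma ActsByZero.of_isometry {c S : C} (h : ActsByZero M c) {f : S ⟶ c} (hf : f ≫ dagger f = 𝟙 S) : ActsByZero M S := by
  intro n
  rw [← actionHomRight_id, ← hf, actionHomRight_comp, ← Category.comp_id (n ⊴ᵣ f), h n, comp_zero, zero_comp]

lemma ActsByZero.tensor_left {c d : C} (h : ActsByZero M d) : ActsByZero M (c ⊗ d) := by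
  intro n
  rw [← (αᵣ n c d).hom_inv_id, ← Category.comp_id (αᵣ n c d).hom, h, comp_zero, zero_comp]

lemma ActsByZero.tensor_right {c d : C} (h : ActsByZero M c) : ActsByZero M (c ⊗ d) := by
  intro n
  rw [← (αᵣ n c d).hom_inv_id, ← Category.comp_id (αᵣ n c d).hom, ← id_actionHomLeft, h n, zero_actionHomLeft, comp_zero, zero_comp]

/-- As `s ▷ q ≠ 0`, the coevaluation of `q` embeds `S` in `q ⊗ q'`, which acts by zero. -/
lemma ActsByZero.unit_summand {q S : C} (h : ActsByZero M q) [Simple S] (s : S ⟶ 𝟙_ C) (hs : s ▷ q ≠ 0) :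
    ActsByZero M S := by
  obtain ⟨q', ⟨p⟩⟩ := exists_rightDual q
  have h0 : s ≫ η_ q q' ≠ 0 := fun h0 => hs (whiskerRight_eq_zero_of_comp_coev h0)
  obtain ⟨c, -, hc⟩ := exists_isometry_of_ne_zero h0
  exact (h.tensor_right (d := q')).of_isometry hc

/-- An indecomposable category acts faithfully. -/
lemma IsIndecomposable.not_actsByZero (hC : IsIndecomposable C) {n : M} (hn : 𝟙 n ≠ 0) {w : C} (hw : 𝟙 w ≠ 0) :
    ¬ ActsByZero M w := by
  intro h
  obtain ⟨κ, _, t, ht, ⟨e⟩⟩ := exists_simple_decomposition (𝟙_ C)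
  obtain ⟨k, hk⟩ : ∃ k, e.incl k ▷ w ≠ 0 := by
    by_contra! h'
    apply hw
    have : 𝟙 (𝟙_ C ⊗ w) = 0 := by
      rw [← id_whiskerRight, ← e.total]
      simp [sum_whiskerRight, h']
    rw [← Iso.inv_hom_id (λ_ w), ← Category.comp_id (λ_ w).inv, this]
    simp
  have := ht
  have hT := h.unit_summand (e.incl k) hk
  -- Indecomposability connects `t l` to the summand `t k`, already known to act by zero: `Z ⊗ t k`
  -- acts by zero and is not killed by `t l`.
  have hall : ∀ l, ActsByZero M (t l) := by
    intro l
    obtain ⟨Z, hZ⟩ := hC.2 (t l) (t k) (ht l) (ht k) ⟨retractOfIsometry _ (e.isometry l)⟩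
      ⟨retractOfIsometry _ (e.isometry k)⟩
    refine (hT.tensor_left (c := Z)).unit_summand (e.incl l) fun h0 => hZ ?_
    rw [IsZero.iff_id_eq_zero, ← Iso.hom_inv_id (α_ (t l) Z (t k)), ← Category.comp_id (α_ (t l) Z (t k)).hom,
      ← id_whiskerRight, ← e.isometry l, comp_whiskerRight, h0]
    simp
  apply hn
  have h1 : 𝟙 (n ⊙ᵣ 𝟙_ C) = 0 := by
    rw [← actionHomRight_id, ← e.total, actionHomRight_sum]
    refine Finset.sum_eq_zero fun k _ => ?_
    rw [actionHomRight_comp, ← Category.comp_id (n ⊴ᵣ dagger (e.incl k)), hall k, comp_zero, zero_comp]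
  rw [← Iso.inv_hom_id (ρᵣ[C] n), ← Category.comp_id (ρᵣ n).inv, h1, comp_zero, zero_comp]

end

/-! ## Morita equivalent categories -/

section
open UnitaryCategory UnitaryMultifusionCategory MonoidalRightAction
open scoped MonoidalLeftAction
variable {C : Type u} [Category.{v} C] [MonoidalCategory C] [UnitaryMultifusionCategory C]
  {D : Type u'} [Category.{v'} D] [MonoidalCategory D] [UnitaryMultifusionCategory D]
  {M : Type w} [Category.{w'} M] [UnitaryCategory M] [MonoidalLeftAction D M] [MonoidalRightAction C M]
  [UnitaryLeftModule D M] [UnitaryRightModule C M]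

lemma zero_actionHomLeft_left (d d' : D) (n : M) : (0 : d ⟶ d') ⊵ₗ n = 0 := by
  have h := UnitaryLeftModule.smul_actionHomLeft (0 : ℂ) (0 : d ⟶ d') n
  rwa [zero_smul, zero_smul] at h

lemma UnitaryBimodule.IsInvertible.hom_ext {B : UnitaryBimodule D C M} (hB : B.IsInvertible) {d d' : D}
    {f g : d ⟶ d'} (h : ∀ n : M, f ⊵ₗ n = g ⊵ₗ n) : f = g :=
  (hB.exists_hom d d' (fun n => g ⊵ₗ n) (fun _ => MonoidalLeftAction.action_exchange _ _)
    (fun c n => B.mid_naturality_left g n c)).unique h (fun _ => rfl)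

lemma UnitaryBimodule.IsInvertible.exists_ne_zero {B : UnitaryBimodule D C M} (hB : B.IsInvertible) {d : D}
    (h : 𝟙 d ≠ 0) : ∃ n : M, 𝟙 (d ⊙ₗ n) ≠ 0 := by
  by_contra! h'
  exact h (hB.hom_ext fun n => by rw [MonoidalLeftAction.id_actionHomLeft, h', zero_actionHomLeft_left])

namespace InternalHom
variable {κ : Type} [Fintype κ] {S : κ → C} {ι : Type} [Fintype ι] {R : DualReps S} {m : ι → M}
  [∀ a, Simple (m a)] (H : InternalHom R m)

/-- By the definition of the internal hom, `S k` occurs in `G m₀` as soon as some `m a` occurs in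
`m₀ ⊙ᵣ R.dual k`. If that object vanished, `R.dual k` would act by zero, because every object of `M`
is a retract of a multiple of `m₀`. -/
lemma exists_isometry_simple (hC : IsIndecomposable C) (hm : SimpleReps m) {m₀ : M}
    (hm₀ : ∀ s : M, Simple s → Nonempty (Retract s m₀)) {n : M} (hn : 𝟙 n ≠ 0) (u : C) [Simple u] :
    ∃ g : u ⟶ H.G.obj m₀, g ≫ dagger g = 𝟙 u := by
  obtain ⟨k, ⟨e⟩⟩ := R.reps.exists_iso u inferInstance
  have := R.reps.simple k
  have := R.reps_dual.simple k
  have h1 : 𝟙 (m₀ ⊙ᵣ R.dual k) ≠ 0 := by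
    intro h0
    refine hC.not_actsByZero hn (id_nonzero (R.dual k)) fun n' => ?_
    obtain ⟨K, _, p, q, hpq⟩ := exists_sum_comp_eq_id hm₀ n'
    rw [← id_actionHomLeft, ← hpq, sum_actionHomLeft]
    refine Finset.sum_eq_zero fun i _ => ?_
    rw [comp_actionHomLeft, ← Category.comp_id (p i ⊵ᵣ _), h0, comp_zero, zero_comp]
  obtain ⟨a, f, hf⟩ := hm.exists_ne_zero h1
  obtain ⟨c, -, hc⟩ := exists_isometry_of_ne_zero hf
  obtain ⟨t, ht, -⟩ := exists_unitary_of_iso e.symm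
  refine ⟨t ≫ H.E a k m₀ (c • f), ?_⟩
  rw [dagger_comp, Category.assoc, ← Category.assoc (H.E a k m₀ _), H.E_inner, hc, scal_id, one_smul, Category.id_comp, ht]

/-- The unit is a sum of duals of representatives, so one of them does not kill `n` and gives a
nonzero morphism `E`. -/
lemma obj_ne_zero (hm : SimpleReps m) {n : M} (hn : 𝟙 n ≠ 0) : 𝟙 (H.G.obj n) ≠ 0 := by
  obtain ⟨k, hk⟩ : ∃ k, 𝟙 (n ⊙ᵣ R.dual k) ≠ 0 := by
    by_contra! h
    have := R.reps_dual.simple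
    have e := R.reps_dual.sum_homBasis (fun k => homBasis (R.dual k) (𝟙_ C))
    apply hn
    have h1 : 𝟙 (n ⊙ᵣ 𝟙_ C) = 0 := by
      rw [← actionHomRight_id, ← e, actionHomRight_sum]
      refine Finset.sum_eq_zero fun k _ => ?_
      rw [actionHomRight_sum]
      refine Finset.sum_eq_zero fun j _ => ?_
      rw [actionHomRight_comp, ← Category.comp_id (n ⊴ᵣ dagger _), h, comp_zero, zero_comp]
    rw [← Iso.inv_hom_id (ρᵣ[C] n), ← Category.comp_id (ρᵣ n).inv, h1, comp_zero, zero_comp]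
  obtain ⟨a, f, hf⟩ := hm.exists_ne_zero hk
  obtain ⟨c, -, hc⟩ := exists_isometry_of_ne_zero hf
  have := R.reps.simple k
  refine ne_zero_of_isometry (f := H.E a k n (c • f)) ?_ (id_nonzero (S k))
  rw [H.E_inner, hc, scal_id, one_smul]

/-- An isomorphism of module functors `y ⊙ₗ - ≅ m₀ ⊙ᵣ G -`. -/
abbrev FreeRep (B : UnitaryBimodule D C M) (y : D) (m₀ : M) :=
  B.eqvAction.Rep y (H.eqvFunctor.comp (freeFunctor C m₀))

variable {H} {B : UnitaryBimodule D C M}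

/-- The component of the isomorphism at `n`. -/
def FreeRep.iso {y : D} {m₀ : M} (e : H.FreeRep B y m₀) (n : M) : y ⊙ₗ n ≅ m₀ ⊙ᵣ H.G.obj n := e.e n

lemma FreeRep.naturality' {y : D} {m₀ : M} (e : H.FreeRep B y m₀) {n n' : M} (f : n ⟶ n') :
    y ⊴ₗ f ≫ (e.iso n').hom = (e.iso n).hom ≫ m₀ ⊴ᵣ H.G.map f := e.naturality f

lemma FreeRep.equivariant' {y : D} {m₀ : M} (e : H.FreeRep B y m₀) (c : C) (n : M) :
    (e.iso n).hom ⊵ᵣ c ≫ (αᵣ m₀ (H.G.obj n) c).inv ≫ m₀ ⊴ᵣ H.lineator n c =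
      (B.mid y n c).hom ≫ (e.iso (n ⊙ᵣ c)).hom := e.equivariant c n

/-- A morphism of the parameters gives a module transformation of the functors `m ⊙ᵣ G -`, and the
action of `D` is full on those. -/
lemma FreeRep.exists_map (hB : B.IsInvertible) {y₁ y₂ : D} {m₁ m₂ : M} (e₁ : H.FreeRep B y₁ m₁)
    (e₂ : H.FreeRep B y₂ m₂) (p : m₁ ⟶ m₂) :
    ∃ J : y₁ ⟶ y₂, ∀ n, J ⊵ₗ n = (e₁.iso n).hom ≫ p ⊵ᵣ H.G.obj n ≫ (e₂.iso n).inv := by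
  refine (hB.exists_hom y₁ y₂ (fun n => (e₁.iso n).hom ≫ p ⊵ᵣ H.G.obj n ≫ (e₂.iso n).inv)
    (fun {n n'} f => ?_) (fun c n => ?_)).exists
  · rw [reassoc_of% e₁.naturality' f, Category.assoc, Category.assoc]
    congr 1
    rw [action_exchange_assoc]
    congr 1
    rw [Iso.eq_inv_comp, ← reassoc_of% e₂.naturality' f, Iso.hom_inv_id, Category.comp_id]
  · have h2 : (e₂.iso n).inv ⊵ᵣ c ≫ (B.mid y₂ n c).hom =
        (αᵣ m₂ (H.G.obj n) c).inv ≫ m₂ ⊴ᵣ H.lineator n c ≫ (e₂.iso (n ⊙ᵣ c)).inv := by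
      have h := e₂.equivariant' c n
      rw [← cancel_epi ((e₂.iso n).hom ⊵ᵣ c), hom_inv_actionHomLeft_assoc, reassoc_of% h, Iso.hom_inv_id,
        Category.comp_id]
    simp only [comp_actionHomLeft, Category.assoc]
    rw [h2, ← reassoc_of% e₁.equivariant' c n, action_exchange_assoc, actionHomLeft_tensor_assoc,
      Iso.inv_hom_id_assoc]

/-- The action of `w ⊗ y`, if `y` acts by `m₀ ⊙ᵣ G -`. -/
noncomputable def FreeRep.tensor {y : D} {m₀ : M} (e : H.FreeRep B y m₀) (w : D) : H.FreeRep B (w ⊗ y) (w ⊙ₗ m₀) where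
  e n := (MonoidalLeftAction.actionAssocIso w y n) ≪≫
    ⟨w ⊴ₗ (e.iso n).hom, w ⊴ₗ (e.iso n).inv, MonoidalLeftAction.actionHomRight_hom_inv _ _,
      MonoidalLeftAction.actionHomRight_inv_hom _ _⟩ ≪≫ (B.mid w m₀ (H.G.obj n)).symm
  naturality {n n'} f := by
    have key : (w ⊗ y) ⊴ₗ f ≫ (αₗ w y n').hom ≫ w ⊴ₗ (e.iso n').hom ≫ (B.mid w m₀ (H.G.obj n')).inv =
        ((αₗ w y n).hom ≫ w ⊴ₗ (e.iso n).hom ≫ (B.mid w m₀ (H.G.obj n)).inv) ≫ (w ⊙ₗ m₀) ⊴ᵣ H.G.map f := by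
      rw [MonoidalLeftAction.tensor_actionHomRight]
      simp only [Category.assoc, Iso.inv_hom_id_assoc]
      congr 1
      rw [← MonoidalLeftAction.actionHomRight_comp_assoc, e.naturality', MonoidalLeftAction.actionHomRight_comp_assoc]
      congr 1
      rw [Iso.eq_inv_comp, ← reassoc_of% B.mid_naturality_right, Iso.hom_inv_id, Category.comp_id]
    exact key
  equivariant c n := by
    have key : ((αₗ w y n).hom ≫ w ⊴ₗ (e.iso n).hom ≫ (B.mid w m₀ (H.G.obj n)).inv) ⊵ᵣ c ≫
        (αᵣ (w ⊙ₗ m₀) (H.G.obj n) c).inv ≫ (w ⊙ₗ m₀) ⊴ᵣ H.lineator n c =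
        (B.mid (w ⊗ y) n c).hom ≫ (αₗ w y (n ⊙ᵣ c)).hom ≫ w ⊴ₗ (e.iso (n ⊙ᵣ c)).hom ≫
          (B.mid w m₀ (H.G.obj (n ⊙ᵣ c))).inv := by
      rw [reassoc_of% B.mid_tensor_left, ← MonoidalLeftAction.actionHomRight_comp_assoc, ← e.equivariant']
      simp only [comp_actionHomLeft, MonoidalLeftAction.actionHomRight_comp, Category.assoc]
      rw [← reassoc_of% B.mid_naturality_middle]
      congr 2
      have h := B.mid_tensor_right w m₀ (H.G.obj n) c
      have h2 := B.mid_naturality_right w m₀ (H.lineator n c)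
      rw [← cancel_mono (B.mid w m₀ (H.G.obj (n ⊙ᵣ c))).hom]
      simp only [Category.assoc, Iso.inv_hom_id, Category.comp_id]
      rw [h2, ← cancel_epi ((B.mid w m₀ (H.G.obj n)).hom ⊵ᵣ c), hom_inv_actionHomLeft_assoc,
        ← cancel_epi (αᵣ (w ⊙ₗ m₀) (H.G.obj n) c).hom, Iso.hom_inv_id_assoc, ← reassoc_of% h,
        MonoidalLeftAction.actionHomRight_hom_inv_assoc]
    exact key

/-- A nonzero morphism `d ⟶ (d ⊗ y') ⊗ y` comes from a coevaluation of `y`. The object `w ⊗ y` acts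
by `(w ⊙ₗ m₀) ⊙ᵣ G -`, and `w ⊙ₗ m₀` is a retract of a multiple of `m₀`, so `w ⊗ y` is resolved by
morphisms to `y`. Hence some composite `d ⟶ y` is nonzero. -/
lemma FreeRep.exists_isometry_simple (hC : IsIndecomposable C) (hB : B.IsInvertible) (hm : SimpleReps m) {m₀ : M}
    (hm₀ : ∀ s : M, Simple s → Nonempty (Retract s m₀)) {y : D} (e : H.FreeRep B y m₀) (d : D) [Simple d] :
    ∃ g : d ⟶ y, g ≫ dagger g = 𝟙 d := by
  suffices h : ∃ g : d ⟶ y, g ≠ 0 by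
    obtain ⟨g, hg⟩ := h
    obtain ⟨c, -, hc⟩ := exists_isometry_of_ne_zero hg
    exact ⟨_, hc⟩
  obtain ⟨T, _, s, hs, hds⟩ := exists_unit_summand d
  -- If `y ⊗ T` vanished, `G (T ⊙ₗ n)` would be a nonzero object of `C` that acts by zero on the
  -- generator `m₀` and thus on all of `M`.
  have hyT : 𝟙 (y ⊗ T) ≠ 0 := by
    intro h0
    obtain ⟨n, hn⟩ := hB.exists_ne_zero (id_nonzero T)
    have h1 := H.obj_ne_zero hm hn
    have h2 : 𝟙 (m₀ ⊙ᵣ H.G.obj (T ⊙ₗ n)) = 0 := by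
      have h3 : 𝟙 ((y ⊗ T) ⊙ₗ n) = 0 := by
        rw [← MonoidalLeftAction.id_actionHomLeft, h0, zero_actionHomLeft_left]
      have h4 : 𝟙 (y ⊙ₗ (T ⊙ₗ n)) = 0 := by
        rw [← Iso.inv_hom_id (αₗ y T n), ← Category.comp_id (αₗ y T n).inv, h3, comp_zero, zero_comp]
      rw [← Iso.inv_hom_id (e.iso (T ⊙ₗ n)), ← Category.comp_id (e.iso (T ⊙ₗ n)).inv, h4, comp_zero, zero_comp]
    refine hC.not_actsByZero hn h1 fun n' => ?_
    obtain ⟨K, _, p, q, hpq⟩ := exists_sum_comp_eq_id hm₀ n'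
    rw [← id_actionHomLeft, ← hpq, sum_actionHomLeft]
    refine Finset.sum_eq_zero fun i _ => ?_
    rw [comp_actionHomLeft, ← Category.comp_id (p i ⊵ᵣ _), h2, comp_zero, zero_comp]
  obtain ⟨y', ⟨π⟩⟩ := exists_leftDual y
  have hξ : s ≫ η_ y' y ≠ 0 := by
    intro h0
    apply hyT
    rw [← whiskerLeft_id, ← hs, MonoidalCategory.whiskerLeft_comp, whiskerLeft_eq_zero_of_comp_coev h0, zero_comp]
  obtain ⟨z, -, hz⟩ := exists_isometry_of_ne_zero hξ
  set ξ := z • s ≫ η_ y' y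
  let θ : d ⟶ (d ⊗ y') ⊗ y := ((ρ_ d).inv ≫ d ◁ dagger s) ≫ d ◁ ξ ≫ (α_ d y' y).inv
  have hθ : θ ≠ 0 := by
    intro h0
    apply hds
    have h1 := congrArg (· ≫ (α_ d y' y).hom ≫ d ◁ dagger ξ) h0
    simp only [θ, Category.assoc, Iso.inv_hom_id_assoc, zero_comp] at h1
    rwa [← MonoidalCategory.whiskerLeft_comp d ξ, hz, whiskerLeft_id, Category.comp_id] at h1
  by_contra! h
  obtain ⟨K, _, p, q, hpq⟩ := exists_sum_comp_eq_id hm₀ ((d ⊗ y') ⊙ₗ m₀)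
  choose J hJ using fun i => FreeRep.exists_map hB (e.tensor (d ⊗ y')) e (p i)
  refine hθ (hB.hom_ext fun n => ?_)
  rw [zero_actionHomLeft_left, ← Category.comp_id (θ ⊵ₗ n), ← Iso.hom_inv_id ((e.tensor (d ⊗ y')).iso n),
    ← Category.comp_id ((e.tensor (d ⊗ y')).iso n).hom, ← id_actionHomLeft, ← hpq, sum_actionHomLeft]
  simp only [Preadditive.comp_sum, Preadditive.sum_comp]
  refine Finset.sum_eq_zero fun i _ => ?_
  have h1 : θ ⊵ₗ n ≫ J i ⊵ₗ n = 0 := by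
    rw [← MonoidalLeftAction.comp_actionHomLeft, h (θ ≫ J i), zero_actionHomLeft_left]
  rw [hJ, ← Category.assoc, ← Category.assoc, Iso.comp_inv_eq, zero_comp] at h1
  rw [comp_actionHomLeft, Category.assoc, Category.assoc, ← Category.assoc, ← Category.assoc]
  simp only [Category.assoc] at h1 ⊢
  rw [reassoc_of% h1, zero_comp]

end InternalHom

end

/-! ### Proof for Morita equivalent categories. -/

section
open UnitaryCategory UnitaryMultifusionCategory MonoidalRightAction
open scoped MonoidalLeftAction

lemma UnitaryCategory.SimpleReps.retract_sum {M : Type w} [Category.{w'} M] [UnitaryCategory M] {ι : Type}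
    [Fintype ι] {m : ι → M} (hm : SimpleReps m) {g : M} (d : OrthoSum m g) (s : M) (hs : Simple s) :
    Nonempty (Retract s g) := by
  obtain ⟨a, ⟨e⟩⟩ := hm.exists_iso s hs
  exact ⟨⟨e.inv ≫ d.incl a, dagger (d.incl a) ≫ e.hom, by
    rw [Category.assoc, reassoc_of% d.isometry, Iso.inv_hom_id]⟩⟩

variable {C : Type u} [Category.{v} C] [MonoidalCategory C] [UnitaryMultifusionCategory C]
  {D : Type u'} [Category.{v'} D] [MonoidalCategory D] [UnitaryMultifusionCategory D]

theorem boundedSpreadIsomorphic_of_moritaEquivalent {X : C} {Y : D} (hC : IsIndecomposable C)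
    (hD : IsIndecomposable D) (h : MoritaEquivalent.{v, u, w, v', u', w'} C D)
    (hX : IsStrongTensorGenerator X) (hY : IsStrongTensorGenerator Y) :
    BoundedSpreadIsomorphic (fusionSpinChain X).stabilization (fusionSpinChain Y).stabilization := by
  obtain ⟨M, _, _, _, _, _, _, B, hB⟩ := h
  obtain ⟨N, hN, hXN, hYN⟩ := exists_common_power hX hY
  obtain ⟨κ, _, S, hS⟩ := exists_simpleReps C
  obtain ⟨R⟩ := hS.nonempty_dualReps
  obtain ⟨ι, _, m, hm⟩ := exists_simpleReps M
  have := hm.simple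
  obtain ⟨H⟩ := nonempty_internalHom R m
  -- `M` is nonzero because `D` is nonzero and acts faithfully.
  obtain ⟨n, hn⟩ : ∃ n : M, 𝟙 n ≠ 0 :=
    (hB.exists_ne_zero (fun h => hD.1 ((IsZero.iff_id_eq_zero _).2 h))).imp' _ fun _ h => h
  obtain ⟨g, ⟨dg⟩⟩ := exists_orthoSum m
  have hg := hm.retract_sum dg
  obtain ⟨K, _, s, hs, ⟨d⟩⟩ := exists_simple_decomposition (tensorPower X N)
  obtain ⟨K', _, s', hs', ⟨d'⟩⟩ := exists_simple_decomposition (tensorPower Y N)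
  -- One copy of the generator `g` for every simple summand of `X^{⊗ N}` and of `Y^{⊗ N}`: since `G
  -- g` and `y'` contain each simple object at least once, `G m₀` and `y` contain them often enough.
  obtain ⟨m₀, ⟨dm⟩⟩ := exists_orthoSum (fun _ : K ⊕ K' => g)
  obtain ⟨y, e, he⟩ := H.exists_rep hB m₀
  obtain ⟨y', e', he'⟩ := H.exists_rep hB g
  have hG := H.isDagger
  choose a ha using fun k => have := hs k; H.exists_isometry_simple hC hm hg hn (s k)
  choose b hb using fun k => have := hs' k
    InternalHom.FreeRep.exists_isometry_simple (H := H) hC hB hm hg e' (s' k)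
  obtain ⟨i, hi⟩ := exists_isometry_of_orthogonal_family d a ha (fun k => H.G.map (dm.incl k))
    (fun k => by rw [← hG.2.2, ← H.G.map_comp, dm.isometry, CategoryTheory.Functor.map_id])
    (fun k l hkl => by
      rw [← hG.2.2, ← H.G.map_comp, dm.ortho k l hkl, ← zero_smul ℂ (𝟙 _ ≫ 0), hG.2.1, zero_smul])
    Sum.inl Sum.inl_injective
  -- The inclusions of the copies of `g` in `m₀` induce orthogonal isometries of `y'` into `y`; the
  -- orthogonality relations are checked after acting on `M`.
  choose J hJ using fun k => InternalHom.FreeRep.exists_map (H := H) hB e' e (dm.incl k)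
  have hJd : ∀ k l n, (J k ≫ dagger (J l)) ⊵ₗ n = (InternalHom.FreeRep.iso e' n).hom ≫
      (dm.incl k ≫ dagger (dm.incl l)) ⊵ᵣ H.G.obj n ≫ (InternalHom.FreeRep.iso e' n).inv := by
    intro k l n
    have h1 : dagger (InternalHom.FreeRep.iso e n).hom = (InternalHom.FreeRep.iso e n).inv := he n
    have h2 : dagger (InternalHom.FreeRep.iso e' n).hom = (InternalHom.FreeRep.iso e' n).inv := he' n
    rw [MonoidalLeftAction.comp_actionHomLeft, ← UnitaryLeftModule.dagger_actionHomLeft, hJ, hJ]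
    simp only [dagger_comp, ← h1, ← h2, dagger_dagger, UnitaryRightModule.dagger_actionHomLeft, Category.assoc,
      comp_actionHomLeft]
    rw [h1, Iso.inv_hom_id_assoc]
  obtain ⟨j, hj⟩ := exists_isometry_of_orthogonal_family d' b hb J
    (fun k => hB.hom_ext fun n => by
      rw [hJd, dm.isometry, id_actionHomLeft, Category.id_comp, Iso.hom_inv_id, MonoidalLeftAction.id_actionHomLeft])
    (fun k l hkl => hB.hom_ext fun n => by
      rw [hJd, dm.ortho k l hkl, zero_actionHomLeft, zero_comp, comp_zero, zero_actionHomLeft_left])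
    Sum.inr Sum.inr_injective
  obtain ⟨φ, ψ, hφ, hψ, hψφ, hφψ⟩ := exists_interleaving selfEqvAction_isFullyFaithful hB.isFullyFaithful
    (freeFunctor C m₀) H.eqvFunctor (isDaggerFunctor_freeFunctor m₀) H.isDagger (H.selfRep m₀) e
    (H.selfRep_isUnitary m₀) he
  obtain ⟨θ, hθ⟩ := exists_blockAlg_equiv hN i hi (fun S hS _ => hXN S hS)
  obtain ⟨ϑ, hϑ⟩ := exists_blockAlg_equiv hN j hj (fun S hS _ => hYN S hS)
  exact boundedSpreadIsomorphic_of_interleaved hN θ hθ ϑ hϑ φ ψ hφ hψ hψφ hφψ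

end

/-! ## Matrix categories -/

section
open UnitaryCategory
variable {M : Type w} [Category.{w'} M] [UnitaryCategory M] {ι : Type} [Fintype ι] {m : ι → M}

lemma IsDaggerFunctor.map_sum {B : Type u} [Category.{v} B] [UnitaryCategory B] {A : M ⥤ B} (hA : IsDaggerFunctor A)
    {K : Type} [Fintype K] {n n' : M} (f : K → (n ⟶ n')) : A.map (∑ k, f k) = ∑ k, A.map (f k) :=
  _root_.map_sum (AddMonoidHom.mk' (fun f : n ⟶ n' => A.map f) (fun f g => hA.1 f g)) f _

lemma IsDaggerFunctor.map_zero {B : Type u} [Category.{v} B] [UnitaryCategory B] {A : M ⥤ B} (hA : IsDaggerFunctor A)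
    (n n' : M) : A.map (0 : n ⟶ n') = 0 := by
  have h := hA.2.1 (0 : ℂ) (0 : n ⟶ n')
  rwa [zero_smul, zero_smul] at h

lemma IsDaggerFunctor.hom_ext {B : Type u} [Category.{v} B] [UnitaryCategory B] {A : M ⥤ B} (hA : IsDaggerFunctor A)
    (hm : SimpleReps m) {n : M} {Y : B} {f g : A.obj n ⟶ Y}
    (h : ∀ a (b : m a ⟶ n), A.map b ≫ f = A.map b ≫ g) : f = g := by
  have := hm.simple
  have e := hm.sum_homBasis (fun k => homBasis (m k) n)
  rw [← Category.id_comp f, ← Category.id_comp g, ← CategoryTheory.Functor.map_id, ← e]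
  simp only [hA.map_sum, A.map_comp, Preadditive.sum_comp, Category.assoc, h]

/-- Natural transformations of dagger functors are determined by their components at simple objects,
which are arbitrary. -/
lemma exists_natTrans_of_simples {B : Type u} [Category.{v} B] [UnitaryCategory B] (hm : SimpleReps m) {A A' : M ⥤ B} (hA : IsDaggerFunctor A)
    (hA' : IsDaggerFunctor A') (θ : ∀ a, A.obj (m a) ⟶ A'.obj (m a)) :
    ∃ η : A ⟶ A', ∀ a, η.app (m a) = θ a := by
  classical
  have := hm.simple
  let η : ∀ n, A.obj n ⟶ A'.obj n := fun n => ∑ a, ∑ j, A.map (dagger ((homBasis (m a) n).b j)) ≫ θ a ≫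
    A'.map ((homBasis (m a) n).b j)
  have hη : ∀ a n (f : m a ⟶ n), A.map f ≫ η n = θ a ≫ A'.map f := by
    intro a n f
    simp only [η, Preadditive.comp_sum]
    rw [Finset.sum_eq_single a]
    · conv_rhs => rw [← (homBasis (m a) n).total f, hA'.map_sum, Preadditive.comp_sum]
      refine Finset.sum_congr rfl fun j _ => ?_
      rw [← A.map_comp_assoc, ← scal_smul_id (f ≫ dagger _), hA.2.1, hA'.2.1, CategoryTheory.Functor.map_id,
        Linear.smul_comp, Category.id_comp, Linear.comp_smul, scal_smul_id]
    · intro b _ hb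
      refine Finset.sum_eq_zero fun j _ => ?_
      rw [← A.map_comp_assoc, hm.hom_eq_zero hb.symm (f ≫ _), hA.map_zero, zero_comp]
    · simp
  refine ⟨⟨η, fun n n' f => hA.hom_ext hm fun a b => ?_⟩, fun a => ?_⟩
  · rw [← A.map_comp_assoc, hη, ← Category.assoc, hη, Category.assoc, A'.map_comp]
  · have := hη a (m a) (𝟙 _)
    rwa [CategoryTheory.Functor.map_id, CategoryTheory.Functor.map_id, Category.id_comp, Category.comp_id] at this

end

section
open UnitaryCategory MonoidalLeftAction
variable {E : Type u} [Category.{v} E] [MonoidalCategory E] [UnitaryMultifusionCategory E]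
  {M : Type w} [Category.{w'} M] [UnitaryCategory M] [MonoidalLeftAction E M] [UnitaryLeftModule E M]

lemma isDaggerFunctor_curriedAction (d : E) : IsDaggerFunctor ((curriedAction E M).obj d) :=
  ⟨fun _ _ => UnitaryLeftModule.actionHomRight_add _ _ _,
    fun _ _ => UnitaryLeftModule.actionHomRight_smul _ _ _,
    fun _ => (UnitaryLeftModule.dagger_actionHomRight _ _).symm⟩

variable (E M) in
/-- The action of `E` is an equivalence onto the dagger endofunctors of `M`. -/
structure IsEndAction : Prop where
  fullyFaithful : ∀ (d d' : E) (η : (curriedAction E M).obj d ⟶ (curriedAction E M).obj d'),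
        ∃! f : d ⟶ d', (curriedAction E M).map f = η
  essSurj : ∀ F : M ⥤ M, IsDaggerFunctor F →
    ∃ (d : E) (e : (curriedAction E M).obj d ≅ F), ∀ m : M, dagger (e.hom.app m) = e.inv.app m

variable (E M) in
/-- The equivariance of the action with respect to no functors at all. -/
def trivialEqvAction : EqvAction E (fun γ : PEmpty.{1} => (γ.elim : M ⥤ M)) where
  mid γ := γ.elim
  naturality_left γ := γ.elim
  naturality_right γ := γ.elim
  tensor γ := γ.elim
  unit γ := γ.elim

/-- A functor, as an equivariant functor with respect to no functors at all. -/
def trivialEqvFunctor (F : M ⥤ M) :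
    EqvFunctor (fun γ : PEmpty.{1} => (γ.elim : M ⥤ M)) (fun γ : PEmpty.{1} => (γ.elim : M ⥤ M)) where
  F := F
  μ γ := γ.elim
  μ_naturality γ := γ.elim

namespace IsEndAction
variable {ι : Type} [Fintype ι] {m : ι → M}

lemma isFullyFaithful (h : IsEndAction E M) : (trivialEqvAction E M).IsFullyFaithful := by
  intro d η hn _
  obtain ⟨f, hf, hu⟩ := h.fullyFaithful d d ⟨η, fun _ _ f => hn f⟩
  refine ⟨f, fun n => congr_app hf n, fun g hg => hu g ?_⟩
  ext n
  exact hg n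

lemma exists_rep (h : IsEndAction E M) {F G : M ⥤ M} (hF : IsDaggerFunctor F) (hG : IsDaggerFunctor G) :
    ∃ (x : E) (e : (trivialEqvAction E M).Rep x ((trivialEqvFunctor F).comp (trivialEqvFunctor G))), e.IsUnitary := by
  obtain ⟨x, e, he⟩ := h.essSurj (F ⋙ G)
    ⟨fun f g => (congrArg G.map (hF.1 f g)).trans (hG.1 _ _),
      fun z f => (congrArg G.map (hF.2.1 z f)).trans (hG.2.1 _ _),
      fun f => (congrArg G.map (hF.2.2 f)).trans (hG.2.2 _)⟩
  exact ⟨x, ⟨fun n => e.app n, fun f => e.hom.naturality f, fun γ => γ.elim⟩, he⟩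

lemma exists_hom (h : IsEndAction E M) (hm : SimpleReps m) {d d' : E} (θ : ∀ a, d ⊙ₗ m a ⟶ d' ⊙ₗ m a) :
    ∃ f : d ⟶ d', ∀ a, f ⊵ₗ m a = θ a := by
  obtain ⟨η, hη⟩ := exists_natTrans_of_simples hm (isDaggerFunctor_curriedAction d)
    (isDaggerFunctor_curriedAction d') θ
  obtain ⟨f, hf, -⟩ := h.fullyFaithful d d' η
  exact ⟨f, fun a => (congr_app hf (m a)).trans (hη a)⟩

lemma hom_ext (h : IsEndAction E M) (hm : SimpleReps m) {d d' : E} {f g : d ⟶ d'}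
    (hfg : ∀ a, f ⊵ₗ m a = g ⊵ₗ m a) : f = g := by
  refine (h.fullyFaithful d d' ((curriedAction E M).map g)).unique ?_ rfl
  ext n
  change f ⊵ₗ n = g ⊵ₗ n
  refine (isDaggerFunctor_curriedAction d).hom_ext hm (fun a b => ?_)
  change d ⊴ₗ b ≫ f ⊵ₗ n = d ⊴ₗ b ≫ g ⊵ₗ n
  rw [action_exchange, action_exchange, hfg]

/-- Morphisms in `E` are arbitrary families of components at the simple objects, so isometries may
be chosen componentwise. -/
lemma exists_isometry (h : IsEndAction E M) (hm : SimpleReps m) {d d' : E}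
    (hi : ∀ a, ∃ i : d ⊙ₗ m a ⟶ d' ⊙ₗ m a, i ≫ dagger i = 𝟙 _) : ∃ i : d ⟶ d', i ≫ dagger i = 𝟙 d := by
  choose i hi using hi
  obtain ⟨f, hf⟩ := h.exists_hom hm i
  refine ⟨f, h.hom_ext hm fun a => ?_⟩
  rw [comp_actionHomLeft, ← UnitaryLeftModule.dagger_actionHomLeft, hf, hi, id_actionHomLeft]

lemma exists_retract (h : IsEndAction E M) (hm : SimpleReps m) {d d' : E} [Simple d] {a : ι}
    {f : d ⊙ₗ m a ⟶ d' ⊙ₗ m a} (hf : f ≠ 0) : Nonempty (Retract d d') := by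
  classical
  obtain ⟨g, hg⟩ := h.exists_hom hm (d := d) (d' := d') (fun b => if e : a = b then e ▸ f else 0)
  refine nonempty_retract_of_ne_zero (f := g) ?_
  rintro rfl
  have := hg a
  rw [dif_pos rfl] at this
  exact hf (this.symm.trans (zero_actionHomLeft_left _ _ _))

end IsEndAction

end

section
open UnitaryCategory
variable {M : Type w} [Category.{w'} M] [UnitaryCategory M] {ι : Type} [Fintype ι] {s m : ι → M}
  [∀ a, Simple (m a)] (R : SumFunctor s m (fun _ => 𝟭 M))

namespace SumFunctor

/-- The inclusion of `s a` into the value at `m a`. -/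
def unit (a : ι) : s a ⟶ R.G.obj (m a) := R.E a (m a) (𝟙 (m a))

lemma unit_isometry (a : ι) : R.unit a ≫ dagger (R.unit a) = 𝟙 _ := by
  have h := R.E_inner a (m a) (𝟙 (m a)) (𝟙 (m a))
  refine h.trans ?_
  rw [dagger_id]
  refine (congrArg (· • 𝟙 (s a)) ?_).trans (one_smul ℂ _)
  exact (congrArg scal (Category.comp_id (𝟙 (m a)))).trans scal_id

end SumFunctor
end

section
open UnitaryCategory MonoidalLeftAction
variable {E : Type u} [Category.{v} E] [MonoidalCategory E] [UnitaryMultifusionCategory E]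
  {M : Type w} [Category.{w'} M] [UnitaryCategory M] [MonoidalLeftAction E M] [UnitaryLeftModule E M]
  {ι : Type} [Fintype ι] {m : ι → M}

lemma actionHomRight_zero_left (d : E) (n n' : M) : d ⊴ₗ (0 : n ⟶ n') = 0 :=
  (isDaggerFunctor_curriedAction d).map_zero _ _

/-- There is an object that acts as the projection to the summand of `m a₀`. -/
lemma IsEndAction.exists_matrixUnit (h : IsEndAction E M) (hm : SimpleReps m) (a₀ : ι) :
    ∃ s : E, (∃ u : m a₀ ⟶ s ⊙ₗ m a₀, u ≫ dagger u = 𝟙 _ ∧ dagger u ≫ u = 𝟙 _) ∧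
      ∀ a, a ≠ a₀ → 𝟙 (s ⊙ₗ m a) = 0 := by
  have := hm.simple
  -- The functor `m a₀ ⊗ Hom(m a₀, -)` is the projection to one isotypic component.
  obtain ⟨Q⟩ := exists_sumFunctor (fun _ : Unit => m a₀) (fun _ => m a₀) (fun _ => 𝟭 M)
    (fun _ => ⟨fun _ _ => rfl, fun _ _ => rfl, fun _ => rfl⟩)
  obtain ⟨s, e, he⟩ := h.essSurj Q.G Q.isDagger
  let i : ∀ n, s ⊙ₗ n ≅ Q.G.obj n := fun n => e.app n
  have hi : ∀ n, dagger (i n).hom = (i n).inv := he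
  refine ⟨s, ⟨Q.unit () ≫ (i (m a₀)).inv, ?_, ?_⟩, fun a ha => ?_⟩
  · rw [dagger_comp, ← hi, dagger_dagger, hi, Category.assoc, Iso.inv_hom_id_assoc, Q.unit_isometry]
  · have h1 : dagger (Q.unit ()) ≫ Q.unit () = 𝟙 _ := by
      refine Q.hom_ext fun k φ => ?_
      obtain ⟨z, hz⟩ := exists_scalar (S := m a₀) φ
      have h2 : Q.E k (m a₀) φ = z • Q.unit () := by
        rw [hz]
        exact map_smul (Q.E () (m a₀)) z (𝟙 (m a₀))
      rw [h2, Linear.smul_comp, Linear.smul_comp, ← Category.assoc, Q.unit_isometry, Category.id_comp, Category.comp_id]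
    rw [dagger_comp, ← hi, dagger_dagger, hi, Category.assoc, ← Category.assoc (dagger (Q.unit ())), h1, Category.id_comp,
      Iso.hom_inv_id]
  · have h1 : 𝟙 (Q.G.obj (m a)) = 0 := by
      refine Q.hom_ext fun k φ => ?_
      have h2 : φ = 0 := hm.hom_eq_zero ha.symm φ
      rw [h2, map_zero, zero_comp, zero_comp]
    rw [← (i (m a)).hom_inv_id, ← Category.comp_id (i (m a)).hom, h1, comp_zero, zero_comp]

/-- If `s` acts on `n` by the identity up to a unitary, so do its tensor powers. -/
lemma exists_unitary_tensorPower {s : E} {n : M} {u : n ⟶ s ⊙ₗ n} (hu : u ≫ dagger u = 𝟙 _)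
    (hu' : dagger u ≫ u = 𝟙 _) (k : ℕ) :
    ∃ v : n ⟶ tensorPower s k ⊙ₗ n, v ≫ dagger v = 𝟙 _ ∧ dagger v ≫ v = 𝟙 _ := by
  induction k with
  | zero =>
    have h : dagger (λₗ[E] n).hom = (λₗ n).inv := UnitaryLeftModule.dagger_actionUnitIso n
    have key : (λₗ[E] n).inv ≫ dagger (λₗ[E] n).inv = 𝟙 _ ∧ dagger (λₗ[E] n).inv ≫ (λₗ[E] n).inv = 𝟙 _ := by
      rw [← h, dagger_dagger, h, Iso.inv_hom_id, Iso.hom_inv_id]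
      exact ⟨rfl, rfl⟩
    exact ⟨(λₗ[E] n).inv, key⟩
  | succ k ih =>
    obtain ⟨v, hv, hv'⟩ := ih
    have h : dagger (αₗ (tensorPower s k) s n).hom = (αₗ (tensorPower s k) s n).inv :=
      UnitaryLeftModule.dagger_actionAssocIso _ _ _
    have key : ∃ w : n ⟶ (tensorPower s k ⊗ s) ⊙ₗ n, w ≫ dagger w = 𝟙 _ ∧ dagger w ≫ w = 𝟙 _ := by
      refine ⟨v ≫ tensorPower s k ⊴ₗ u ≫ (αₗ (tensorPower s k) s n).inv, ?_, ?_⟩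
      · simp only [dagger_comp, ← h, dagger_dagger, UnitaryLeftModule.dagger_actionHomRight, Category.assoc]
        rw [h, Iso.inv_hom_id_assoc, ← actionHomRight_comp_assoc, hu, actionHomRight_id, Category.id_comp, hv]
      · simp only [dagger_comp, ← h, dagger_dagger, UnitaryLeftModule.dagger_actionHomRight, Category.assoc]
        rw [reassoc_of% hv', ← actionHomRight_comp_assoc, hu', actionHomRight_id, Category.id_comp, h, Iso.hom_inv_id]
    exact key

lemma tensorPower_succ_action_eq_zero {s : E} {n : M} (h : 𝟙 (s ⊙ₗ n) = 0) (k : ℕ) :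
    𝟙 (tensorPower s (k + 1) ⊙ₗ n) = 0 := by
  have key : 𝟙 ((tensorPower s k ⊗ s) ⊙ₗ n) = 0 := by
    rw [← (αₗ (tensorPower s k) s n).hom_inv_id, ← Category.comp_id (αₗ (tensorPower s k) s n).hom,
      ← actionHomRight_id, h, actionHomRight_zero_left, comp_zero, zero_comp]
  exact key

/-- The stabilized chain of an object whose tensor powers have only scalar endomorphisms. -/
lemma exists_oscillatorChain_equiv {s : E} (h0 : ∀ k, 𝟙 (tensorPower s k) ≠ 0)
    (hs : ∀ k, 0 < k → ∀ f : End (tensorPower s k), ∃ z : ℂ, f = algebraMap ℂ _ z) :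
    ∃ θ : ∀ I : NonemptyInterval ℤ, oscillatorChain.alg I ≃⋆ₐ[ℂ] (fusionSpinChain s).stabilization.alg I,
      ∀ I J (h : I ≤ J) a, θ J (oscillatorChain.incl I J h a) =
        (fusionSpinChain s).stabilization.incl I J h (θ I a) := by
  let f : ∀ I : NonemptyInterval ℤ, oscillatorChain.alg I →⋆ₐ[ℂ] (fusionSpinChain s).stabilization.alg I := fun I =>
    { (Algebra.TensorProduct.includeRight : oscillatorChain.alg I →ₐ[ℂ]
        TensorProduct ℂ (End (tensorPower s I.card)) (oscillatorChain.alg I)) with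
      map_star' := fun a => by
        change (1 : End (tensorPower s I.card)) ⊗ₜ[ℂ] (star a) = star ((1 : End (tensorPower s I.card)) ⊗ₜ[ℂ] a)
        rw [TensorProduct.star_tmul, star_one] }
  have hcard : ∀ I : NonemptyInterval ℤ, 0 < I.card := fun I => by
    have := I.fst_le_snd
    simp only [NonemptyInterval.card]
    omega
  have hf : ∀ I, Function.Bijective (f I) := by
    intro I
    -- The endomorphism algebra is `ℂ`, so tensoring with it changes nothing. Intervals are
    -- nonempty, so the zeroth power, whose endomorphisms need not be scalars, does not occur.
    have : Nontrivial (End (tensorPower s I.card)) := ⟨⟨1, 0, h0 I.card⟩⟩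
    constructor
    · exact Algebra.TensorProduct.includeRight_injective (algebraMap ℂ (End (tensorPower s I.card))).injective
    · intro x
      change ∃ a, (1 : End (tensorPower s I.card)) ⊗ₜ[ℂ] a = x
      induction x using TensorProduct.induction_on with
      | zero => exact ⟨0, TensorProduct.tmul_zero _ _⟩
      | tmul g a =>
        obtain ⟨z, hz⟩ := hs I.card (hcard I) g
        refine ⟨z • a, ?_⟩
        have key : ((1 : End (tensorPower s I.card)) ⊗ₜ[ℂ] (z • a) :
            TensorProduct ℂ (End (tensorPower s I.card)) (oscillatorChain.alg I)) =
            (algebraMap ℂ (End (tensorPower s I.card)) z) ⊗ₜ[ℂ] a := by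
          rw [Algebra.algebraMap_eq_smul_one, TensorProduct.smul_tmul]
        rw [hz]
        exact key
      | add x y hx hy =>
        obtain ⟨a, rfl⟩ := hx
        obtain ⟨b, rfl⟩ := hy
        exact ⟨a + b, TensorProduct.tmul_add _ _ _⟩
  refine ⟨fun I => StarAlgEquiv.ofBijective (f I) (hf I), fun I J h a => ?_⟩
  change (1 : End (tensorPower s J.card)) ⊗ₜ[ℂ] (oscillatorChain.incl I J h a) =
    ((fusionSpinChain s).incl I J h 1) ⊗ₜ[ℂ] (oscillatorChain.incl I J h a)
  rw [map_one]
  rfl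

end

/-! ### Proof for matrix categories. -/

section
open UnitaryCategory MonoidalLeftAction
variable {E : Type u} [Category.{v} E] [MonoidalCategory E] [UnitaryMultifusionCategory E]

lemma exists_component_ne_zero {M : Type w} [Category.{w'} M] [UnitaryCategory M] [MonoidalLeftAction E M]
    [UnitaryLeftModule E M] {ι : Type} [Fintype ι] {m : ι → M} (h : IsEndAction E M) (hm : SimpleReps m) {d : E}
    (hd : 𝟙 d ≠ 0) : ∃ a, 𝟙 (d ⊙ₗ m a) ≠ 0 := by
  by_contra! h'
  exact hd (h.hom_ext hm fun a => by rw [id_actionHomLeft, h', zero_actionHomLeft_left])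

theorem boundedSpreadIsomorphic_oscillatorChain {n : ℕ} (hn : 1 ≤ n) (hE : IsMatrixCategory.{v, u, w, w'} n E)
    {X : E} (hX : IsStrongTensorGenerator X) :
    BoundedSpreadIsomorphic (fusionSpinChain X).stabilization oscillatorChain := by
  obtain ⟨M, _, _, _, _, ⟨m, hm1, hm2, hm3⟩, hff, hes⟩ := hE
  have h : IsEndAction E M := ⟨hff, hes⟩
  have hm : SimpleReps m := ⟨hm1, hm2, fun X hX => (hm3 X hX).imp fun _ e => e.map Iso.symm⟩
  obtain ⟨N, hN, hXN⟩ := hX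
  let a₀ : Fin n := ⟨0, hn⟩
  have hid : IsDaggerFunctor (𝟭 M) := ⟨fun _ _ => rfl, fun _ _ => rfl, fun _ => rfl⟩
  choose K hK t ht d using fun a => exists_simple_decomposition (tensorPower X N ⊙ₗ m a)
  -- The functor `G` has to produce every simple object often enough to hold all summands of `X^{⊗
  -- N} ⊙ₗ m a`, hence one label for each of them. The label `none` guarantees a copy of `m a₀` even
  -- when there are no summands.
  let L := Fin n × Option (Σ a, K a)
  -- `F` sends every simple object to `m a₀`, and `G` is supported on `m a₀`. Thus `F` followed by
  -- `G` is a large endofunctor, represented by `x`, while `G` followed by `F` is a multiple of the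
  -- projection to `m a₀`, represented by `y`.
  obtain ⟨F⟩ := exists_sumFunctor (fun _ : Fin n => m a₀) m (fun _ => 𝟭 M) (fun _ => hid)
  obtain ⟨G⟩ := exists_sumFunctor (fun p : L => m p.1) (fun _ => m a₀) (fun _ => 𝟭 M) (fun _ => hid)
  obtain ⟨x, e₀, he₀⟩ := h.exists_rep F.isDagger G.isDagger
  obtain ⟨y, e₁, he₁⟩ := h.exists_rep G.isDagger F.isDagger
  obtain ⟨φ, ψ, hφ, hψ, hψφ, hφψ⟩ := exists_interleaving h.isFullyFaithful h.isFullyFaithful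
    (trivialEqvFunctor F.G) (trivialEqvFunctor G.G) F.isDagger G.isDagger e₀ e₁ he₀ he₁
  let i₀ : ∀ n, x ⊙ₗ n ≅ G.G.obj (F.G.obj n) := fun n => e₀.e n
  have hi₀ : ∀ n, dagger (i₀ n).hom = (i₀ n).inv := he₀
  let i₁ : ∀ n, y ⊙ₗ n ≅ F.G.obj (G.G.obj n) := fun n => e₁.e n
  have hi₁ : ∀ n, dagger (i₁ n).hom = (i₁ n).inv := he₁
  have hGE : ∀ (p : L) (n : M) (f : m a₀ ⟶ n), f ≫ dagger f = 𝟙 _ → G.E p n f ≫ dagger (G.E p n f) = 𝟙 _ :=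
    fun p n f hf => (G.E_inner p n f f).trans (by rw [hf, scal_id, one_smul])
  have hFE : ∀ (a : Fin n) (n : M) (f : m a ⟶ n), f ≫ dagger f = 𝟙 _ → F.E a n f ≫ dagger (F.E a n f) = 𝟙 _ :=
    fun a n f hf => (F.E_inner a n f f).trans (by rw [hf, scal_id, one_smul])
  obtain ⟨i, hi⟩ : ∃ i : tensorPower X N ⟶ x, i ≫ dagger i = 𝟙 _ := by
    refine h.exists_isometry hm fun a => ?_
    choose b hb using fun k => hm.exists_iso (t a k) (ht a k)
    choose c hc hc' using fun k => have := ht a k; exists_unitary_of_iso (hb k).some.symm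
    refine (d a).some.exists_isometry (fun k => (c k ≫ G.E (b k, some ⟨a, k⟩) _ (F.unit a)) ≫ (i₀ (m a)).inv)
      (fun k => ?_) (fun k l hkl => ?_)
    · rw [dagger_comp, ← hi₀, dagger_dagger, hi₀, Category.assoc, Iso.inv_hom_id_assoc, dagger_comp, Category.assoc,
        ← Category.assoc (G.E _ _ _), hGE _ _ _ (F.unit_isometry a), Category.id_comp, hc]
    · rw [dagger_comp, ← hi₀, dagger_dagger, hi₀, Category.assoc, Iso.inv_hom_id_assoc, dagger_comp, Category.assoc,
        ← Category.assoc (G.E _ _ _), G.E_ortho _ _ _ _ _ (fun h => hkl (by simpa using (Prod.mk.inj h).2)), zero_comp,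
        comp_zero]
  obtain ⟨s, ⟨u, hu, hu'⟩, hs⟩ := h.exists_matrixUnit hm a₀
  choose U hU hU' using fun k => exists_unitary_tensorPower (E := E) hu hu' k
  have hs0 : ∀ k a, 0 < k → a ≠ a₀ → 𝟙 (tensorPower s k ⊙ₗ m a) = 0 := by
    intro k a hk ha
    obtain ⟨k, rfl⟩ := Nat.exists_eq_succ_of_ne_zero hk.ne'
    exact tensorPower_succ_action_eq_zero (hs a ha) k
  have hm0 := hm.simple
  obtain ⟨θ', hθ'⟩ := exists_oscillatorChain_equiv (s := s)
    (fun k h0 => ne_zero_of_isometry (hU k) (id_nonzero (m a₀)) (by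
      rw [← id_actionHomLeft, h0, zero_actionHomLeft_left]))
    (fun k hk f => by
      obtain ⟨z, hz⟩ := exists_scalar (U k ≫ (f : tensorPower s k ⟶ tensorPower s k) ⊵ₗ m a₀ ≫ dagger (U k))
      have key : (f : tensorPower s k ⟶ tensorPower s k) = z • 𝟙 _ := by
        refine h.hom_ext hm fun a => ?_
        by_cases ha : a = a₀
        · subst ha
          have h1 : (f : tensorPower s k ⟶ tensorPower s k) ⊵ₗ m a₀ = dagger (U k) ≫
              (U k ≫ (f : tensorPower s k ⟶ tensorPower s k) ⊵ₗ m a₀ ≫ dagger (U k)) ≫ U k := by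
            simp only [Category.assoc]
            rw [hU', Category.comp_id, ← Category.assoc, hU', Category.id_comp]
          rw [h1, hz, Linear.smul_comp, Linear.comp_smul, Category.id_comp, hU',
            UnitaryLeftModule.smul_actionHomLeft, id_actionHomLeft]
        · rw [← Category.comp_id ((f : tensorPower s k ⟶ tensorPower s k) ⊵ₗ m a), hs0 k a hk ha, comp_zero,
            ← Category.comp_id ((z • 𝟙 _) ⊵ₗ m a), hs0 k a hk ha, comp_zero]
      exact ⟨z, key⟩)
  -- Away from `m a₀` the power of `s` acts by zero and the zero morphism is an isometry; at `m a₀`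
  -- it acts like the identity, and `F (G (m a₀))` contains `m a₀`.
  obtain ⟨j, hj⟩ : ∃ j : tensorPower s N ⟶ y, j ≫ dagger j = 𝟙 _ := by
    refine h.exists_isometry hm fun a => ?_
    by_cases ha : a = a₀
    · subst ha
      obtain ⟨v, hv⟩ : ∃ v : m a₀ ⟶ F.G.obj (G.G.obj (m a₀)), v ≫ dagger v = 𝟙 _ :=
        ⟨_, hFE a₀ _ (G.unit (a₀, none)) (G.unit_isometry (a₀, none))⟩
      refine ⟨dagger (U N) ≫ v ≫ (i₁ (m a₀)).inv, ?_⟩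
      simp only [dagger_comp, dagger_dagger, Category.assoc]
      rw [← hi₁, dagger_dagger, hi₁, Iso.inv_hom_id_assoc, reassoc_of% hv, hU']
    · exact ⟨0, by rw [zero_comp, hs0 N a hN ha]⟩
  have hy : ∀ T : E, Simple T → Nonempty (Retract T y) → Nonempty (Retract T (tensorPower s N)) := by
    rintro T hT ⟨r⟩
    obtain ⟨f, hf⟩ := exists_isometry_of_retract r
    obtain ⟨a, ha⟩ := exists_component_ne_zero h hm (id_nonzero T)
    have hfa : (f ⊵ₗ m a ≫ (i₁ (m a)).hom) ≫ dagger (f ⊵ₗ m a ≫ (i₁ (m a)).hom) = 𝟙 _ := by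
      rw [dagger_comp, hi₁, Category.assoc, Iso.hom_inv_id_assoc, UnitaryLeftModule.dagger_actionHomLeft,
        ← comp_actionHomLeft, hf, id_actionHomLeft]
    have hFG := ne_zero_of_isometry hfa ha
    -- A simple summand of `y` can act nontrivially only on `m a₀`, because `G` kills the other
    -- simple objects.
    obtain rfl : a = a₀ := by
      by_contra hne
      refine hFG ?_
      have h1 : 𝟙 (G.G.obj (m a)) = 0 := G.hom_ext fun k φ => by
        rw [show φ = 0 from hm.hom_eq_zero (Ne.symm hne) φ, map_zero, zero_comp, zero_comp]
      rw [← CategoryTheory.Functor.map_id, h1, F.isDagger.map_zero]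
    obtain ⟨b, φ, hφ0⟩ : ∃ b φ, (f ⊵ₗ m a₀ ≫ (i₁ (m a₀)).hom) ≫ dagger (F.E b (G.G.obj (m a₀)) φ) ≠ 0 := by
      by_contra! h0
      have h1 : dagger (f ⊵ₗ m a₀ ≫ (i₁ (m a₀)).hom) = 0 := F.hom_ext fun b φ =>
        dagger_injective (by rw [dagger_comp, dagger_dagger, h0, comp_zero, dagger_zero])
      rw [h1, comp_zero] at hfa
      exact ha hfa.symm
    -- The values of `F` are multiples of `m a₀`, so a component of the inclusion of `T` in `y`
    -- reaches `m a₀`, and `U N` carries it on to the action of `s^{⊗ N}`.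
    refine h.exists_retract hm (f := ((f ⊵ₗ m a₀ ≫ (i₁ (m a₀)).hom) ≫ dagger (F.E b (G.G.obj (m a₀)) φ)) ≫ U N)
      fun h0 => hφ0 ?_
    rw [← Category.comp_id (_ ≫ dagger _), ← hU N, ← Category.assoc, h0, zero_comp]
  obtain ⟨θ, hθ⟩ := exists_blockAlg_equiv hN i hi (fun S hS _ => hXN S hS)
  obtain ⟨ϑ, hϑ⟩ := exists_blockAlg_equiv hN j hj hy
  -- The blocks of `oscillatorChain` are identified with those of the stabilized chain of `s`, and
  -- these with the block algebras of `y`.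
  refine boundedSpreadIsomorphic_of_interleaved hN θ hθ (fun J => (θ' (J.block N)).trans (ϑ J)) (fun I J hIJ a => ?_)
    φ ψ hφ hψ hψφ hφψ
  exact (congrArg (ϑ J) (hθ' _ _ _ a)).trans (hϑ I J hIJ _)

end

theorem mainTheorem1 :
    (∀ (C : Type u) [Category.{v} C] [MonoidalCategory C] [UnitaryMultifusionCategory C]
      (D : Type u') [Category.{v'} D] [MonoidalCategory D] [UnitaryMultifusionCategory D]
      (X : C) (Y : D), IsIndecomposable C → IsIndecomposable D →
      MoritaEquivalent.{v, u, w, v', u', w'} C D →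
      IsStrongTensorGenerator X → IsStrongTensorGenerator Y →
      BoundedSpreadIsomorphic (fusionSpinChain X).stabilization (fusionSpinChain Y).stabilization) ∧
    (∀ (n : ℕ) (E : Type u) [Category.{v} E] [MonoidalCategory E] [UnitaryMultifusionCategory E]
      (X : E), 1 ≤ n → IsMatrixCategory.{v, u, w, w'} n E → IsStrongTensorGenerator X →
      BoundedSpreadIsomorphic (fusionSpinChain X).stabilization oscillatorChain) :=
  ⟨fun _ _ _ _ _ _ _ _ _ _ hC hD h hX hY => boundedSpreadIsomorphic_of_moritaEquivalent hC hD h hX hY,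
    fun _ _ _ _ _ _ hn hE hX => boundedSpreadIsomorphic_oscillatorChain hn hE hX⟩
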